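/- Let $a\in\mathbb{R}$ and $s\in\{2,-2\}$. For $m\in\mathbb{Z}$ and $\omega\in\mathbb{R}$ consider, in the variable $x=\cos\theta\in(-1,1)$, the spin-weighted spheroidal operator $$L_m^{[s]}(\omega)S=\frac{d}{dx}\Big((1-x^2)\frac{dS}{dx}\Big)-\frac{(m+sx)^2}{1-x^2}S+\big(s+(a\omega)^2x^2-2sa\omega x\big)S$$ on the real functions $S$ for which $S(\cos\theta)e^{im\varphi}$ is a smooth spin $s$-weighted function on $\mathbb{S}^2$, i.e. is of the form $\alpha(\mathbf m,\mathbf m)$ (for $s=2$) or $\alpha(\overline{\mathbf m},\overline{\mathbf m})$ (for $s=-2$) on $\{0<\theta<\pi\}$, where $\alpha$ is a smooth symmetric $2$-covariant tensor field on $\mathbb{S}^2$ and $\mathbf m=\frac{1}{\sqrt2}(\partial_\theta+\frac{i}{\sin\theta}\partial_\varphi)$. For $l\ge\max(|m|,|s|)$ let $S_{ml}(\cdot\,;\omega)$ be the eigenfunction belonging to the eigenvalue of $L_m^{[s]}(\omega)$ above which there lie exactly $l-\max(|m|,|s|)$ other eigenvalues, normalised in $L^2([-1,1])$ and positive near $x=-1$,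 and put $Y_{ml}(\theta,\varphi;\omega)=\frac{1}{\sqrt{2\pi}}S_{ml}(\cos\theta;\omega)e^{im\varphi}$. All sums over $l,l'$ below run over the integers $\ge\max(|m|,|s|)$. (i) For $x\in(-1,1)$ the function $\omega\mapsto S_{ml}(x;\omega)$ is smooth on $\mathbb{R}$; for all $k\ge0$ and $\omega\in\mathbb{R}$ we have $\partial_\omega^kS_{ml}(\omega)\in L^2([-1,1])$, and in $L^2([-1,1])$ $$\partial_\omega^kS_{ml}(\omega)=\sum_{l'}D_{mll';k}(\omega)\,S_{ml'}(\omega),\qquad D_{mll';k}(\omega)=\int_{-1}^1\partial_\omega^kS_{ml}(x;\omega)\,S_{ml'}(x;\omega)\,dx\in\mathbb{R}.$$ (ii) There exists $\varepsilon>0$ such that for every $k\ge1$ there is a constant $C(k)<\infty$ with $$\sum_{l,l'}|D_{mll';k}(\omega)|^2\le C(k)\qquad\text{for all }m\in\mathbb{Z}\text{ and all }|\omega|\le\varepsilon.$$ (iii) Let $\varepsilon>0$ be as in (ii), let $f\in L^2_{(-\varepsilon,\varepsilon)}L^2_{\mathbb{S}^2}$, let $f_{ml}(\omega)=\int_{\mathbb{S}^2}f(\omega,\theta,\varphi)\overline{Y_{ml}(\theta,\varphi;\omega)}\,\mathrm{vol}_{\mathbb{S}^2}$,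 and let $q_0\in\mathbb{N}_0$. Then the weak derivatives $\partial_\omega^qf$ exist in $L^2_{(-\varepsilon,\varepsilon)}L^2_{\mathbb{S}^2}$ for all $0\le q\le q_0$ if and only if the weak derivatives $\partial_\omega^q(f_{ml})$ exist for all $m,l$ and satisfy $$\int_{-\varepsilon}^{\varepsilon}\sum_{m,l}|\partial_\omega^q(f_{ml})(\omega)|^2\,d\omega<\infty$$ for all $0\le q\le q_0$. -/

import Mathlib

open MeasureTheory Filter Topology Set
open scoped ENNReal NNReal

noncomputable section

namespace Spheroidal

/-- Euclidean three-space; the sphere `S²` is its unit sphere. -/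
abbrev E3 : Type := EuclideanSpace ℝ (Fin 3)

/-- The point of `S²` with polar angle `θ` and azimuth `φ`. -/
def spherePt (θ φ : ℝ) : E3 :=
  !₂[Real.sin θ * Real.cos φ, Real.sin θ * Real.sin φ, Real.cos θ]

/-- The frame vector `E₁ = ∂_θ`. -/
def frameθ (θ φ : ℝ) : E3 :=
  !₂[Real.cos θ * Real.cos φ, Real.cos θ * Real.sin φ, -Real.sin θ]

/-- The frame vector `E₂ = (1 / sin θ) ∂_φ`. -/
def frameφ (φ : ℝ) : E3 :=
  !₂[-Real.sin φ, Real.cos φ, 0]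

/-- Smooth spin `s`-weighted functions on `S²` for `s = 2` and `s = -2`, in the coordinates
`(θ, φ)`: the functions `α(𝐦, 𝐦)` for `s = 2`, and `α(𝐦̄, 𝐦̄)` for `s = -2`, where `α` is a smooth
symmetric 2-covariant tensor field on `S²` and `𝐦 = (E₁ + i E₂) / √2`.
A smooth symmetric 2-covariant tensor field on `S²` is the restriction to `S²` (and to tangent
vectors) of a smooth field of symmetric bilinear forms on `ℝ³`. -/
def IsSmoothSpinWeighted (s : ℤ) (f : ℝ → ℝ → ℂ) : Prop :=
  ∃ α : E3 → E3 →L[ℝ] E3 →L[ℝ] ℝ, ContDiff ℝ (⊤ : ℕ∞) α ∧ (∀ p u v, α p u v = α p v u) ∧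
    ∀ θ ∈ Ioo 0 Real.pi, ∀ φ : ℝ,
      f θ φ = (1 / 2 : ℂ) *
          ((α (spherePt θ φ) (frameθ θ φ) (frameθ θ φ) : ℂ)
            - (α (spherePt θ φ) (frameφ φ) (frameφ φ) : ℂ))
        + (s.sign : ℂ) * Complex.I * (α (spherePt θ φ) (frameθ θ φ) (frameφ φ) : ℂ)

/-- The spin-weighted spheroidal operator `L_m^{[s]}(ω)`, in the variable `x = cos θ ∈ (-1, 1)`. -/
def angularOp (a : ℝ) (s m : ℤ) (ω : ℝ) (S : ℝ → ℝ) (x : ℝ) : ℝ :=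
  deriv (fun y => (1 - y ^ 2) * deriv S y) x - ((m : ℝ) + s * x) ^ 2 / (1 - x ^ 2) * S x
    + ((s : ℝ) + (a * ω) ^ 2 * x ^ 2 - 2 * s * a * ω * x) * S x

/-- `S` is an eigenfunction of `L_m^{[s]}(ω)` with eigenvalue `lam`; the domain consists of the `S`
for which `S(cos θ) e^{imφ}` is a smooth spin `s`-weighted function on `S²`. -/
def IsEigenfunction (a : ℝ) (s m : ℤ) (ω lam : ℝ) (S : ℝ → ℝ) : Prop :=
  IsSmoothSpinWeighted s
      (fun θ φ => (S (Real.cos θ) : ℂ) * Complex.exp (Complex.I * (m : ℂ) * (φ : ℂ))) ∧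
    (∀ x ∈ Ioo (-1 : ℝ) 1, angularOp a s m ω S x = lam * S x) ∧
    ∃ x ∈ Ioo (-1 : ℝ) 1, S x ≠ 0

/-- The set of eigenvalues of `L_m^{[s]}(ω)`. -/
def eigenvalues (a : ℝ) (s m : ℤ) (ω : ℝ) : Set ℝ :=
  {lam | ∃ S, IsEigenfunction a s m ω lam S}

/-- The smallest admissible `l`, namely `max (|m|, |s|)`. -/
def lMin (s m : ℤ) : ℕ := max m.natAbs s.natAbs

/-- The admissible `l` for given `m`, namely `l ≥ max (|m|, |s|)`. -/
abbrev Modes (s m : ℤ) : Type := {l : ℕ // lMin s m ≤ l}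

/-- `S` is the normalised `(m, l)` eigenfunction: it belongs to the eigenvalue with exactly
`l - max (|m|, |s|)` eigenvalues above it, has `L²([-1, 1])`-norm one, and is positive
near `x = -1`. -/
def IsSpheroidalS (a : ℝ) (s m : ℤ) (l : ℕ) (ω : ℝ) (S : ℝ → ℝ) : Prop :=
  (∃ lam : ℝ, IsEigenfunction a s m ω lam S ∧
      {μ ∈ eigenvalues a s m ω | lam < μ}.encard = ((l - lMin s m : ℕ) : ℕ∞)) ∧
    (∫ x in Icc (-1 : ℝ) 1, S x ^ 2 = 1) ∧
    ∀ᶠ x in 𝓝[>] (-1 : ℝ), 0 < S x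

/-- The spin-weighted spheroidal eigenfunction `x ↦ S_{ml}^{[s]}(x; ω)`; it is determined on
`(-1, 1)` by `IsSpheroidalS`. -/
def spheroidalS (a : ℝ) (s m : ℤ) (l : ℕ) (ω : ℝ) : ℝ → ℝ :=
  Classical.epsilon (IsSpheroidalS a s m l ω)

/-- The `k`-th derivative `∂_ω^k S_{ml}^{[s]}(x; ω)`. -/
def dS (a : ℝ) (s m : ℤ) (l k : ℕ) (ω x : ℝ) : ℝ :=
  iteratedDeriv k (fun w => spheroidalS a s m l w x) ω

/-- The expansion coefficient `D_{mll';k}^{[s]}(ω)` of `∂_ω^k S_{ml}^{[s]}(ω)` with respect to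
`S_{ml'}^{[s]}(ω)` in `L²([-1, 1])`. -/
def coeffD (a : ℝ) (s m : ℤ) (l l' k : ℕ) (ω : ℝ) : ℝ :=
  ∫ x in Icc (-1 : ℝ) 1, dS a s m l k ω x * spheroidalS a s m l' ω x

/-- For every `k ≥ 1` there is a constant that bounds the sum over `l, l'` of
`|D_{mll';k}^{[s]}(ω)|²` for all `m` and all `|ω| ≤ ε`. -/
def CoeffBound (a : ℝ) (s : ℤ) (ε : ℝ) : Prop :=
  ∀ k : ℕ, 1 ≤ k → ∃ C : ℝ≥0, ∀ (m : ℤ) (ω : ℝ), |ω| ≤ ε →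
    ∑' p : Modes s m × Modes s m, ENNReal.ofReal (coeffD a s m p.1 p.2 k ω ^ 2) ≤ (C : ℝ≥0∞)

/-- The spin-weighted spheroidal harmonic `Y_{ml}^{[s]}(θ, φ; ω)`, with norm one in `L²(S²)`. -/
def spheroidalY (a : ℝ) (s m : ℤ) (l : ℕ) (ω θ φ : ℝ) : ℂ :=
  ((Real.sqrt (2 * Real.pi))⁻¹ * spheroidalS a s m l ω (Real.cos θ) : ℝ)
    * Complex.exp (Complex.I * (m : ℂ) * (φ : ℂ))

/-- The volume measure `sin θ dθ dφ` of `S²` in the coordinates `(θ, φ) ∈ (0, π) × (0, 2π)`. -/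
def sphereMeasure : Measure (ℝ × ℝ) :=
  (volume.restrict (Ioo 0 Real.pi ×ˢ Ioo 0 (2 * Real.pi))).withDensity
    (fun p => ENNReal.ofReal (Real.sin p.1))

/-- The product measure `dω × vol_{S²}` on `(-ε, ε) × S²`. -/
def cylinderMeasure (ε : ℝ) : Measure (ℝ × ℝ × ℝ) :=
  (volume.restrict (Ioo (-ε) ε)).prod sphereMeasure

/-- `f_{ml}(ω)`, the coefficient of `f(ω, ·)` with respect to `Y_{ml}^{[s]}(ω)`. -/
def modeCoeff (a : ℝ) (s : ℤ) (f : ℝ × ℝ × ℝ → ℂ) (m : ℤ) (l : ℕ) (ω : ℝ) : ℂ :=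
  ∫ p, f (ω, p) * starRingEnd ℂ (spheroidalY a s m l ω p.1 p.2) ∂sphereMeasure

/-- `g` is the weak derivative `∂_ω^q f` on `(-ε, ε) × S²`. The test functions are the smooth
functions on `ℝ × S²` (restrictions of smooth functions on `ℝ × ℝ³`) that vanish for `ω` outside
a compact subset of `(-ε, ε)`. -/
def IsWeakDerivSphere (ε : ℝ) (q : ℕ) (f g : ℝ × ℝ × ℝ → ℂ) : Prop :=
  ∀ χ : ℝ × E3 → ℂ, ContDiff ℝ (⊤ : ℕ∞) χ →
    (∃ K : Set ℝ, IsCompact K ∧ K ⊆ Ioo (-ε) ε ∧ ∀ w ∉ K, ∀ p, χ (w, p) = 0) →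
    ∫ z, f z * iteratedDeriv q (fun w => χ (w, spherePt z.2.1 z.2.2)) z.1 ∂(cylinderMeasure ε) =
      (-1) ^ q * ∫ z, g z * χ (z.1, spherePt z.2.1 z.2.2) ∂(cylinderMeasure ε)

/-- `g` is the `q`-th weak derivative of `f` on `(-ε, ε)`. -/
def IsWeakDerivInterval (ε : ℝ) (q : ℕ) (f g : ℝ → ℂ) : Prop :=
  ∀ χ : ℝ → ℂ, ContDiff ℝ (⊤ : ℕ∞) χ → HasCompactSupport χ → tsupport χ ⊆ Ioo (-ε) ε →
    ∫ ω in Ioo (-ε) ε, f ω * iteratedDeriv q χ ω =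
      (-1) ^ q * ∫ ω in Ioo (-ε) ε, g ω * χ ω

/-- The weak derivative `∂_ω^q f` exists and lies in `L²_{(-ε, ε)} L²(S²)`. -/
def WeakDerivInL2Sphere (ε : ℝ) (q : ℕ) (f : ℝ × ℝ × ℝ → ℂ) : Prop :=
  ∃ g : ℝ × ℝ × ℝ → ℂ, MemLp g 2 (cylinderMeasure ε) ∧ IsWeakDerivSphere ε q f g

/-- The weak derivatives `∂_ω^q F_{ml}` exist for all `m` and `l ≥ max (|m|, |s|)`, and the family
of them lies in `L²_{(-ε, ε)} ℓ²_{ml}`. -/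
def WeakDerivInL2Modes (s : ℤ) (ε : ℝ) (q : ℕ) (F : ℤ → ℕ → ℝ → ℂ) : Prop :=
  ∃ G : ℤ → ℕ → ℝ → ℂ,
    (∀ (m : ℤ) (l : Modes s m),
      AEStronglyMeasurable (G m l) (volume.restrict (Ioo (-ε) ε)) ∧
        IsWeakDerivInterval ε q (F m l) (G m l)) ∧
    ∫⁻ ω in Ioo (-ε) ε, ∑' (m : ℤ) (l : Modes s m), ‖G m l ω‖ₑ ^ 2 < ∞

end Spheroidal

end

/-! Put α = |m + s|, β = |m - s| and S = (1 - x)^(α/2) (1 + x)^(β/2) h. Conjugation by this root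
weight turns the spheroidal operator into the Jacobi operator for (α, β), plus multiplication by
ω²a²x² - 2saωx, minus a constant (`angularOp_rootWeight_mul`). The normalised Jacobi functions are
an orthonormal basis of L²([-1, 1]), so the problem becomes -Λ + M(ω), where Λ is diagonal with
entries n(n + α + β + 1) and M(ω) is bounded, symmetric and quadratic in ω. No domain is chosen for
this unbounded operator: `DiagRel` tests it against the basis, and `diagRel_iff` rewrites the
relation as a fixed-point equation for a compact operator.

Regularity. M(ω) is banded in the Jacobi basis while Λ grows quadratically, so the coefficients of
an eigenvector decay faster than any geometric sequence (`exists_decay`). Jacobi functions grow at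
most geometrically on compact sets of ℂ, so h is analytic. At -1 the equation has a regular singular
point, and an analytic solution is determined by h(-1); hence all eigenvalues are simple
(`simpleEigenvalues_mulOp`). Conversely, smoothness in θ of a spin-weighted function removes the
boundary terms in Green's identity, so the eigenfunctions of the statement are exactly these
eigenvectors (`isSpheroidalS_iff`).

Smoothness in ω. Simple eigenpairs continue smoothly by the implicit function theorem; Weyl's
inequality keeps their numbering and positivity near -1 keeps their sign (`contDiff_eigenpair`).
Evaluation at x is a bounded functional after a resolvent, which transfers smoothness from L² to
single points x.

The coefficient bound. For small ω the eigenvalues move by at most 1, so the gap around the l-th one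
is at least l. In the k-times differentiated eigenvalue equation the reduced resolvent gains the
inverse gap, which gives ‖∂_ω^k S_ml‖ ≤ c/l uniformly in m (`exists_bound_iteratedDeriv`). By
Parseval the sum over l' of the squared coefficients is ‖∂_ω^k S_ml‖², and the sum of 1/l²
converges.

Regularity of f. The bound shows that every ω-derivative of the analysis operator f ↦ (f_ml) is
bounded, one azimuthal sector at a time and uniformly in m. A family of operators with smooth matrix
entries and bounded derivatives preserves vector-valued Sobolev regularity by the product rule, and
so does the family of adjoints. The analysis operator is isometric, so its adjoint recovers f from
the coefficients (`exists_sobolev_coeff_iff`). -/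

noncomputable section

namespace Spheroidal

/-! ### Jacobi polynomials: eigenvalue equation, orthogonality, weighted norms -/

open Polynomial in
/-- The Jacobi differential operator on polynomials. -/
def jacobiOp (α β : ℕ) (p : ℝ[X]) : ℝ[X] :=
  (1 - X ^ 2) * derivative (derivative p) +
    (C ((β : ℝ) - α) - C ((α : ℝ) + β + 2) * X) * derivative p

open Polynomial in
/-- The Jacobi weight `(1 - x)^α (1 + x)^β`. -/
def jacobiWeight (α β : ℕ) : ℝ[X] := (1 - X) ^ α * (1 + X) ^ β

/-- The eigenvalues of the negative Jacobi operator. -/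
def jacobiEv (α β n : ℕ) : ℝ := n * (n + α + β + 1)

/-- The coefficients of the Jacobi polynomial in powers of `1 + x`. -/
def jacobiCoeff (α β n k : ℕ) : ℝ :=
  ∏ i ∈ Finset.range k,
    (jacobiEv α β i - jacobiEv α β n) / (2 * ((i : ℝ) + 1) * ((i : ℝ) + 1 + β))

open Polynomial in
/-- The Jacobi polynomial of degree `n`, with value one at `-1`. -/
def jacobiP (α β n : ℕ) : ℝ[X] :=
  ∑ k ∈ Finset.range (n + 1), C (jacobiCoeff α β n k) * (X + 1) ^ k

section
open Polynomial

variable (α β : ℕ)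

theorem jacobiOp_add (p q : ℝ[X]) : jacobiOp α β (p + q) = jacobiOp α β p + jacobiOp α β q := by
  simp only [jacobiOp, map_add]; ring

theorem jacobiOp_C_mul (c : ℝ) (q : ℝ[X]) : jacobiOp α β (C c * q) = C c * jacobiOp α β q := by
  simp only [jacobiOp, derivative_C_mul]; ring

theorem jacobiOp_sum {ι : Type*} (t : Finset ι) (p : ι → ℝ[X]) :
    jacobiOp α β (∑ i ∈ t, p i) = ∑ i ∈ t, jacobiOp α β (p i) := by
  classical
  induction t using Finset.induction_on with
  | empty => simp [jacobiOp]
  | insert i t hi ih => rw [Finset.sum_insert hi, Finset.sum_insert hi, jacobiOp_add, ih]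

/-- In powers of `X + 1` the operator is bidiagonal, so the eigenvalue equation becomes the two-term
recursion solved by `jacobiCoeff`. The truncated exponent at `k = 0` is harmless because its
coefficient is zero. -/
theorem jacobiOp_pow (k : ℕ) : jacobiOp α β ((X + 1) ^ k) =
    - C (jacobiEv α β k) * (X + 1) ^ k
      + C (2 * (k : ℝ) * (k + β)) * (X + 1) ^ (k - 1) := by
  have h1 : derivative (X + 1 : ℝ[X]) = 1 := by simp
  have h0 : derivative (1 : ℝ[X]) = 0 := derivative_one
  rcases k with _ | _ | k
  · simp [jacobiOp, jacobiEv]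
  · simp only [jacobiOp, jacobiEv, zero_add, pow_one, h1, derivative_one]
    simp only [map_mul, map_add, map_sub, C_1, map_natCast, Nat.cast_one, map_ofNat]
    ring
  · simp only [jacobiOp, jacobiEv, derivative_pow, h1, h0, derivative_mul,
      derivative_C, Nat.succ_sub_one]
    simp only [map_mul, map_add, map_sub, C_1, map_natCast, Nat.cast_one, map_ofNat, Nat.cast_add]
    ring

theorem jacobiEv_nonneg (n : ℕ) : 0 ≤ jacobiEv α β n := by unfold jacobiEv; positivity

theorem jacobiEv_strictMono : StrictMono (jacobiEv α β) := by
  refine strictMono_nat_of_lt_succ fun n => ?_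
  unfold jacobiEv; push_cast
  nlinarith [(Nat.cast_nonneg n : (0:ℝ) ≤ n), (Nat.cast_nonneg α : (0:ℝ) ≤ α),
    (Nat.cast_nonneg β : (0:ℝ) ≤ β)]

theorem jacobiEv_add_one_ge (n : ℕ) : ((n : ℝ) + 1) ^ 2 / 2 ≤ jacobiEv α β n + 1 := by
  unfold jacobiEv
  have := mul_nonneg (Nat.cast_nonneg n : (0:ℝ) ≤ n) (Nat.cast_nonneg α : (0:ℝ) ≤ α)
  have := mul_nonneg (Nat.cast_nonneg n : (0:ℝ) ≤ n) (Nat.cast_nonneg β : (0:ℝ) ≤ β)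
  nlinarith [sq_nonneg (n : ℝ)]

theorem jacobiCoeff_succ (n k : ℕ) :
    2 * ((k : ℝ) + 1) * ((k : ℝ) + 1 + β) * jacobiCoeff α β n (k + 1) =
      (jacobiEv α β k - jacobiEv α β n) * jacobiCoeff α β n k := by
  rw [jacobiCoeff, Finset.prod_range_succ, ← jacobiCoeff]
  field_simp

theorem jacobiOp_jacobiP (n : ℕ) :
    jacobiOp α β (jacobiP α β n) = - C (jacobiEv α β n) * jacobiP α β n := by
  rw [jacobiP, jacobiOp_sum]
  have e (k : ℕ) (A B : ℝ[X]) : C (jacobiCoeff α β n k) * (A + B) =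
    C (jacobiCoeff α β n k) * A + C (jacobiCoeff α β n k) * B := mul_add _ _ _
  simp only [jacobiOp_C_mul, jacobiOp_pow, e, Finset.sum_add_distrib]
  -- Shifting the index of the lowering terms aligns equal powers, where the recursion applies. The
  -- shifted-out term `k = 0` vanishes, and the top term `k = n` already carries the eigenvalue for
  -- `n`.
  rw [Finset.sum_range_succ' (fun k => C (jacobiCoeff α β n k) *
    (C (2 * (k : ℝ) * (k + β)) * (X + 1) ^ (k - 1)))]
  rw [Finset.sum_range_succ (fun k => C (jacobiCoeff α β n k) *
    (- C (jacobiEv α β k) * (X + 1) ^ k)), Finset.sum_range_succ (fun k => C (jacobiCoeff α β n k) * (X + 1) ^ k),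
    mul_add (-C (jacobiEv α β n)), Finset.mul_sum]
  have key : ∀ k, C (jacobiCoeff α β n k) * (- C (jacobiEv α β k) * (X + 1 : ℝ[X]) ^ k) +
      C (jacobiCoeff α β n (k + 1)) *
        (C (2 * ((k + 1 : ℕ) : ℝ) * ((k + 1 : ℕ) + β)) * (X + 1) ^ (k + 1 - 1)) =
      - C (jacobiEv α β n) * (C (jacobiCoeff α β n k) * (X + 1) ^ k) := by
    intro k
    have h := congrArg (C : ℝ → ℝ[X]) (jacobiCoeff_succ α β n k)
    simp only [map_mul, map_add, map_sub, C_1, map_natCast, map_ofNat] at h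
    simp only [map_mul, map_add, map_natCast, map_ofNat, Nat.add_sub_cancel]
    push_cast
    linear_combination (X + 1) ^ k * h
  rw [← Finset.sum_congr rfl (fun k _ => key k), Finset.sum_add_distrib]
  simp
  ring

theorem jacobiCoeff_ne_zero {n k : ℕ} (hk : k ≤ n) : jacobiCoeff α β n k ≠ 0 := by
  refine Finset.prod_ne_zero_iff.2 fun i hi => div_ne_zero ?_ (by positivity)
  have := jacobiEv_strictMono α β ((Finset.mem_range.1 hi).trans_le hk)
  exact (sub_neg.2 this).ne

theorem natDegree_jacobiP_sub (n : ℕ) :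
    (jacobiP α β n - C (jacobiCoeff α β n n) * (X + 1) ^ n).degree < (n : WithBot ℕ) := by
  rw [jacobiP, Finset.sum_range_succ, add_sub_cancel_right]
  refine (degree_sum_le _ _).trans_lt ((Finset.sup_lt_iff (WithBot.bot_lt_coe n)).2 ?_)
  intro k hk
  rw [degree_C_mul (jacobiCoeff_ne_zero α β (Finset.mem_range.1 hk).le),
    show (X + 1 : ℝ[X]) = X + C 1 by simp, degree_pow, degree_X_add_C]
  simp only [nsmul_one]
  exact Nat.cast_lt.2 (Finset.mem_range.1 hk)

theorem degree_jacobiP (n : ℕ) : (jacobiP α β n).degree = n := by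
  have h : (C (jacobiCoeff α β n n) * (X + 1 : ℝ[X]) ^ n).degree = n := by
    rw [degree_C_mul (jacobiCoeff_ne_zero α β le_rfl),
      show (X + 1 : ℝ[X]) = X + C 1 by simp, degree_pow, degree_X_add_C]; simp
  have := natDegree_jacobiP_sub α β n
  have e : jacobiP α β n = (jacobiP α β n - C (jacobiCoeff α β n n) * (X + 1) ^ n) +
    C (jacobiCoeff α β n n) * (X + 1) ^ n := by ring
  rw [e, degree_add_eq_right_of_degree_lt (by rwa [h]), h]

theorem mem_span_jacobiP (N : ℕ) : ∀ q : ℝ[X], q.degree < N →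
    q ∈ Submodule.span ℝ (jacobiP α β '' Iio N) := by
  induction N with
  | zero =>
    intro q hq
    have : q = 0 := by
      rw [← degree_eq_bot]; simpa using hq
    simp [this]
  | succ N ih =>
    intro q hq
    have hmono : Submodule.span ℝ (jacobiP α β '' Iio N) ≤
        Submodule.span ℝ (jacobiP α β '' Iio (N + 1)) :=
      Submodule.span_mono (image_mono (Iio_subset_Iio (Nat.le_succ N)))
    set P := jacobiP α β N with hP
    have hd : P.degree = N := degree_jacobiP α β N
    have hlc : P.coeff N ≠ 0 := by
      have : P.natDegree = N := natDegree_eq_of_degree_eq_some hd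
      have h0 : P ≠ 0 := by intro h; rw [h] at hd; simp at hd
      simpa [leadingCoeff, this] using leadingCoeff_ne_zero.2 h0
    have h2 : (q - C (q.coeff N / P.coeff N) * P).degree < N := by
      rw [degree_lt_iff_coeff_zero]
      intro m hm
      rcases hm.eq_or_lt with rfl | hm
      · simp [hlc]
      · have h3 : q.coeff m = 0 := (degree_lt_iff_coeff_zero q (N + 1)).1 (by exact_mod_cast hq) m hm
        have h4 : P.coeff m = 0 :=
          coeff_eq_zero_of_degree_lt (by rw [hd]; exact_mod_cast hm)
        simp [h3, h4]
    have h5 := Submodule.add_mem _ (hmono (ih _ h2))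
      (Submodule.smul_mem _ (q.coeff N / P.coeff N)
        (Submodule.subset_span (mem_image_of_mem (jacobiP α β) (show N ∈ Iio (N + 1) by simp))))
    rwa [← C_mul', ← hP, sub_add_cancel] at h5

/-- Divergence form of the Jacobi operator. The weight with both exponents raised vanishes at both
end points, so integration by parts leaves no boundary terms and the operator is symmetric. -/
theorem derivative_jacobiWeight_mul (p : ℝ[X]) :
    derivative (jacobiWeight (α + 1) (β + 1) * derivative p) =
      jacobiWeight α β * jacobiOp α β p := by
  simp only [jacobiWeight, jacobiOp, derivative_mul, derivative_pow,
    derivative_one, derivative_X, map_add, map_sub, map_natCast, map_ofNat,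
    Nat.add_sub_cancel]
  push_cast
  ring

theorem integral_eval_derivative (p : ℝ[X]) (a b : ℝ) :
    ∫ x in a..b, (derivative p).eval x = p.eval b - p.eval a :=
  intervalIntegral.integral_eq_sub_of_hasDerivAt (fun x _ => p.hasDerivAt x)
    ((derivative p).continuous.intervalIntegrable _ _)

theorem jacobiWeight_succ_eval_one : (jacobiWeight (α + 1) (β + 1)).eval 1 = 0 := by
  simp [jacobiWeight]

theorem jacobiWeight_succ_eval_neg_one : (jacobiWeight (α + 1) (β + 1)).eval (-1) = 0 := by
  simp [jacobiWeight]

theorem jacobiWeight_succ : jacobiWeight (α + 1) (β + 1) = jacobiWeight α β * (1 - X ^ 2) := by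
  simp only [jacobiWeight]; ring

theorem jacobiWeight_nonneg {x : ℝ} (hx : x ∈ Icc (-1 : ℝ) 1) : 0 ≤ (jacobiWeight α β).eval x := by
  simp only [jacobiWeight, eval_mul, eval_pow, eval_sub, eval_add, eval_one, eval_X]
  have := hx.1; have := hx.2
  exact mul_nonneg (pow_nonneg (by linarith) _) (pow_nonneg (by linarith) _)

theorem jacobiWeight_pos {x : ℝ} (hx : x ∈ Ioo (-1 : ℝ) 1) : 0 < (jacobiWeight α β).eval x := by
  simp only [jacobiWeight, eval_mul, eval_pow, eval_sub, eval_add, eval_one, eval_X]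
  have := hx.1; have := hx.2
  exact mul_pos (pow_pos (by linarith) _) (pow_pos (by linarith) _)

theorem integral_jacobiOp_mul (p q : ℝ[X]) :
    ∫ x in (-1 : ℝ)..1, (jacobiWeight α β * jacobiOp α β p * q).eval x =
      - ∫ x in (-1 : ℝ)..1,
        (jacobiWeight (α + 1) (β + 1) * derivative p * derivative q).eval x := by
  have h := integral_eval_derivative (jacobiWeight (α + 1) (β + 1) * derivative p * q) (-1) 1
  rw [derivative_mul, derivative_jacobiWeight_mul] at h
  simp only [eval_add] at h
  rw [intervalIntegral.integral_add ((Polynomial.continuous _).intervalIntegrable _ _)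
    ((Polynomial.continuous _).intervalIntegrable _ _)] at h
  simp only [eval_mul, jacobiWeight_succ_eval_one, jacobiWeight_succ_eval_neg_one] at h ⊢
  linarith

theorem integral_jacobiP_mul_jacobiP {n k : ℕ} (h : n ≠ k) :
    ∫ x in (-1 : ℝ)..1, (jacobiWeight α β * jacobiP α β n * jacobiP α β k).eval x = 0 := by
  have h1 := integral_jacobiOp_mul α β (jacobiP α β n) (jacobiP α β k)
  have h2 := integral_jacobiOp_mul α β (jacobiP α β k) (jacobiP α β n)
  rw [jacobiOp_jacobiP] at h1 h2
  have e1 : ∀ x : ℝ, (jacobiWeight α β * (-C (jacobiEv α β n) * jacobiP α β n) *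
      jacobiP α β k).eval x = - jacobiEv α β n *
        (jacobiWeight α β * jacobiP α β n * jacobiP α β k).eval x := by
    intro x; simp; ring
  have e2 : ∀ x : ℝ, (jacobiWeight α β * (-C (jacobiEv α β k) * jacobiP α β k) *
      jacobiP α β n).eval x = - jacobiEv α β k *
        (jacobiWeight α β * jacobiP α β n * jacobiP α β k).eval x := by
    intro x; simp; ring
  have e3 : ∀ x : ℝ, (jacobiWeight (α + 1) (β + 1) * derivative (jacobiP α β k) *
      derivative (jacobiP α β n)).eval x = (jacobiWeight (α + 1) (β + 1) *
        derivative (jacobiP α β n) * derivative (jacobiP α β k)).eval x := by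
    intro x; simp; ring
  simp only [e1, intervalIntegral.integral_const_mul] at h1
  simp only [e2, e3, intervalIntegral.integral_const_mul] at h2
  have h3 : jacobiEv α β n ≠ jacobiEv α β k := (jacobiEv_strictMono α β).injective.ne h
  have : (jacobiEv α β n - jacobiEv α β k) *
    ∫ x in (-1 : ℝ)..1, (jacobiWeight α β * jacobiP α β n * jacobiP α β k).eval x = 0 := by
    linarith
  exact (mul_eq_zero.1 this).resolve_left (sub_ne_zero.2 h3)

theorem integral_jacobiP_mul_of_degree_lt {n : ℕ} {q : ℝ[X]} (hq : q.degree < n) :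
    ∫ x in (-1 : ℝ)..1, (jacobiWeight α β * jacobiP α β n * q).eval x = 0 := by
  have := mem_span_jacobiP α β n q hq
  clear hq
  induction this using Submodule.span_induction with
  | mem x hx =>
    obtain ⟨k, hk, rfl⟩ := hx
    exact integral_jacobiP_mul_jacobiP α β (ne_of_gt hk)
  | zero => simp
  | add x y hx hy h1 h2 =>
    simp only [mul_add, eval_add]
    rw [intervalIntegral.integral_add ((Polynomial.continuous _).intervalIntegrable _ _)
      ((Polynomial.continuous _).intervalIntegrable _ _), h1, h2, add_zero]
  | smul c x hx h => simp only [mul_smul_comm, eval_smul, intervalIntegral.integral_smul, h, smul_zero]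

theorem integral_jacobiP_sq_pos (n : ℕ) :
    0 < ∫ x in (-1 : ℝ)..1, (jacobiWeight α β * jacobiP α β n ^ 2).eval x := by
  have h0 : jacobiP α β n ≠ 0 := by
    intro h; have := degree_jacobiP α β n; rw [h] at this; simp at this
  have hfin : {x : ℝ | (jacobiP α β n).eval x = 0}.Finite := by
    refine (jacobiP α β n).roots.toFinset.finite_toSet.subset fun x hx => ?_
    simpa [h0] using hx
  obtain ⟨x, hx, hx0⟩ := (Set.Ioo_infinite (show (-1 : ℝ) < 1 by norm_num)).exists_notMem_finite hfin
  refine intervalIntegral.integral_pos (by norm_num) (Polynomial.continuous _).continuousOn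
    (fun y hy => ?_) ⟨x, Ioo_subset_Icc_self hx, ?_⟩
  · rw [eval_mul, eval_pow]
    exact mul_nonneg (jacobiWeight_nonneg α β (Ioc_subset_Icc_self hy)) (sq_nonneg _)
  · rw [eval_mul, eval_pow]
    exact mul_pos (jacobiWeight_pos α β hx) (sq_pos_of_ne_zero hx0)

theorem integral_derivative_jacobiP_sq (n : ℕ) :
    ∫ x in (-1 : ℝ)..1, (jacobiWeight (α + 1) (β + 1) * derivative (jacobiP α β n) ^ 2).eval x =
      jacobiEv α β n * ∫ x in (-1 : ℝ)..1, (jacobiWeight α β * jacobiP α β n ^ 2).eval x := by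
  have h := integral_jacobiOp_mul α β (jacobiP α β n) (jacobiP α β n)
  rw [jacobiOp_jacobiP] at h
  have e1 : ∀ x : ℝ, (jacobiWeight α β * (-C (jacobiEv α β n) * jacobiP α β n) *
      jacobiP α β n).eval x = - (jacobiEv α β n *
        (jacobiWeight α β * jacobiP α β n ^ 2).eval x) := by
    intro x; simp; ring
  simp only [e1, intervalIntegral.integral_neg, intervalIntegral.integral_const_mul] at h
  rw [neg_injective h]
  simp only [mul_assoc, ← pow_two]

end

/-! ### Pointwise bounds for Jacobi polynomials -/

section
open Polynomial

variable {α β : ℕ} {ν : ℝ} {p : ℝ[X]}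

theorem jacobiOp_eval (h : jacobiOp α β p = - C ν * p) (x : ℝ) :
    (1 - x ^ 2) * (derivative (derivative p)).eval x
      + ((β - α) - (α + β + 2) * x) * (derivative p).eval x = - ν * p.eval x := by
  have := congrArg (eval x) h
  simpa [jacobiOp] using this

/-- Differentiating the equation raises both parameters by one and lowers the eigenvalue, so bounds
for eigenpolynomials pass to their derivatives by induction. -/
theorem jacobiOp_derivative (h : jacobiOp α β p = - C ν * p) :
    jacobiOp (α + 1) (β + 1) (derivative p) = - C (ν - (α + β + 2)) * derivative p := by
  have h0 : derivative (1 : ℝ[X]) = 0 := derivative_one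
  have := congrArg derivative h
  simp only [jacobiOp, derivative_mul, derivative_neg, derivative_C,
    derivative_X, derivative_pow, h0, map_sub, map_add, map_natCast, map_ofNat] at this
  simp only [jacobiOp, map_sub, map_add, map_natCast, map_ofNat, Nat.cast_add, Nat.cast_one, C_1]
    at this ⊢
  simp only [derivative_natCast, Polynomial.derivative_ofNat] at this
  linear_combination this

/-- Sonine's argument: along a solution the derivative of ν p² + (1 - x²) p'² is p'² times an affine
function of x. This quantity therefore decreases and then increases, and at ±1 it reduces to ν p².
-/
theorem sq_eval_le_of_jacobiOp (h : jacobiOp α β p = - C ν * p) (hν : 0 < ν) {x : ℝ}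
    (hx : x ∈ Icc (-1 : ℝ) 1) : p.eval x ^ 2 ≤ max (p.eval (-1) ^ 2) (p.eval 1 ^ 2) := by
  set F : ℝ → ℝ := fun x => ν * p.eval x ^ 2 + (1 - x ^ 2) * (derivative p).eval x ^ 2 with hF
  have hd : ∀ x, HasDerivAt F
      (2 * (derivative p).eval x ^ 2 * ((α : ℝ) - β + (α + β + 1) * x)) x := by
    intro x
    have h1 := p.hasDerivAt x
    have h2 := (derivative p).hasDerivAt x
    have h3 := ((h1.pow 2).const_mul ν).add ((((hasDerivAt_id x).pow 2).const_sub 1).mul (h2.pow 2))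
    refine h3.congr_deriv ?_
    have := jacobiOp_eval h x
    simp
    linear_combination 2 * (derivative p).eval x * this
  have hc : Continuous F := continuous_iff_continuousAt.2 fun x => (hd x).continuousAt
  set y : ℝ := ((β : ℝ) - α) / (α + β + 1) with hy
  have hpos : (0 : ℝ) < α + β + 1 := by positivity
  have hxF : ν * p.eval x ^ 2 ≤ F x := by
    have : 0 ≤ (1 - x ^ 2) * (derivative p).eval x ^ 2 :=
      mul_nonneg (by nlinarith [hx.1, hx.2]) (sq_nonneg _)
    simp only [hF]; linarith
  have key : F x ≤ max (F (-1)) (F 1) := by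
    rcases le_total x y with hxy | hxy
    · refine le_max_of_le_left ?_
      refine (antitoneOn_of_deriv_nonpos (convex_Iic y) hc.continuousOn
        (fun z _ => (hd z).differentiableAt.differentiableWithinAt) fun z hz => ?_)
        (hx.1.trans hxy) hxy hx.1
      rw [interior_Iic] at hz
      rw [(hd z).deriv]
      refine mul_nonpos_of_nonneg_of_nonpos (by positivity) ?_
      have : z * (α + β + 1) < β - α := (lt_div_iff₀ hpos).1 hz
      linarith
    · refine le_max_of_le_right ?_
      refine (monotoneOn_of_deriv_nonneg (convex_Ici y) hc.continuousOn
        (fun z _ => (hd z).differentiableAt.differentiableWithinAt) fun z hz => ?_)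
        hxy (hxy.trans hx.2) hx.2
      rw [interior_Ici] at hz
      rw [(hd z).deriv]
      refine mul_nonneg (by positivity) ?_
      have : β - α < z * (α + β + 1) := (div_lt_iff₀ hpos).1 hz
      linarith
  have h3 : ν * p.eval x ^ 2 ≤ ν * max (p.eval (-1) ^ 2) (p.eval 1 ^ 2) := by
    refine hxF.trans (key.trans (le_of_eq ?_))
    rw [mul_max_of_nonneg _ _ hν.le]
    simp [hF]
  exact le_of_mul_le_mul_left h3 hν

theorem abs_eval_le_of_jacobiOp (h : jacobiOp α β p = - C ν * p) (hν : 0 < ν) {M : ℝ}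
    (h1 : |p.eval (-1)| ≤ M) (h2 : |p.eval 1| ≤ M) {x : ℝ}
    (hx : x ∈ Icc (-1 : ℝ) 1) : |p.eval x| ≤ M := by
  have hM : 0 ≤ M := (abs_nonneg _).trans h1
  refine abs_le_of_sq_le_sq ((sq_eval_le_of_jacobiOp h hν hx).trans ?_) hM
  exact max_le (sq_le_sq.2 (by rwa [abs_of_nonneg hM])) (sq_le_sq.2 (by rwa [abs_of_nonneg hM]))

/-- At ±1 the second-order term drops out of the equation, which bounds p' there by the eigenvalue
times p. As p' is again an eigenpolynomial, with a smaller eigenvalue, the end point bound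
propagates by induction on `k`. -/
theorem abs_iterate_derivative_eval_le {n : ℕ} (k : ℕ) {M : ℝ} (hn : p.natDegree ≤ n)
    (h : jacobiOp α β p = - C (jacobiEv α β n) * p)
    (h1 : |p.eval (-1)| ≤ M) (h2 : |p.eval 1| ≤ M) {x : ℝ}
    (hx : x ∈ Icc (-1 : ℝ) 1) : |(derivative^[k] p).eval x| ≤ jacobiEv α β n ^ k * M := by
  induction k generalizing α β n p M with
  | zero =>
    rcases n with _ | n
    · rw [eq_C_of_natDegree_le_zero hn] at h1 ⊢
      simpa using h1
    · simpa using abs_eval_le_of_jacobiOp h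
        (by unfold jacobiEv; positivity) h1 h2 hx
  | succ k ih =>
    have hM : 0 ≤ M := (abs_nonneg _).trans h1
    rcases n with _ | n
    · rw [eq_C_of_natDegree_le_zero hn]
      simp [jacobiEv]
    · have e : jacobiEv α β (n + 1) - (α + β + 2) = jacobiEv (α + 1) (β + 1) n := by
        unfold jacobiEv; push_cast; ring
      have hd := jacobiOp_derivative h
      rw [e] at hd
      have hn' : (derivative p).natDegree ≤ n := by
        have := natDegree_derivative_le p; omega
      have hν := jacobiEv_nonneg α β (n + 1)
      have a1 : |(derivative p).eval (-1)| ≤ jacobiEv α β (n + 1) * M := by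
        have := jacobiOp_eval h (-1)
        have e2 : (2 * β + 2) * (derivative p).eval (-1) =
          - (jacobiEv α β (n + 1) * p.eval (-1)) := by linear_combination this
        have e3 : (2 * (β : ℝ) + 2) * |(derivative p).eval (-1)| =
            jacobiEv α β (n + 1) * |p.eval (-1)| := by
          rw [← abs_of_pos (show (0 : ℝ) < 2 * β + 2 by positivity), ← abs_mul, e2, abs_neg, abs_mul,
            abs_of_nonneg hν]
        have := mul_le_mul_of_nonneg_left h1 hν
        have := mul_nonneg (show (0 : ℝ) ≤ 2 * β + 1 by positivity) (abs_nonneg ((derivative p).eval (-1)))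
        linarith
      have a2 : |(derivative p).eval 1| ≤ jacobiEv α β (n + 1) * M := by
        have := jacobiOp_eval h 1
        have e2 : (2 * α + 2) * (derivative p).eval 1 =
          jacobiEv α β (n + 1) * p.eval 1 := by linear_combination - this
        have e3 : (2 * (α : ℝ) + 2) * |(derivative p).eval 1| =
            jacobiEv α β (n + 1) * |p.eval 1| := by
          rw [← abs_of_pos (show (0 : ℝ) < 2 * α + 2 by positivity), ← abs_mul, e2, abs_mul,
            abs_of_nonneg hν]
        have := mul_le_mul_of_nonneg_left h2 hν
        have := mul_nonneg (show (0 : ℝ) ≤ 2 * α + 1 by positivity) (abs_nonneg ((derivative p).eval 1))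
        linarith
      have := ih hn' hd a1 a2
      rw [Function.iterate_succ_apply]
      refine this.trans ?_
      rw [pow_succ, mul_assoc]
      refine mul_le_mul_of_nonneg_right (pow_le_pow_left₀ (jacobiEv_nonneg _ _ _) ?_ k)
        (mul_nonneg hν hM)
      rw [← e]
      have : (0 : ℝ) ≤ α + β + 2 := by positivity
      linarith

theorem natDegree_jacobiP (α β n : ℕ) : (jacobiP α β n).natDegree = n :=
  natDegree_eq_of_degree_eq_some (degree_jacobiP α β n)

/-- The larger of the endpoint values of a Jacobi polynomial. -/
def jacobiMax (α β n : ℕ) : ℝ := max |(jacobiP α β n).eval (-1)| |(jacobiP α β n).eval 1|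

theorem abs_iterate_derivative_jacobiP_le (α β n k : ℕ) {x : ℝ} (hx : x ∈ Icc (-1 : ℝ) 1) :
    |(derivative^[k] (jacobiP α β n)).eval x| ≤ jacobiEv α β n ^ k * jacobiMax α β n :=
  abs_iterate_derivative_eval_le k (natDegree_jacobiP α β n).le (jacobiOp_jacobiP α β n)
    (le_max_left _ _) (le_max_right _ _) hx

theorem abs_jacobiP_sub_le (α β n : ℕ) {x y : ℝ} (hx : x ∈ Icc (-1 : ℝ) 1)
    (hy : y ∈ Icc (-1 : ℝ) 1) :
    |(jacobiP α β n).eval x - (jacobiP α β n).eval y| ≤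
      jacobiEv α β n * jacobiMax α β n * |x - y| := by
  have := (convex_Icc (-1 : ℝ) 1).norm_image_sub_le_of_norm_hasDerivWithin_le
    (f := fun x => (jacobiP α β n).eval x) (C := jacobiEv α β n * jacobiMax α β n)
    (fun z _ => ((jacobiP α β n).hasDerivAt z).hasDerivWithinAt)
    (fun z hz => by simpa using abs_iterate_derivative_jacobiP_le α β n 1 hz) hy hx
  simpa using this

theorem sq_le_integral_of_le_near_neg_one {α β : ℕ} {f : ℝ → ℝ} (hf : Continuous f) {M δ : ℝ}
    (hδ : 0 < δ) (hδ1 : δ ≤ 1) (hM : 0 ≤ M) (h : ∀ x ∈ Icc (-1 : ℝ) (-1 + δ), M ≤ f x ^ 2) :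
    M * (δ ^ (β + 1) / (β + 1)) ≤ ∫ x in (-1 : ℝ)..1, (jacobiWeight α β).eval x * f x ^ 2 := by
  have hc : Continuous fun x => (jacobiWeight α β).eval x * f x ^ 2 :=
    (Polynomial.continuous _).mul (hf.pow 2)
  have h1 : ∫ x in (-1 : ℝ)..(-1 + δ), M * (x + 1) ^ β = M * (δ ^ (β + 1) / (β + 1)) := by
    rw [intervalIntegral.integral_const_mul,
      intervalIntegral.integral_comp_add_right (fun x => x ^ β) 1]
    simp
  rw [← h1]
  have h2 : ∫ x in (-1 : ℝ)..(-1 + δ), M * (x + 1) ^ β ≤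
      ∫ x in (-1 : ℝ)..(-1 + δ), (jacobiWeight α β).eval x * f x ^ 2 := by
    refine intervalIntegral.integral_mono_on (by linarith)
      ((by fun_prop : Continuous fun x : ℝ => M * (x + 1) ^ β).intervalIntegrable _ _)
      (hc.intervalIntegrable _ _) fun x hx => ?_
    have a1 : 0 ≤ x + 1 := by linarith [hx.1]
    have a2 : 1 ≤ (1 - x) ^ α := one_le_pow₀ (by linarith [hx.2])
    have a3 := h x hx
    have a4 : (x + 1) ^ β ≤ (jacobiWeight α β).eval x := by
      simp only [jacobiWeight, eval_mul, eval_pow, eval_sub, eval_add, eval_one, eval_X]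
      rw [add_comm 1 x]
      exact le_mul_of_one_le_left (pow_nonneg a1 _) a2
    rw [mul_comm]
    exact mul_le_mul a4 a3 hM ((pow_nonneg a1 _).trans a4)
  refine h2.trans ?_
  rw [← intervalIntegral.integral_add_adjacent_intervals (hc.intervalIntegrable (-1) (-1 + δ))
    (hc.intervalIntegrable (-1 + δ) 1)]
  refine le_add_of_nonneg_right (intervalIntegral.integral_nonneg (by linarith) fun x hx => ?_)
  exact mul_nonneg (jacobiWeight_nonneg α β ⟨by linarith [hx.1], hx.2⟩) (sq_nonneg _)

theorem jacobiWeight_eval_neg (α β : ℕ) (x : ℝ) :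
    (jacobiWeight α β).eval (-x) = (jacobiWeight β α).eval x := by
  simp [jacobiWeight]; ring

/-- The derivative bound keeps |P| above half its end point maximum on a short interval at that end
point, and the mass there bounds the norm from below. The right end point reduces to the left one by
x ↦ -x, which exchanges α and β. -/
theorem sq_jacobiMax_le (α β n : ℕ) :
    jacobiMax α β n ^ 2 ≤ 4 * (α + β + 1) * (2 * (jacobiEv α β n + 1)) ^ (α + β + 1) *
      ∫ x in (-1 : ℝ)..1, (jacobiWeight α β * jacobiP α β n ^ 2).eval x := by
  set P := jacobiP α β n with hP
  set M := jacobiMax α β n with hM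
  set L := jacobiEv α β n + 1 with hL
  have hL1 : 1 ≤ L := by have := jacobiEv_nonneg α β n; linarith
  have hM0 : 0 ≤ M := (abs_nonneg _).trans (le_max_left _ _)
  have hLM : jacobiEv α β n * M ≤ L * M := mul_le_mul_of_nonneg_right (by linarith) hM0
  -- With this length the derivative bound allows a change of at most M/2.
  set δ := 1 / (2 * L) with hδ
  have hδ0 : 0 < δ := by positivity
  have hδ1 : δ ≤ 1 := by rw [hδ, div_le_one (by positivity)]; linarith
  have hLδ : L * δ = 1 / 2 := by rw [hδ]; field_simp
  have near : ∀ x ∈ Icc (-1 : ℝ) 1, ∀ y ∈ Icc (-1 : ℝ) 1, |x - y| ≤ δ → |P.eval y| = M →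
      (M / 2) ^ 2 ≤ P.eval x ^ 2 := by
    intro x hx y hy hxy hyM
    have h1 := abs_jacobiP_sub_le α β n hy hx
    rw [abs_sub_comm y x] at h1
    have h2 : jacobiEv α β n * M * |x - y| ≤ L * M * δ :=
      mul_le_mul hLM hxy (abs_nonneg _) (by positivity)
    have h3 := abs_sub_abs_le_abs_sub (P.eval y) (P.eval x)
    rw [sq_le_sq, abs_of_nonneg (by positivity : 0 ≤ M / 2)]
    have h4 : L * M * δ = M / 2 := by rw [mul_right_comm, hLδ]; ring
    linarith
  have conv : ∀ γ : ℕ, γ ≤ α + β → δ ^ (α + β + 1) / (α + β + 1) ≤ δ ^ (γ + 1) / (γ + 1) := by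
    intro γ hγ
    have h1 : δ ^ (α + β + 1) ≤ δ ^ (γ + 1) := pow_le_pow_of_le_one hδ0.le hδ1 (by omega)
    have h2 : (γ : ℝ) + 1 ≤ α + β + 1 := by exact_mod_cast Nat.succ_le_succ hγ
    exact div_le_div₀ (by positivity) h1 (by positivity) h2
  have key : (M / 2) ^ 2 * (δ ^ (α + β + 1) / (α + β + 1)) ≤
      ∫ x in (-1 : ℝ)..1, (jacobiWeight α β * P ^ 2).eval x := by
    simp only [eval_mul, eval_pow]
    rcases max_choice |P.eval (-1)| |P.eval 1| with h | h
    · refine (mul_le_mul_of_nonneg_left (conv β (by omega)) (by positivity)).trans ?_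
      refine sq_le_integral_of_le_near_neg_one P.continuous hδ0 hδ1 (by positivity) fun x hx => ?_
      refine near x ⟨hx.1, by linarith [hx.2]⟩ (-1) (by norm_num) ?_ h.symm
      rw [abs_of_nonneg] <;> linarith [hx.1, hx.2]
    · refine (mul_le_mul_of_nonneg_left (conv α (by omega)) (by positivity)).trans ?_
      have e : ∫ x in (-1 : ℝ)..1, (jacobiWeight α β).eval x * P.eval x ^ 2 =
          ∫ x in (-1 : ℝ)..1, (jacobiWeight β α).eval x * P.eval (-x) ^ 2 := by
        have := intervalIntegral.integral_comp_neg (a := (-1 : ℝ)) (b := 1)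
          (fun x => (jacobiWeight α β).eval x * P.eval x ^ 2)
        rw [neg_neg] at this
        rw [← this]
        simp only [jacobiWeight_eval_neg]
      rw [e]
      refine sq_le_integral_of_le_near_neg_one (P.continuous.comp continuous_neg) hδ0 hδ1
        (by positivity) fun x hx => ?_
      refine near (-x) ⟨by linarith [hx.2], by linarith [hx.1]⟩ 1 (by norm_num) ?_ h.symm
      rw [abs_le]; constructor <;> linarith [hx.1, hx.2]
  have h5 : M ^ 2 = 4 * (α + β + 1) * (2 * L) ^ (α + β + 1) *
      ((M / 2) ^ 2 * (δ ^ (α + β + 1) / (α + β + 1))) := by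
    have : (2 * L) ^ (α + β + 1) * δ ^ (α + β + 1) = 1 := by
      rw [← mul_pow, hδ, mul_one_div_cancel (by positivity), one_pow]
    field_simp
    linear_combination (-4) * M ^ 2 * this
  rw [h5]
  exact mul_le_mul_of_nonneg_left key (by positivity)

/-- A one-dimensional Sobolev estimate: W P² vanishes at -1, and its derivative is controlled by w
P² and W P'², whose integrals are the squared norm and the eigenvalue times it. Growth no worse than
the eigenvalue is what makes `evalVec` square summable. -/
theorem jacobiWeight_mul_sq_le (α β n : ℕ) {x : ℝ} (hx : x ∈ Icc (-1 : ℝ) 1) :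
    (jacobiWeight (α + 1) (β + 1) * jacobiP α β n ^ 2).eval x ≤
      (jacobiEv α β n + (2 * (α + β + 2) + 1)) *
        ∫ x in (-1 : ℝ)..1, (jacobiWeight α β * jacobiP α β n ^ 2).eval x := by
  set P := jacobiP α β n with hP
  set w := jacobiWeight α β with hw
  set W := jacobiWeight (α + 1) (β + 1) with hW
  have hd : derivative W = w * (C ((β : ℝ) - α) - C ((α : ℝ) + β + 2) * X) := by
    have := derivative_jacobiWeight_mul α β X
    simpa [jacobiOp] using this
  have h1 := integral_eval_derivative (W * P ^ 2) (-1) x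
  have h2 : (W * P ^ 2).eval (-1) = 0 := by
    rw [eval_mul, jacobiWeight_succ_eval_neg_one, zero_mul]
  rw [h2, sub_zero] at h1
  rw [← h1, add_comm, add_mul, ← integral_derivative_jacobiP_sq, ← hW, ← hP,
    ← intervalIntegral.integral_const_mul, ← intervalIntegral.integral_add
    ((by fun_prop : Continuous fun t => (2 * ((α : ℝ) + β + 2) + 1) *
      (w * P ^ 2).eval t).intervalIntegrable _ _)
    ((Polynomial.continuous _).intervalIntegrable _ _)]
  have hpt : ∀ t ∈ Icc (-1 : ℝ) 1, (derivative (W * P ^ 2)).eval t ≤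
      (2 * (α + β + 2) + 1) * (w * P ^ 2).eval t + (W * derivative P ^ 2).eval t := by
    intro t ht
    have hw0 := jacobiWeight_nonneg α β ht
    have e : W.eval t = w.eval t * (1 - t ^ 2) := by
      rw [hW, jacobiWeight_succ]; simp [hw]
    rw [derivative_mul, hd]
    simp only [derivative_pow, eval_add, eval_mul, eval_sub, eval_C, eval_X, eval_pow, e]
    simp only [Nat.cast_ofNat, Nat.add_one_sub_one, pow_one]
    have b1 : (β : ℝ) - α - (α + β + 2) * t ≤ 2 * (α + β + 2) := by
      have : (0 : ℝ) ≤ α := by positivity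
      have : (0 : ℝ) ≤ (α + β + 2) * (t + 1) := mul_nonneg (by positivity) (by linarith [ht.1])
      linarith
    have b2 : 0 ≤ 1 - t ^ 2 := by nlinarith [ht.1, ht.2]
    have b3 : 2 * P.eval t * (derivative P).eval t ≤ P.eval t ^ 2 + (derivative P).eval t ^ 2 := by
      nlinarith [sq_nonneg (P.eval t - (derivative P).eval t)]
    have c1 := mul_le_mul_of_nonneg_left b1 (mul_nonneg hw0 (sq_nonneg (P.eval t)))
    have c2 := mul_le_mul_of_nonneg_left b3 (mul_nonneg hw0 b2)
    have c3 := mul_nonneg (mul_nonneg hw0 (sq_nonneg (P.eval t))) (sq_nonneg t)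
    simp only [← hw] at *
    linarith
  have hc : Continuous fun t => (2 * ((α : ℝ) + β + 2) + 1) * (w * P ^ 2).eval t +
      (W * derivative P ^ 2).eval t :=
    (continuous_const.mul (Polynomial.continuous _)).add (Polynomial.continuous _)
  refine (intervalIntegral.integral_mono_on hx.1
    ((Polynomial.continuous _).intervalIntegrable _ _) (hc.intervalIntegrable _ _)
    fun t ht => hpt t ⟨ht.1, ht.2.trans hx.2⟩).trans ?_
  rw [← intervalIntegral.integral_add_adjacent_intervals (hc.intervalIntegrable (-1) x)
    (hc.intervalIntegrable x 1)]
  refine le_add_of_nonneg_right (intervalIntegral.integral_nonneg hx.2 fun t ht => ?_)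
  have ht' : t ∈ Icc (-1 : ℝ) 1 := ⟨hx.1.trans ht.1, ht.2⟩
  simp only [eval_mul, eval_pow]
  have := jacobiWeight_nonneg α β ht'
  have := jacobiWeight_nonneg (α + 1) (β + 1) ht'
  positivity

end

/-! ### Spectral theory of a diagonal operator with a bounded symmetric perturbation -/

section SpectralTheory

open scoped InnerProductSpace

variable {H : Type*} [NormedAddCommGroup H] [InnerProductSpace ℝ H]

/-- The operator that is diagonal in the Hilbert basis `φ`, with summable diagonal `t`. -/
def diagOp (φ : HilbertBasis ℕ ℝ H) (t : ℕ → ℝ) : H →L[ℝ] H :=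
  ∑' n, t n • (innerSL ℝ (φ n)).smulRight (φ n)

/-- `g` is the image of `u` under the operator `-Λ + M`, where `Λ` is diagonal in `φ`. -/
def DiagRel (φ : HilbertBasis ℕ ℝ H) (Λ : ℕ → ℝ) (M : H →L[ℝ] H) (u g : H) : Prop :=
  ∀ n, ⟪φ n, g⟫_ℝ = - Λ n * ⟪φ n, u⟫_ℝ + ⟪φ n, M u⟫_ℝ

/-- A complete system of eigenvectors of `-Λ + M`, with strictly decreasing eigenvalues. -/
structure EigSys (φ : HilbertBasis ℕ ℝ H) (Λ : ℕ → ℝ) (M : H →L[ℝ] H) where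
  /-- the eigenvectors -/
  ψ : HilbertBasis ℕ ℝ H
  /-- the eigenvalues -/
  τ : ℕ → ℝ
  anti : StrictAnti τ
  rel : ∀ n, DiagRel φ Λ M (ψ n) (τ n • ψ n)

/-- All eigenvalues of `-Λ + M` are simple. -/
def SimpleEigenvalues (φ : HilbertBasis ℕ ℝ H) (Λ : ℕ → ℝ) (M : H →L[ℝ] H) : Prop :=
  ∀ (τ : ℝ) (u v : H), DiagRel φ Λ M u (τ • u) → DiagRel φ Λ M v (τ • v) → u ≠ 0 →
    ∃ c : ℝ, v = c • u

theorem hilbertBasis_ext (φ : HilbertBasis ℕ ℝ H) {u v : H}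
    (h : ∀ n, ⟪φ n, u⟫_ℝ = ⟪φ n, v⟫_ℝ) : u = v := by
  apply φ.repr.injective
  ext n
  rw [φ.repr_apply_apply, φ.repr_apply_apply]
  exact h n

theorem summable_diagOp (φ : HilbertBasis ℕ ℝ H) [CompleteSpace H] {t : ℕ → ℝ} (ht : Summable t) :
    Summable fun n => t n • (innerSL ℝ (φ n)).smulRight (φ n) := by
  refine Summable.of_norm ?_
  refine ht.abs.congr fun n => ?_
  rw [norm_smul, ContinuousLinearMap.norm_smulRight_apply, innerSL_apply_norm,
    φ.orthonormal.norm_eq_one]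
  simp

variable {φ : HilbertBasis ℕ ℝ H} {Λ : ℕ → ℝ} {M M' : H →L[ℝ] H}

theorem inner_diagOp [CompleteSpace H] {t : ℕ → ℝ} (ht : Summable t) (n : ℕ) (u : H) :
    ⟪φ n, diagOp φ t u⟫_ℝ = t n * ⟪φ n, u⟫_ℝ := by
  have h1 := (summable_diagOp φ ht).hasSum
  have h2 := (h1.mapL (ContinuousLinearMap.apply ℝ H u)).mapL (innerSL ℝ (φ n))
  have h3 := h2.unique (hasSum_single n fun k hk => ?_)
  · simp only [innerSL_apply_apply, ContinuousLinearMap.apply_apply] at h3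
    rw [diagOp, h3]
    simp [inner_smul_right, φ.orthonormal.norm_eq_one]
  · have := φ.orthonormal.2 hk.symm
    simp [this]

theorem isCompactOperator_diagOp [CompleteSpace H] {t : ℕ → ℝ} (ht : Summable t) :
    IsCompactOperator (diagOp φ t) := by
  refine isCompactOperator_of_tendsto (summable_diagOp φ ht).hasSum (Eventually.of_forall fun s => ?_)
  induction s using Finset.cons_induction with
  | empty => simpa using isCompactOperator_zero
  | cons a s ha ih =>
    rw [Finset.sum_cons]
    refine IsCompactOperator.add (IsCompactOperator.smul (?_) _) ih
    have : IsCompactOperator (ContinuousLinearMap.toSpanSingleton ℝ (φ a)) :=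
      isCompactOperator_of_locallyCompactSpace_rng _
    exact this.comp_clm (innerSL ℝ (φ a))

theorem summable_inv_add {Λ : ℕ → ℝ} (hΛ : ∀ n, 0 ≤ Λ n) (hs : Summable fun n => (Λ n + 1)⁻¹)
    {c : ℝ} (hc : 0 < c) : Summable fun n => (Λ n + c)⁻¹ := by
  refine Summable.of_nonneg_of_le (fun n => inv_nonneg.2 (by have := hΛ n; linarith)) (fun n => ?_)
    (hs.mul_left (max 1 c⁻¹))
  have := hΛ n
  rw [← div_eq_mul_inv, le_div_iff₀ (by linarith), inv_mul_le_iff₀ (by linarith)]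
  have h1 : Λ n ≤ Λ n * max 1 c⁻¹ := le_mul_of_one_le_right (hΛ n) (le_max_left _ _)
  have h2 : 1 ≤ c * max 1 c⁻¹ := by
    have := mul_le_mul_of_nonneg_left (le_max_right 1 c⁻¹) hc.le
    rwa [mul_inv_cancel₀ hc.ne'] at this
  linarith

/-- Adding `c` to Λ and inverting turns the unbounded relation into an equation with the compact
operator (Λ + c)⁻¹. All later arguments of Fredholm type start from this form. -/
theorem diagRel_iff [CompleteSpace H] (hΛ : ∀ n, 0 ≤ Λ n)
    (hs : Summable fun n => (Λ n + 1)⁻¹) {c : ℝ} (hc : 0 < c) {u g : H} :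
    DiagRel φ Λ M u g ↔ u = diagOp φ (fun n => (Λ n + c)⁻¹) (M u + c • u - g) := by
  have hs' := summable_inv_add hΛ hs hc
  constructor
  · intro h
    refine hilbertBasis_ext φ fun n => ?_
    rw [inner_diagOp hs', inner_sub_right, inner_add_right, inner_smul_right, h n]
    have := hΛ n
    field_simp
    ring
  · intro h n
    have h1 : ⟪φ n, u⟫_ℝ = _ := congrArg (fun v => ⟪φ n, v⟫_ℝ) h
    rw [inner_diagOp hs', inner_sub_right, inner_add_right, inner_smul_right] at h1
    have := hΛ n
    have h2 : Λ n + c ≠ 0 := by linarith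
    rw [eq_comm, inv_mul_eq_iff_eq_mul₀ h2] at h1
    linarith

theorem DiagRel.add {u v g k : H} (h : DiagRel φ Λ M u g) (h' : DiagRel φ Λ M v k) :
    DiagRel φ Λ M (u + v) (g + k) := fun n => by
  rw [inner_add_right, inner_add_right, map_add, inner_add_right, h n, h' n]; ring

theorem DiagRel.smul {u g : H} (c : ℝ) (h : DiagRel φ Λ M u g) :
    DiagRel φ Λ M (c • u) (c • g) := fun n => by
  rw [inner_smul_right, inner_smul_right, map_smul, inner_smul_right, h n]; ring

theorem diagRel_zero : DiagRel φ Λ M 0 0 := fun n => by simp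

theorem DiagRel.sum {ι : Type*} (t : Finset ι) {u g : ι → H}
    (h : ∀ i ∈ t, DiagRel φ Λ M (u i) (g i)) : DiagRel φ Λ M (∑ i ∈ t, u i) (∑ i ∈ t, g i) := by
  classical
  induction t using Finset.induction_on with
  | empty => simpa using diagRel_zero
  | insert i t hi ih =>
    rw [Finset.sum_insert hi, Finset.sum_insert hi]
    exact (h i (Finset.mem_insert_self i t)).add
      (ih fun j hj => h j (Finset.mem_insert_of_mem hj))

/-- Green's identity. In the Parseval expansions the contributions of Λ cancel term by term, so no
convergence question about Λ itself arises. -/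
theorem DiagRel.inner_sub_inner (hM' : ∀ u v, ⟪M' u, v⟫_ℝ = ⟪u, M' v⟫_ℝ) {u v g k : H}
    (h : DiagRel φ Λ M u g) (h' : DiagRel φ Λ M' v k) :
    ⟪v, g⟫_ℝ - ⟪k, u⟫_ℝ = ⟪v, (M - M') u⟫_ℝ := by
  have e : ⟪v, (M - M') u⟫_ℝ = ⟪v, M u⟫_ℝ - ⟪M' v, u⟫_ℝ := by
    rw [hM', sub_apply, inner_sub_right]
  rw [e]
  have h1 := φ.hasSum_inner_mul_inner v g
  have h2 := φ.hasSum_inner_mul_inner k u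
  have h3 := φ.hasSum_inner_mul_inner v (M u)
  have h4 := φ.hasSum_inner_mul_inner (M' v) u
  refine (h1.sub h2).unique ((h3.sub h4).congr_fun fun n => ?_)
  rw [real_inner_comm _ k, real_inner_comm _ v, real_inner_comm _ (M' v), h n, h' n]
  ring

theorem DiagRel.inner_le (hΛ : ∀ n, 0 ≤ Λ n) {u g : H} (h : DiagRel φ Λ M u g) :
    ⟪u, g⟫_ℝ ≤ ‖M‖ * ‖u‖ ^ 2 := by
  have h1 := φ.hasSum_inner_mul_inner u g
  have h2 := φ.hasSum_inner_mul_inner u (M u)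
  have h3 : ⟪u, g⟫_ℝ ≤ ⟪u, M u⟫_ℝ := by
    refine hasSum_le (fun n => ?_) h1 h2
    rw [h n, real_inner_comm]
    nlinarith [mul_nonneg (hΛ n) (sq_nonneg ⟪φ n, u⟫_ℝ)]
  refine h3.trans ((real_inner_le_norm _ _).trans ?_)
  nlinarith [M.le_opNorm u, norm_nonneg u]

/-- A dimension count: `n` linear conditions on `n + 1` coefficients. -/
theorem exists_ne_zero_inner_eq_zero (n : ℕ) (u : Fin (n + 1) → H) (v : ℕ → H) :
    ∃ a : Fin (n + 1) → ℝ, a ≠ 0 ∧ ∀ j < n, ⟪v j, ∑ i, a i • u i⟫_ℝ = 0 := by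
  let f : (Fin (n + 1) → ℝ) →ₗ[ℝ] (Fin n → ℝ) :=
    LinearMap.pi fun j => (innerₛₗ ℝ (v j)).comp (Fintype.linearCombination ℝ u)
  have := LinearMap.ker_ne_bot_of_finrank_lt (f := f) (by simp)
  obtain ⟨a, ha, ha0⟩ := (Submodule.ne_bot_iff _).1 this
  refine ⟨a, ha0, fun j hj => ?_⟩
  have := congrFun (LinearMap.mem_ker.1 ha) ⟨j, hj⟩
  simpa [f, Fintype.linearCombination_apply] using this

/-- Weyl's inequality. -/
theorem EigSys.le_add_norm (hM' : ∀ u v, ⟪M' u, v⟫_ℝ = ⟪u, M' v⟫_ℝ) (E : EigSys φ Λ M') (n : ℕ)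
    {u : Fin (n + 1) → H} (hu : Orthonormal ℝ u) {t : ℝ} {σ : Fin (n + 1) → ℝ} (hσ : ∀ i, t ≤ σ i)
    (hr : ∀ i, DiagRel φ Λ M (u i) (σ i • u i)) : t ≤ E.τ n + ‖M - M'‖ := by
  -- The min-max test vector: a combination of the given eigenvectors orthogonal to the first `n`
  -- eigenvectors of `M'`. Its Rayleigh quotient for `M` is at least `t`.
  obtain ⟨a, ha, hav⟩ := exists_ne_zero_inner_eq_zero n u E.ψ
  set w := ∑ i, a i • u i with hw
  set g := ∑ i, a i • (σ i • u i) with hg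
  have hrel : DiagRel φ Λ M w g := DiagRel.sum _ fun i _ => (hr i).smul (a i)
  have hww : ‖w‖ ^ 2 = ∑ i, a i ^ 2 := by
    rw [← real_inner_self_eq_norm_sq, hw, hu.inner_sum]
    simp [pow_two]
  have hwpos : 0 < ‖w‖ ^ 2 := by
    rw [hww]
    obtain ⟨i, hi⟩ := Function.ne_iff.1 ha
    exact Finset.sum_pos' (fun i _ => sq_nonneg _) ⟨i, Finset.mem_univ _, sq_pos_of_ne_zero hi⟩
  have hwg : t * ‖w‖ ^ 2 ≤ ⟪w, g⟫_ℝ := by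
    have : g = ∑ i, (a i * σ i) • u i := by simp [hg, smul_smul]
    rw [hww, this, hw, hu.inner_sum, Finset.mul_sum]
    refine Finset.sum_le_sum fun i _ => ?_
    simp only [conj_trivial]
    nlinarith [mul_le_mul_of_nonneg_right (hσ i) (sq_nonneg (a i))]
  have h1 := E.ψ.hasSum_inner_mul_inner w g
  have h2 := E.ψ.hasSum_inner_mul_inner w ((M - M') w)
  have h3 := E.ψ.hasSum_inner_mul_inner w w
  have h4 := (h3.mul_left (E.τ n)).add h2
  have h5 : ⟪w, g⟫_ℝ ≤ E.τ n * ⟪w, w⟫_ℝ + ⟪w, (M - M') w⟫_ℝ := by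
    refine hasSum_le (fun j => ?_) h1 h4
    have e := hrel.inner_sub_inner hM' (E.rel j)
    rw [inner_smul_left] at e
    simp only [conj_trivial] at e
    rw [real_inner_comm]
    rcases lt_or_ge j n with hj | hj
    · rw [hav j hj]; simp
    · have hτ : E.τ j ≤ E.τ n := E.anti.antitone hj
      have : ⟪E.ψ j, g⟫_ℝ = E.τ j * ⟪E.ψ j, w⟫_ℝ + ⟪E.ψ j, (M - M') w⟫_ℝ := by linarith
      rw [this]
      nlinarith [mul_le_mul_of_nonneg_right hτ (sq_nonneg ⟪E.ψ j, w⟫_ℝ)]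
  have h6 : ⟪w, (M - M') w⟫_ℝ ≤ ‖M - M'‖ * ‖w‖ ^ 2 := by
    refine (real_inner_le_norm _ _).trans ?_
    nlinarith [(M - M').le_opNorm w, norm_nonneg w]
  rw [real_inner_self_eq_norm_sq] at h5
  have h7 : t * ‖w‖ ^ 2 ≤ (E.τ n + ‖M - M'‖) * ‖w‖ ^ 2 := by linarith
  exact le_of_mul_le_mul_right h7 hwpos

theorem EigSys.abs_sub_le (hM : ∀ u v, ⟪M u, v⟫_ℝ = ⟪u, M v⟫_ℝ)
    (hM' : ∀ u v, ⟪M' u, v⟫_ℝ = ⟪u, M' v⟫_ℝ) (E : EigSys φ Λ M) (E' : EigSys φ Λ M') (n : ℕ) :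
    |E.τ n - E'.τ n| ≤ ‖M - M'‖ := by
  have key : ∀ {M M' : H →L[ℝ] H} (_ : ∀ u v, ⟪M' u, v⟫_ℝ = ⟪u, M' v⟫_ℝ) (E : EigSys φ Λ M)
      (E' : EigSys φ Λ M'), E.τ n ≤ E'.τ n + ‖M - M'‖ := by
    intro M M' hM' E E'
    refine E'.le_add_norm hM' n (u := fun i : Fin (n + 1) => E.ψ i)
      (E.ψ.orthonormal.comp _ Fin.val_injective) (σ := fun i => E.τ i) (fun i => ?_) fun i => E.rel i
    exact E.anti.antitone (Nat.lt_succ_iff.1 i.2)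
  have h1 := key hM' E E'
  have h2 := key hM E' E
  rw [norm_sub_rev] at h2
  rw [abs_le]; constructor <;> linarith

/-- The unperturbed eigenvector system. -/
def EigSys.diag (φ : HilbertBasis ℕ ℝ H) (hΛ : StrictMono Λ) : EigSys φ Λ 0 where
  ψ := φ
  τ n := - Λ n
  anti := fun _ _ h => neg_lt_neg (hΛ h)
  rel n k := by
    rcases eq_or_ne k n with rfl | h
    · simp [inner_smul_right]
    · simp [inner_smul_right, φ.orthonormal.2 h]

theorem DiagRel.inner_eq_zero (hM : ∀ u v, ⟪M u, v⟫_ℝ = ⟪u, M v⟫_ℝ) {u v : H} {σ τ : ℝ}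
    (h : DiagRel φ Λ M u (σ • u)) (h' : DiagRel φ Λ M v (τ • v)) (hne : σ ≠ τ) :
    ⟪u, v⟫_ℝ = 0 := by
  have := h.inner_sub_inner hM h'
  rw [sub_self, zero_apply, inner_zero_right, inner_smul_left, inner_smul_right,
    real_inner_comm] at this
  simp only [conj_trivial] at this
  have h3 : (σ - τ) * ⟪u, v⟫_ℝ = 0 := by linarith
  exact (mul_eq_zero.1 h3).resolve_left (sub_ne_zero.2 hne)

/-- A subset of `ℝ` that is infinite, with only finitely many elements above any bound, is the
range of a strictly decreasing sequence. -/
theorem exists_strictAnti_range {E : Set ℝ} (hE : E.Infinite) (hf : ∀ t, (E ∩ Ici t).Finite) :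
    ∃ τ : ℕ → ℝ, StrictAnti τ ∧ range τ = E := by
  have below : ∀ t : ℝ, ∃ y ∈ E, y < t := by
    intro t
    by_contra! h
    exact hE ((hf t).subset fun y hy => ⟨hy, h y hy⟩)
  have next : ∀ t : ℝ, ∃ y ∈ E, y < t ∧ ∀ z ∈ E, z < t → z ≤ y := by
    intro t
    obtain ⟨y, hy, hyt⟩ := below t
    have hfin : (E ∩ Ici y ∩ Iio t).Finite := (hf y).subset inter_subset_left
    obtain ⟨z, hz, hmax⟩ := hfin.exists_maximalFor id _ ⟨y, ⟨hy, mem_Ici.2 le_rfl⟩, hyt⟩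
    refine ⟨z, hz.1.1, hz.2, fun w hw hwt => ?_⟩
    rcases le_total w z with h | h
    · exact h
    · exact hmax ⟨⟨hw, hz.1.2.trans h⟩, hwt⟩ h
  choose f hfE hflt hfmax using next
  obtain ⟨y0, hy0⟩ := hE.nonempty
  -- `T` bounds all of `E`, since elements below `y0` are no larger. Hence `f (T + 1)`, where the
  -- sequence starts, is the maximum of `E`.
  obtain ⟨T, hT⟩ := (hf y0).bddAbove
  let τ : ℕ → ℝ := fun n => Nat.rec (f (T + 1)) (fun _ t => f t) n
  have hanti : StrictAnti τ := strictAnti_nat_of_succ_lt fun n => hflt (τ n)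
  have hmem : ∀ n, τ n ∈ E := fun n => by cases n <;> exact hfE _
  refine ⟨τ, hanti, Subset.antisymm (range_subset_iff.2 hmem) fun e he => ?_⟩
  by_contra hne
  have hlt : ∀ n, e < τ n := by
    intro n
    induction n with
    | zero =>
      refine lt_of_le_of_ne (hfmax _ e he ?_) fun h => hne ⟨0, h.symm⟩
      rcases le_total e y0 with h | h
      · have := hT ⟨hy0, mem_Ici.2 le_rfl⟩; linarith
      · have := hT ⟨he, h⟩; linarith
    | succ n ih => exact lt_of_le_of_ne (hfmax _ e he ih) fun h => hne ⟨n + 1, h.symm⟩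
  exact (infinite_range_of_injective hanti.injective)
    ((hf e).subset (range_subset_iff.2 fun n => ⟨hmem n, (hlt n).le⟩))

/-- With T = (Λ + c)⁻¹ the resolvent is (1 - TM)⁻¹T. By the Fredholm alternative 1 - TM is
invertible unless `c` is an eigenvalue of -Λ + M, and eigenvalues are at most ‖M‖ because Λ ≥ 0.
Symmetry follows from Green's identity. -/
theorem exists_resolvent [CompleteSpace H] (hM : ∀ u v, ⟪M u, v⟫_ℝ = ⟪u, M v⟫_ℝ)
    (hΛ : ∀ n, 0 ≤ Λ n) (hs : Summable fun n => (Λ n + 1)⁻¹) {c : ℝ} (hc : ‖M‖ < c) :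
    ∃ B : H →L[ℝ] H, IsCompactOperator B ∧ (B : H →ₗ[ℝ] H).IsSymmetric ∧
      ∀ g, DiagRel φ Λ M (B g) (c • B g - g) := by
  have hc0 : 0 < c := (norm_nonneg _).trans_lt hc
  set T := diagOp φ (fun n => (Λ n + c)⁻¹) with hT
  have hTc : IsCompactOperator T := isCompactOperator_diagOp (summable_inv_add hΛ hs hc0)
  have hcomp : IsCompactOperator (T * M) := hTc.comp_clm M
  have hunit : IsUnit (1 - T * M) := by
    rcases hcomp.hasEigenvalue_or_mem_resolventSet (one_ne_zero (α := ℝ)) with h | h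
    · exfalso
      obtain ⟨u, hu, hu0⟩ := h.exists_hasEigenvector
      rw [Module.End.mem_eigenspace_iff, one_smul] at hu
      have hrel : DiagRel φ Λ M u (c • u) := by
        rw [diagRel_iff hΛ hs hc0, add_sub_cancel_right]
        exact hu.symm
      have h1 := hrel.inner_le hΛ
      rw [inner_smul_right, real_inner_self_eq_norm_sq] at h1
      have : 0 < ‖u‖ ^ 2 := by positivity
      nlinarith
    · simpa [spectrum.mem_resolventSet_iff] using h
  obtain ⟨R, hR⟩ := hunit
  set B : H →L[ℝ] H := (↑R⁻¹ : H →L[ℝ] H) * T with hB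
  have hrel : ∀ g, DiagRel φ Λ M (B g) (c • B g - g) := by
    intro g
    rw [diagRel_iff hΛ hs hc0]
    have h1 : (1 - T * M) (B g) = T g := by
      rw [← hR, hB, ← mul_apply_eq_comp, ← mul_assoc, Units.mul_inv, one_mul]
    have h2 : B g = T (M (B g)) + T g := by
      rw [← h1]; simp
    conv_lhs => rw [h2, ← map_add]
    rw [← hT]
    congr 1
    abel
  refine ⟨B, hTc.clm_comp _, fun g k => ?_, hrel⟩
  have := (hrel g).inner_sub_inner hM (hrel k)
  rw [sub_self, zero_apply, inner_zero_right, inner_sub_left, inner_sub_right,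
    inner_smul_left, inner_smul_right] at this
  simp only [conj_trivial] at this
  simp only [ContinuousLinearMap.coe_coe]
  linarith [real_inner_comm g (B k), real_inner_comm k (B g)]

theorem exists_eigSys [CompleteSpace H] (hM : ∀ u v, ⟪M u, v⟫_ℝ = ⟪u, M v⟫_ℝ)
    (hΛ : ∀ n, 0 ≤ Λ n) (hmono : StrictMono Λ) (hs : Summable fun n => (Λ n + 1)⁻¹)
    (hsimple : SimpleEigenvalues φ Λ M) : Nonempty (EigSys φ Λ M) := by
  set E : Set ℝ := {τ | ∃ u, u ≠ 0 ∧ DiagRel φ Λ M u (τ • u)} with hE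
  have hvec : ∀ τ : ℝ, ∃ u : H, τ ∈ E → ‖u‖ = 1 ∧ DiagRel φ Λ M u (τ • u) := by
    intro τ
    by_cases h : τ ∈ E
    · obtain ⟨u, hu, hr⟩ := h
      refine ⟨‖u‖⁻¹ • u, fun _ => ⟨by simp [norm_smul, hu], ?_⟩⟩
      rw [smul_comm]
      exact hr.smul _
    · exact ⟨0, fun h' => absurd h' h⟩
  choose U hU using hvec
  have horth : Orthonormal ℝ fun τ : E => U τ := by
    refine ⟨fun τ => (hU _ τ.2).1, fun σ τ hne => ?_⟩
    exact (hU _ σ.2).2.inner_eq_zero hM (hU _ τ.2).2 fun h => hne (Subtype.ext h)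
  have htend : Tendsto Λ atTop atTop := by
    have h1 := hs.tendsto_atTop_zero
    have h2 := tendsto_inv_nhdsGT_zero.comp (tendsto_nhdsWithin_iff.2
      ⟨h1, Eventually.of_forall fun n => by
        have := hΛ n; exact inv_pos.2 (by linarith : 0 < Λ n + 1)⟩)
    have h3 : Tendsto (fun n => Λ n + 1) atTop atTop := by
      refine h2.congr fun n => by simp
    exact (tendsto_atTop_add_const_right _ (-1) h3).congr fun n => by ring
  -- Weyl's inequality against the unperturbed system: `N + 1` eigenvalues above `t` force t ≤ -Λ_N
  -- + ‖M‖, which fails for large `N`.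
  have hfin : ∀ t, (E ∩ Ici t).Finite := by
    intro t
    by_contra hinf
    obtain ⟨N, hN⟩ := (htend.eventually_gt_atTop (‖M‖ - t)).exists
    obtain ⟨s, hs, hcard⟩ := (show (E ∩ Ici t).Infinite from hinf).exists_subset_card_eq (N + 1)
    let e := s.equivFinOfCardEq hcard
    have hmem : ∀ i, ((e.symm i : s) : ℝ) ∈ E ∩ Ici t := fun i => hs (e.symm i).2
    have := (EigSys.diag φ hmono).le_add_norm (M := M) (by simp) N
      (u := fun i => U (e.symm i)) (σ := fun i => (e.symm i : s)) (t := t)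
      (horth.comp (fun i => (⟨(e.symm i : s), (hmem i).1⟩ : E)) fun i j h => by
        simpa using Subtype.ext_iff.1 h) (fun i => (hmem i).2) fun i => (hU _ (hmem i).1).2
    simp only [EigSys.diag, sub_zero] at this
    linarith
  obtain ⟨B, hBc, hBs, hB⟩ := exists_resolvent (φ := φ) hM hΛ hs (lt_add_one ‖M‖)
  set c := ‖M‖ + 1
  have hsp := ContinuousLinearMap.orthogonalComplement_iSup_eigenspaces_eq_bot hBc hBs
  -- Completeness comes from the spectral theorem for the compact resolvent `B`: an eigenvector of
  -- `B` for μ ≠ 0 is an eigenvector of -Λ + M for c - μ⁻¹, and by simplicity it is a multiple of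
  -- the chosen one. The value μ = 0 is excluded since `B` is injective.
  have hperp : ∀ v : H, (∀ τ ∈ E, ⟪U τ, v⟫_ℝ = 0) → v = 0 := by
    intro v hv
    have : v ∈ (⨆ μ, Module.End.eigenspace (B : Module.End ℝ H) μ)ᗮ := by
      rw [← Submodule.iInf_orthogonal, Submodule.mem_iInf]
      intro μ
      rw [Submodule.mem_orthogonal]
      intro y hy
      have hy' : B y = μ • y := Module.End.mem_eigenspace_iff.1 hy
      rcases eq_or_ne y 0 with rfl | hy0
      · simp
      have hr := hB y
      rw [hy'] at hr
      have hμ : μ ≠ 0 := by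
        rintro rfl
        refine hy0 (hilbertBasis_ext φ fun n => ?_)
        have := hr n
        simpa using this
      have hr2 := hr.smul μ⁻¹
      rw [smul_smul, inv_mul_cancel₀ hμ, one_smul] at hr2
      have e : μ⁻¹ • (c • μ • y - y) = (c - μ⁻¹) • y := by
        rw [smul_sub, sub_smul, smul_comm c, smul_smul, inv_mul_cancel₀ hμ, one_smul]
      rw [e] at hr2
      have hmem : c - μ⁻¹ ∈ E := ⟨y, hy0, hr2⟩
      obtain ⟨hn, hrU⟩ := hU _ hmem
      obtain ⟨a, ha⟩ := hsimple _ _ _ hrU hr2 (by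
        intro h0; rw [h0, norm_zero] at hn; exact zero_ne_one hn)
      rw [ha, inner_smul_left, hv _ hmem, mul_zero]
    rw [hsp] at this
    exact (Submodule.mem_bot ℝ).1 this
  -- Finitely many eigenvectors could not be complete: a nontrivial combination of more basis
  -- vectors than eigenvalues would be orthogonal to all of them.
  have hinf : E.Infinite := by
    intro hfinE
    have := hfinE.fintype
    obtain ⟨a, ha, hav⟩ := exists_ne_zero_inner_eq_zero (Fintype.card E)
      (fun i => φ i) (fun j => if h : j < Fintype.card E then
        U ((Fintype.equivFin E).symm ⟨j, h⟩) else 0)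
    have hz : ∑ i, a i • φ (i : Fin (Fintype.card E + 1)) = 0 := by
      refine hperp _ fun τ hτ => ?_
      have := hav (Fintype.equivFin E ⟨τ, hτ⟩) (Fin.is_lt _)
      rw [dif_pos (Fin.is_lt _)] at this
      simpa only [Fin.eta, Equiv.symm_apply_apply] using this
    refine ha (funext fun i => ?_)
    have hli := (φ.orthonormal.comp (fun i : Fin (Fintype.card E + 1) => (i : ℕ))
      Fin.val_injective).linearIndependent
    exact Fintype.linearIndependent_iff.1 hli a hz i
  obtain ⟨τ, hanti, hrange⟩ := exists_strictAnti_range hinf hfin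
  have hmem : ∀ n, τ n ∈ E := fun n => hrange ▸ mem_range_self n
  have hon : Orthonormal ℝ fun n => U (τ n) :=
    horth.comp (fun n => (⟨τ n, hmem n⟩ : E)) fun i j h => hanti.injective (Subtype.ext_iff.1 h)
  refine ⟨⟨HilbertBasis.mkOfOrthogonalEqBot hon ?_, τ, hanti, fun n => ?_⟩⟩
  · rw [Submodule.eq_bot_iff]
    intro v hv
    refine hperp v fun σ hσ => ?_
    rw [← hrange] at hσ
    obtain ⟨n, rfl⟩ := hσ
    exact (Submodule.mem_orthogonal _ _).1 hv _ (Submodule.subset_span (mem_range_self n))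
  · rw [HilbertBasis.coe_mkOfOrthogonalEqBot]
    exact (hU _ (hmem n)).2

theorem EigSys.exists_eq_of_diagRel (hM : ∀ u v, ⟪M u, v⟫_ℝ = ⟪u, M v⟫_ℝ) (E : EigSys φ Λ M)
    {u : H} (hu : u ≠ 0) {σ : ℝ} (h : DiagRel φ Λ M u (σ • u)) : ∃ n, E.τ n = σ := by
  by_contra! hne
  refine hu (hilbertBasis_ext E.ψ fun n => ?_)
  rw [inner_zero_right]
  exact (E.rel n).inner_eq_zero hM h (hne n)

end SpectralTheory

/-! ### Smooth dependence of eigenpairs on the parameter and derivative bounds from the gap -/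

section PerturbationTheory

open scoped InnerProductSpace

theorem hasDerivAt_iteratedDeriv {F : Type*} [NormedAddCommGroup F] [NormedSpace ℝ F] {f : ℝ → F}
    (hf : ContDiff ℝ (⊤ : ℕ∞) f) (k : ℕ) (x : ℝ) :
    HasDerivAt (iteratedDeriv k f) (iteratedDeriv (k + 1) f x) x := by
  rw [iteratedDeriv_succ]
  exact ((hf.differentiable_iteratedDeriv k (by exact_mod_cast WithTop.coe_lt_top _)) x).hasDerivAt

theorem iteratedDeriv_clm_apply {F G : Type*} [NormedAddCommGroup F] [NormedSpace ℝ F]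
    [NormedAddCommGroup G] [NormedSpace ℝ G] (L : F →L[ℝ] G) {f : ℝ → F} (hf : ContDiff ℝ (⊤ : ℕ∞) f)
    (k : ℕ) (x : ℝ) : iteratedDeriv k (fun x => L (f x)) x = L (iteratedDeriv k f x) := by
  induction k generalizing x with
  | zero => simp
  | succ k ih =>
    rw [iteratedDeriv_succ, funext ih]
    exact (L.hasFDerivAt.comp_hasDerivAt x (hasDerivAt_iteratedDeriv hf k x)).deriv

/-- Leibniz rule for the derivatives of an inner product. -/
theorem iteratedDeriv_inner {H : Type*} [NormedAddCommGroup H] [InnerProductSpace ℝ H] {f g : ℝ → H}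
    (hf : ContDiff ℝ (⊤ : ℕ∞) f) (hg : ContDiff ℝ (⊤ : ℕ∞) g) (k : ℕ) (x : ℝ) :
    iteratedDeriv k (fun x => ⟪f x, g x⟫_ℝ) x = ∑ ij ∈ Finset.HasAntidiagonal.antidiagonal k,
      k.choose ij.1 • ⟪iteratedDeriv ij.1 f x, iteratedDeriv ij.2 g x⟫_ℝ := by
  induction k generalizing x with
  | zero => simp
  | succ k ih =>
    rw [iteratedDeriv_succ, funext ih]
    have h : HasDerivAt (fun x => ∑ ij ∈ Finset.HasAntidiagonal.antidiagonal k,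
        k.choose ij.1 • ⟪iteratedDeriv ij.1 f x, iteratedDeriv ij.2 g x⟫_ℝ)
        (∑ ij ∈ Finset.HasAntidiagonal.antidiagonal k, k.choose ij.1 •
          (⟪iteratedDeriv ij.1 f x, iteratedDeriv (ij.2 + 1) g x⟫_ℝ +
            ⟪iteratedDeriv (ij.1 + 1) f x, iteratedDeriv ij.2 g x⟫_ℝ)) x :=
      HasDerivAt.fun_sum fun ij _ => ((hasDerivAt_iteratedDeriv hf ij.1 x).inner ℝ
        (hasDerivAt_iteratedDeriv hg ij.2 x)).const_smul (k.choose ij.1)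
    rw [h.deriv, Finset.sum_antidiagonal_choose_succ_nsmul
      (fun i j => ⟪iteratedDeriv i f x, iteratedDeriv j g x⟫_ℝ)]
    simp only [smul_add, Finset.sum_add_distrib]
    congr 1
    refine Finset.sum_congr rfl fun ij hij => ?_
    rw [Nat.choose_symm_of_eq_add (Finset.HasAntidiagonal.mem_antidiagonal.1 hij).symm]

variable {H : Type*} [NormedAddCommGroup H] [InnerProductSpace ℝ H]

/-- The quadratic operator pencil `ω ↦ ω² A₂ + ω A₁`. -/
def pencil (A₁ A₂ : H →L[ℝ] H) (ω : ℝ) : H →L[ℝ] H := ω ^ 2 • A₂ + ω • A₁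

variable {φ : HilbertBasis ℕ ℝ H} {Λ : ℕ → ℝ} {A₁ A₂ M : H →L[ℝ] H}

theorem pencil_symm (h1 : ∀ u v, ⟪A₁ u, v⟫_ℝ = ⟪u, A₁ v⟫_ℝ) (h2 : ∀ u v, ⟪A₂ u, v⟫_ℝ = ⟪u, A₂ v⟫_ℝ)
    (ω : ℝ) (u v : H) : ⟪pencil A₁ A₂ ω u, v⟫_ℝ = ⟪u, pencil A₁ A₂ ω v⟫_ℝ := by
  simp [pencil, inner_add_left, inner_add_right, inner_smul_left, inner_smul_right, h1, h2]

theorem continuous_pencil : Continuous (pencil A₁ A₂) := by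
  unfold pencil; fun_prop

/-- An eigenpair for a simple eigenvalue extends to a smooth local family of eigenpairs. -/
theorem exists_local_eigenpair [CompleteSpace H] (h1 : ∀ u v, ⟪A₁ u, v⟫_ℝ = ⟪u, A₁ v⟫_ℝ)
    (h2 : ∀ u v, ⟪A₂ u, v⟫_ℝ = ⟪u, A₂ v⟫_ℝ)
    (hΛ : ∀ n, 0 ≤ Λ n) (hs : Summable fun n => (Λ n + 1)⁻¹) {ω₀ τ₀ : ℝ} {u₀ : H}
    (hsimple : SimpleEigenvalues φ Λ (pencil A₁ A₂ ω₀)) (hu₀ : ‖u₀‖ = 1)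
    (hr : DiagRel φ Λ (pencil A₁ A₂ ω₀) u₀ (τ₀ • u₀)) :
    ∃ (u : ℝ → H) (τ : ℝ → ℝ), ContDiffAt ℝ (⊤ : ℕ∞) u ω₀ ∧ ContDiffAt ℝ (⊤ : ℕ∞) τ ω₀ ∧ u ω₀ = u₀ ∧ τ ω₀ = τ₀ ∧
      ∀ᶠ ω in 𝓝 ω₀, DiagRel φ Λ (pencil A₁ A₂ ω) (u ω) (τ ω • u ω) ∧ ‖u ω‖ = 1 := by
  set T := diagOp φ (fun n => (Λ n + 1)⁻¹) with hT
  -- Normalised eigenpairs are the solutions of F = (0, 1): the first slot is the fixed-point form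
  -- of the eigenvalue equation, the second is the squared norm. Only bounded operators occur, so
  -- `F` is smooth on all of its domain.
  set F : ℝ × (H × ℝ) → H × ℝ := fun p =>
    (p.2.1 - T (p.1 ^ 2 • A₂ p.2.1 + p.1 • A₁ p.2.1 + p.2.1 - p.2.2 • p.2.1),
      ⟪p.2.1, p.2.1⟫_ℝ) with hF
  have hFc : ContDiff ℝ (⊤ : ℕ∞) F := by
    refine ContDiff.prodMk ?_ ?_
    · fun_prop
    · exact ContDiff.inner ℝ (by fun_prop) (by fun_prop)
  set p₀ : ℝ × (H × ℝ) := (ω₀, u₀, τ₀) with hp₀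
  have hFp : F p₀ = (0, 1) := by
    have := (diagRel_iff hΛ hs one_pos).1 hr
    simp only [hF, hp₀, real_inner_self_eq_norm_sq, hu₀]
    rw [one_smul] at this
    ext
    · simp only
      rw [sub_eq_zero]
      exact this
    · norm_num
  set M := pencil A₁ A₂ ω₀ with hM
  set S : H × ℝ →L[ℝ] H := (M + 1 - τ₀ • 1) ∘L ContinuousLinearMap.fst ℝ H ℝ -
    (ContinuousLinearMap.snd ℝ H ℝ).smulRight u₀ with hS
  set ℓ : H × ℝ →L[ℝ] ℝ := ContinuousLinearMap.snd ℝ H ℝ -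
    (2 : ℝ) • ((innerSL ℝ u₀) ∘L ContinuousLinearMap.fst ℝ H ℝ) with hℓ
  set K : H × ℝ →L[ℝ] H × ℝ := (ContinuousLinearMap.inl ℝ H ℝ) ∘L (T ∘L S) +
    (ContinuousLinearMap.inr ℝ H ℝ) ∘L ℓ with hK
  have hKapp : ∀ v σ, K (v, σ) = (T (M v + v - τ₀ • v - σ • u₀), σ - 2 * ⟪u₀, v⟫_ℝ) := by
    intro v σ
    simp [hK, hS, hℓ]
  have hKc : IsCompactOperator K := by
    refine IsCompactOperator.add ?_ ?_
    · exact ((isCompactOperator_diagOp hs).comp_clm S).clm_comp (ContinuousLinearMap.inl ℝ H ℝ)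
    · exact (isCompactOperator_of_locallyCompactSpace_dom ℓ).clm_comp
        (ContinuousLinearMap.inr ℝ H ℝ)
  -- The partial derivative of `F` in (u, τ) is 1 - K with `K` compact, so injectivity suffices. For
  -- (v, σ) in the kernel, v ⟂ u₀ and (-Λ + M - τ₀)v = σu₀; pairing with u₀ gives σ = 0, and then
  -- simplicity makes v a multiple of u₀, hence zero.
  have hunit : IsUnit (1 - K) := by
    rcases hKc.hasEigenvalue_or_mem_resolventSet (one_ne_zero (α := ℝ)) with h | h
    · exfalso
      obtain ⟨⟨v, σ⟩, hv, hv0⟩ := h.exists_hasEigenvector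
      rw [Module.End.mem_eigenspace_iff, one_smul] at hv
      have hv' : K (v, σ) = (v, σ) := hv
      rw [hKapp, Prod.mk.injEq] at hv'
      obtain ⟨hva, hvb⟩ := hv'
      have huv : ⟪u₀, v⟫_ℝ = 0 := by linarith
      have hrel : DiagRel φ Λ M v (τ₀ • v + σ • u₀) := by
        rw [diagRel_iff hΛ hs one_pos, one_smul, ← sub_sub]
        exact hva.symm
      have e := hrel.inner_sub_inner (pencil_symm h1 h2 ω₀) hr
      rw [sub_self, zero_apply, inner_zero_right, inner_add_right, inner_smul_right,
        inner_smul_right, inner_smul_left, huv, real_inner_self_eq_norm_sq, hu₀] at e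
      have hσ : σ = 0 := by simpa using e
      rw [hσ, zero_smul, add_zero] at hrel
      obtain ⟨c, hc⟩ := hsimple _ _ _ hr hrel (by
        intro h0; rw [h0, norm_zero] at hu₀; exact zero_ne_one hu₀)
      rw [hc, inner_smul_right, real_inner_self_eq_norm_sq, hu₀] at huv
      have hc0 : c = 0 := by simpa using huv
      exact hv0 (by rw [hσ, hc, hc0, zero_smul]; rfl)
    · simpa [spectrum.mem_resolventSet_iff] using h
  have hderiv : fderiv ℝ F p₀ ∘L .inr ℝ ℝ (H × ℝ) = 1 - K := by
    refine ContinuousLinearMap.ext fun ⟨v, σ⟩ => ?_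
    have hd : HasFDerivAt F (fderiv ℝ F p₀) p₀ := (hFc.differentiable (by simp) p₀).hasFDerivAt
    have hcurve : HasDerivAt (fun t : ℝ => p₀ + t • ((0, v, σ) : ℝ × H × ℝ)) (0, v, σ) 0 := by
      simpa using ((hasDerivAt_id (0 : ℝ)).smul_const ((0, v, σ) : ℝ × H × ℝ)).const_add p₀
    have hc1 : HasDerivAt (fun t : ℝ => F (p₀ + t • ((0, v, σ) : ℝ × H × ℝ)))
        (fderiv ℝ F p₀ (0, v, σ)) 0 := by
      have hd' : HasFDerivAt F (fderiv ℝ F p₀) (p₀ + (0 : ℝ) • ((0, v, σ) : ℝ × H × ℝ)) := by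
        simpa using hd
      exact hd'.comp_hasDerivAt (0 : ℝ) hcurve
    have ha : HasDerivAt (fun t : ℝ => u₀ + t • v) v 0 := by
      simpa using ((hasDerivAt_id (0 : ℝ)).smul_const v).const_add u₀
    have hb : HasDerivAt (fun t : ℝ => τ₀ + t * σ) σ 0 := by
      simpa using ((hasDerivAt_id (0 : ℝ)).mul_const σ).const_add τ₀
    have hMa : HasDerivAt (fun t : ℝ => M (u₀ + t • v)) (M v) 0 :=
      M.hasFDerivAt.comp_hasDerivAt 0 ha
    have hab := hb.smul ha
    have hT1 := T.hasFDerivAt.comp_hasDerivAt (0 : ℝ) ((hMa.add ha).sub hab)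
    have hc2 := (ha.sub hT1).prodMk (ha.inner ℝ ha)
    have e : (fun t : ℝ => F (p₀ + t • ((0, v, σ) : ℝ × H × ℝ))) = fun t =>
        ((u₀ + t • v) - T (M (u₀ + t • v) + (u₀ + t • v) - (τ₀ + t * σ) • (u₀ + t • v)),
          ⟪u₀ + t • v, u₀ + t • v⟫_ℝ) := by
      funext t
      simp [hF, hp₀, hM, pencil]
    rw [e] at hc1
    have := hc1.unique hc2
    simp only [ContinuousLinearMap.comp_apply, ContinuousLinearMap.inr_apply, this]
    rw [sub_apply, hKapp, one_apply_eq_self]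
    simp only [zero_smul, add_zero, zero_mul]
    ext
    · simp only [Prod.mk_sub_mk]
      rw [sub_sub]
    · simp only [Prod.mk_sub_mk]
      rw [real_inner_comm]; ring
  have hinv : (fderiv ℝ F p₀ ∘L .inr ℝ ℝ (H × ℝ)).IsInvertible := by
    rw [hderiv]
    obtain ⟨R, hR⟩ := hunit
    exact ⟨ContinuousLinearEquiv.ofUnit R, hR⟩
  have hcd : ContDiffAt ℝ (⊤ : ℕ∞) F p₀ := hFc.contDiffAt
  have hne : ((⊤ : ℕ∞) : WithTop ℕ∞) ≠ 0 := by simp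
  set ψ := hcd.implicitFunction hne hinv with hψ
  have hψ0 : ψ ω₀ = (u₀, τ₀) := hcd.implicitFunction_apply_self hne hinv
  have hψc : ContDiffAt ℝ (⊤ : ℕ∞) ψ ω₀ := hcd.contDiffAt_implicitFunction hne hinv
  have hψe : ∀ᶠ ω in 𝓝 ω₀, F (ω, ψ ω) = F p₀ := hcd.eventually_apply_implicitFunction hne hinv
  refine ⟨fun ω => (ψ ω).1, fun ω => (ψ ω).2, hψc.fst, hψc.snd, by simp [hψ0], by simp [hψ0], ?_⟩
  filter_upwards [hψe] with ω hω
  rw [hFp] at hω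
  obtain ⟨e1, e2⟩ := Prod.ext_iff.1 hω
  simp only [hF] at e1 e2
  constructor
  · rw [diagRel_iff hΛ hs one_pos, one_smul]
    exact sub_eq_zero.1 e1
  · rw [real_inner_self_eq_norm_sq] at e2
    nlinarith [norm_nonneg (ψ ω).1]

/-- The `n`-th eigenvalue and the suitably normalised `n`-th eigenvector are smooth. -/
theorem contDiff_eigenpair [CompleteSpace H] (h1 : ∀ u v, ⟪A₁ u, v⟫_ℝ = ⟪u, A₁ v⟫_ℝ)
    (h2 : ∀ u v, ⟪A₂ u, v⟫_ℝ = ⟪u, A₂ v⟫_ℝ)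
    (hΛ : ∀ n, 0 ≤ Λ n) (hs : Summable fun n => (Λ n + 1)⁻¹)
    (hsimple : ∀ ω, SimpleEigenvalues φ Λ (pencil A₁ A₂ ω))
    (E : ∀ ω, EigSys φ Λ (pencil A₁ A₂ ω)) (n : ℕ) {U : ℝ → H} (hU1 : ∀ ω, ‖U ω‖ = 1)
    (hU : ∀ ω, DiagRel φ Λ (pencil A₁ A₂ ω) (U ω) ((E ω).τ n • U ω))
    (hpos : ∀ ω₀, ∃ g : H, ∀ᶠ ω in 𝓝 ω₀,
      0 < ⟪g, pencil A₁ A₂ ω (U ω) + U ω - (E ω).τ n • U ω⟫_ℝ) :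
    ContDiff ℝ (⊤ : ℕ∞) U ∧ ContDiff ℝ (⊤ : ℕ∞) fun ω => (E ω).τ n := by
  have key : ∀ ω₀, ContDiffAt ℝ (⊤ : ℕ∞) U ω₀ ∧ ContDiffAt ℝ (⊤ : ℕ∞) (fun ω => (E ω).τ n) ω₀ := by
    intro ω₀
    obtain ⟨u, τ, hu, hτ, hu0, hτ0, hev⟩ :=
      exists_local_eigenpair h1 h2 hΛ hs (hsimple ω₀) (hU1 ω₀) (hU ω₀)
    have hsymm := pencil_symm h1 h2
    have hne : ∀ {v : H}, ‖v‖ = 1 → v ≠ 0 := fun hv h0 => by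
      rw [h0, norm_zero] at hv; exact zero_ne_one hv
    have hdist : Tendsto (fun ω => ‖pencil A₁ A₂ ω - pencil A₁ A₂ ω₀‖) (𝓝 ω₀) (𝓝 0) := by
      have := ((continuous_pencil (A₁ := A₁) (A₂ := A₂)).tendsto ω₀).sub_const (pencil A₁ A₂ ω₀)
      simpa using this.norm
    have hW : ∀ ω k, |(E ω).τ k - (E ω₀).τ k| ≤ ‖pencil A₁ A₂ ω - pencil A₁ A₂ ω₀‖ :=
      fun ω k => (E ω).abs_sub_le (hsymm ω) (hsymm ω₀) (E ω₀) k
    have hτt : Tendsto τ (𝓝 ω₀) (𝓝 ((E ω₀).τ n)) := hτ0 ▸ hτ.continuousAt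
    -- By Weyl's inequality the neighbouring eigenvalues stay close to their values at ω₀, so the
    -- continued eigenvalue remains strictly between those of indices n - 1 and n + 1 and must be
    -- the n-th one.
    have hlow : ∀ᶠ ω in 𝓝 ω₀, (E ω).τ (n + 1) < τ ω := by
      have ht : Tendsto (fun ω => (E ω₀).τ (n + 1) +
          ‖pencil A₁ A₂ ω - pencil A₁ A₂ ω₀‖) (𝓝 ω₀) (𝓝 ((E ω₀).τ (n + 1) + 0)) := hdist.const_add _
      rw [add_zero] at ht
      filter_upwards [ht.eventually_lt hτt ((E ω₀).anti (Nat.lt_succ_self n))] with ω hω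
      have := (abs_le.1 (hW ω (n + 1))).2
      linarith
    have hup : ∀ᶠ ω in 𝓝 ω₀, ∀ k < n, τ ω < (E ω).τ k := by
      rcases n with _ | m
      · simp
      have ht : Tendsto (fun ω => (E ω₀).τ m -
          ‖pencil A₁ A₂ ω - pencil A₁ A₂ ω₀‖) (𝓝 ω₀) (𝓝 ((E ω₀).τ m - 0)) := hdist.const_sub _
      rw [sub_zero] at ht
      filter_upwards [hτt.eventually_lt ht ((E ω₀).anti (Nat.lt_succ_self m))] with ω hω k hk
      have h3 := (abs_le.1 (hW ω m)).1
      have h4 := (E ω).anti.antitone (Nat.lt_succ_iff.1 hk)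
      linarith
    have hτeq : ∀ᶠ ω in 𝓝 ω₀, τ ω = (E ω).τ n := by
      filter_upwards [hev, hlow, hup] with ω hω hl hu'
      obtain ⟨k, hk⟩ := (E ω).exists_eq_of_diagRel (hsymm ω) (hne hω.2) hω.1
      rcases lt_trichotomy k n with h | h | h
      · exact absurd hk (hu' k h).ne'
      · rw [← hk, h]
      · have := (E ω).anti.antitone (Nat.succ_le_of_lt h)
        rw [hk] at this
        exact absurd hl this.not_gt
    -- The sign is fixed by pairing `g` with the image of the eigenvector under Λ + 1. The pairing
    -- is positive for `U` by hypothesis and for the local family by continuity, so the two unit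
    -- vectors agree.
    obtain ⟨g, hg⟩ := hpos ω₀
    have hcont : ContinuousAt (fun ω => ⟪g, pencil A₁ A₂ ω (u ω) + u ω - τ ω • u ω⟫_ℝ) ω₀ := by
      have hc1 := hu.continuousAt
      have hc2 := hτ.continuousAt
      have hc3 := (continuous_pencil (A₁ := A₁) (A₂ := A₂)).continuousAt (x := ω₀)
      exact ContinuousAt.inner continuousAt_const (((hc3.clm_apply hc1).add hc1).sub (hc2.smul hc1))
    have hgpos : ∀ᶠ ω in 𝓝 ω₀, 0 < ⟪g, pencil A₁ A₂ ω (u ω) + u ω - τ ω • u ω⟫_ℝ := by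
      refine hcont.eventually (lt_mem_nhds ?_)
      have := hg.self_of_nhds
      simp only [hu0, hτ0]
      exact this
    have hueq : U =ᶠ[𝓝 ω₀] u := by
      filter_upwards [hev, hτeq, hg, hgpos] with ω hω hτω h3 h4
      obtain ⟨c, hc⟩ := hsimple ω _ _ _ (hU ω) (hτω ▸ hω.1) (hne (hU1 ω))
      have hc1 : |c| = 1 := by
        have := hω.2
        rwa [hc, norm_smul, hU1, mul_one] at this
      have e : pencil A₁ A₂ ω (u ω) + u ω - τ ω • u ω =
          c • (pencil A₁ A₂ ω (U ω) + U ω - (E ω).τ n • U ω) := by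
        rw [hc, hτω, map_smul, smul_sub, smul_add, smul_comm c]
      rw [e, inner_smul_right] at h4
      have hcpos : 0 < c := (pos_iff_pos_of_mul_pos h4).2 h3
      rw [abs_of_pos hcpos] at hc1
      rw [hc, hc1, one_smul]
    exact ⟨hu.congr_of_eventuallyEq hueq, hτ.congr_of_eventuallyEq (hτeq.mono fun _ h => h.symm)⟩
  exact ⟨contDiff_iff_contDiffAt.2 fun ω => (key ω).1, contDiff_iff_contDiffAt.2 fun ω => (key ω).2⟩

/-- The bound for the reduced resolvent: in the eigenbasis the coefficients of `r` are those of `V`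
times τ_j - τ_n, and the n-th coefficient of `V` is zero because `U` spans that direction. -/
theorem inner_sub_inner_eq_norm_le (hM : ∀ u v, ⟪M u, v⟫_ℝ = ⟪u, M v⟫_ℝ) (E : EigSys φ Λ M) {n : ℕ}
    {U V r : H} (hU1 : ‖U‖ = 1) (hU : DiagRel φ Λ M U (E.τ n • U))
    (hV : DiagRel φ Λ M V (E.τ n • V + r)) (hUV : ⟪U, V⟫_ℝ = 0) {γ : ℝ} (hγ : 0 < γ)
    (hgap : ∀ j, j ≠ n → γ ≤ |E.τ j - E.τ n|) : ‖V‖ ≤ ‖r‖ / γ := by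
  have h0 : ∀ j, j ≠ n → ⟪E.ψ j, U⟫_ℝ = 0 := fun j hj =>
    (E.rel j).inner_eq_zero hM hU (E.anti.injective.ne hj)
  have hUψ : U = ⟪E.ψ n, U⟫_ℝ • E.ψ n := by
    refine hilbertBasis_ext E.ψ fun j => ?_
    rw [inner_smul_right]
    rcases eq_or_ne j n with rfl | hj
    · rw [real_inner_self_eq_norm_sq, E.ψ.orthonormal.norm_eq_one]; simp
    · rw [h0 j hj, E.ψ.orthonormal.2 hj, mul_zero]
  have hne : ⟪E.ψ n, U⟫_ℝ ≠ 0 := by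
    intro h
    rw [h, zero_smul] at hUψ
    rw [hUψ, norm_zero] at hU1
    exact zero_ne_one hU1
  have hVn : ⟪E.ψ n, V⟫_ℝ = 0 := by
    rw [hUψ, inner_smul_left] at hUV
    exact (mul_eq_zero.1 hUV).resolve_left (by simpa using hne)
  have hcoef : ∀ j, ⟪E.ψ j, r⟫_ℝ = (E.τ j - E.τ n) * ⟪E.ψ j, V⟫_ℝ := by
    intro j
    have := hV.inner_sub_inner hM (E.rel j)
    rw [sub_self, zero_apply, inner_zero_right, inner_add_right, inner_smul_right,
      inner_smul_left] at this
    simp only [conj_trivial] at this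
    linarith
  have h1 := E.ψ.hasSum_inner_mul_inner V V
  have h2 := E.ψ.hasSum_inner_mul_inner r r
  have h3 : γ ^ 2 * ‖V‖ ^ 2 ≤ ‖r‖ ^ 2 := by
    rw [← real_inner_self_eq_norm_sq, ← real_inner_self_eq_norm_sq]
    refine hasSum_le (fun j => ?_) (h1.mul_left (γ ^ 2)) h2
    rw [real_inner_comm, real_inner_comm _ r, hcoef j]
    rcases eq_or_ne j n with rfl | hj
    · simp [hVn]
    · have : γ ^ 2 ≤ (E.τ j - E.τ n) ^ 2 := by
        rw [← sq_abs (E.τ j - E.τ n)]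
        exact pow_le_pow_left₀ hγ.le (hgap j hj) 2
      nlinarith [mul_le_mul_of_nonneg_right this (sq_nonneg ⟪E.ψ j, V⟫_ℝ)]
  rw [le_div_iff₀ hγ, mul_comm]
  rw [← mul_pow] at h3
  exact le_of_sq_le_sq h3 (norm_nonneg _)

/-- The `i`-th derivative of the operator pencil. -/
def pencilDeriv (A₁ A₂ : H →L[ℝ] H) (i : ℕ) (ω : ℝ) : H →L[ℝ] H :=
  ((Nat.descFactorial 2 i : ℝ) * ω ^ (2 - i)) • A₂ + ((Nat.descFactorial 1 i : ℝ) * ω ^ (1 - i)) • A₁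

/-- The descending factorials vanish once `i` exceeds the degree, so the truncated exponents never
matter; the surviving coefficients are at most 2 and 1 for |ω| ≤ 1. -/
theorem norm_pencilDeriv_le {K : ℝ} (hA₁ : ‖A₁‖ ≤ K) (hA₂ : ‖A₂‖ ≤ K) {ω : ℝ} (hω : |ω| ≤ 1) (i : ℕ) :
    ‖pencilDeriv A₁ A₂ i ω‖ ≤ 3 * K := by
  have hK : 0 ≤ K := (norm_nonneg _).trans hA₁
  have d2 : (Nat.descFactorial 2 i : ℝ) ≤ 2 := by
    rcases i with _ | _ | _ | i <;> norm_num [Nat.descFactorial]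
  have d1 : (Nat.descFactorial 1 i : ℝ) ≤ 1 := by
    rcases i with _ | _ | i <;> norm_num [Nat.descFactorial]
  have b2 : ‖(Nat.descFactorial 2 i : ℝ) * ω ^ (2 - i)‖ ≤ 2 := by
    rw [norm_mul, norm_pow, Real.norm_eq_abs ω, Real.norm_natCast]
    exact (mul_le_mul d2 (pow_le_one₀ (abs_nonneg _) hω) (by positivity) (by norm_num)).trans
      (by norm_num)
  have b1 : ‖(Nat.descFactorial 1 i : ℝ) * ω ^ (1 - i)‖ ≤ 1 := by
    rw [norm_mul, norm_pow, Real.norm_eq_abs ω, Real.norm_natCast]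
    exact (mul_le_mul d1 (pow_le_one₀ (abs_nonneg _) hω) (by positivity) (by norm_num)).trans
      (by norm_num)
  refine (norm_add_le _ _).trans ?_
  rw [norm_smul, norm_smul]
  have := mul_le_mul b2 hA₂ (norm_nonneg _) (by norm_num)
  have := mul_le_mul b1 hA₁ (norm_nonneg _) (by norm_num)
  linarith

/-- The differentiated eigenvector equation. -/
theorem diagRel_iteratedDeriv {U : ℝ → H} {τ : ℝ → ℝ} (hU : ContDiff ℝ (⊤ : ℕ∞) U)
    (hτ : ContDiff ℝ (⊤ : ℕ∞) τ)
    (hr : ∀ ω, DiagRel φ Λ (pencil A₁ A₂ ω) (U ω) (τ ω • U ω)) (k : ℕ) (ω : ℝ) :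
    DiagRel φ Λ (pencil A₁ A₂ ω) (iteratedDeriv k U ω) (τ ω • iteratedDeriv k U ω +
      ∑ i ∈ Finset.range k, (k.choose (i + 1) : ℝ) • (iteratedDeriv (i + 1) τ ω •
        iteratedDeriv (k - (i + 1)) U ω -
          pencilDeriv A₁ A₂ (i + 1) ω (iteratedDeriv (k - (i + 1)) U ω))) := by
  intro n
  set y : ℝ → ℝ := fun ω => ⟪φ n, U ω⟫_ℝ with hy
  set z₁ : ℝ → ℝ := fun ω => ⟪φ n, A₁ (U ω)⟫_ℝ with hz₁
  set z₂ : ℝ → ℝ := fun ω => ⟪φ n, A₂ (U ω)⟫_ℝ with hz₂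
  have cy : ContDiff ℝ (⊤ : ℕ∞) y := (innerSL ℝ (φ n)).contDiff.comp hU
  have c1 : ContDiff ℝ (⊤ : ℕ∞) z₁ := (innerSL ℝ (φ n)).contDiff.comp (A₁.contDiff.comp hU)
  have c2 : ContDiff ℝ (⊤ : ℕ∞) z₂ := (innerSL ℝ (φ n)).contDiff.comp (A₂.contDiff.comp hU)
  have iy : ∀ k, iteratedDeriv k y ω = ⟪φ n, iteratedDeriv k U ω⟫_ℝ := fun k =>
    iteratedDeriv_clm_apply (innerSL ℝ (φ n)) hU k ω
  have i1 : ∀ k, iteratedDeriv k z₁ ω = ⟪φ n, A₁ (iteratedDeriv k U ω)⟫_ℝ := fun k =>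
    iteratedDeriv_clm_apply ((innerSL ℝ (φ n)) ∘L A₁) hU k ω
  have i2 : ∀ k, iteratedDeriv k z₂ ω = ⟪φ n, A₂ (iteratedDeriv k U ω)⟫_ℝ := fun k =>
    iteratedDeriv_clm_apply ((innerSL ℝ (φ n)) ∘L A₂) hU k ω
  -- Pairing with φ_n reduces the claim to the scalar Leibniz rule. Writing ω as ω ^ 1 lets both
  -- terms of the pencil be treated alike.
  have heq : (fun ω => τ ω * y ω) = fun ω => - Λ n * y ω + (ω ^ 2 * z₂ ω + ω ^ 1 * z₁ ω) := by
    funext ω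
    have := hr ω n
    simpa [pencil, inner_smul_right, inner_add_right, hy, hz₁, hz₂] using this
  have hat : ∀ {f : ℝ → ℝ}, ContDiff ℝ (⊤ : ℕ∞) f → ContDiffAt ℝ k f ω := fun hf =>
    (hf.of_le (by exact_mod_cast le_top)).contDiffAt
  have cpow : ∀ m : ℕ, ContDiff ℝ (⊤ : ℕ∞) fun ω : ℝ => ω ^ m := fun m => contDiff_id.pow m
  have hd := congrArg (fun f => iteratedDeriv k f ω) heq
  have cc : ContDiff ℝ (⊤ : ℕ∞) fun ω => - Λ n * y ω := contDiff_const.mul cy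
  rw [iteratedDeriv_fun_add (hat cc) (hat (((cpow 2).mul c2).add ((cpow 1).mul c1))),
    iteratedDeriv_fun_add (hat ((cpow 2).mul c2)) (hat ((cpow 1).mul c1)),
    iteratedDeriv_const_mul_field, iteratedDeriv_fun_mul (hat hτ) (hat cy),
    iteratedDeriv_fun_mul (hat (cpow 2)) (hat c2), iteratedDeriv_fun_mul (hat (cpow 1)) (hat c1),
    ← Finset.sum_add_distrib, Finset.sum_range_succ' _ k, Finset.sum_range_succ' _ k] at hd
  simp only [iy, i1, i2, iteratedDeriv_pow] at hd
  rw [inner_add_right, inner_smul_right, inner_sum]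
  simp only [inner_smul_right, inner_sub_right, pencilDeriv, add_apply, smul_apply,
    inner_add_right, pencil, mul_sub, Finset.sum_sub_distrib]
  simp only [Nat.descFactorial_zero, Nat.choose_zero_right, iteratedDeriv_zero, Nat.sub_zero,
    Nat.cast_one, one_mul, pow_one] at hd
  have e1 : ∑ i ∈ Finset.range k, (k.choose (i + 1) : ℝ) * (iteratedDeriv (i + 1) τ ω *
      ⟪φ n, iteratedDeriv (k - (i + 1)) U ω⟫_ℝ) = ∑ i ∈ Finset.range k,
      (k.choose (i + 1) : ℝ) * iteratedDeriv (i + 1) τ ω *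
      ⟪φ n, iteratedDeriv (k - (i + 1)) U ω⟫_ℝ := Finset.sum_congr rfl fun i _ => by ring
  have e2 : ∑ i ∈ Finset.range k, (k.choose (i + 1) : ℝ) *
      ((Nat.descFactorial 2 (i + 1) : ℝ) * ω ^ (2 - (i + 1)) *
        ⟪φ n, A₂ (iteratedDeriv (k - (i + 1)) U ω)⟫_ℝ +
      (Nat.descFactorial 1 (i + 1) : ℝ) * ω ^ (1 - (i + 1)) *
        ⟪φ n, A₁ (iteratedDeriv (k - (i + 1)) U ω)⟫_ℝ) = ∑ i ∈ Finset.range k,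
      ((k.choose (i + 1) : ℝ) * ((Nat.descFactorial 2 (i + 1) : ℝ) * ω ^ (2 - (i + 1))) *
        ⟪φ n, A₂ (iteratedDeriv (k - (i + 1)) U ω)⟫_ℝ +
      (k.choose (i + 1) : ℝ) * ((Nat.descFactorial 1 (i + 1) : ℝ) * ω ^ (1 - (i + 1))) *
        ⟪φ n, A₁ (iteratedDeriv (k - (i + 1)) U ω)⟫_ℝ) :=
    Finset.sum_congr rfl fun i _ => by ring
  rw [e1, e2]
  linarith

/-- Bounds for the derivatives of an eigenvector and its eigenvalue in terms of the spectral gap. -/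
theorem exists_bound_iteratedDeriv (K : ℝ) (N : ℕ) : ∃ c : ℝ, 1 ≤ c ∧
    ∀ (φ : HilbertBasis ℕ ℝ H) (Λ : ℕ → ℝ) (A₁ A₂ : H →L[ℝ] H), ‖A₁‖ ≤ K → ‖A₂‖ ≤ K →
    (∀ u v, ⟪A₁ u, v⟫_ℝ = ⟪u, A₁ v⟫_ℝ) → (∀ u v, ⟪A₂ u, v⟫_ℝ = ⟪u, A₂ v⟫_ℝ) →
    ∀ (U : ℝ → H) (τ : ℝ → ℝ), ContDiff ℝ (⊤ : ℕ∞) U → ContDiff ℝ (⊤ : ℕ∞) τ → (∀ ω, ‖U ω‖ = 1) →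
    (∀ ω, DiagRel φ Λ (pencil A₁ A₂ ω) (U ω) (τ ω • U ω)) →
    ∀ (ω γ : ℝ) (E : EigSys φ Λ (pencil A₁ A₂ ω)) (n : ℕ), |ω| ≤ 1 → 1 ≤ γ → E.τ n = τ ω →
    (∀ j, j ≠ n → γ ≤ |E.τ j - E.τ n|) → ∀ j, 1 ≤ j → j ≤ N →
      |iteratedDeriv j τ ω| ≤ c ∧ ‖iteratedDeriv j U ω‖ ≤ c / γ := by
  rcases lt_or_ge K 0 with hK | hK
  · exact ⟨1, le_rfl, fun φ Λ A₁ A₂ h => absurd ((norm_nonneg _).trans h) (not_le.2 hK)⟩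
  -- Induction on the order of differentiation. The hypothesis γ ≥ 1 turns the bounds c/γ for lower
  -- derivatives into bounds c, so the remainder `r` is bounded independently of the gap, and only
  -- the last inversion produces 1/γ.
  induction N with
  | zero => exact ⟨1, le_rfl, by intros; omega⟩
  | succ N ih =>
    obtain ⟨c, hc, ih⟩ := ih
    set m := 3 * K with hm
    have hm0 : 0 ≤ m := by positivity
    set S : ℝ := ∑ i ∈ Finset.range (N + 1), ((N + 1).choose (i + 1) : ℝ) with hS
    have hS0 : 0 ≤ S := by positivity
    set S' : ℝ := ∑ ij ∈ Finset.HasAntidiagonal.antidiagonal (N + 1),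
      ((N + 1).choose ij.1 : ℝ) with hS'
    have hS'0 : 0 ≤ S' := by positivity
    set c₁ := m + S * ((c + m) * c) with hc₁
    have hc₁0 : 0 ≤ c₁ := by positivity
    set R := S * ((c + c₁ + m) * c) with hR
    have hR0 : 0 ≤ R := by positivity
    refine ⟨c + c₁ + R + S' * (c * c), by nlinarith [mul_nonneg hS'0 (mul_self_nonneg c)], ?_⟩
    intro φ Λ A₁ A₂ hA₁ hA₂ h1 h2 U τ hU hτ hU1 hr ω γ E n hω hγ hEτ hgap
    have ih' := ih φ Λ A₁ A₂ hA₁ hA₂ h1 h2 U τ hU hτ hU1 hr ω γ E n hω hγ hEτ hgap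
    have hγ0 : 0 < γ := by linarith
    have hcγ : c / γ ≤ c := div_le_self (by linarith) hγ
    have hUc : ∀ j ≤ N, ‖iteratedDeriv j U ω‖ ≤ c := by
      intro j hj
      rcases Nat.eq_zero_or_pos j with rfl | h
      · simpa [hU1] using hc
      · exact ((ih' j h hj).2).trans hcγ
    set r := ∑ i ∈ Finset.range (N + 1), ((N + 1).choose (i + 1) : ℝ) • (iteratedDeriv (i + 1) τ ω •
        iteratedDeriv (N + 1 - (i + 1)) U ω -
          pencilDeriv A₁ A₂ (i + 1) ω (iteratedDeriv (N + 1 - (i + 1)) U ω)) with hrdef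
    have hrel := diagRel_iteratedDeriv hU hτ hr (N + 1) ω
    rw [← hrdef] at hrel
    have hsymm := pencil_symm h1 h2 ω
    -- The solvability condition for the differentiated equation. Its summand of top index contains
    -- the new eigenvalue derivative times `U`, which gives a Feynman–Hellmann formula for that
    -- derivative in terms of quantities already bounded.
    have hUr : ⟪U ω, r⟫_ℝ = 0 := by
      have := hrel.inner_sub_inner hsymm (hr ω)
      rw [sub_self, zero_apply, inner_zero_right, inner_add_right, inner_smul_right,
        inner_smul_left] at this
      simp only [conj_trivial] at this
      linarith
    have hterm : ∀ (i : ℕ) (t : ℝ), |iteratedDeriv (i + 1) τ ω| ≤ t → 0 ≤ t →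
        ‖iteratedDeriv (i + 1) τ ω • iteratedDeriv (N + 1 - (i + 1)) U ω -
          pencilDeriv A₁ A₂ (i + 1) ω (iteratedDeriv (N + 1 - (i + 1)) U ω)‖ ≤ (t + m) * c := by
      intro i t ht ht0
      have b1 := hUc (N + 1 - (i + 1)) (by omega)
      refine (norm_sub_le _ _).trans ?_
      rw [norm_smul, add_mul]
      refine add_le_add (mul_le_mul ht b1 (norm_nonneg _) ht0) ?_
      exact (ContinuousLinearMap.le_opNorm _ _).trans
        (mul_le_mul (norm_pencilDeriv_le hA₁ hA₂ hω _) b1 (norm_nonneg _) hm0)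
    have hτN : |iteratedDeriv (N + 1) τ ω| ≤ c₁ := by
      rw [hrdef, Finset.sum_range_succ, inner_add_right] at hUr
      simp only [Nat.choose_self, Nat.cast_one, one_smul, Nat.sub_self, iteratedDeriv_zero] at hUr
      rw [inner_sub_right, inner_smul_right, real_inner_self_eq_norm_sq, hU1] at hUr
      set r' := ∑ i ∈ Finset.range N, ((N + 1).choose (i + 1) : ℝ) • (iteratedDeriv (i + 1) τ ω •
        iteratedDeriv (N + 1 - (i + 1)) U ω -
          pencilDeriv A₁ A₂ (i + 1) ω (iteratedDeriv (N + 1 - (i + 1)) U ω)) with hr'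
      have b1 : ‖r'‖ ≤ S * ((c + m) * c) := by
        rw [hr', hS, Finset.sum_mul, Finset.sum_range_succ]
        refine (norm_sum_le_of_le _ fun i hi => ?_).trans (le_add_of_nonneg_right (by positivity))
        rw [norm_smul, Real.norm_natCast]
        refine mul_le_mul_of_nonneg_left (hterm i c ?_ (by linarith)) (by positivity)
        exact (ih' (i + 1) (by omega) (Finset.mem_range.1 hi)).1
      have b2 : |⟪U ω, r'⟫_ℝ| ≤ S * ((c + m) * c) := by
        refine (abs_real_inner_le_norm _ _).trans ?_
        rwa [hU1, one_mul]
      have b3 : |⟪U ω, pencilDeriv A₁ A₂ (N + 1) ω (U ω)⟫_ℝ| ≤ m := by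
        refine (abs_real_inner_le_norm _ _).trans ?_
        rw [hU1, one_mul]
        refine (ContinuousLinearMap.le_opNorm _ _).trans ?_
        rw [hU1, mul_one]
        exact norm_pencilDeriv_le hA₁ hA₂ hω _
      have b4 : iteratedDeriv (N + 1) τ ω =
          ⟪U ω, pencilDeriv A₁ A₂ (N + 1) ω (U ω)⟫_ℝ - ⟪U ω, r'⟫_ℝ := by linarith
      rw [b4]
      exact (abs_sub _ _).trans (add_le_add b3 b2)
    have hrR : ‖r‖ ≤ R := by
      rw [hrdef, hR, hS, Finset.sum_mul]
      refine norm_sum_le_of_le _ fun i hi => ?_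
      rw [norm_smul, Real.norm_natCast]
      refine mul_le_mul_of_nonneg_left (hterm i (c + c₁) ?_ (by linarith)) (by positivity)
      rcases (Nat.lt_succ_iff.1 (Finset.mem_range.1 hi)).eq_or_lt with h | h
      · rw [h]; linarith
      · have := (ih' (i + 1) (by omega) h).1
        linarith
    set W := iteratedDeriv (N + 1) U ω with hW
    -- The new derivative is split into its part orthogonal to `U`, where the gap bound applies, and
    -- its component along `U`, which the equation leaves undetermined.
    set V := W + (-⟪U ω, W⟫_ℝ) • U ω with hV
    have hUV : ⟪U ω, V⟫_ℝ = 0 := by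
      rw [hV, inner_add_right, inner_smul_right, real_inner_self_eq_norm_sq, hU1]; ring
    have hVrel : DiagRel φ Λ (pencil A₁ A₂ ω) V (E.τ n • V + r) := by
      have := hrel.add ((hr ω).smul (-⟪U ω, W⟫_ℝ))
      have e : τ ω • W + r + (-⟪U ω, W⟫_ℝ) • τ ω • U ω = E.τ n • V + r := by
        rw [hEτ, hV, smul_add, smul_comm (τ ω)]; abel
      rwa [e] at this
    have hVle : ‖V‖ ≤ R / γ :=
      (inner_sub_inner_eq_norm_le hsymm E (hU1 ω) (by rw [hEτ]; exact hr ω) hVrel hUV hγ0 hgap).trans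
        (div_le_div_of_nonneg_right hrR hγ0.le)
    -- The component along `U` comes from differentiating ⟪U, U⟫ = 1: apart from the two extreme
    -- terms, each term pairs derivatives of orders between 1 and N, bounded by c and c/γ.
    have hinner : |⟪U ω, W⟫_ℝ| ≤ S' * (c * c) / γ := by
      have hconst : (fun ω => ⟪U ω, U ω⟫_ℝ) = fun _ => (1 : ℝ) := by
        funext ω; rw [real_inner_self_eq_norm_sq, hU1]; norm_num
      have hL := iteratedDeriv_inner hU hU (N + 1) ω
      rw [hconst, iteratedDeriv_const, if_neg (by omega)] at hL
      have hmem0 : ((0, N + 1) : ℕ × ℕ) ∈ Finset.HasAntidiagonal.antidiagonal (N + 1) := by simp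
      have hmem1 : ((N + 1, 0) : ℕ × ℕ) ∈
        (Finset.HasAntidiagonal.antidiagonal (N + 1)).erase (0, N + 1) := by simp
      rw [← Finset.add_sum_erase _ _ hmem0, ← Finset.add_sum_erase _ _ hmem1] at hL
      simp only [Nat.choose_zero_right, Nat.choose_self, one_smul, iteratedDeriv_zero] at hL
      rw [real_inner_comm, ← hW] at hL
      set Z := ∑ ij ∈ ((Finset.HasAntidiagonal.antidiagonal (N + 1)).erase (0, N + 1)).erase (N + 1, 0),
        (N + 1).choose ij.1 • ⟪iteratedDeriv ij.1 U ω, iteratedDeriv ij.2 U ω⟫_ℝ with hZ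
      have hZle : |Z| ≤ S' * (c * c) / γ := by
        rw [hZ, mul_div_assoc, hS', Finset.sum_mul]
        refine (Finset.abs_sum_le_sum_abs _ _).trans ?_
        refine (Finset.sum_le_sum fun ij hij => ?_).trans (Finset.sum_le_sum_of_subset_of_nonneg
          ((Finset.erase_subset _ _).trans (Finset.erase_subset _ _)) fun ij _ _ => by positivity)
        rw [nsmul_eq_mul, abs_mul, Nat.abs_cast]
        refine mul_le_mul_of_nonneg_left ?_ (by positivity)
        obtain ⟨i, j⟩ := ij
        simp only [Finset.mem_erase, ne_eq, Prod.mk.injEq, Finset.HasAntidiagonal.mem_antidiagonal] at hij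
        refine (abs_real_inner_le_norm _ _).trans ?_
        rw [mul_div_assoc]
        exact mul_le_mul (hUc i (by omega)) (ih' j (by omega) (by omega)).2 (norm_nonneg _)
          (by linarith)
      have : 2 * ⟪U ω, W⟫_ℝ = - Z := by
        have := real_inner_comm (U ω) W
        linarith
      have h3 : 2 * |⟪U ω, W⟫_ℝ| = |Z| := by
        rw [← abs_neg Z, ← this, abs_mul]; norm_num
      have := abs_nonneg ⟪U ω, W⟫_ℝ
      linarith
    have hWle : ‖W‖ ≤ (R + S' * (c * c)) / γ := by
      have e : W = V + ⟪U ω, W⟫_ℝ • U ω := by rw [hV]; simp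
      rw [e, add_div]
      refine (norm_add_le _ _).trans (add_le_add hVle ?_)
      rwa [norm_smul, hU1, mul_one, Real.norm_eq_abs]
    have hS'c : 0 ≤ S' * (c * c) := by positivity
    intro j hj1 hjN
    rcases hjN.eq_or_lt with rfl | hjN
    · refine ⟨hτN.trans (by linarith), hWle.trans (div_le_div_of_nonneg_right (by linarith) hγ0.le)⟩
    · have := ih' j hj1 (by omega)
      exact ⟨this.1.trans (by linarith), this.2.trans (div_le_div_of_nonneg_right (by linarith) hγ0.le)⟩

end PerturbationTheory

/-! ### L²([-1, 1]), the Jacobi basis and multiplication operators -/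

/-- Lebesgue measure on `[-1, 1]`. -/
abbrev intervalMeasure : Measure ℝ := volume.restrict (Icc (-1 : ℝ) 1)

/-- The real Hilbert space `L²([-1, 1])`. -/
abbrev L2I : Type := Lp ℝ 2 intervalMeasure

section
open scoped InnerProductSpace

theorem memLp_of_continuousOn {E : Type*} [NormedAddCommGroup E] {f : ℝ → E}
    (hf : ContinuousOn f (Icc (-1) 1)) : MemLp f 2 intervalMeasure := by
  obtain ⟨C, hC⟩ := isCompact_Icc.exists_bound_of_continuousOn hf
  refine MemLp.of_bound (hf.aestronglyMeasurable measurableSet_Icc) C ?_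
  filter_upwards [ae_restrict_mem measurableSet_Icc] with x hx using hC x hx

theorem memLp_of_continuous {E : Type*} [NormedAddCommGroup E] {f : ℝ → E}
    (hf : Continuous f) : MemLp f 2 intervalMeasure := memLp_of_continuousOn hf.continuousOn

theorem inner_L2I (u v : L2I) : ⟪u, v⟫_ℝ = ∫ x in Icc (-1 : ℝ) 1, u x * v x := by
  rw [L2.inner_def]
  refine integral_congr_ae (Eventually.of_forall fun x => ?_)
  simp [mul_comm]

theorem inner_L2I_of_ae {u v : L2I} {f g : ℝ → ℝ} (hu : u =ᵐ[intervalMeasure] f)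
    (hv : v =ᵐ[intervalMeasure] g) : ⟪u, v⟫_ℝ = ∫ x in Icc (-1 : ℝ) 1, f x * g x := by
  rw [inner_L2I]
  refine integral_congr_ae ?_
  filter_upwards [hu, hv] with x h1 h2
  rw [h1, h2]

/-- Weierstrass approximation upgrades polynomial test functions to smooth ones. It is stated for
integrable, vector-valued functions so that it serves for root weight times an L² function and for
complex functions on the sphere. -/
theorem ae_eq_zero_of_integral_polynomial {E : Type*} [NormedAddCommGroup E] [NormedSpace ℝ E]
    [CompleteSpace E] {f : ℝ → E} (hf : Integrable f intervalMeasure)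
    (h : ∀ q : Polynomial ℝ, ∫ x in Icc (-1 : ℝ) 1, q.eval x • f x = 0) :
    f =ᵐ[intervalMeasure] 0 := by
  refine ae_eq_zero_of_integral_contDiff_smul_eq_zero hf.locallyIntegrable fun g hg _ => ?_
  have hgc : Continuous g := hg.continuous
  have hgi : Integrable (fun x => g x • f x) intervalMeasure := by
    obtain ⟨C, hC⟩ := (isCompact_Icc (a := (-1:ℝ)) (b := 1)).exists_bound_of_continuousOn
      hgc.continuousOn
    refine hf.bdd_smul C hgc.aestronglyMeasurable ?_
    filter_upwards [ae_restrict_mem measurableSet_Icc] with x hx using hC x hx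
  rw [← norm_le_zero_iff]
  refine le_of_forall_pos_le_add fun ε hε => ?_
  set I := ∫ x in Icc (-1 : ℝ) 1, ‖f x‖ with hI
  have hI0 : 0 ≤ I := integral_nonneg fun x => norm_nonneg _
  obtain ⟨p, hp⟩ := exists_polynomial_near_of_continuousOn (-1) 1 g hgc.continuousOn (ε / (I + 1))
    (by positivity)
  have hpi : Integrable (fun x => p.eval x • f x) intervalMeasure := by
    obtain ⟨C, hC⟩ := (isCompact_Icc (a := (-1:ℝ)) (b := 1)).exists_bound_of_continuousOn
      p.continuous.continuousOn
    refine hf.bdd_smul C p.continuous.aestronglyMeasurable ?_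
    filter_upwards [ae_restrict_mem measurableSet_Icc] with x hx using hC x hx
  have e : ∫ x in Icc (-1 : ℝ) 1, g x • f x = ∫ x in Icc (-1 : ℝ) 1, (g x - p.eval x) • f x := by
    simp only [sub_smul]
    rw [integral_sub hgi hpi, h p, sub_zero]
  rw [e]
  calc ‖∫ x in Icc (-1 : ℝ) 1, (g x - p.eval x) • f x‖
      ≤ ∫ x in Icc (-1 : ℝ) 1, ε / (I + 1) * ‖f x‖ := by
        refine norm_integral_le_of_norm_le (hf.norm.const_mul _) ?_
        filter_upwards [ae_restrict_mem measurableSet_Icc] with x hx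
        rw [norm_smul]
        refine mul_le_mul_of_nonneg_right ?_ (norm_nonneg _)
        rw [← norm_neg, neg_sub]
        exact (hp x hx).le
    _ = ε / (I + 1) * I := by rw [integral_const_mul]
    _ ≤ 0 + ε := by
        rw [zero_add, div_mul_eq_mul_div, div_le_iff₀ (by positivity)]
        nlinarith

/-- The square root of the Jacobi weight. -/
def rootWeight (α β : ℕ) (x : ℝ) : ℝ := Real.sqrt ((jacobiWeight α β).eval x)

/-- The weighted `L²` norm of the Jacobi polynomial. -/
def jacobiNorm (α β n : ℕ) : ℝ :=
  Real.sqrt (∫ x in (-1 : ℝ)..1, (jacobiWeight α β * jacobiP α β n ^ 2).eval x)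

/-- The normalised Jacobi functions. -/
def jacobiFun (α β n : ℕ) (x : ℝ) : ℝ :=
  rootWeight α β x * ((jacobiP α β n).eval x / jacobiNorm α β n)

variable (α β : ℕ)

theorem continuous_rootWeight : Continuous (rootWeight α β) :=
  Real.continuous_sqrt.comp (jacobiWeight α β).continuous

theorem rootWeight_pos {x : ℝ} (hx : x ∈ Ioo (-1 : ℝ) 1) : 0 < rootWeight α β x :=
  Real.sqrt_pos.2 (jacobiWeight_pos α β hx)

theorem rootWeight_sq {x : ℝ} (hx : x ∈ Icc (-1 : ℝ) 1) :
    rootWeight α β x ^ 2 = (jacobiWeight α β).eval x :=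
  Real.sq_sqrt (jacobiWeight_nonneg α β hx)

theorem jacobiNorm_pos (n : ℕ) : 0 < jacobiNorm α β n :=
  Real.sqrt_pos.2 (integral_jacobiP_sq_pos α β n)

theorem jacobiNorm_sq (n : ℕ) : jacobiNorm α β n ^ 2 =
    ∫ x in (-1 : ℝ)..1, (jacobiWeight α β * jacobiP α β n ^ 2).eval x :=
  Real.sq_sqrt (integral_jacobiP_sq_pos α β n).le

theorem continuous_jacobiFun (n : ℕ) : Continuous (jacobiFun α β n) :=
  (continuous_rootWeight α β).mul ((jacobiP α β n).continuous.div_const _)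

/-- The normalised Jacobi functions as elements of `L²([-1, 1])`. -/
def jacobiVec (n : ℕ) : L2I := (memLp_of_continuous (continuous_jacobiFun α β n)).toLp _

theorem coeFn_jacobiVec (n : ℕ) : jacobiVec α β n =ᵐ[intervalMeasure] jacobiFun α β n :=
  MemLp.coeFn_toLp _

theorem integral_Icc_eq (f : ℝ → ℝ) : ∫ x in Icc (-1 : ℝ) 1, f x = ∫ x in (-1 : ℝ)..1, f x := by
  rw [intervalIntegral.integral_of_le (by norm_num), integral_Icc_eq_integral_Ioc]

theorem integral_jacobiFun_mul (n k : ℕ) (q : Polynomial ℝ) :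
    ∫ x in Icc (-1 : ℝ) 1, jacobiFun α β n x * (q.eval x * jacobiFun α β k x) =
      (jacobiNorm α β n)⁻¹ * (jacobiNorm α β k)⁻¹ *
        ∫ x in (-1 : ℝ)..1, (jacobiWeight α β * jacobiP α β n * (q * jacobiP α β k)).eval x := by
  rw [← integral_Icc_eq, ← integral_const_mul]
  refine setIntegral_congr_fun measurableSet_Icc fun x hx => ?_
  have := rootWeight_sq α β hx
  simp only [jacobiFun, Polynomial.eval_mul, ← this]
  ring

theorem orthonormal_jacobiVec : Orthonormal ℝ (jacobiVec α β) := by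
  rw [orthonormal_iff_ite]
  intro n k
  rw [inner_L2I_of_ae (coeFn_jacobiVec α β n) (coeFn_jacobiVec α β k)]
  have := integral_jacobiFun_mul α β n k 1
  simp only [Polynomial.eval_one, one_mul] at this
  rw [this]
  split_ifs with h
  · subst h
    rw [mul_assoc (jacobiWeight α β), ← pow_two (jacobiP α β n), ← jacobiNorm_sq]
    have := (jacobiNorm_pos α β n).ne'
    field_simp
  · rw [integral_jacobiP_mul_jacobiP α β h, mul_zero]

/-- Orthogonality to all Jacobi functions says that root weight times `u` annihilates all Jacobi
polynomials, hence all polynomials; the root weight is positive inside the interval and can be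
divided out. -/
theorem eq_zero_of_inner_jacobiVec {u : L2I} (h : ∀ n, ⟪jacobiVec α β n, u⟫_ℝ = 0) : u = 0 := by
  have hI : Integrable (fun x => rootWeight α β x * u x) intervalMeasure :=
    MemLp.integrable_mul (memLp_of_continuous (continuous_rootWeight α β)) (Lp.memLp u)
  have key : ∀ n, ∫ x in Icc (-1 : ℝ) 1, (jacobiP α β n).eval x • (rootWeight α β x * u x) = 0 := by
    intro n
    have h1 := h n
    rw [inner_L2I_of_ae (coeFn_jacobiVec α β n) (ae_eq_refl _)] at h1
    have : ∀ x, jacobiFun α β n x * u x =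
        (jacobiNorm α β n)⁻¹ * ((jacobiP α β n).eval x • (rootWeight α β x * u x)) := fun x => by
      simp only [jacobiFun, smul_eq_mul]; ring
    simp only [this] at h1
    rw [integral_const_mul] at h1
    exact (mul_eq_zero.1 h1).resolve_left (inv_ne_zero (jacobiNorm_pos α β n).ne')
  have hint : ∀ q : Polynomial ℝ,
      Integrable (fun x => q.eval x • (rootWeight α β x * u x)) intervalMeasure := fun q =>  by
    obtain ⟨C, hC⟩ := (isCompact_Icc (a := (-1:ℝ)) (b := 1)).exists_bound_of_continuousOn
      q.continuous.continuousOn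
    refine hI.bdd_smul C q.continuous.aestronglyMeasurable ?_
    filter_upwards [ae_restrict_mem measurableSet_Icc] with x hx using hC x hx
  have h0 : (fun x => rootWeight α β x * u x) =ᵐ[intervalMeasure] 0 := by
    refine ae_eq_zero_of_integral_polynomial hI fun q => ?_
    have hq := mem_span_jacobiP α β (q.natDegree + 1) q
      (Polynomial.degree_le_natDegree.trans_lt (by exact_mod_cast Nat.lt_succ_self _))
    generalize q.natDegree + 1 = N at hq
    induction hq using Submodule.span_induction with
    | mem y hy => obtain ⟨n, -, rfl⟩ := hy; exact key n
    | zero => simp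
    | add y z _ _ hy hz =>
      simp only [Polynomial.eval_add, add_smul]
      rw [integral_add (hint y) (hint z), hy, hz, add_zero]
    | smul c y _ hy =>
      simp only [Polynomial.eval_smul, smul_assoc]
      rw [integral_smul, hy, smul_zero]
  rw [Lp.eq_zero_iff_ae_eq_zero]
  have hne : ∀ᵐ x ∂intervalMeasure, x ∈ Ioo (-1 : ℝ) 1 := by
    rw [intervalMeasure, ← restrict_Ioo_eq_restrict_Icc]
    exact ae_restrict_mem measurableSet_Ioo
  filter_upwards [h0, hne] with x hx h1
  exact (mul_eq_zero.1 hx).resolve_left (rootWeight_pos α β h1).ne'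

/-- The Hilbert basis of normalised Jacobi functions. -/
def jacobiBasis : HilbertBasis ℕ ℝ L2I :=
  HilbertBasis.mkOfOrthogonalEqBot (orthonormal_jacobiVec α β) (by
    rw [Submodule.eq_bot_iff]
    intro u hu
    refine eq_zero_of_inner_jacobiVec α β fun n => ?_
    exact (Submodule.mem_orthogonal _ u).1 hu _ (Submodule.subset_span ⟨n, rfl⟩))

theorem coe_jacobiBasis : ⇑(jacobiBasis α β) = jacobiVec α β :=
  HilbertBasis.coe_mkOfOrthogonalEqBot _ _

theorem memLp_polynomial_mul (q : Polynomial ℝ) (u : L2I) :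
    MemLp (fun x => q.eval x * u x) 2 intervalMeasure := by
  obtain ⟨C, hC⟩ := (isCompact_Icc (a := (-1:ℝ)) (b := 1)).exists_bound_of_continuousOn
    q.continuous.continuousOn
  refine (Lp.memLp u).of_le_mul (c := C)
    (q.continuous.aestronglyMeasurable.mul (Lp.aestronglyMeasurable u)) ?_
  filter_upwards [ae_restrict_mem measurableSet_Icc] with x hx
  rw [norm_mul]
  exact mul_le_mul_of_nonneg_right (hC x hx) (norm_nonneg _)

/-- Multiplication by a polynomial, as an operator on `L²([-1, 1])`. -/
def mulOp (q : Polynomial ℝ) : L2I →L[ℝ] L2I :=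
  LinearMap.mkContinuousOfExistsBound
    { toFun := fun u => (memLp_polynomial_mul q u).toLp _
      map_add' := fun u v => by
        rw [← MemLp.toLp_add]
        refine MemLp.toLp_congr _ _ ?_
        filter_upwards [Lp.coeFn_add u v] with x hx
        simp only [hx, Pi.add_apply]; ring
      map_smul' := fun c u => by
        rw [RingHom.id_apply, ← MemLp.toLp_const_smul]
        refine MemLp.toLp_congr _ _ ?_
        filter_upwards [Lp.coeFn_smul c u] with x hx
        simp only [hx, Pi.smul_apply, smul_eq_mul]; ring }
    (by
      obtain ⟨C, hC⟩ := (isCompact_Icc (a := (-1:ℝ)) (b := 1)).exists_bound_of_continuousOn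
          q.continuous.continuousOn
      refine ⟨C, fun u => Lp.norm_le_mul_norm_of_ae_le_mul ?_⟩
      filter_upwards [ae_restrict_mem measurableSet_Icc,
        MemLp.coeFn_toLp (memLp_polynomial_mul q u)] with x hx h1
      simp only [LinearMap.coe_mk, AddHom.coe_mk]
      rw [h1, norm_mul]
      exact mul_le_mul_of_nonneg_right (hC x hx) (norm_nonneg _))

theorem coeFn_mulOp (q : Polynomial ℝ) (u : L2I) :
    mulOp q u =ᵐ[intervalMeasure] fun x => q.eval x * u x :=
  MemLp.coeFn_toLp (memLp_polynomial_mul q u)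

theorem norm_mulOp_le {q : Polynomial ℝ} {K : ℝ} (hK : ∀ x ∈ Icc (-1 : ℝ) 1, |q.eval x| ≤ K) :
    ‖mulOp q‖ ≤ K := by
  refine ContinuousLinearMap.opNorm_le_bound _
    ((abs_nonneg _).trans (hK 0 (by norm_num))) fun u => Lp.norm_le_mul_norm_of_ae_le_mul ?_
  filter_upwards [ae_restrict_mem measurableSet_Icc, coeFn_mulOp q u] with x hx h1
  rw [h1, norm_mul]
  exact mul_le_mul_of_nonneg_right (hK x hx) (norm_nonneg _)

theorem mulOp_symm (q : Polynomial ℝ) (u v : L2I) : ⟪mulOp q u, v⟫_ℝ = ⟪u, mulOp q v⟫_ℝ := by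
  rw [inner_L2I_of_ae (coeFn_mulOp q u) (ae_eq_refl _), inner_L2I_of_ae (ae_eq_refl _) (coeFn_mulOp q v)]
  congr 1; ext x; ring

theorem mulOp_add (p q : Polynomial ℝ) : mulOp (p + q) = mulOp p + mulOp q := by
  ext u
  rw [add_apply]
  filter_upwards [coeFn_mulOp (p + q) u, coeFn_mulOp p u, coeFn_mulOp q u,
    Lp.coeFn_add (mulOp p u) (mulOp q u)] with x h1 h2 h3 h4
  rw [h1, h4, Pi.add_apply, h2, h3, Polynomial.eval_add, add_mul]

theorem mulOp_C_mul (c : ℝ) (q : Polynomial ℝ) : mulOp (Polynomial.C c * q) = c • mulOp q := by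
  ext u
  rw [smul_apply]
  filter_upwards [coeFn_mulOp (Polynomial.C c * q) u, coeFn_mulOp q u,
    Lp.coeFn_smul c (mulOp q u)] with x h1 h2 h3
  rw [h1, h3, Pi.smul_apply, h2, Polynomial.eval_mul, Polynomial.eval_C, smul_eq_mul, mul_assoc]

/-- Multiplication by a polynomial has a banded matrix, because P_n is orthogonal to every
polynomial of lower degree. This is the source of the recursion behind `exists_decay`. -/
theorem inner_mulOp_jacobiVec_eq_zero {q : Polynomial ℝ} {n k : ℕ} (h : q.natDegree + k < n) :
    ⟪jacobiVec α β n, mulOp q (jacobiVec α β k)⟫_ℝ = 0 := by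
  have : mulOp q (jacobiVec α β k) =ᵐ[intervalMeasure] fun x => q.eval x * jacobiFun α β k x := by
    filter_upwards [coeFn_mulOp q (jacobiVec α β k), coeFn_jacobiVec α β k] with x h1 h2
    rw [h1, h2]
  rw [inner_L2I_of_ae (coeFn_jacobiVec α β n) this, integral_jacobiFun_mul,
    integral_jacobiP_mul_of_degree_lt, mul_zero]
  refine (Polynomial.degree_mul_le _ _).trans_lt ?_
  rw [degree_jacobiP]
  refine lt_of_le_of_lt (add_le_add_left Polynomial.degree_le_natDegree _) ?_
  exact_mod_cast h

theorem inner_mulOp_jacobiVec_eq_zero' {q : Polynomial ℝ} {n k : ℕ} (h : q.natDegree + n < k) :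
    ⟪jacobiVec α β n, mulOp q (jacobiVec α β k)⟫_ℝ = 0 := by
  rw [← mulOp_symm, real_inner_comm]
  exact inner_mulOp_jacobiVec_eq_zero α β h

end

/-! ### Growth of Jacobi functions and rapid decay of eigenvector coefficients -/

section
open scoped InnerProductSpace Nat

variable (α β : ℕ)

theorem abs_jacobiCoeff_le (n k : ℕ) (hk : k ≤ n + 1) :
    |jacobiCoeff α β n k| ≤ jacobiEv α β n ^ k / (k ! : ℝ) ^ 2 := by
  induction k with
  | zero => simp [jacobiCoeff]
  | succ k ih =>
    have ih := ih (by omega)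
    rw [jacobiCoeff, Finset.prod_range_succ, ← jacobiCoeff, abs_mul, pow_succ, Nat.factorial_succ]
    push_cast
    rw [mul_pow, mul_comm (((k : ℝ) + 1) ^ 2), mul_div_mul_comm]
    refine mul_le_mul ih ?_ (abs_nonneg _) (div_nonneg (pow_nonneg (jacobiEv_nonneg α β n) _) (by positivity))
    rw [abs_div]
    have h1 : jacobiEv α β k ≤ jacobiEv α β n := (jacobiEv_strictMono α β).monotone (by omega)
    have h2 := jacobiEv_nonneg α β k
    have hb : (0:ℝ) ≤ β := Nat.cast_nonneg β
    have hk : (0:ℝ) ≤ k := Nat.cast_nonneg k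
    refine div_le_div₀ (jacobiEv_nonneg α β n) (abs_le.2 ⟨by linarith, by linarith⟩) (by positivity) ?_
    rw [abs_of_nonneg (by positivity)]
    nlinarith

/-- The coefficient bound makes the k-th term at most (y^k / k!)² with y² = Λ_n R, hence at most
e^(2y). Since the square root of Λ_n is O(n), the growth in n is at most geometric on bounded sets
of ℂ. -/
theorem norm_aeval_jacobiP_le (n : ℕ) {z : ℂ} {R : ℝ} (hz : ‖z + 1‖ ≤ R) :
    ‖Polynomial.aeval z (jacobiP α β n)‖ ≤
      ((n : ℝ) + 1) * Real.exp (2 * Real.sqrt (jacobiEv α β n * R)) := by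
  have hR : 0 ≤ R := (norm_nonneg _).trans hz
  have hL := jacobiEv_nonneg α β n
  set y := Real.sqrt (jacobiEv α β n * R) with hy
  have hy2 : y ^ 2 = jacobiEv α β n * R := Real.sq_sqrt (mul_nonneg hL hR)
  have hy0 : 0 ≤ y := Real.sqrt_nonneg _
  rw [jacobiP, map_sum]
  refine (norm_sum_le_of_le _ (f := fun k => Polynomial.aeval z (Polynomial.C (jacobiCoeff α β n k) * (Polynomial.X + 1) ^ k)) (n := fun _ => Real.exp (2 * y)) fun k hk => ?_).trans ?_
  · simp only [map_mul, Polynomial.aeval_C, map_pow, map_add, Polynomial.aeval_X, map_one, norm_mul,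
      norm_pow, norm_algebraMap', Real.norm_eq_abs]
    have h1 := abs_jacobiCoeff_le α β n k (by have := Finset.mem_range.1 hk; omega)
    calc |jacobiCoeff α β n k| * ‖z + 1‖ ^ k
        ≤ jacobiEv α β n ^ k / (k ! : ℝ) ^ 2 * R ^ k := by gcongr
      _ = (y ^ k / k !) ^ 2 := by
          rw [div_pow, ← pow_mul, mul_comm k 2, pow_mul, hy2, mul_pow]; ring
      _ ≤ (Real.exp y) ^ 2 := by
          gcongr
          exact Real.pow_div_factorial_le_exp y hy0 k
      _ = Real.exp (2 * y) := by rw [← Real.exp_nat_mul]; norm_num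
  · simp

/-- The normalisation P_n(-1) = 1 makes `jacobiMax` at least 1, so the norm is bounded below by an
inverse power of the eigenvalue. This is weakened to an exponential, which is all that the
analyticity argument needs. -/
theorem inv_jacobiNorm_le : ∃ A : ℝ, 0 ≤ A ∧ ∀ n, (jacobiNorm α β n)⁻¹ ≤
    A * Real.exp ((α + β + 1 : ℕ) * (n : ℝ)) := by
  set d : ℕ := α + β + 1 with hd
  refine ⟨1 + 4 * d * (4 ^ d * Real.exp (d * d)), by positivity, fun n => ?_⟩
  have hN := jacobiNorm_pos α β n
  have h1 : 1 ≤ jacobiMax α β n ^ 2 := by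
    have : 1 ≤ jacobiMax α β n := by
      have e : (jacobiP α β n).eval (-1) = 1 := by
        simp [jacobiP, Polynomial.eval_finsetSum, Finset.sum_range_succ', jacobiCoeff]
      have : |(jacobiP α β n).eval (-1)| ≤ jacobiMax α β n := le_max_left _ _
      rwa [e, abs_one] at this
    nlinarith
  have h2 := h1.trans (sq_jacobiMax_le α β n)
  rw [← jacobiNorm_sq] at h2
  have hdn : (α : ℝ) + β + 1 = d := by rw [hd]; push_cast; ring
  rw [hdn] at h2
  have hd1 : (1:ℝ) ≤ d := by rw [← hdn]; have := Nat.cast_nonneg (α := ℝ) α; have := Nat.cast_nonneg (α := ℝ) β; linarith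
  have hn : (0:ℝ) ≤ n := Nat.cast_nonneg n
  have h3 : 2 * (jacobiEv α β n + 1) ≤ 4 * Real.exp (n + d) := by
    have := Real.quadratic_le_exp_of_nonneg (x := (n : ℝ) + d) (by positivity)
    have e : jacobiEv α β n = n * (n + d) := by rw [jacobiEv, ← hdn]; ring
    rw [e]
    nlinarith
  have h4 : (2 * (jacobiEv α β n + 1)) ^ d ≤ 4 ^ d * Real.exp (d * d) * Real.exp (d * n) := by
    calc (2 * (jacobiEv α β n + 1)) ^ d ≤ (4 * Real.exp (n + d)) ^ d :=
          pow_le_pow_left₀ (by have := jacobiEv_nonneg α β n; linarith) h3 d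
      _ = _ := by rw [mul_pow, ← Real.exp_nat_mul, mul_assoc, ← Real.exp_add]; ring_nf
  have h5 : (jacobiNorm α β n)⁻¹ ^ 2 ≤ 4 * d * (4 ^ d * Real.exp (d * d) * Real.exp (d * n)) := by
    rw [inv_pow, inv_le_iff_one_le_mul₀ (by positivity)]
    exact h2.trans (by gcongr)
  have h6 : (1:ℝ) ≤ Real.exp (d * n) := Real.one_le_exp (by positivity)
  have h7 : (jacobiNorm α β n)⁻¹ ≤ 1 + (jacobiNorm α β n)⁻¹ ^ 2 := by
    nlinarith [sq_nonneg ((jacobiNorm α β n)⁻¹ - 1)]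
  nlinarith

theorem exists_norm_aeval_le (R : ℝ) : ∃ A B : ℝ, 0 ≤ A ∧ 0 < B ∧ ∀ n (z : ℂ), ‖z‖ ≤ R →
    ‖Polynomial.aeval z (jacobiP α β n)‖ * (jacobiNorm α β n)⁻¹ ≤ A * B ^ n := by
  obtain ⟨A, hA, h⟩ := inv_jacobiNorm_le α β
  set d : ℝ := ((α + β + 1 : ℕ) : ℝ) with hd
  set r := Real.sqrt (R + 1) with hr
  have hd0 : 0 ≤ d := by positivity
  refine ⟨A * Real.exp (2 * (d * r)), Real.exp (1 + 2 * r + d), by positivity, by positivity,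
    fun n z hz => ?_⟩
  have hR : 0 ≤ R := (norm_nonneg _).trans hz
  have h1 := norm_aeval_jacobiP_le α β n (z := z) (R := R + 1)
    ((norm_add_le _ _).trans (by rw [norm_one]; linarith))
  have h2 : Real.sqrt (jacobiEv α β n * (R + 1)) ≤ (n + d) * r := by
    rw [Real.sqrt_mul (jacobiEv_nonneg α β n)]
    refine mul_le_mul_of_nonneg_right (Real.sqrt_le_iff.2 ⟨by positivity, ?_⟩) (Real.sqrt_nonneg _)
    have e : jacobiEv α β n = n * (n + d) := by rw [jacobiEv, hd]; push_cast; ring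
    have hn : (0:ℝ) ≤ n := Nat.cast_nonneg n
    rw [e]; nlinarith [mul_nonneg hn hd0]
  calc _ ≤ (Real.exp n * Real.exp (2 * ((n + d) * r))) * (A * Real.exp (d * n)) := by
        refine mul_le_mul (h1.trans ?_) (h n) (inv_nonneg.2 (jacobiNorm_pos α β n).le) (by positivity)
        gcongr
        exact Real.add_one_le_exp _
    _ = _ := by
        rw [← Real.exp_nat_mul, mul_left_comm, ← Real.exp_add, ← Real.exp_add, mul_assoc,
          ← Real.exp_add]
        ring_nf

theorem summable_inv_jacobiEv : Summable fun n => (jacobiEv α β n + 1)⁻¹ := by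
  have h : Summable fun n : ℕ => 2 * (1 / ((n + 1 : ℕ) : ℝ) ^ 2) :=
    (((summable_nat_add_iff 1).2 (Real.summable_one_div_nat_pow.2 one_lt_two)).mul_left 2)
  refine Summable.of_nonneg_of_le (fun n => inv_nonneg.2 (by have := jacobiEv_nonneg α β n; linarith))
    (fun n => ?_) h
  have := jacobiEv_add_one_ge α β n
  have e : 2 * (1 / ((n + 1 : ℕ) : ℝ) ^ 2) = (((n : ℝ) + 1) ^ 2 / 2)⁻¹ := by push_cast; field_simp
  rw [e]
  exact inv_anti₀ (by positivity) this

theorem tendsto_jacobiEv : Tendsto (jacobiEv α β) atTop atTop := by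
  refine tendsto_atTop_mono (f := fun n : ℕ => (n : ℝ)) (fun n => ?_) tendsto_natCast_atTop_atTop
  unfold jacobiEv
  have := Nat.cast_nonneg (α := ℝ) α; have := Nat.cast_nonneg (α := ℝ) β
  have hn : (0:ℝ) ≤ n := Nat.cast_nonneg n
  rcases Nat.eq_zero_or_pos n with rfl | h
  · simp
  · have : (1:ℝ) ≤ n := by exact_mod_cast h
    nlinarith [mul_nonneg hn (Nat.cast_nonneg (α := ℝ) α), mul_nonneg hn (Nat.cast_nonneg (α := ℝ) β)]

theorem abs_inner_mulOp_le {q : Polynomial ℝ} (hq : q.natDegree ≤ 2) (n : ℕ) (u : L2I) :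
    |⟪jacobiVec α β n, mulOp q u⟫_ℝ| ≤
      ‖mulOp q‖ * ∑ j ∈ Finset.Icc (n - 2) (n + 2), |⟪jacobiVec α β j, u⟫_ℝ| := by
  rw [← mulOp_symm]
  have h := (jacobiBasis α β).hasSum_inner_mul_inner (mulOp q (jacobiVec α β n)) u
  rw [coe_jacobiBasis] at h
  rw [← h.tsum_eq, tsum_eq_sum (s := Finset.Icc (n - 2) (n + 2))]
  · rw [Finset.mul_sum]
    refine (Finset.abs_sum_le_sum_abs _ _).trans (Finset.sum_le_sum fun j _ => ?_)
    rw [abs_mul]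
    refine mul_le_mul_of_nonneg_right ?_ (abs_nonneg _)
    refine (abs_real_inner_le_norm _ _).trans ?_
    have h1 : ∀ k, ‖jacobiVec α β k‖ = 1 := (orthonormal_jacobiVec α β).1
    have := (mulOp q).le_opNorm (jacobiVec α β n)
    rw [h1] at this ⊢
    simpa using this
  · intro j hj
    rw [Finset.mem_Icc, not_and_or] at hj
    rw [mulOp_symm]
    rcases hj with hj | hj
    · rw [inner_mulOp_jacobiVec_eq_zero, zero_mul]; omega
    · rw [inner_mulOp_jacobiVec_eq_zero', zero_mul]; omega

/-- The n-th component of the eigenvalue equation equates (Λ_n + τ)u_n with a combination of at most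
five neighbouring coefficients. As Λ_n → ∞ this forces decay faster than any geometric rate. -/
theorem exists_decay {q : Polynomial ℝ} (hq : q.natDegree ≤ 2) {u : L2I} {τ : ℝ}
    (h : DiagRel (jacobiBasis α β) (jacobiEv α β) (mulOp q) u (τ • u)) {R : ℝ} (hR : 1 ≤ R) :
    ∃ C : ℝ, ∀ n, |⟪jacobiVec α β n, u⟫_ℝ| * R ^ n ≤ C := by
  set v : ℕ → ℝ := fun n => |⟪jacobiVec α β n, u⟫_ℝ| with hv
  have hv0 : ∀ n, 0 ≤ v n := fun n => abs_nonneg _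
  have hvu : ∀ n, v n ≤ ‖u‖ := fun n => by
    have := abs_real_inner_le_norm (jacobiVec α β n) u
    rwa [(orthonormal_jacobiVec α β).1 n, one_mul] at this
  have hM := norm_nonneg (mulOp q)
  have hR0 : 0 < R := by linarith
  -- The threshold makes the recursion a contraction: five neighbours with weights shifted by at
  -- most R² contribute 5‖M‖R² times the supremum, at most half of what the factor 10‖M‖R² + 1
  -- absorbs.
  obtain ⟨n₀, hn₀⟩ := (tendsto_atTop.1 (tendsto_jacobiEv α β)
    (10 * ‖mulOp q‖ * R ^ 2 + 1 + |τ|)).exists_forall_of_atTop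
  have hrec : ∀ n ≥ n₀, (10 * ‖mulOp q‖ * R ^ 2 + 1) * v n ≤
      ‖mulOp q‖ * ∑ j ∈ Finset.Icc (n - 2) (n + 2), v j := by
    intro n hn
    refine le_trans ?_ (abs_inner_mulOp_le α β hq n u)
    have h1 := h n
    rw [coe_jacobiBasis, inner_smul_right] at h1
    have h2 : ⟪jacobiVec α β n, mulOp q u⟫_ℝ = (jacobiEv α β n + τ) * ⟪jacobiVec α β n, u⟫_ℝ := by
      linarith
    rw [h2, abs_mul]
    refine mul_le_mul_of_nonneg_right ?_ (abs_nonneg _)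
    have := hn₀ n hn
    exact le_trans (by linarith [neg_abs_le τ]) (le_abs_self _)
  -- Truncating the weight at `p` makes the supremum `B` finite beforehand. Beyond n₀ each term is
  -- at most B/2, so `B` is controlled by the first n₀ terms, with a bound free of `p`; finally p =
  -- n.
  have key : ∀ p n, v n * R ^ (min n p) ≤ R ^ n₀ * ‖u‖ := by
    intro p
    have hbdd : BddAbove (range fun n => v n * R ^ (min n p)) := by
      refine ⟨‖u‖ * R ^ p, ?_⟩
      rintro _ ⟨n, rfl⟩
      exact mul_le_mul (hvu n) (pow_le_pow_right₀ hR (min_le_right _ _)) (by positivity) (norm_nonneg _)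
    set B := ⨆ n, v n * R ^ (min n p) with hB
    have hle : ∀ n, v n * R ^ (min n p) ≤ B := fun n => le_ciSup hbdd n
    have hB0 : 0 ≤ B := (mul_nonneg (hv0 0) (by positivity)).trans (hle 0)
    have hmax : B ≤ max (B / 2) (R ^ n₀ * ‖u‖) := by
      refine ciSup_le fun n => ?_
      rcases lt_or_ge n n₀ with hn | hn
      · refine le_max_of_le_right ?_
        rw [mul_comm]
        exact mul_le_mul (pow_le_pow_right₀ hR ((min_le_left _ _).trans hn.le)) (hvu n) (hv0 n) (by positivity)
      · refine le_max_of_le_left ?_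
        have h1 : (∑ j ∈ Finset.Icc (n - 2) (n + 2), v j) * R ^ (min n p) ≤ 5 * (R ^ 2 * B) := by
          rw [Finset.sum_mul]
          refine (Finset.sum_le_card_nsmul _ _ (R ^ 2 * B) fun j hj => ?_).trans ?_
          · rw [Finset.mem_Icc] at hj
            calc v j * R ^ (min n p) ≤ v j * R ^ (2 + min j p) := by
                  refine mul_le_mul_of_nonneg_left (pow_le_pow_right₀ hR ?_) (hv0 j)
                  omega
              _ = R ^ 2 * (v j * R ^ (min j p)) := by rw [pow_add]; ring
              _ ≤ _ := by gcongr; exact hle j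
          · rw [nsmul_eq_mul]
            refine mul_le_mul_of_nonneg_right ?_ (by positivity)
            have : (Finset.Icc (n - 2) (n + 2)).card ≤ 5 := by rw [Nat.card_Icc]; omega
            exact_mod_cast this
        have h2 := mul_le_mul_of_nonneg_right (hrec n hn) (by positivity : 0 ≤ R ^ (min n p))
        rw [mul_assoc, mul_assoc ‖mulOp q‖] at h2
        have h3 : (10 * ‖mulOp q‖ * R ^ 2 + 1) * (v n * R ^ (min n p)) ≤ ‖mulOp q‖ * (5 * (R ^ 2 * B)) :=
          h2.trans (mul_le_mul_of_nonneg_left h1 hM)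
        have h4 : 0 ≤ ‖mulOp q‖ * R ^ 2 := by positivity
        have h5 : 0 ≤ v n * R ^ (min n p) := mul_nonneg (hv0 n) (by positivity)
        by_contra hc
        push Not at hc
        nlinarith [mul_nonneg h4 hB0, mul_le_mul_of_nonneg_left hc.le h4]
    have : B ≤ R ^ n₀ * ‖u‖ := by
      rcases le_max_iff.1 hmax with h | h
      · have : B ≤ 0 := by linarith
        exact this.trans (by positivity)
      · exact h
    exact fun n => (hle n).trans this
  exact ⟨R ^ n₀ * ‖u‖, fun n => by simpa using key n n⟩

end

/-! ### Jacobi series: analyticity and evaluation at a point -/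

section
open scoped InnerProductSpace

variable (α β : ℕ)

/-- The Jacobi series of `u`, as a function on the real line. -/
def jacobiSeries (u : L2I) (x : ℝ) : ℝ :=
  ∑' n, ⟪jacobiVec α β n, u⟫_ℝ * ((jacobiP α β n).eval x / jacobiNorm α β n)

variable {α β}

/-- Taking the decay rate as twice the growth rate B leaves the summable factor 2⁻ⁿ. -/
theorem exists_summable_bound {u : L2I}
    (h : ∀ R : ℝ, 1 ≤ R → ∃ C : ℝ, ∀ n, |⟪jacobiVec α β n, u⟫_ℝ| * R ^ n ≤ C) (r : ℝ) :
    ∃ b : ℕ → ℝ, Summable b ∧ ∀ n (z : ℂ), ‖z‖ ≤ r →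
      ‖((⟪jacobiVec α β n, u⟫_ℝ * (jacobiNorm α β n)⁻¹ : ℝ) : ℂ) *
        Polynomial.aeval z (jacobiP α β n)‖ ≤ b n := by
  obtain ⟨A, B, hA, hB, hAB⟩ := exists_norm_aeval_le α β r
  obtain ⟨C, hC⟩ := h (max 1 (2 * B)) (le_max_left _ _)
  refine ⟨fun n => A * C * (1 / 2) ^ n, summable_geometric_two.mul_left _, fun n z hz => ?_⟩
  have hN := inv_pos.2 (jacobiNorm_pos α β n)
  rw [norm_mul, Complex.norm_real, Real.norm_eq_abs, abs_mul, abs_of_pos hN]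
  have h1 := hAB n z hz
  have h2 : |⟪jacobiVec α β n, u⟫_ℝ| * (2 * B) ^ n ≤ C :=
    le_trans (mul_le_mul_of_nonneg_left (pow_le_pow_left₀ (by positivity) (le_max_right _ _) n)
      (abs_nonneg _)) (hC n)
  calc _ = |⟪jacobiVec α β n, u⟫_ℝ| *
        (‖Polynomial.aeval z (jacobiP α β n)‖ * (jacobiNorm α β n)⁻¹) := by ring
    _ ≤ |⟪jacobiVec α β n, u⟫_ℝ| * (A * B ^ n) := by gcongr
    _ = A * (|⟪jacobiVec α β n, u⟫_ℝ| * (2 * B) ^ n) * (1 / 2) ^ n := by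
        rw [mul_pow, div_pow, one_pow]; field_simp
    _ ≤ A * C * (1 / 2) ^ n := by gcongr

theorem aeval_ofReal_eq (x : ℝ) (p : Polynomial ℝ) :
    Polynomial.aeval (x : ℂ) p = ((p.eval x : ℝ) : ℂ) := by
  have := Polynomial.aeval_algebraMap_apply ℂ x p
  simpa [Polynomial.coe_aeval_eq_eval] using this

theorem hasSum_jacobiSeries {u : L2I}
    (h : ∀ R : ℝ, 1 ≤ R → ∃ C : ℝ, ∀ n, |⟪jacobiVec α β n, u⟫_ℝ| * R ^ n ≤ C) (x : ℝ) :
    HasSum (fun n => ⟪jacobiVec α β n, u⟫_ℝ * ((jacobiP α β n).eval x / jacobiNorm α β n))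
      (jacobiSeries α β u x) := by
  refine Summable.hasSum ?_
  obtain ⟨b, hb, hn⟩ := exists_summable_bound h |x|
  refine Summable.of_norm_bounded hb fun n => ?_
  have := hn n x (by simp)
  rw [aeval_ofReal_eq, ← Complex.ofReal_mul, Complex.norm_real] at this
  refine le_trans (le_of_eq ?_) this
  congr 1; ring

/-- The bounds hold on complex discs, so the series converges locally uniformly to an entire
function, of which `jacobiSeries` is the restriction to the real line. -/
theorem analyticOnNhd_jacobiSeries {u : L2I}
    (h : ∀ R : ℝ, 1 ≤ R → ∃ C : ℝ, ∀ n, |⟪jacobiVec α β n, u⟫_ℝ| * R ^ n ≤ C) :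
    AnalyticOnNhd ℝ (jacobiSeries α β u) univ := by
  set f : ℕ → ℂ → ℂ := fun n z => ((⟪jacobiVec α β n, u⟫_ℝ * (jacobiNorm α β n)⁻¹ : ℝ) : ℂ) *
        Polynomial.aeval z (jacobiP α β n) with hf
  set F : ℂ → ℂ := fun z => ∑' n, f n z with hF
  have hd : Differentiable ℂ F := by
    intro z
    obtain ⟨b, hb, hn⟩ := exists_summable_bound h (‖z‖ + 1)
    have := Complex.differentiableOn_tsum_of_summable_norm (U := Metric.ball 0 (‖z‖ + 1)) hb
      (F := f) (fun n => ((Polynomial.differentiable_aeval _).const_mul _).differentiableOn)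
      Metric.isOpen_ball (fun n w hw => hn n w (by simpa using (mem_ball_zero_iff.1 hw).le))
    exact this.differentiableAt (Metric.isOpen_ball.mem_nhds (by simp))
  have hFa : AnalyticOnNhd ℝ F univ :=
    (hd.differentiableOn.analyticOnNhd isOpen_univ).restrictScalars
  have e : jacobiSeries α β u = fun x : ℝ => Complex.reCLM (F (Complex.ofRealCLM x)) := by
    ext x
    have : F x = ((jacobiSeries α β u x : ℝ) : ℂ) := by
      rw [hF, jacobiSeries, Complex.ofReal_tsum]
      refine tsum_congr fun n => ?_
      rw [hf]; simp only
      rw [aeval_ofReal_eq, ← Complex.ofReal_mul]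
      congr 1; ring
    simp [this]
  rw [e]
  intro x _
  exact (Complex.reCLM.analyticAt _).comp ((hFa _ (mem_univ _)).comp (Complex.ofRealCLM.analyticAt _))

/-- Convergence in L² gives almost everywhere convergence along a subsequence of the partial sums,
and this limit must be the pointwise sum. -/
theorem ae_eq_of_hasSum {μ : Measure ℝ} {u : Lp ℝ 2 μ} {c : ℕ → ℝ} {φ : ℕ → Lp ℝ 2 μ}
    {F : ℕ → ℝ → ℝ} (hF : ∀ n, φ n =ᵐ[μ] F n) (h : HasSum (fun n => c n • φ n) u) {f : ℝ → ℝ}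
    (hf : ∀ᵐ x ∂μ, HasSum (fun n => c n * F n x) (f x)) : u =ᵐ[μ] f := by
  have h1 := h.tendsto_sum_nat
  have h2 : TendstoInMeasure μ (fun N => ((∑ n ∈ Finset.range N, c n • φ n : Lp ℝ 2 μ) : ℝ → ℝ))
      atTop u := tendstoInMeasure_of_tendsto_Lp h1
  obtain ⟨ns, hns, hae⟩ := h2.exists_seq_tendsto_ae
  have h3 : ∀ᵐ x ∂μ, ∀ N, ((∑ n ∈ Finset.range N, c n • φ n : Lp ℝ 2 μ) : ℝ → ℝ) x =
      ∑ n ∈ Finset.range N, c n * F n x := by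
    rw [ae_all_iff]
    intro N
    induction N with
    | zero =>
      filter_upwards [Lp.coeFn_zero ℝ 2 μ] with x hx
      rw [Finset.range_zero, Finset.sum_empty, Finset.sum_empty]
      exact hx
    | succ N ih =>
      simp only [Finset.sum_range_succ]
      filter_upwards [ih, Lp.coeFn_add (∑ n ∈ Finset.range N, c n • φ n) (c N • φ N),
        Lp.coeFn_smul (c N) (φ N), hF N] with x h1 h2 h3 h4
      rw [h2, Pi.add_apply, h1, h3, Pi.smul_apply, h4, smul_eq_mul]
  filter_upwards [hae, h3, hf] with x hx h3 hfx
  simp only [h3] at hx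
  exact tendsto_nhds_unique hx (hfx.tendsto_sum_nat.comp hns.tendsto_atTop)

theorem hasSum_jacobiVec (u : L2I) :
    HasSum (fun n => ⟪jacobiVec α β n, u⟫_ℝ • jacobiVec α β n) u := by
  have := (jacobiBasis α β).hasSum_repr u
  simpa only [HilbertBasis.repr_apply_apply, coe_jacobiBasis] using this

theorem ae_mem_Ioo : ∀ᵐ x ∂intervalMeasure, x ∈ Ioo (-1 : ℝ) 1 := by
  rw [intervalMeasure, ← restrict_Ioo_eq_restrict_Icc]
  exact ae_restrict_mem measurableSet_Ioo

theorem ae_eq_jacobiSeries {u : L2I}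
    (h : ∀ R : ℝ, 1 ≤ R → ∃ C : ℝ, ∀ n, |⟪jacobiVec α β n, u⟫_ℝ| * R ^ n ≤ C) :
    u =ᵐ[intervalMeasure] fun x => rootWeight α β x * jacobiSeries α β u x := by
  refine ae_eq_of_hasSum (coeFn_jacobiVec α β) (hasSum_jacobiVec u) (Eventually.of_forall fun x => ?_)
  refine ((hasSum_jacobiSeries h x).mul_left (rootWeight α β x)).congr_fun fun n => ?_
  rw [jacobiFun]; ring

variable (α β)

/-- Evaluation at a point is not bounded on L², but it becomes bounded after the resolvent: by the
Sobolev estimate φ_n(x)² is O(Λ_n + 1) for fixed interior x, and the sum of (Λ_n + 1)⁻¹ converges.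
-/
theorem exists_evalVec {x : ℝ} (hx : x ∈ Ioo (-1 : ℝ) 1) : ∃ G : L2I, ∀ n,
    ⟪jacobiVec α β n, G⟫_ℝ = jacobiFun α β n x * (jacobiEv α β n + 1)⁻¹ := by
  set c : ℕ → ℝ := fun n => jacobiFun α β n x * (jacobiEv α β n + 1)⁻¹ with hc
  have hx1 : 0 < 1 - x ^ 2 := by nlinarith [hx.1, hx.2]
  set D : ℝ := 2 * (α + β + 2) + 1 with hD
  have hD1 : 1 ≤ D := by rw [hD]; have := Nat.cast_nonneg (α := ℝ) α; have := Nat.cast_nonneg (α := ℝ) β; linarith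
  have hsum : Summable fun n => ‖c n‖ ^ 2 := by
    refine Summable.of_nonneg_of_le (fun n => sq_nonneg _) (fun n => ?_)
      ((summable_inv_jacobiEv α β).mul_left ((1 - x ^ 2)⁻¹ * D))
    have h1 := jacobiWeight_mul_sq_le α β n (Ioo_subset_Icc_self hx)
    rw [← jacobiNorm_sq, jacobiWeight_succ] at h1
    simp only [Polynomial.eval_mul, Polynomial.eval_pow, Polynomial.eval_sub, Polynomial.eval_one,
      Polynomial.eval_X] at h1
    rw [← rootWeight_sq α β (Ioo_subset_Icc_self hx), ← hD] at h1
    have hL := jacobiEv_nonneg α β n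
    have hN := jacobiNorm_pos α β n
    have h2 : jacobiFun α β n x ^ 2 ≤ (1 - x ^ 2)⁻¹ * (jacobiEv α β n + D) := by
      rw [inv_mul_eq_div, le_div_iff₀ hx1, jacobiFun, mul_pow, div_pow, mul_div_assoc', div_mul_eq_mul_div,
        div_le_iff₀ (by positivity)]
      linarith
    rw [Real.norm_eq_abs, sq_abs, hc]
    simp only [mul_pow]
    calc _ ≤ (1 - x ^ 2)⁻¹ * (jacobiEv α β n + D) * (jacobiEv α β n + 1)⁻¹ ^ 2 := by gcongr
      _ ≤ (1 - x ^ 2)⁻¹ * (D * (jacobiEv α β n + 1)) * (jacobiEv α β n + 1)⁻¹ ^ 2 := by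
          gcongr; nlinarith
      _ = _ := by field_simp
  refine ⟨(jacobiBasis α β).repr.symm ⟨c, memℓp_gen ?_⟩, fun n => ?_⟩
  · simpa using hsum
  · rw [← coe_jacobiBasis, ← HilbertBasis.repr_apply_apply]
    simp [hc]

/-- The vector representing evaluation at `x` after the resolvent of the Jacobi operator. -/
def evalVec (x : ℝ) : L2I :=
  if hx : x ∈ Ioo (-1 : ℝ) 1 then (exists_evalVec α β hx).choose else 0

theorem inner_jacobiVec_evalVec {x : ℝ} (hx : x ∈ Ioo (-1 : ℝ) 1) (n : ℕ) :
    ⟪jacobiVec α β n, evalVec α β x⟫_ℝ = jacobiFun α β n x * (jacobiEv α β n + 1)⁻¹ := by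
  rw [evalVec, dif_pos hx]
  exact (exists_evalVec α β hx).choose_spec n

theorem hasSum_inner_evalVec {x : ℝ} (hx : x ∈ Ioo (-1 : ℝ) 1) (g : L2I) :
    HasSum (fun n => ((jacobiEv α β n + 1)⁻¹ * ⟪jacobiVec α β n, g⟫_ℝ) * jacobiFun α β n x)
      ⟪evalVec α β x, g⟫_ℝ := by
  have := (jacobiBasis α β).hasSum_inner_mul_inner (evalVec α β x) g
  rw [coe_jacobiBasis] at this
  refine this.congr_fun fun n => ?_
  rw [real_inner_comm (jacobiVec α β n) (evalVec α β x), inner_jacobiVec_evalVec α β hx]; ring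

/-- The resolvent of the Jacobi operator at `-1`. -/
abbrev jacobiRes : L2I →L[ℝ] L2I := diagOp (jacobiBasis α β) fun n => (jacobiEv α β n + 1)⁻¹

theorem jacobiRes_ae_eq (g : L2I) :
    jacobiRes α β g =ᵐ[intervalMeasure] fun x => ⟪evalVec α β x, g⟫_ℝ := by
  refine ae_eq_of_hasSum (coeFn_jacobiVec α β) (hasSum_jacobiVec (α := α) (β := β) _) ?_
  filter_upwards [ae_mem_Ioo] with x hx
  refine (hasSum_inner_evalVec α β hx g).congr_fun fun n => ?_
  have := inner_diagOp (φ := jacobiBasis α β) (summable_inv_jacobiEv α β) n g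
  rw [coe_jacobiBasis] at this
  rw [this]

variable {α β}

theorem diagRel_iff_jacobiRes {M : L2I →L[ℝ] L2I} {u g : L2I} :
    DiagRel (jacobiBasis α β) (jacobiEv α β) M u g ↔ u = jacobiRes α β (M u + u - g) := by
  have := diagRel_iff (φ := jacobiBasis α β) (M := M) (jacobiEv_nonneg α β) (summable_inv_jacobiEv α β) one_pos
    (u := u) (g := g)
  rwa [one_smul] at this

/-- An eigenvector is `rootWeight` times its Jacobi series, and the evaluation vectors compute it. -/
theorem inner_evalVec_eq {M : L2I →L[ℝ] L2I} {u g : L2I}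
    (hu : ∀ R : ℝ, 1 ≤ R → ∃ C : ℝ, ∀ n, |⟪jacobiVec α β n, u⟫_ℝ| * R ^ n ≤ C)
    (h : DiagRel (jacobiBasis α β) (jacobiEv α β) M u g) {x : ℝ} (hx : x ∈ Ioo (-1 : ℝ) 1) :
    ⟪evalVec α β x, M u + u - g⟫_ℝ = rootWeight α β x * jacobiSeries α β u x := by
  refine (hasSum_inner_evalVec α β hx _).unique ?_
  refine ((hasSum_jacobiSeries hu x).mul_left (rootWeight α β x)).congr_fun fun n => ?_
  have h1 := h n
  rw [coe_jacobiBasis] at h1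
  have hL := jacobiEv_nonneg α β n
  rw [inner_sub_right, inner_add_right, h1, jacobiFun]
  field_simp
  ring

end

/-! ### The differential equation, behaviour at the end point -1, simplicity -/

section
open scoped InnerProductSpace

/-- The Jacobi operator applied to a function. -/
def jacobiDiff (α β : ℕ) (h : ℝ → ℝ) (x : ℝ) : ℝ :=
  (1 - x ^ 2) * deriv (deriv h) x + (((β : ℝ) - α) - ((α : ℝ) + β + 2) * x) * deriv h x

variable (α β : ℕ)

theorem derivative_jacobiWeight : Polynomial.derivative (jacobiWeight (α + 1) (β + 1)) =
    jacobiWeight α β * (Polynomial.C ((β : ℝ) - α) - Polynomial.C ((α : ℝ) + β + 2) * Polynomial.X) := by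
  have := derivative_jacobiWeight_mul α β Polynomial.X
  simpa [jacobiOp] using this

theorem hasDerivAt_jacobiWeight_mul {h : ℝ → ℝ} {x : ℝ} (h1 : DifferentiableAt ℝ (deriv h) x) :
    HasDerivAt (fun y => (jacobiWeight (α + 1) (β + 1)).eval y * deriv h y)
      ((jacobiWeight α β).eval x * jacobiDiff α β h x) x := by
  have := ((jacobiWeight (α + 1) (β + 1)).hasDerivAt x).mul h1.hasDerivAt
  refine this.congr_deriv ?_
  rw [derivative_jacobiWeight, jacobiWeight_succ, jacobiDiff]
  simp only [Polynomial.eval_mul, Polynomial.eval_sub, Polynomial.eval_C, Polynomial.eval_X,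
    Polynomial.eval_one, Polynomial.eval_pow]
  ring

theorem continuous_jacobiDiff {h : ℝ → ℝ} (hh : ContDiff ℝ 2 h) : Continuous (jacobiDiff α β h) := by
  have h1 : Continuous (deriv h) := (hh.iterate_deriv' 1 1).continuous
  have h2 : Continuous (deriv (deriv h)) := (hh.iterate_deriv' 0 2).continuous
  unfold jacobiDiff
  fun_prop

theorem jacobiDiff_eval (n : ℕ) (x : ℝ) : jacobiDiff α β (fun y => (jacobiP α β n).eval y) x =
    - jacobiEv α β n * (jacobiP α β n).eval x := by
  have e : deriv (fun y => (jacobiP α β n).eval y) =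
    fun y => (Polynomial.derivative (jacobiP α β n)).eval y := by ext y; exact Polynomial.deriv _
  rw [jacobiDiff, e, Polynomial.deriv]
  exact jacobiOp_eval (jacobiOp_jacobiP α β n) x

theorem integral_jacobiDiff_mul {h k : ℝ → ℝ} (hh : ContDiff ℝ 2 h) (hk : ContDiff ℝ 2 k) :
    ∫ x in (-1 : ℝ)..1, (jacobiWeight α β).eval x * jacobiDiff α β h x * k x =
      ∫ x in (-1 : ℝ)..1, (jacobiWeight α β).eval x * jacobiDiff α β k x * h x := by
  have hd : ∀ {f : ℝ → ℝ}, ContDiff ℝ 2 f → Differentiable ℝ f ∧ Differentiable ℝ (deriv f) :=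
    fun hf => ⟨hf.differentiable (by norm_num), (hf.iterate_deriv' 1 1).differentiable (by norm_num)⟩
  have key : ∀ x ∈ uIcc (-1 : ℝ) 1, HasDerivAt (fun y =>
      (jacobiWeight (α + 1) (β + 1)).eval y * deriv h y * k y
        - (jacobiWeight (α + 1) (β + 1)).eval y * deriv k y * h y)
      ((jacobiWeight α β).eval x * jacobiDiff α β h x * k x
        - (jacobiWeight α β).eval x * jacobiDiff α β k x * h x) x := by
    intro x _
    have h1 := (hasDerivAt_jacobiWeight_mul α β ((hd hh).2 x)).mul ((hd hk).1 x).hasDerivAt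
    have h2 := (hasDerivAt_jacobiWeight_mul α β ((hd hk).2 x)).mul ((hd hh).1 x).hasDerivAt
    exact (h1.sub h2).congr_deriv (by ring)
  have c : ∀ {f g : ℝ → ℝ}, ContDiff ℝ 2 f → ContDiff ℝ 2 g →
    Continuous fun x => (jacobiWeight α β).eval x * jacobiDiff α β f x * g x := fun hf hg =>
      ((jacobiWeight α β).continuous.mul (continuous_jacobiDiff α β hf)).mul hg.continuous
  rw [← sub_eq_zero, ← intervalIntegral.integral_sub ((c hh hk).intervalIntegrable _ _)
    ((c hk hh).intervalIntegrable _ _), intervalIntegral.integral_eq_sub_of_hasDerivAt key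
    (((c hh hk).sub (c hk hh)).intervalIntegrable _ _)]
  simp [jacobiWeight_succ_eval_one, jacobiWeight_succ_eval_neg_one]

variable {α β}

/-- For a twice differentiable `h`, the spectral relation for `rootWeight * h` is the differential
equation. -/
theorem jacobiDiff_of_diagRel {q : Polynomial ℝ} {u : L2I} {τ : ℝ} {h : ℝ → ℝ} (hh : ContDiff ℝ 2 h)
    (hu : u =ᵐ[intervalMeasure] fun x => rootWeight α β x * h x)
    (hr : DiagRel (jacobiBasis α β) (jacobiEv α β) (mulOp q) u (τ • u)) :
    ∀ x ∈ Icc (-1 : ℝ) 1, jacobiDiff α β h x = (τ - q.eval x) * h x := by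
  -- The weighted residual of the differential equation. It is orthogonal to every Jacobi function,
  -- hence zero; dividing by the root weight proves the equation inside, and continuity extends it
  -- to the end points.
  set k : ℝ → ℝ := fun x => rootWeight α β x * ((τ - q.eval x) * h x - jacobiDiff α β h x) with hk
  have hkc : Continuous k := (continuous_rootWeight α β).mul
    (((continuous_const.sub q.continuous).mul hh.continuous).sub (continuous_jacobiDiff α β hh))
  have hP : ∀ n, ContDiff ℝ 2 fun y => (jacobiP α β n).eval y := fun n => by
    simpa [Polynomial.coe_aeval_eq_eval] using (jacobiP α β n).contDiff_aeval (𝕜 := ℝ) 2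
  have hz : (memLp_of_continuous hkc).toLp k = 0 := by
    refine eq_zero_of_inner_jacobiVec α β fun n => ?_
    rw [inner_L2I_of_ae (coeFn_jacobiVec α β n) (MemLp.coeFn_toLp _)]
    have h1 := hr n
    have hq : mulOp q u =ᵐ[intervalMeasure] fun x => q.eval x * (rootWeight α β x * h x) := by
      filter_upwards [coeFn_mulOp q u, hu] with x h1 h2
      rw [h1, h2]
    rw [coe_jacobiBasis, inner_smul_right, inner_L2I_of_ae (coeFn_jacobiVec α β n) hu,
      inner_L2I_of_ae (coeFn_jacobiVec α β n) hq, ← integral_const_mul, ← integral_const_mul] at h1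
    have hJ := integral_jacobiDiff_mul α β hh (hP n)
    simp only [jacobiDiff_eval] at hJ
    rw [← integral_Icc_eq, ← integral_Icc_eq] at hJ
    have hJ' := congrArg (fun t => (jacobiNorm α β n)⁻¹ * t) hJ
    simp only [← integral_const_mul] at hJ'
    have e1 : ∀ x ∈ Icc (-1 : ℝ) 1, (jacobiNorm α β n)⁻¹ * ((jacobiWeight α β).eval x *
        jacobiDiff α β h x * (jacobiP α β n).eval x) =
        jacobiFun α β n x * (rootWeight α β x * jacobiDiff α β h x) := fun x hx => by
      rw [← rootWeight_sq α β hx, jacobiFun]; ring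
    have e2 : ∀ x ∈ Icc (-1 : ℝ) 1, (jacobiNorm α β n)⁻¹ * ((jacobiWeight α β).eval x *
        (-jacobiEv α β n * (jacobiP α β n).eval x) * h x) =
        - jacobiEv α β n * (jacobiFun α β n x * (rootWeight α β x * h x)) := fun x hx => by
      rw [← rootWeight_sq α β hx, jacobiFun]; ring
    rw [setIntegral_congr_fun measurableSet_Icc e1, setIntegral_congr_fun measurableSet_Icc e2] at hJ'
    have ci : ∀ {f : ℝ → ℝ}, Continuous f → Integrable f intervalMeasure := fun hf =>
      hf.continuousOn.integrableOn_Icc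
    have c1 := continuous_jacobiFun α β n
    have c2 := continuous_rootWeight α β
    have c3 := hh.continuous
    have c4 := continuous_jacobiDiff α β hh
    have c5 : Continuous fun x => q.eval x := q.continuous
    rw [← hJ', ← integral_add (ci (by fun_prop)) (ci (by fun_prop)), ← sub_eq_zero,
      ← integral_sub (ci (by fun_prop)) (ci (by fun_prop))] at h1
    rw [← h1]
    congr 1; ext x
    rw [hk]; ring
  have h0 : k =ᵐ[intervalMeasure] fun _ => (0 : ℝ) := by
    have := (Lp.eq_zero_iff_ae_eq_zero).1 hz
    exact (MemLp.coeFn_toLp _).symm.trans this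
  have h0' := Measure.eqOn_Icc_of_ae_eq volume (by norm_num : (-1 : ℝ) ≠ 1) h0 hkc.continuousOn
    continuousOn_const
  have hIoo : EqOn (fun x => (τ - q.eval x) * h x - jacobiDiff α β h x) (fun _ => 0) (Ioo (-1) 1) :=
    fun x hx => (mul_eq_zero.1 (h0' (Ioo_subset_Icc_self hx))).resolve_left (rootWeight_pos α β hx).ne'
  have hcl := hIoo.closure (((continuous_const.sub q.continuous).mul hh.continuous).sub
    (continuous_jacobiDiff α β hh)) continuous_const
  rw [closure_Ioo (by norm_num)] at hcl
  intro x hx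
  have := hcl hx
  simp only at this
  linarith

/-- Near the end point `-1` a solution deviates little from its end point value. -/
theorem abs_sub_le_of_jacobiDiff {h v : ℝ → ℝ} (hh : ContDiff ℝ 2 h) {Q : ℝ} (hQ : 1 ≤ Q)
    (hv : ∀ x ∈ Icc (-1 : ℝ) 1, |v x| ≤ Q)
    (ho : ∀ x ∈ Icc (-1 : ℝ) 1, jacobiDiff α β h x = v x * h x) {x : ℝ}
    (hx : x ∈ Icc (-1 : ℝ) (-1 + (4 * Q * 2 ^ α)⁻¹)) : |h x - h (-1)| ≤ |h (-1)| / 3 := by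
  set δ := (4 * Q * 2 ^ α)⁻¹ with hδ
  have h2a : (1:ℝ) ≤ 2 ^ α := one_le_pow₀ (by norm_num)
  have hQa : 1 ≤ Q * 2 ^ α := by nlinarith
  have hδ0 : 0 < δ := by positivity
  have hδQ : δ * (Q * 2 ^ α) = 1 / 4 := by rw [hδ]; field_simp
  have hδ1 : δ ≤ 1 := by nlinarith
  have hsub : Icc (-1 : ℝ) (-1 + δ) ⊆ Icc (-1) 1 := Icc_subset_Icc_right (by linarith)
  obtain ⟨y₀, hy₀, hmax⟩ := (isCompact_Icc (a := (-1 : ℝ)) (b := -1 + δ)).exists_isMaxOn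
    ⟨-1, by simp [hδ0.le]⟩ (f := fun y => |h y|) (hh.continuous.abs.continuousOn)
  set B := |h y₀| with hB
  have hBle : ∀ y ∈ Icc (-1 : ℝ) (-1 + δ), |h y| ≤ B := fun y hy => hmax hy
  have hB0 : 0 ≤ B := abs_nonneg _
  have hdiff : Differentiable ℝ h := hh.differentiable (by norm_num)
  have hdiff2 : Differentiable ℝ (deriv h) := (hh.iterate_deriv' 1 1).differentiable (by norm_num)
  -- At -1 the equation itself determines h'. For y > -1 the divergence form is estimated from -1 to
  -- y: the weight of total order β + 1 at y is matched by (1 + y)^β times the length 1 + y, so the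
  -- singular factor cancels.
  have hder : ∀ y ∈ Icc (-1 : ℝ) (-1 + δ), ‖deriv h y‖ ≤ Q * 2 ^ α * B := by
    intro y hy
    rcases eq_or_lt_of_le hy.1 with rfl | hlt
    · have := ho (-1) (by norm_num)
      have hv1 := hv (-1) (by norm_num)
      have hb := hBle (-1) ⟨le_rfl, by linarith⟩
      rw [jacobiDiff] at this
      have e : (2 * (β + 1) : ℝ) * deriv h (-1) = v (-1) * h (-1) := by rw [← this]; ring
      have e2 := congrArg abs e
      rw [abs_mul (2 * (β + 1) : ℝ), abs_of_pos (by positivity : (0 : ℝ) < 2 * (β + 1)), abs_mul (v (-1))] at e2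
      have h3 : |v (-1)| * |h (-1)| ≤ Q * B := mul_le_mul hv1 hb (abs_nonneg _) (by linarith)
      have h4 : (1:ℝ) ≤ 2 * (β + 1) := by have := Nat.cast_nonneg (α := ℝ) β; linarith
      rw [Real.norm_eq_abs]
      have h5 := le_mul_of_one_le_left (abs_nonneg (deriv h (-1))) h4
      have h6 : Q * B ≤ Q * 2 ^ α * B := by
        rw [mul_assoc]; exact mul_le_mul_of_nonneg_left (le_mul_of_one_le_left hB0 h2a) (by linarith)
      linarith
    · set W := fun t => (jacobiWeight (α + 1) (β + 1)).eval t * deriv h t with hW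
      have hWd : ∀ t ∈ Icc (-1 : ℝ) y, ‖(jacobiWeight α β).eval t * jacobiDiff α β h t‖ ≤
          2 ^ α * (1 + y) ^ β * (Q * B) := by
        intro t ht
        have ht1 : t ∈ Icc (-1 : ℝ) (-1 + δ) := ⟨ht.1, ht.2.trans hy.2⟩
        rw [ho t (hsub ht1), norm_mul, norm_mul, Real.norm_eq_abs, Real.norm_eq_abs, Real.norm_eq_abs,
          abs_of_nonneg (jacobiWeight_nonneg α β (hsub ht1))]
        have h1 : (jacobiWeight α β).eval t ≤ 2 ^ α * (1 + y) ^ β := by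
          simp only [jacobiWeight, Polynomial.eval_mul, Polynomial.eval_pow, Polynomial.eval_sub,
            Polynomial.eval_add, Polynomial.eval_one, Polynomial.eval_X]
          have := ht.1; have := (hsub ht1).2
          have := ht.2
          gcongr
          · exact pow_nonneg (by linarith) _
          · linarith
          · linarith
        have := jacobiWeight_nonneg α β (hsub ht1)
        exact mul_le_mul h1 (mul_le_mul (hv t (hsub ht1)) (hBle t ht1) (abs_nonneg _) (by linarith))
          (by positivity) (by have := hy.1; exact mul_nonneg (by positivity) (pow_nonneg (by linarith) _))
      have hm := (convex_Icc (-1 : ℝ) y).norm_image_sub_le_of_norm_hasDerivWithin_le (f := W)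
        (fun t _ => (hasDerivAt_jacobiWeight_mul α β (hdiff2 t)).hasDerivWithinAt) hWd
        (left_mem_Icc.2 hy.1) (right_mem_Icc.2 hy.1)
      have hW1 : W (-1) = 0 := by rw [hW]; simp only [jacobiWeight_succ_eval_neg_one, zero_mul]
      rw [hW1, sub_zero, hW] at hm
      have hWge : (1 + y) ^ (β + 1) ≤ (jacobiWeight (α + 1) (β + 1)).eval y := by
        simp only [jacobiWeight, Polynomial.eval_mul, Polynomial.eval_pow, Polynomial.eval_sub,
          Polynomial.eval_add, Polynomial.eval_one, Polynomial.eval_X]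
        have := hy.2
        exact le_mul_of_one_le_left (pow_nonneg (by linarith) _) (one_le_pow₀ (by linarith))
      have hy1 : 0 < 1 + y := by linarith
      rw [norm_mul, Real.norm_eq_abs ((jacobiWeight (α + 1) (β + 1)).eval y),
        abs_of_nonneg (le_trans (by positivity) hWge), Real.norm_eq_abs (y - -1),
        abs_of_nonneg (by linarith)] at hm
      have h3 := (mul_le_mul_of_nonneg_right hWge (norm_nonneg (deriv h y))).trans hm
      have h4 : (1 + y) ^ (β + 1) * ‖deriv h y‖ ≤ (1 + y) ^ (β + 1) * (Q * 2 ^ α * B) := by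
        refine h3.trans (le_of_eq ?_); ring
      exact le_of_mul_le_mul_left h4 (by positivity)
  have hm : ∀ y ∈ Icc (-1 : ℝ) (-1 + δ), |h y - h (-1)| ≤ B / 4 := by
    intro y hy
    have := (convex_Icc (-1 : ℝ) (-1 + δ)).norm_image_sub_le_of_norm_hasDerivWithin_le (f := h)
        (fun t _ => (hdiff t).hasDerivAt.hasDerivWithinAt) hder
        (left_mem_Icc.2 (by linarith)) hy
    rw [Real.norm_eq_abs, Real.norm_eq_abs, abs_of_nonneg (by linarith [hy.1] : 0 ≤ y - -1)] at this
    refine this.trans ?_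
    calc Q * 2 ^ α * B * (y - -1) ≤ Q * 2 ^ α * B * δ := by
          refine mul_le_mul_of_nonneg_left (by linarith [hy.2]) (by positivity)
      _ = (δ * (Q * 2 ^ α)) * B := by ring
      _ = _ := by rw [hδQ]; ring
  -- The maximum is compared with the end point value, whence B/4 ≤ |h(-1)|/3.
  have hB1 : B ≤ |h (-1)| + B / 4 := by
    have h1 := hm y₀ hy₀
    have h2 := abs_sub_abs_le_abs_sub (h y₀) (h (-1))
    rw [← hB] at h2
    linarith
  have := hm x hx
  linarith

/-- A zero value at -1 makes the deviation estimate vanish, so h = 0 on an interval at -1;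
analyticity spreads this to the whole line. -/
theorem eq_zero_of_jacobiDiff {h v : ℝ → ℝ} (hh : AnalyticOnNhd ℝ h univ) (hv : Continuous v)
    (ho : ∀ x ∈ Icc (-1 : ℝ) 1, jacobiDiff α β h x = v x * h x) (h0 : h (-1) = 0) : h = 0 := by
  have hc : ContDiff ℝ 2 h := hh.contDiff
  obtain ⟨C, hC⟩ := (isCompact_Icc (a := (-1 : ℝ)) (b := 1)).exists_bound_of_continuousOn hv.continuousOn
  set Q := max 1 C with hQ
  have hQ1 : 1 ≤ Q := le_max_left _ _
  have key : ∀ x ∈ Icc (-1 : ℝ) (-1 + (4 * Q * 2 ^ α)⁻¹), h x = 0 := fun x hx => by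
    have := abs_sub_le_of_jacobiDiff hc hQ1 (fun x hx => (hC x hx).trans (le_max_right _ _)) ho hx
    rw [h0, sub_zero, abs_zero, zero_div] at this
    exact abs_nonpos_iff.1 this
  have hp : 0 < (4 * Q * 2 ^ α)⁻¹ := by positivity
  refine hh.eq_of_eventuallyEq (g := 0) (fun _ _ => analyticAt_const) (z₀ := -1 + (4 * Q * 2 ^ α)⁻¹ / 2) ?_
  filter_upwards [Icc_mem_nhds (by linarith : (-1 : ℝ) < -1 + (4 * Q * 2 ^ α)⁻¹ / 2)
    (by linarith : -1 + (4 * Q * 2 ^ α)⁻¹ / 2 < -1 + (4 * Q * 2 ^ α)⁻¹)] with x hx using key x hx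

/-- The regularity package for an eigenvector. -/
theorem eigenvector_regular {q : Polynomial ℝ} (hq : q.natDegree ≤ 2) {u : L2I} {τ : ℝ}
    (h : DiagRel (jacobiBasis α β) (jacobiEv α β) (mulOp q) u (τ • u)) :
    AnalyticOnNhd ℝ (jacobiSeries α β u) univ ∧
    (u =ᵐ[intervalMeasure] fun x => rootWeight α β x * jacobiSeries α β u x) ∧
    (∀ x ∈ Icc (-1 : ℝ) 1, jacobiDiff α β (jacobiSeries α β u) x =
      (τ - q.eval x) * jacobiSeries α β u x) ∧
    (∀ x ∈ Ioo (-1 : ℝ) 1, ⟪evalVec α β x, mulOp q u + u - τ • u⟫_ℝ =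
      rootWeight α β x * jacobiSeries α β u x) ∧
    (u ≠ 0 → jacobiSeries α β u (-1) ≠ 0) := by
  have hd := fun R (hR : 1 ≤ R) => exists_decay α β hq h hR
  have ha := analyticOnNhd_jacobiSeries hd
  have he := ae_eq_jacobiSeries hd
  have ho := jacobiDiff_of_diagRel ha.contDiff he h
  refine ⟨ha, he, ho, fun x hx => inner_evalVec_eq hd h hx, fun hu h0 => hu ?_⟩
  have := eq_zero_of_jacobiDiff ha (continuous_const.sub q.continuous) ho h0
  rw [Lp.eq_zero_iff_ae_eq_zero]
  filter_upwards [he] with x hx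
  rw [hx, this]; simp

theorem jacobiSeries_smul_sub {u v : L2I} (a b : ℝ)
    (hu : ∀ R : ℝ, 1 ≤ R → ∃ C : ℝ, ∀ n, |⟪jacobiVec α β n, u⟫_ℝ| * R ^ n ≤ C)
    (hv : ∀ R : ℝ, 1 ≤ R → ∃ C : ℝ, ∀ n, |⟪jacobiVec α β n, v⟫_ℝ| * R ^ n ≤ C) (x : ℝ) :
    jacobiSeries α β (a • u + b • v) x = a * jacobiSeries α β u x + b * jacobiSeries α β v x := by
  rw [jacobiSeries]
  refine HasSum.tsum_eq ?_
  refine (((hasSum_jacobiSeries hu x).mul_left a).add ((hasSum_jacobiSeries hv x).mul_left b)).congr_fun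
    fun n => ?_
  rw [inner_add_right, inner_smul_right, inner_smul_right]; ring

/-- Two eigenvectors for the same eigenvalue have a nontrivial combination whose series vanishes at
-1, and such an eigenvector is zero. -/
theorem simpleEigenvalues_mulOp {q : Polynomial ℝ} (hq : q.natDegree ≤ 2) :
    SimpleEigenvalues (jacobiBasis α β) (jacobiEv α β) (mulOp q) := by
  intro τ u v hu hv hne
  set a := jacobiSeries α β v (-1) with ha
  set b := jacobiSeries α β u (-1) with hb
  have hb0 : b ≠ 0 := (eigenvector_regular hq hu).2.2.2.2 hne
  have hw : DiagRel (jacobiBasis α β) (jacobiEv α β) (mulOp q) (a • u + (-b) • v)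
      (τ • (a • u + (-b) • v)) := by
    have := (hu.smul a).add (hv.smul (-b))
    rwa [smul_comm a τ, smul_comm (-b) τ, ← smul_add] at this
  have hz : a • u + (-b) • v = 0 := by
    by_contra hc
    refine (eigenvector_regular hq hw).2.2.2.2 hc ?_
    rw [jacobiSeries_smul_sub a (-b) (fun R hR => exists_decay α β hq hu hR)
      (fun R hR => exists_decay α β hq hv hR)]
    ring
  refine ⟨b⁻¹ * a, ?_⟩
  rw [neg_smul, ← sub_eq_add_neg, sub_eq_zero] at hz
  rw [mul_smul, hz, smul_smul, inv_mul_cancel₀ hb0, one_smul]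

end

/-! ### Eigenvalues and eigenvectors of the perturbed Jacobi operator -/

section
open scoped InnerProductSpace

/-- The potential `c₂ ω² x² + c₁ ω x`. -/
def potPoly (c₁ c₂ ω : ℝ) : Polynomial ℝ :=
  Polynomial.C (ω ^ 2) * (Polynomial.C c₂ * Polynomial.X ^ 2)
    + Polynomial.C ω * (Polynomial.C c₁ * Polynomial.X)

theorem natDegree_potPoly (c₁ c₂ ω : ℝ) : (potPoly c₁ c₂ ω).natDegree ≤ 2 := by
  unfold potPoly; compute_degree

theorem potPoly_eval (c₁ c₂ ω x : ℝ) :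
    (potPoly c₁ c₂ ω).eval x = ω ^ 2 * (c₂ * x ^ 2) + ω * (c₁ * x) := by
  simp [potPoly]

/-- The linear part of the potential. -/
abbrev linOp (c₁ : ℝ) : L2I →L[ℝ] L2I := mulOp (Polynomial.C c₁ * Polynomial.X)

/-- The quadratic part of the potential. -/
abbrev quadOp (c₂ : ℝ) : L2I →L[ℝ] L2I := mulOp (Polynomial.C c₂ * Polynomial.X ^ 2)

theorem pencil_eq (c₁ c₂ ω : ℝ) :
    pencil (linOp c₁) (quadOp c₂) ω = mulOp (potPoly c₁ c₂ ω) := by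
  rw [pencil, potPoly, mulOp_add, mulOp_C_mul (ω ^ 2), mulOp_C_mul ω]

theorem norm_linOp_le (c₁ : ℝ) : ‖linOp c₁‖ ≤ |c₁| := norm_mulOp_le fun x hx => by
  rw [Polynomial.eval_mul, Polynomial.eval_C, Polynomial.eval_X, abs_mul]
  exact mul_le_of_le_one_right (abs_nonneg _) (abs_le.2 hx)

theorem norm_quadOp_le (c₂ : ℝ) : ‖quadOp c₂‖ ≤ |c₂| := norm_mulOp_le fun x hx => by
  rw [Polynomial.eval_mul, Polynomial.eval_C, Polynomial.eval_pow, Polynomial.eval_X, abs_mul, abs_pow]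
  exact mul_le_of_le_one_right (abs_nonneg _) (pow_le_one₀ (abs_nonneg _) (abs_le.2 hx))

theorem norm_pencil_le (c₁ c₂ ω : ℝ) :
    ‖pencil (linOp c₁) (quadOp c₂) ω‖ ≤ ω ^ 2 * |c₂| + |ω| * |c₁| := by
  rw [pencil]
  refine (norm_add_le _ _).trans (add_le_add ?_ ?_)
  · rw [norm_smul, Real.norm_eq_abs, abs_of_nonneg (sq_nonneg ω)]
    exact mul_le_mul_of_nonneg_left (norm_quadOp_le c₂) (sq_nonneg _)
  · rw [norm_smul, Real.norm_eq_abs]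
    exact mul_le_mul_of_nonneg_left (norm_linOp_le c₁) (abs_nonneg _)

variable (α β : ℕ) (c₁ c₂ : ℝ)

/-- The spectral decomposition of the spheroidal operator. -/
def spheroidSys (ω : ℝ) :
    EigSys (jacobiBasis α β) (jacobiEv α β) (pencil (linOp c₁) (quadOp c₂) ω) :=
  (exists_eigSys (by rw [pencil_eq]; exact mulOp_symm _) (jacobiEv_nonneg α β)
    (jacobiEv_strictMono α β) (summable_inv_jacobiEv α β)
    (by rw [pencil_eq]; exact simpleEigenvalues_mulOp (natDegree_potPoly c₁ c₂ ω))).some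

/-- The `n`-th eigenvalue. -/
def spheroidEv (n : ℕ) (ω : ℝ) : ℝ := (spheroidSys α β c₁ c₂ ω).τ n

open Classical in
/-- The `n`-th normalised eigenvector, positive near `-1`. -/
def spheroidVec (n : ℕ) (ω : ℝ) : L2I :=
  if 0 < jacobiSeries α β ((spheroidSys α β c₁ c₂ ω).ψ n) (-1) then (spheroidSys α β c₁ c₂ ω).ψ n
  else - (spheroidSys α β c₁ c₂ ω).ψ n

theorem spheroidVec_eq_or (n : ℕ) (ω : ℝ) :
    spheroidVec α β c₁ c₂ n ω = (spheroidSys α β c₁ c₂ ω).ψ n ∨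
    spheroidVec α β c₁ c₂ n ω = - (spheroidSys α β c₁ c₂ ω).ψ n := by
  unfold spheroidVec; split_ifs <;> simp

theorem diagRel_spheroidVec (n : ℕ) (ω : ℝ) :
    DiagRel (jacobiBasis α β) (jacobiEv α β) (pencil (linOp c₁) (quadOp c₂) ω)
      (spheroidVec α β c₁ c₂ n ω) (spheroidEv α β c₁ c₂ n ω • spheroidVec α β c₁ c₂ n ω) := by
  have h := (spheroidSys α β c₁ c₂ ω).rel n
  rcases spheroidVec_eq_or α β c₁ c₂ n ω with e | e <;> rw [e]
  · exact h
  · have := h.smul (-1)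
    rwa [neg_one_smul, neg_one_smul, ← smul_neg] at this

theorem diagRel_spheroidVec' (n : ℕ) (ω : ℝ) :
    DiagRel (jacobiBasis α β) (jacobiEv α β) (mulOp (potPoly c₁ c₂ ω))
      (spheroidVec α β c₁ c₂ n ω) (spheroidEv α β c₁ c₂ n ω • spheroidVec α β c₁ c₂ n ω) := by
  rw [← pencil_eq]; exact diagRel_spheroidVec α β c₁ c₂ n ω

theorem orthonormal_spheroidVec (ω : ℝ) :
    Orthonormal ℝ fun n => spheroidVec α β c₁ c₂ n ω := by
  have ho := (spheroidSys α β c₁ c₂ ω).ψ.orthonormal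
  refine ⟨fun n => ?_, fun n k hnk => ?_⟩
  · change ‖spheroidVec α β c₁ c₂ n ω‖ = 1
    rcases spheroidVec_eq_or α β c₁ c₂ n ω with e | e <;> rw [e]
    · exact ho.1 n
    · rw [norm_neg]; exact ho.1 n
  · have := ho.2 hnk
    change ⟪spheroidVec α β c₁ c₂ n ω, spheroidVec α β c₁ c₂ k ω⟫_ℝ = 0
    rcases spheroidVec_eq_or α β c₁ c₂ n ω with e | e <;>
      rcases spheroidVec_eq_or α β c₁ c₂ k ω with e' | e' <;> rw [e, e'] <;>
      simp [this]

/-- The eigenvectors as a Hilbert basis. -/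
def spheroidBasis (ω : ℝ) : HilbertBasis ℕ ℝ L2I :=
  HilbertBasis.mkOfOrthogonalEqBot (orthonormal_spheroidVec α β c₁ c₂ ω) (by
    rw [Submodule.eq_bot_iff]
    intro u hu
    refine hilbertBasis_ext (spheroidSys α β c₁ c₂ ω).ψ fun n => ?_
    have := (Submodule.mem_orthogonal _ u).1 hu _ (Submodule.subset_span ⟨n, rfl⟩)
    rw [inner_zero_right]
    change ⟪spheroidVec α β c₁ c₂ n ω, u⟫_ℝ = 0 at this
    rcases spheroidVec_eq_or α β c₁ c₂ n ω with e | e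
    · rwa [e] at this
    · rwa [e, inner_neg_left, neg_eq_zero] at this)

theorem coe_spheroidBasis (ω : ℝ) :
    ⇑(spheroidBasis α β c₁ c₂ ω) = fun n => spheroidVec α β c₁ c₂ n ω :=
  HilbertBasis.coe_mkOfOrthogonalEqBot _ _

theorem jacobiSeries_neg (u : L2I) (x : ℝ) : jacobiSeries α β (-u) x = - jacobiSeries α β u x := by
  simp only [jacobiSeries, inner_neg_right, neg_mul, tsum_neg]

theorem jacobiSeries_spheroidVec_pos (n : ℕ) (ω : ℝ) :
    0 < jacobiSeries α β (spheroidVec α β c₁ c₂ n ω) (-1) := by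
  have h : DiagRel (jacobiBasis α β) (jacobiEv α β) (mulOp (potPoly c₁ c₂ ω))
      ((spheroidSys α β c₁ c₂ ω).ψ n)
      ((spheroidSys α β c₁ c₂ ω).τ n • (spheroidSys α β c₁ c₂ ω).ψ n) := fun k => by
    rw [← pencil_eq]; exact (spheroidSys α β c₁ c₂ ω).rel n k
  have hne := (eigenvector_regular (natDegree_potPoly c₁ c₂ ω) h).2.2.2.2
    ((spheroidSys α β c₁ c₂ ω).ψ.orthonormal.ne_zero n)
  unfold spheroidVec
  split_ifs with hc
  · exact hc
  · rw [jacobiSeries_neg]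
    have := lt_of_le_of_ne (not_lt.1 hc) hne
    linarith

/-- The eigenvectors are chosen separately for each ω, so a sign condition uniform near ω₀ is
needed. Weyl's inequality bounds the eigenvalue, and with it the potential, by one `Q` for all ω
near ω₀; the deviation estimate then gives positivity at a single point x₀ close to -1, and
`evalVec` at x₀ detects it. -/
theorem exists_pos_evalVec (n : ℕ) (ω₀ : ℝ) : ∃ g : L2I, ∀ᶠ ω in 𝓝 ω₀,
    0 < ⟪g, pencil (linOp c₁) (quadOp c₂) ω (spheroidVec α β c₁ c₂ n ω) + spheroidVec α β c₁ c₂ n ω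
      - spheroidEv α β c₁ c₂ n ω • spheroidVec α β c₁ c₂ n ω⟫_ℝ := by
  set r := |ω₀| + 1 with hr
  set Q := 1 + |spheroidEv α β c₁ c₂ n ω₀| + 1 + (r ^ 2 * |c₂| + r * |c₁|) with hQ
  have hr0 : 0 ≤ r := by positivity
  have hQ1 : 1 ≤ Q := by
    have : 0 ≤ |spheroidEv α β c₁ c₂ n ω₀| + 1 + (r ^ 2 * |c₂| + r * |c₁|) := by positivity
    rw [hQ]; linarith
  have hp : 0 < (4 * Q * 2 ^ α)⁻¹ := by positivity
  set x₀ := -1 + (4 * Q * 2 ^ α)⁻¹ with hx₀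
  have hx1 : (4 * Q * 2 ^ α)⁻¹ < 1 := by
    refine inv_lt_one_of_one_lt₀ ?_
    have : (1:ℝ) ≤ 2 ^ α := one_le_pow₀ (by norm_num)
    nlinarith
  have hx₀' : x₀ ∈ Ioo (-1 : ℝ) 1 := ⟨by linarith, by linarith⟩
  refine ⟨evalVec α β x₀, ?_⟩
  have hcont : Tendsto (fun ω => ‖pencil (linOp c₁) (quadOp c₂) ω - pencil (linOp c₁) (quadOp c₂) ω₀‖)
      (𝓝 ω₀) (𝓝 0) := by
    have := ((continuous_pencil (A₁ := linOp c₁) (A₂ := quadOp c₂)).tendsto ω₀).sub_const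
      (pencil (linOp c₁) (quadOp c₂) ω₀)
    simpa using this.norm
  filter_upwards [hcont.eventually (gt_mem_nhds one_pos), Metric.ball_mem_nhds ω₀ one_pos] with ω h1 h2
  have hev : |spheroidEv α β c₁ c₂ n ω - spheroidEv α β c₁ c₂ n ω₀| ≤ 1 :=
    (EigSys.abs_sub_le (by rw [pencil_eq]; exact mulOp_symm _) (by rw [pencil_eq]; exact mulOp_symm _)
      (spheroidSys α β c₁ c₂ ω) (spheroidSys α β c₁ c₂ ω₀) n).trans h1.le
  have hω : |ω| ≤ r := by
    have := abs_sub_abs_le_abs_sub ω ω₀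
    rw [Metric.mem_ball, Real.dist_eq] at h2
    linarith
  obtain ⟨ha, -, ho, he, -⟩ := eigenvector_regular (natDegree_potPoly c₁ c₂ ω)
    (diagRel_spheroidVec' α β c₁ c₂ n ω)
  have hv : ∀ x ∈ Icc (-1 : ℝ) 1, |spheroidEv α β c₁ c₂ n ω - (potPoly c₁ c₂ ω).eval x| ≤ Q := by
    intro x hx
    have h3 : |(potPoly c₁ c₂ ω).eval x| ≤ r ^ 2 * |c₂| + r * |c₁| := by
      have hx' : |x| ≤ 1 := abs_le.2 hx
      rw [potPoly_eval]
      refine (abs_add_le _ _).trans (add_le_add ?_ ?_)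
      · rw [abs_mul, abs_mul, abs_pow, abs_pow]
        gcongr
        exact mul_le_of_le_one_right (abs_nonneg _) (pow_le_one₀ (abs_nonneg _) hx')
      · rw [abs_mul, abs_mul]
        gcongr
        exact mul_le_of_le_one_right (abs_nonneg _) hx'
    have h4 := abs_sub_abs_le_abs_sub (spheroidEv α β c₁ c₂ n ω) (spheroidEv α β c₁ c₂ n ω₀)
    have h5 := abs_sub (spheroidEv α β c₁ c₂ n ω) ((potPoly c₁ c₂ ω).eval x)
    linarith
  rw [pencil_eq, he x₀ hx₀']
  refine mul_pos (rootWeight_pos α β hx₀') ?_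
  have h6 := abs_sub_le_of_jacobiDiff (x := x₀) ha.contDiff hQ1 hv ho ⟨hx₀'.1.le, le_rfl⟩
  have h7 := jacobiSeries_spheroidVec_pos α β c₁ c₂ n ω
  rw [abs_of_pos h7] at h6
  have := (abs_le.1 h6).1
  linarith

theorem contDiff_spheroid (n : ℕ) : ContDiff ℝ (⊤ : ℕ∞) (spheroidVec α β c₁ c₂ n) ∧
    ContDiff ℝ (⊤ : ℕ∞) (spheroidEv α β c₁ c₂ n) :=
  contDiff_eigenpair (mulOp_symm _) (mulOp_symm _) (jacobiEv_nonneg α β) (summable_inv_jacobiEv α β)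
    (fun ω => by rw [pencil_eq]; exact simpleEigenvalues_mulOp (natDegree_potPoly c₁ c₂ ω))
    (spheroidSys α β c₁ c₂) n (fun ω => (orthonormal_spheroidVec α β c₁ c₂ ω).1 n)
    (diagRel_spheroidVec α β c₁ c₂ n) (exists_pos_evalVec α β c₁ c₂ n)

/-- The preimage of the eigenvector under the resolvent of the Jacobi operator. -/
def spheroidPre (n : ℕ) (ω : ℝ) : L2I :=
  pencil (linOp c₁) (quadOp c₂) ω (spheroidVec α β c₁ c₂ n ω) + spheroidVec α β c₁ c₂ n ω
      - spheroidEv α β c₁ c₂ n ω • spheroidVec α β c₁ c₂ n ω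

theorem contDiff_spheroidPre (n : ℕ) : ContDiff ℝ (⊤ : ℕ∞) (spheroidPre α β c₁ c₂ n) := by
  have h1 := (contDiff_spheroid α β c₁ c₂ n).1
  have h2 := (contDiff_spheroid α β c₁ c₂ n).2
  have h3 : ContDiff ℝ (⊤ : ℕ∞) fun ω => pencil (linOp c₁) (quadOp c₂) ω := by
    unfold pencil; fun_prop
  exact ((h3.clm_apply h1).add h1).sub (h2.smul h1)

theorem jacobiRes_spheroidPre (n : ℕ) (ω : ℝ) :
    jacobiRes α β (spheroidPre α β c₁ c₂ n ω) = spheroidVec α β c₁ c₂ n ω :=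
  (diagRel_iff_jacobiRes.1 (diagRel_spheroidVec α β c₁ c₂ n ω)).symm

/-- The eigenfunction, defined pointwise. -/
def spheroidFun (n : ℕ) (ω x : ℝ) : ℝ := ⟪evalVec α β x, spheroidPre α β c₁ c₂ n ω⟫_ℝ

theorem spheroidFun_eq (n : ℕ) (ω : ℝ) {x : ℝ} (hx : x ∈ Ioo (-1 : ℝ) 1) :
    spheroidFun α β c₁ c₂ n ω x =
      rootWeight α β x * jacobiSeries α β (spheroidVec α β c₁ c₂ n ω) x := by
  rw [spheroidFun, spheroidPre, pencil_eq]
  exact (eigenvector_regular (natDegree_potPoly c₁ c₂ ω)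
    (diagRel_spheroidVec' α β c₁ c₂ n ω)).2.2.2.1 x hx

theorem contDiff_spheroidFun (n : ℕ) (x : ℝ) :
    ContDiff ℝ (⊤ : ℕ∞) fun ω => spheroidFun α β c₁ c₂ n ω x :=
  contDiff_const.inner ℝ (contDiff_spheroidPre α β c₁ c₂ n)

/-- The L² derivative and the pointwise derivative agree because the resolvent and the evaluation
functionals are bounded linear maps applied to the same smooth curve `spheroidPre`, and they commute
with differentiation. -/
theorem iteratedDeriv_spheroidFun_ae (n k : ℕ) (ω : ℝ) :
    ((iteratedDeriv k (spheroidVec α β c₁ c₂ n) ω : L2I) : ℝ → ℝ) =ᵐ[intervalMeasure]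
      fun x => iteratedDeriv k (fun w => spheroidFun α β c₁ c₂ n w x) ω := by
  have h1 : iteratedDeriv k (spheroidVec α β c₁ c₂ n) ω =
      jacobiRes α β (iteratedDeriv k (spheroidPre α β c₁ c₂ n) ω) := by
    rw [← iteratedDeriv_clm_apply (jacobiRes α β) (contDiff_spheroidPre α β c₁ c₂ n) k ω]
    congr 1; ext1 w
    exact (jacobiRes_spheroidPre α β c₁ c₂ n w).symm
  rw [h1]
  refine (jacobiRes_ae_eq α β _).trans (Eventually.of_forall fun x => ?_)
  exact (iteratedDeriv_clm_apply (innerSL ℝ (evalVec α β x)) (contDiff_spheroidPre α β c₁ c₂ n) k ω).symm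

/-- Uniform bounds on the derivatives of the eigenvectors. -/
theorem exists_bound_spheroidVec (k : ℕ) (hk : 1 ≤ k) : ∃ c : ℝ, 1 ≤ c ∧
    ∀ (α β N : ℕ), α + β = 2 * N → 2 ≤ N → ∀ (n : ℕ) (ω : ℝ), |ω| ≤ (1 + |c₁| + |c₂|)⁻¹ →
      ‖iteratedDeriv k (spheroidVec α β c₁ c₂ n) ω‖ ≤ c / ((n : ℝ) + N) := by
  obtain ⟨c, hc, h⟩ := exists_bound_iteratedDeriv (H := L2I) (|c₁| + |c₂|) k
  refine ⟨c, hc, fun α β N hN hN2 n ω hω => ?_⟩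
  have hc1 := abs_nonneg c₁
  have hc2 := abs_nonneg c₂
  have hN2' : (2:ℝ) ≤ N := by exact_mod_cast hN2
  have hn0 : (0:ℝ) ≤ n := Nat.cast_nonneg n
  have hD : 1 ≤ 1 + |c₁| + |c₂| := by linarith
  have hω1 : |ω| ≤ 1 := hω.trans (inv_le_one_of_one_le₀ hD)
  have hωc : |ω| * (1 + |c₁| + |c₂|) ≤ 1 := by
    rwa [← le_div_iff₀ (by positivity), one_div]
  -- The range of ω is chosen so that the perturbation has norm at most one, whatever α, β and n
  -- are.
  have hM : ‖pencil (linOp c₁) (quadOp c₂) ω‖ ≤ 1 := by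
    refine (norm_pencil_le c₁ c₂ ω).trans ?_
    have := abs_nonneg ω
    rw [← sq_abs]
    nlinarith
  refine (h (jacobiBasis α β) (jacobiEv α β) (linOp c₁) (quadOp c₂)
    ((norm_linOp_le c₁).trans (by linarith)) ((norm_quadOp_le c₂).trans (by linarith))
    (mulOp_symm _) (mulOp_symm _) _ _ (contDiff_spheroid α β c₁ c₂ n).1
    (contDiff_spheroid α β c₁ c₂ n).2 (fun ω => (orthonormal_spheroidVec α β c₁ c₂ ω).1 n)
    (diagRel_spheroidVec α β c₁ c₂ n) ω (n + N) (spheroidSys α β c₁ c₂ ω) n hω1 (by linarith) rfl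
    ?_ k hk le_rfl).2
  intro j hj
  have hsym : ∀ u v, ⟪pencil (linOp c₁) (quadOp c₂) ω u, v⟫_ℝ = ⟪u, pencil (linOp c₁) (quadOp c₂) ω v⟫_ℝ := by
    rw [pencil_eq]; exact mulOp_symm _
  have hw := fun i => EigSys.abs_sub_le hsym (by simp) (spheroidSys α β c₁ c₂ ω)
    (EigSys.diag (jacobiBasis α β) (jacobiEv_strictMono α β)) i
  rw [sub_zero] at hw
  have hj1 := abs_le.1 ((hw j).trans hM)
  have hn1 := abs_le.1 ((hw n).trans hM)
  change -1 ≤ _ - (- jacobiEv α β j) ∧ _ - (- jacobiEv α β j) ≤ 1 at hj1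
  change -1 ≤ _ - (- jacobiEv α β n) ∧ _ - (- jacobiEv α β n) ≤ 1 at hn1
  have hNr : (α : ℝ) + β = 2 * N := by exact_mod_cast hN
  -- Consecutive unperturbed eigenvalues differ by 2(i + 1 + N). Each moves by at most 1, so a gap
  -- of at least 2(n + N) - 2 ≥ n + N remains around the n-th one; here N ≥ 2 is used.
  have hgap : ∀ i, jacobiEv α β (i + 1) - jacobiEv α β i = 2 * ((i : ℝ) + 1 + N) := fun i => by
    unfold jacobiEv; push_cast; linear_combination hNr
  rcases lt_or_gt_of_ne hj with hlt | hgt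
  · obtain ⟨p, rfl⟩ := Nat.exists_eq_add_of_lt hlt
    have h1 := hgap (j + p)
    have h2 := (jacobiEv_strictMono α β).monotone (Nat.le_add_right j p)
    refine le_trans ?_ (le_abs_self _)
    push_cast at h1 ⊢
    linarith [hj1.1, hn1.2, Nat.cast_nonneg (α := ℝ) j, Nat.cast_nonneg (α := ℝ) p]
  · have h1 := hgap n
    have h2 := (jacobiEv_strictMono α β).monotone (Nat.succ_le_of_lt hgt)
    rw [Nat.succ_eq_add_one] at h2
    refine le_trans ?_ (neg_le_abs _)
    linarith [hj1.2, hn1.1]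

end

/-! ### Construction of smooth spin-weighted functions -/

section

/-- The cross product `p × u`. -/
def crossE (p : E3) : E3 →ₗ[ℝ] E3 where
  toFun u := !₂[p 1 * u 2 - p 2 * u 1, p 2 * u 0 - p 0 * u 2, p 0 * u 1 - p 1 * u 0]
  map_add' u v := by ext i; fin_cases i <;> simp <;> ring
  map_smul' c u := by ext i; fin_cases i <;> simp <;> ring

theorem crossE_frameθ (θ φ : ℝ) : crossE (spherePt θ φ) (frameθ θ φ) = frameφ φ := by
  have h1 := Real.sin_sq_add_cos_sq θ
  ext i; fin_cases i <;> simp [crossE, spherePt, frameθ, frameφ]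
  · linear_combination (-Real.sin φ) * h1
  · linear_combination (Real.cos φ) * h1
  · ring

theorem crossE_frameφ (θ φ : ℝ) : crossE (spherePt θ φ) (frameφ φ) = - frameθ θ φ := by
  have h1 := Real.sin_sq_add_cos_sq φ
  ext i; fin_cases i <;> simp [crossE, spherePt, frameθ, frameφ]
  linear_combination (Real.sin θ) * h1

/-- The symmetrised product of two complex one-forms. -/
def symProd (κ κ' : E3 →ₗ[ℝ] ℂ) (u v : E3) : ℂ := κ u * κ' v + κ' u * κ v

/-- A real bilinear form with the same `(2, 0)` component as `G` times the product of two complex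
one-forms. -/
def spinForm (κ κ' : E3 →ₗ[ℝ] ℂ) (G : ℂ) (p : E3) : E3 →ₗ[ℝ] E3 →ₗ[ℝ] ℝ :=
  LinearMap.mk₂ ℝ (fun u v => (G * symProd κ κ' u v).re
      - 1 / 2 * (G * (symProd κ κ' (crossE p u) v + symProd κ κ' u (crossE p v))).im)
    (fun u u' v => by
      simp only [symProd, map_add, add_mul, mul_add, Complex.add_re, Complex.add_im]; ring)
    (fun c u v => by
      simp only [symProd, map_smul, Complex.real_smul, smul_eq_mul]
      have e1 : G * (c * κ u * κ' v + c * κ' u * κ v) = c * (G * (κ u * κ' v + κ' u * κ v)) := by ring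
      have e2 : G * (c * κ (crossE p u) * κ' v + c * κ' (crossE p u) * κ v +
          (c * κ u * κ' (crossE p v) + c * κ' u * κ (crossE p v))) =
        c * (G * (κ (crossE p u) * κ' v + κ' (crossE p u) * κ v +
          (κ u * κ' (crossE p v) + κ' u * κ (crossE p v)))) := by ring
      rw [e1, e2, Complex.re_ofReal_mul, Complex.im_ofReal_mul]; ring)
    (fun u v v' => by
      simp only [symProd, map_add, mul_add, Complex.add_re, Complex.add_im]; ring)
    (fun c u v => by
      simp only [symProd, map_smul, Complex.real_smul, smul_eq_mul]
      have e1 : G * (κ u * (c * κ' v) + κ' u * (c * κ v)) = c * (G * (κ u * κ' v + κ' u * κ v)) := by ring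
      have e2 : G * (κ (crossE p u) * (c * κ' v) + κ' (crossE p u) * (c * κ v) +
          (κ u * (c * κ' (crossE p v)) + κ' u * (c * κ (crossE p v)))) =
        c * (G * (κ (crossE p u) * κ' v + κ' (crossE p u) * κ v +
          (κ u * κ' (crossE p v) + κ' u * κ (crossE p v)))) := by ring
      rw [e1, e2, Complex.re_ofReal_mul, Complex.im_ofReal_mul]; ring)

theorem spinForm_apply (κ κ' : E3 →ₗ[ℝ] ℂ) (G : ℂ) (p u v : E3) : spinForm κ κ' G p u v =
    (G * symProd κ κ' u v).re
      - 1 / 2 * (G * (symProd κ κ' (crossE p u) v + symProd κ κ' u (crossE p v))).im := rfl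

/-- The tensor must be real while `f` is complex. On the tangent plane p × · is the rotation by a
right angle, and averaging the imaginary part over the two rotated slots gives a real form with the
same value on (𝐦, 𝐦). The factor 1/2 from the normalisation of 𝐦 cancels the two equal terms of
`symProd`. -/
theorem isSmoothSpinWeighted_of_forms (κ κ' : E3 →ₗ[ℝ] ℂ) {G : E3 → ℂ}
    (hG : ContDiff ℝ (⊤ : ℕ∞) G) {f : ℝ → ℝ → ℂ}
    (hf : ∀ θ ∈ Ioo 0 Real.pi, ∀ φ : ℝ, f θ φ = G (spherePt θ φ) *
      (κ (frameθ θ φ) + Complex.I * κ (frameφ φ)) * (κ' (frameθ θ φ) + Complex.I * κ' (frameφ φ))) :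
    IsSmoothSpinWeighted 2 f := by
  refine ⟨fun p => (spinForm κ κ' (G p) p).toContinuousBilinearMap, ?_, ?_, ?_⟩
  · rw [contDiff_clm_apply_iff]
    intro u
    rw [contDiff_clm_apply_iff]
    intro v
    have e : (fun p => (spinForm κ κ' (G p) p).toContinuousBilinearMap u v) = fun p =>
        Complex.reCLM (G p * symProd κ κ' u v)
        - 1 / 2 * Complex.imCLM (G p * (symProd κ κ' (crossE p u) v + symProd κ κ' u (crossE p v))) := by
      ext p; exact spinForm_apply κ κ' (G p) p u v
    have hc : ∀ w, ContDiff ℝ (⊤ : ℕ∞) fun p => crossE p w := by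
      intro w
      rw [contDiff_euclidean]
      intro i
      fin_cases i <;> simp [crossE] <;> fun_prop
    have hκ : ∀ (κ : E3 →ₗ[ℝ] ℂ) w, ContDiff ℝ (⊤ : ℕ∞) fun p => κ (crossE p w) := fun κ w =>
      (LinearMap.toContinuousLinearMap κ).contDiff.comp (hc w)
    rw [e]
    have h1 := hκ κ u
    have h2 := hκ κ' u
    have h3 := hκ κ v
    have h4 := hκ κ' v
    unfold symProd
    exact ContDiff.sub (Complex.reCLM.contDiff.comp (hG.mul contDiff_const))
      (contDiff_const.mul (Complex.imCLM.contDiff.comp (hG.mul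
        (((h1.mul contDiff_const).add (h2.mul contDiff_const)).add
          ((contDiff_const.mul h4).add (contDiff_const.mul h3))))))
  · intro p u v
    change spinForm κ κ' (G p) p u v = spinForm κ κ' (G p) p v u
    rw [spinForm_apply, spinForm_apply]
    have e1 : symProd κ κ' u v = symProd κ κ' v u := by simp only [symProd]; ring
    have e2 : symProd κ κ' (crossE p u) v + symProd κ κ' u (crossE p v) =
      symProd κ κ' (crossE p v) u + symProd κ κ' v (crossE p u) := by simp only [symProd]; ring
    rw [e1, e2]
  · intro θ hθ φ
    rw [hf θ hθ φ]
    change _ = (1 / 2 : ℂ) * (((spinForm κ κ' (G (spherePt θ φ)) (spherePt θ φ) (frameθ θ φ) (frameθ θ φ) : ℝ) : ℂ)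
      - ((spinForm κ κ' (G (spherePt θ φ)) (spherePt θ φ) (frameφ φ) (frameφ φ) : ℝ) : ℂ))
      + (((2 : ℤ).sign : ℤ) : ℂ) * Complex.I *
        ((spinForm κ κ' (G (spherePt θ φ)) (spherePt θ φ) (frameθ θ φ) (frameφ φ) : ℝ) : ℂ)
    simp only [spinForm_apply, crossE_frameθ, crossE_frameφ, symProd, map_neg]
    generalize G (spherePt θ φ) = g
    generalize κ (frameθ θ φ) = k
    generalize κ (frameφ φ) = l
    generalize κ' (frameθ θ φ) = k'
    generalize κ' (frameφ φ) = l'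
    have : (((2 : ℤ).sign : ℤ) : ℂ) = 1 := by norm_num
    rw [this]
    apply Complex.ext <;> simp <;> ring

theorem isSmoothSpinWeighted_conj {f : ℝ → ℝ → ℂ} (hf : IsSmoothSpinWeighted 2 f) :
    IsSmoothSpinWeighted (-2) fun θ φ => starRingEnd ℂ (f θ φ) := by
  obtain ⟨α, h1, h2, h3⟩ := hf
  refine ⟨α, h1, h2, fun θ hθ φ => ?_⟩
  have e1 : (((2 : ℤ).sign : ℤ) : ℂ) = 1 := by norm_num
  have e2 : (((-2 : ℤ).sign : ℤ) : ℂ) = -1 := by norm_num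
  change starRingEnd ℂ (f θ φ) = _
  rw [h3 θ hθ φ, e1, e2]
  simp [map_ofNat]

/-- The one-form `dx + i dy`. -/
def formZeta : E3 →ₗ[ℝ] ℂ where
  toFun u := u 0 + Complex.I * u 1
  map_add' u v := by simp; ring
  map_smul' c u := by simp; ring

/-- The one-form `dx - i dy`. -/
def formZetaBar : E3 →ₗ[ℝ] ℂ where
  toFun u := u 0 - Complex.I * u 1
  map_add' u v := by simp; ring
  map_smul' c u := by simp; ring

/-- The one-form `dz`. -/
def formZ : E3 →ₗ[ℝ] ℂ where
  toFun u := u 2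
  map_add' u v := by simp
  map_smul' c u := by simp

theorem exp_I_mul (φ : ℝ) : Complex.exp (Complex.I * φ) = Real.cos φ + Complex.I * Real.sin φ := by
  rw [mul_comm, Complex.exp_mul_I, Complex.ofReal_cos, Complex.ofReal_sin]; ring

theorem exp_neg_I_mul (φ : ℝ) :
    Complex.exp (-(Complex.I * φ)) = Real.cos φ - Complex.I * Real.sin φ := by
  have := exp_I_mul (-φ)
  rw [Real.cos_neg, Real.sin_neg] at this
  push_cast at this ⊢
  rw [← mul_neg, this]; ring

theorem formZeta_frame (θ φ : ℝ) : formZeta (frameθ θ φ) + Complex.I * formZeta (frameφ φ) =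
    (Real.cos θ - 1) * Complex.exp (Complex.I * φ) := by
  rw [exp_I_mul]
  simp [formZeta, frameθ, frameφ]
  linear_combination (Complex.cos φ) * Complex.I_sq

theorem formZetaBar_frame (θ φ : ℝ) : formZetaBar (frameθ θ φ) + Complex.I * formZetaBar (frameφ φ) =
    (Real.cos θ + 1) * Complex.exp (-(Complex.I * φ)) := by
  rw [exp_neg_I_mul]
  simp [formZetaBar, frameθ, frameφ]
  linear_combination (-Complex.cos φ) * Complex.I_sq

theorem formZ_frame (θ φ : ℝ) : formZ (frameθ θ φ) + Complex.I * formZ (frameφ φ) =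
    - Real.sin θ := by
  simp [formZ, frameθ, frameφ]

theorem formZeta_spherePt (θ φ : ℝ) : formZeta (spherePt θ φ) =
    Real.sin θ * Complex.exp (Complex.I * φ) := by
  rw [exp_I_mul]
  simp [formZeta, spherePt]; ring

theorem formZetaBar_spherePt (θ φ : ℝ) : formZetaBar (spherePt θ φ) =
    Real.sin θ * Complex.exp (-(Complex.I * φ)) := by
  rw [exp_neg_I_mul]
  simp [formZetaBar, spherePt]; ring

theorem rootWeight_cos {α β : ℕ} {θ t : ℝ} (ht : 0 ≤ t)
    (h : (1 - Real.cos θ) ^ α * (1 + Real.cos θ) ^ β = t ^ 2) : rootWeight α β (Real.cos θ) = t := by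
  rw [rootWeight, jacobiWeight]
  simp only [Polynomial.eval_mul, Polynomial.eval_pow, Polynomial.eval_sub, Polynomial.eval_add,
    Polynomial.eval_one, Polynomial.eval_X]
  rw [h, Real.sqrt_sq ht]

theorem contDiff_zonal {h : ℝ → ℝ} (hh : ContDiff ℝ (⊤ : ℕ∞) h) (κ : E3 →ₗ[ℝ] ℂ) (k : ℕ) (c : ℂ) :
    ContDiff ℝ (⊤ : ℕ∞) fun p : E3 => c * (h (p 2) : ℂ) * κ p ^ k := by
  have h1 : ContDiff ℝ (⊤ : ℕ∞) fun p : E3 => κ p := (LinearMap.toContinuousLinearMap κ).contDiff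
  have h2 : ContDiff ℝ (⊤ : ℕ∞) fun p : E3 => h (p 2) := hh.comp (by fun_prop)
  have h3 : ContDiff ℝ (⊤ : ℕ∞) fun p : E3 => (h (p 2) : ℂ) := Complex.ofRealCLM.contDiff.comp h2
  fun_prop

/-- On E₁ + iE₂ the forms dx + i dy, dx - i dy and dz take the values (cos θ - 1)e^{iφ}, (cos θ +
1)e^{-iφ} and -sin θ. Products of two of them, times a power of x ± iy when |m| > 2, give exactly
the root weight times e^{imφ}; the cases are m ≤ -2, m = -1, 0, 1 and m ≥ 2. -/
theorem isSmoothSpinWeighted_two (m : ℤ) {h S : ℝ → ℝ} (hh : ContDiff ℝ (⊤ : ℕ∞) h)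
    (hS : ∀ x ∈ Ioo (-1 : ℝ) 1, S x = rootWeight (m + 2).natAbs (m - 2).natAbs x * h x) :
    IsSmoothSpinWeighted 2
      (fun θ φ => (S (Real.cos θ) : ℂ) * Complex.exp (Complex.I * (m : ℂ) * (φ : ℂ))) := by
  have hcos : ∀ θ ∈ Ioo 0 Real.pi, Real.cos θ ∈ Ioo (-1 : ℝ) 1 ∧ 0 < Real.sin θ := fun θ hθ => by
    have h1 := Real.sin_pos_of_mem_Ioo hθ
    have h2 := Real.sin_sq_add_cos_sq θ
    exact ⟨⟨by nlinarith, by nlinarith⟩, h1⟩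
  have hs2 : ∀ θ, Real.sin θ ^ 2 = (1 - Real.cos θ) * (1 + Real.cos θ) := fun θ => by
    have h2 := Real.sin_sq_add_cos_sq θ
    linear_combination h2
  have hz : ∀ θ φ, spherePt θ φ 2 = Real.cos θ := fun θ φ => by simp [spherePt]
  rcases lt_trichotomy m 0 with hm | rfl | hm
  · obtain ⟨k, hk⟩ : ∃ k : ℕ, m = -(k + 1 : ℕ) := ⟨m.natAbs - 1, by omega⟩
    have hexp : ∀ φ : ℝ, Complex.exp (Complex.I * (m : ℂ) * φ) =
        Complex.exp (-(Complex.I * φ)) ^ (k + 1) := fun φ => by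
      rw [← Complex.exp_nat_mul, hk]; congr 1; push_cast; ring
    rcases k with _ | k
    · refine isSmoothSpinWeighted_of_forms formZetaBar formZ (contDiff_zonal hh formZ 0 (-1))
        fun θ hθ φ => ?_
      obtain ⟨h1, h2⟩ := hcos θ hθ
      subst hk
      have e : rootWeight (-((0 + 1 : ℕ) : ℤ) + 2).natAbs (-((0 + 1 : ℕ) : ℤ) - 2).natAbs (Real.cos θ) =
          Real.sin θ * (1 + Real.cos θ) := by
        refine rootWeight_cos (mul_nonneg h2.le (by linarith [h1.1])) ?_
        norm_num
        rw [mul_pow, hs2]; ring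
      rw [hS _ h1, e, hexp, formZetaBar_frame, formZ_frame, hz]
      push_cast; ring
    · refine isSmoothSpinWeighted_of_forms formZetaBar formZetaBar (contDiff_zonal hh formZetaBar k 1)
        fun θ hθ φ => ?_
      obtain ⟨h1, h2⟩ := hcos θ hθ
      have e : rootWeight (m + 2).natAbs (m - 2).natAbs (Real.cos θ) =
          Real.sin θ ^ k * (1 + Real.cos θ) ^ 2 := by
        refine rootWeight_cos (mul_nonneg (pow_nonneg h2.le _) (sq_nonneg _)) ?_
        have a1 : (m + 2).natAbs = k := by omega
        have a2 : (m - 2).natAbs = k + 4 := by omega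
        rw [a1, a2, mul_pow, ← pow_mul, mul_comm k 2, pow_mul, hs2, mul_pow]; ring
      rw [hS _ h1, e, hexp, formZetaBar_frame, formZetaBar_spherePt, hz]
      push_cast; ring
  · refine isSmoothSpinWeighted_of_forms formZ formZ (contDiff_zonal hh formZ 0 1)
        fun θ hθ φ => ?_
    obtain ⟨h1, h2⟩ := hcos θ hθ
    have e : rootWeight (0 + 2 : ℤ).natAbs (0 - 2 : ℤ).natAbs (Real.cos θ) = Real.sin θ ^ 2 := by
      refine rootWeight_cos (sq_nonneg _) ?_
      norm_num
      rw [hs2]; ring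
    rw [hS _ h1, e, formZ_frame, hz]
    simp; ring
  · obtain ⟨k, hk⟩ : ∃ k : ℕ, m = (k + 1 : ℕ) := ⟨m.natAbs - 1, by omega⟩
    have hexp : ∀ φ : ℝ, Complex.exp (Complex.I * (m : ℂ) * φ) =
        Complex.exp (Complex.I * φ) ^ (k + 1) := fun φ => by
      rw [← Complex.exp_nat_mul, hk]; congr 1; push_cast; ring
    rcases k with _ | k
    · refine isSmoothSpinWeighted_of_forms formZeta formZ (contDiff_zonal hh formZ 0 1)
        fun θ hθ φ => ?_
      obtain ⟨h1, h2⟩ := hcos θ hθ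
      subst hk
      have e : rootWeight (((0 + 1 : ℕ) : ℤ) + 2).natAbs (((0 + 1 : ℕ) : ℤ) - 2).natAbs (Real.cos θ) =
          Real.sin θ * (1 - Real.cos θ) := by
        refine rootWeight_cos (mul_nonneg h2.le (by linarith [h1.2])) ?_
        norm_num
        rw [mul_pow, hs2]; ring
      rw [hS _ h1, e, hexp, formZeta_frame, formZ_frame, hz]
      push_cast; ring
    · refine isSmoothSpinWeighted_of_forms formZeta formZeta (contDiff_zonal hh formZeta k 1)
        fun θ hθ φ => ?_
      obtain ⟨h1, h2⟩ := hcos θ hθ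
      have e : rootWeight (m + 2).natAbs (m - 2).natAbs (Real.cos θ) =
          Real.sin θ ^ k * (1 - Real.cos θ) ^ 2 := by
        refine rootWeight_cos (mul_nonneg (pow_nonneg h2.le _) (sq_nonneg _)) ?_
        have a1 : (m + 2).natAbs = k + 4 := by omega
        have a2 : (m - 2).natAbs = k := by omega
        rw [a1, a2, mul_pow, ← pow_mul, mul_comm k 2, pow_mul, hs2, mul_pow]; ring
      rw [hS _ h1, e, hexp, formZeta_frame, formZeta_spherePt, hz]
      push_cast; ring

theorem isSmoothSpinWeighted_rootWeight_mul {s : ℤ} (hs : s = 2 ∨ s = -2) (m : ℤ) {h S : ℝ → ℝ}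
    (hh : ContDiff ℝ (⊤ : ℕ∞) h)
    (hS : ∀ x ∈ Ioo (-1 : ℝ) 1, S x = rootWeight (m + s).natAbs (m - s).natAbs x * h x) :
    IsSmoothSpinWeighted s
      (fun θ φ => (S (Real.cos θ) : ℂ) * Complex.exp (Complex.I * (m : ℂ) * (φ : ℂ))) := by
  rcases hs with rfl | rfl
  · exact isSmoothSpinWeighted_two m hh hS
  · have h1 : (-m + 2).natAbs = (m + -2).natAbs := by omega
    have h2 : (-m - 2).natAbs = (m - -2).natAbs := by omega
    have := isSmoothSpinWeighted_conj (isSmoothSpinWeighted_two (-m) hh (S := S) (by rw [h1, h2]; exact hS))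
    convert this using 3 with θ φ
    rw [map_mul, Complex.conj_ofReal, ← Complex.exp_conj]
    simp

end

/-! ### Conjugation of the spheroidal operator to the Jacobi operator -/

section
open scoped InnerProductSpace

theorem hasDerivAt_rootWeight (α β : ℕ) {x : ℝ} (hx : x ∈ Ioo (-1 : ℝ) 1) :
    HasDerivAt (rootWeight α β)
      (rootWeight α β x * (((β : ℝ) - α) / 2 - ((α : ℝ) + β) / 2 * x) / (1 - x ^ 2)) x := by
  have hw := jacobiWeight_pos α β hx
  have h1 := ((jacobiWeight α β).hasDerivAt x).sqrt hw.ne'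
  refine h1.congr_deriv ?_
  have hx1 : 0 < 1 - x ^ 2 := by nlinarith [hx.1, hx.2]
  have h2 := congrArg (Polynomial.eval x) (derivative_jacobiWeight α β)
  rw [jacobiWeight_succ, Polynomial.derivative_mul] at h2
  simp only [Polynomial.eval_mul, Polynomial.eval_sub, Polynomial.eval_add, Polynomial.eval_C,
    Polynomial.eval_X, Polynomial.eval_one, Polynomial.eval_pow, Polynomial.derivative_sub,
    Polynomial.derivative_one, Polynomial.derivative_X_pow, Polynomial.eval_zero] at h2
  have h3 : rootWeight α β x ^ 2 = (jacobiWeight α β).eval x := rootWeight_sq α β (Ioo_subset_Icc_self hx)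
  have h4 := rootWeight_pos α β hx
  change _ / (2 * rootWeight α β x) = _
  rw [div_eq_div_iff (by positivity) hx1.ne']
  norm_num at h2
  rw [← h3] at h2
  linear_combination h2

/-- First derivative of `rootWeight * h`, multiplied by `1 - x²`. -/
def fluxFun (α β : ℕ) (h : ℝ → ℝ) (x : ℝ) : ℝ :=
  rootWeight α β x * ((((β : ℝ) - α) / 2 - ((α : ℝ) + β) / 2 * x) * h x + (1 - x ^ 2) * deriv h x)

theorem mul_deriv_rootWeight_mul {α β : ℕ} {h S : ℝ → ℝ} (hh : Differentiable ℝ h)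
    (hS : ∀ x ∈ Ioo (-1 : ℝ) 1, S x = rootWeight α β x * h x) {x : ℝ} (hx : x ∈ Ioo (-1 : ℝ) 1) :
    DifferentiableAt ℝ S x ∧ (1 - x ^ 2) * deriv S x = fluxFun α β h x := by
  have hx1 : 0 < 1 - x ^ 2 := by nlinarith [hx.1, hx.2]
  have h1 := (hasDerivAt_rootWeight α β hx).mul (hh x).hasDerivAt
  have h2 : HasDerivAt S _ x := h1.congr_of_eventuallyEq (by
    filter_upwards [Ioo_mem_nhds hx.1 hx.2] with y hy using hS y hy)
  refine ⟨h2.differentiableAt, ?_⟩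
  rw [h2.deriv, fluxFun]
  field_simp

theorem hasDerivAt_flux {α β : ℕ} {h S : ℝ → ℝ} (hh : ContDiff ℝ 2 h)
    (hS : ∀ x ∈ Ioo (-1 : ℝ) 1, S x = rootWeight α β x * h x) {x : ℝ} (hx : x ∈ Ioo (-1 : ℝ) 1) :
    HasDerivAt (fun y => (1 - y ^ 2) * deriv S y)
      (rootWeight α β x * (jacobiDiff α β h x
        + ((((β : ℝ) - α) / 2 - ((α : ℝ) + β) / 2 * x) ^ 2 / (1 - x ^ 2) - ((α : ℝ) + β) / 2) * h x)) x := by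
  have hx1 : 0 < 1 - x ^ 2 := by nlinarith [hx.1, hx.2]
  have hd : Differentiable ℝ h := hh.differentiable (by norm_num)
  have hd2 : Differentiable ℝ (deriv h) := (hh.iterate_deriv' 1 1).differentiable (by norm_num)
  have h0 : HasDerivAt (fun y : ℝ => ((β : ℝ) - α) / 2 - ((α : ℝ) + β) / 2 * y) (- (((α : ℝ) + β) / 2)) x := by
    simpa using ((hasDerivAt_id x).const_mul (((α : ℝ) + β) / 2)).const_sub (((β : ℝ) - α) / 2)
  have h00 : HasDerivAt (fun y : ℝ => 1 - y ^ 2) (- (2 * x)) x := by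
    simpa using ((hasDerivAt_pow 2 x).const_sub 1)
  have h1 := (hasDerivAt_rootWeight α β hx).mul
    ((h0.mul (hd x).hasDerivAt).add (h00.mul (hd2 x).hasDerivAt))
  have h2 : HasDerivAt (fun y => (1 - y ^ 2) * deriv S y) _ x := h1.congr_of_eventuallyEq (by
    filter_upwards [Ioo_mem_nhds hx.1 hx.2] with y hy
    rw [(mul_deriv_rootWeight_mul hd hS hy).2]; rfl)
  refine h2.congr_deriv ?_
  simp only [Pi.add_apply, Pi.mul_apply]
  rw [jacobiDiff]
  field_simp
  ring

theorem continuous_fluxFun {α β : ℕ} {h : ℝ → ℝ} (hh : ContDiff ℝ 1 h) : Continuous (fluxFun α β h) := by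
  have h1 : Continuous (deriv h) := hh.continuous_deriv le_rfl
  have h2 := hh.continuous
  have h3 := continuous_rootWeight α β
  unfold fluxFun; fun_prop

/-- Either the root weight vanishes at the end point, or the exponent there is zero and then the
affine coefficient vanishes instead. -/
theorem fluxFun_one (α β : ℕ) (h : ℝ → ℝ) : fluxFun α β h 1 = 0 := by
  rcases Nat.eq_zero_or_pos α with rfl | hα
  · simp [fluxFun]
  · have : rootWeight α β 1 = 0 := by
      simp [rootWeight, jacobiWeight, hα.ne']
    simp [fluxFun, this]

theorem fluxFun_neg_one (α β : ℕ) (h : ℝ → ℝ) : fluxFun α β h (-1) = 0 := by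
  rcases Nat.eq_zero_or_pos β with rfl | hβ
  · simp [fluxFun]; right; ring_nf; simp
  · have : rootWeight α β (-1) = 0 := by
      simp [rootWeight, jacobiWeight, hβ.ne']
    simp [fluxFun, this]

/-- A spin-weighted function of the form `S (cos θ) e^{imφ}` is smooth in `θ`. -/
theorem IsSmoothSpinWeighted.exists_smooth {s m : ℤ} {S : ℝ → ℝ} (h : IsSmoothSpinWeighted s
      (fun θ φ => (S (Real.cos θ) : ℂ) * Complex.exp (Complex.I * (m : ℂ) * (φ : ℂ)))) :
    ∃ r : ℝ → ℝ, ContDiff ℝ (⊤ : ℕ∞) r ∧ ∀ θ ∈ Ioo 0 Real.pi, S (Real.cos θ) = r θ := by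
  obtain ⟨α, h1, -, h3⟩ := h
  have hp : ContDiff ℝ (⊤ : ℕ∞) fun θ : ℝ => spherePt θ 0 := by
    rw [contDiff_euclidean]
    intro i
    fin_cases i <;> simp [spherePt] <;> fun_prop
  have hf : ContDiff ℝ (⊤ : ℕ∞) fun θ : ℝ => frameθ θ 0 := by
    rw [contDiff_euclidean]
    intro i
    fin_cases i <;> simp [frameθ] <;> fun_prop
  refine ⟨fun θ => 1 / 2 * (α (spherePt θ 0) (frameθ θ 0) (frameθ θ 0)
    - α (spherePt θ 0) (frameφ 0) (frameφ 0)), ?_, fun θ hθ => ?_⟩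
  · have ha := h1.comp hp
    exact contDiff_const.mul (((ha.clm_apply hf).clm_apply hf).sub
      ((ha.clm_apply contDiff_const).clm_apply contDiff_const))
  · have := congrArg Complex.re (h3 θ hθ 0)
    simpa using this

variable {a : ℝ} {s m : ℤ}

/-- The exponent of `1 - x`. -/
abbrev expA (s m : ℤ) : ℕ := (m + s).natAbs

/-- The exponent of `1 + x`. -/
abbrev expB (s m : ℤ) : ℕ := (m - s).natAbs

/-- The shift between the eigenvalues of the spheroidal and of the Jacobi operator. -/
def evShift (s m : ℤ) : ℝ := (lMin s m : ℝ) + (lMin s m : ℝ) ^ 2 - (s : ℝ) ^ 2 - s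

theorem expA_add_expB (hs : s = 2 ∨ s = -2) (m : ℤ) : expA s m + expB s m = 2 * lMin s m := by
  unfold expA expB lMin
  rcases hs with rfl | rfl <;> omega

theorem two_le_lMin (hs : s = 2 ∨ s = -2) (m : ℤ) : 2 ≤ lMin s m := by
  unfold lMin
  rcases hs with rfl | rfl <;> omega

theorem sq_expA (s m : ℤ) : (expA s m : ℝ) ^ 2 = ((m : ℝ) + s) ^ 2 := by
  rw [Nat.cast_natAbs, Int.cast_abs, sq_abs]; push_cast; ring

theorem sq_expB (s m : ℤ) : (expB s m : ℝ) ^ 2 = ((m : ℝ) - s) ^ 2 := by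
  rw [Nat.cast_natAbs, Int.cast_abs, sq_abs]; push_cast; ring

/-- The square created by differentiating the root weight twice equals the singular potential (m +
sx)² up to a multiple of 1 - x². After division by 1 - x² the singular terms cancel and only a
constant survives, which is absorbed in `evShift`. -/
theorem sq_flux_coeff (hs : s = 2 ∨ s = -2) (m : ℤ) (x : ℝ) :
    (((expB s m : ℝ) - expA s m) / 2 - ((expA s m : ℝ) + expB s m) / 2 * x) ^ 2 =
      ((m : ℝ) + s * x) ^ 2 - ((lMin s m : ℝ) ^ 2 - (s : ℝ) ^ 2) * (1 - x ^ 2) := by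
  have h1 := sq_expA s m
  have h2 := sq_expB s m
  have h3 : (expA s m : ℝ) + expB s m = 2 * lMin s m := by exact_mod_cast expA_add_expB hs m
  generalize (expA s m : ℝ) = A at *
  generalize (expB s m : ℝ) = B at *
  have h4 : (lMin s m : ℝ) = (A + B) / 2 := by linarith
  rw [h4]
  linear_combination (1 / 2 - x ^ 2 / 2 + (x ^ 2 + x) / 2) * h1 + (1 / 2 - x ^ 2 / 2 + (x ^ 2 - x) / 2) * h2

theorem angularOp_rootWeight_mul (hs : s = 2 ∨ s = -2) {ω : ℝ} {h S : ℝ → ℝ} (hh : ContDiff ℝ 2 h)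
    (hS : ∀ x ∈ Ioo (-1 : ℝ) 1, S x = rootWeight (expA s m) (expB s m) x * h x) {x : ℝ}
    (hx : x ∈ Ioo (-1 : ℝ) 1) :
    angularOp a s m ω S x = rootWeight (expA s m) (expB s m) x *
      (jacobiDiff (expA s m) (expB s m) h x +
        ((potPoly (-2 * s * a) (a ^ 2) ω).eval x - evShift s m) * h x) := by
  have hx1 : 0 < 1 - x ^ 2 := by nlinarith [hx.1, hx.2]
  have h3 : (expA s m : ℝ) + expB s m = 2 * lMin s m := by exact_mod_cast expA_add_expB hs m
  rw [angularOp, (hasDerivAt_flux hh hS hx).deriv, hS x hx, sq_flux_coeff hs, potPoly_eval, evShift, h3]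
  field_simp
  ring

end

/-! ### Identification of the spheroidal eigenfunctions with the eigenvectors -/

section
open scoped InnerProductSpace

variable {a : ℝ} {s m : ℤ}

theorem potPoly_eval_eq (a : ℝ) (s : ℤ) (ω x : ℝ) : (potPoly (-2 * s * a) (a ^ 2) ω).eval x =
    (a * ω) ^ 2 * x ^ 2 - 2 * s * a * ω * x := by
  rw [potPoly_eval]; ring

/-- Green's identity for an eigenfunction and a Jacobi function. -/
theorem integral_mul_jacobiFun_eq_zero (hs : s = 2 ∨ s = -2) {ω lam : ℝ} {S r : ℝ → ℝ}
    (hr : ContDiff ℝ (⊤ : ℕ∞) r) (hS : ∀ θ ∈ Ioo 0 Real.pi, S (Real.cos θ) = r θ)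
    (he : ∀ x ∈ Ioo (-1 : ℝ) 1, angularOp a s m ω S x = lam * S x) (n : ℕ) :
    ∫ x in Icc (-1 : ℝ) 1, (lam + evShift s m + jacobiEv (expA s m) (expB s m) n
      - (potPoly (-2 * s * a) (a ^ 2) ω).eval x) * r (Real.arccos x)
      * jacobiFun (expA s m) (expB s m) n x = 0 := by
  set α := expA s m
  set β := expB s m
  set q := potPoly (-2 * s * a) (a ^ 2) ω with hq
  have hac : ∀ x ∈ Ioo (-1 : ℝ) 1, Real.arccos x ∈ Ioo 0 Real.pi := fun x hx =>
    ⟨Real.arccos_pos.2 hx.2, Real.arccos_lt_pi.2 hx.1⟩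
  have hSr : ∀ x ∈ Ioo (-1 : ℝ) 1, S x = r (Real.arccos x) := fun x hx => by
    rw [← hS _ (hac x hx), Real.cos_arccos hx.1.le hx.2.le]
  have hCS : ∀ x ∈ Ioo (-1 : ℝ) 1, ContDiffAt ℝ (⊤ : ℕ∞) S x := fun x hx => by
    refine ContDiffAt.congr_of_eventuallyEq (f := fun x => r (Real.arccos x)) ?_ ?_
    · exact hr.contDiffAt.comp x (Real.contDiffAt_arccos hx.1.ne' hx.2.ne)
    · filter_upwards [Ioo_mem_nhds hx.1 hx.2] with y hy using hSr y hy
  set h : ℝ → ℝ := fun x => (jacobiP α β n).eval x / jacobiNorm α β n with hh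
  have hhc : ContDiff ℝ 2 h := ContDiff.div_const (by
    simpa [Polynomial.coe_aeval_eq_eval] using (jacobiP α β n).contDiff_aeval (𝕜 := ℝ) 2) _
  have hJ : ∀ x, jacobiDiff α β h x = - jacobiEv α β n * h x := by
    intro x
    have h1 := jacobiDiff_eval α β n x
    have e1 : deriv h = fun x => deriv (fun y => (jacobiP α β n).eval y) x / jacobiNorm α β n := by
      ext y; rw [hh]; exact deriv_div_const _
    have e2 : deriv (deriv h) x = deriv (deriv (fun y => (jacobiP α β n).eval y)) x / jacobiNorm α β n := by
      rw [e1]; exact deriv_div_const _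
    rw [jacobiDiff] at h1 ⊢
    rw [e2, e1]
    simp only [hh]
    have := (jacobiNorm_pos α β n).ne'
    field_simp
    linear_combination h1
  have hφ : ∀ x ∈ Ioo (-1 : ℝ) 1, jacobiFun α β n x = rootWeight α β x * h x := fun x _ => rfl
  -- The Wronskian of `S` and the Jacobi function, written with r(arccos x) so that it is continuous
  -- up to ±1. In this form (1 - x²)S' is -√(1 - x²) r'(arccos x), so both boundary values vanish by
  -- smoothness in θ alone.
  set B : ℝ → ℝ := fun x => - (Real.sqrt (1 - x ^ 2) * deriv r (Real.arccos x)) * jacobiFun α β n x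
    - r (Real.arccos x) * fluxFun α β h x with hB
  have hflux : ∀ x ∈ Ioo (-1 : ℝ) 1, (1 - x ^ 2) * deriv S x =
      - (Real.sqrt (1 - x ^ 2) * deriv r (Real.arccos x)) := by
    intro x hx
    have hx1 : 0 < 1 - x ^ 2 := by nlinarith [hx.1, hx.2]
    have h1 : HasDerivAt S (deriv r (Real.arccos x) * -(1 / Real.sqrt (1 - x ^ 2))) x := by
      refine HasDerivAt.congr_of_eventuallyEq (f := fun x => r (Real.arccos x)) ?_ ?_
      · exact ((hr.differentiable (by simp)) _).hasDerivAt.comp x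
          (Real.hasDerivAt_arccos hx.1.ne' hx.2.ne)
      · filter_upwards [Ioo_mem_nhds hx.1 hx.2] with y hy using hSr y hy
    rw [h1.deriv]
    have h2 := Real.sq_sqrt hx1.le
    have h3 := Real.sqrt_pos.2 hx1
    field_simp
    linear_combination (deriv r (Real.arccos x)) * h2
  have hBe : ∀ x ∈ Ioo (-1 : ℝ) 1, B x = (1 - x ^ 2) * deriv S x * jacobiFun α β n x
      - S x * ((1 - x ^ 2) * deriv (jacobiFun α β n) x) := fun x hx => by
    rw [(mul_deriv_rootWeight_mul (hhc.differentiable (by norm_num)) hφ hx).2, hflux x hx, hSr x hx]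
  have hdr : Continuous (deriv r) := hr.continuous_deriv (by simp)
  have hBc : Continuous B := by
    have := hr.continuous
    have := continuous_jacobiFun α β n
    have := continuous_fluxFun (α := α) (β := β) (hhc.of_le one_le_two)
    have := Real.continuous_arccos
    have := Real.continuous_sqrt
    fun_prop
  have hderiv : ∀ x ∈ Ioo (-1 : ℝ) 1, HasDerivAt B ((lam + evShift s m + jacobiEv α β n
      - q.eval x) * r (Real.arccos x) * jacobiFun α β n x) x := by
    intro x hx
    have hx1 : 0 < 1 - x ^ 2 := by nlinarith [hx.1, hx.2]
    have d1 : DifferentiableAt ℝ (fun y => (1 - y ^ 2) * deriv S y) x := by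
      have : DifferentiableAt ℝ (deriv S) x := by
        have h2 : ContDiffAt ℝ 2 S x := by exact_mod_cast contDiffAt_infty.1 (hCS x hx) 2
        have h3 : ContDiffAt ℝ 1 (deriv S) x :=
          (h2.fderiv_right (m := 1) (by norm_num)).clm_apply contDiffAt_const
        exact h3.differentiableAt (by norm_num)
      fun_prop
    have d2 := hasDerivAt_flux hhc hφ hx
    have d3 := (mul_deriv_rootWeight_mul (hhc.differentiable (by norm_num)) hφ hx).1.hasDerivAt
    have d4 := ((hCS x hx).differentiableAt (by simp)).hasDerivAt
    have d5 := (d1.hasDerivAt.mul d3).sub (d4.mul d2)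
    refine HasDerivAt.congr_of_eventuallyEq (d5.congr_deriv ?_) (by
      filter_upwards [Ioo_mem_nhds hx.1 hx.2] with y hy using hBe y hy)
    have e1 := he x hx
    rw [angularOp] at e1
    have h3 : (α : ℝ) + β = 2 * lMin s m := by exact_mod_cast expA_add_expB hs m
    rw [hJ, sq_flux_coeff hs, h3, hq, potPoly_eval_eq, evShift, ← hSr x hx, hφ x hx]
    have e2 : deriv (fun y => (1 - y ^ 2) * deriv S y) x = lam * S x + ((m : ℝ) + s * x) ^ 2 / (1 - x ^ 2) * S x
      - ((s : ℝ) + (a * ω) ^ 2 * x ^ 2 - 2 * s * a * ω * x) * S x := by linarith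
    rw [e2]
    field_simp
    ring
  have hB1 : B 1 = 0 := by
    rw [hB]; simp only [fluxFun_one]; norm_num
  have hB2 : B (-1) = 0 := by
    rw [hB]; simp only [fluxFun_neg_one]; norm_num
  rw [integral_Icc_eq, intervalIntegral.integral_eq_sub_of_hasDerivAt_of_le (by norm_num) hBc.continuousOn
    hderiv, hB1, hB2, sub_zero]
  refine Continuous.intervalIntegrable ?_ _ _
  have := q.continuous
  have := hr.continuous
  have := continuous_jacobiFun α β n
  have := Real.continuous_arccos
  fun_prop

/-- Only smoothness in θ is extracted from the spin-weighted condition. It makes `S` a bounded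
function satisfying Green's identity against the Jacobi basis, and the regularity of eigenvectors
then recovers the exact form of `S`. -/
theorem IsEigenfunction.exists_vec (hs : s = 2 ∨ s = -2) {ω lam : ℝ} {S : ℝ → ℝ}
    (h : IsEigenfunction a s m ω lam S) : ∃ u : L2I, u ≠ 0 ∧
      DiagRel (jacobiBasis (expA s m) (expB s m)) (jacobiEv (expA s m) (expB s m))
        (mulOp (potPoly (-2 * s * a) (a ^ 2) ω)) u ((lam + evShift s m) • u) ∧
      ∀ x ∈ Ioo (-1 : ℝ) 1, S x =
        rootWeight (expA s m) (expB s m) x * jacobiSeries (expA s m) (expB s m) u x := by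
  obtain ⟨h1, h2, x₀, hx₀, hne⟩ := h
  obtain ⟨r, hr, hS⟩ := h1.exists_smooth
  have hSr : ∀ x ∈ Ioo (-1 : ℝ) 1, S x = r (Real.arccos x) := fun x hx => by
    rw [← hS _ ⟨Real.arccos_pos.2 hx.2, Real.arccos_lt_pi.2 hx.1⟩, Real.cos_arccos hx.1.le hx.2.le]
  have hc : Continuous fun x => r (Real.arccos x) := hr.continuous.comp Real.continuous_arccos
  set u : L2I := (memLp_of_continuous hc).toLp _ with hu
  have hue : u =ᵐ[intervalMeasure] fun x => r (Real.arccos x) := MemLp.coeFn_toLp _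
  have hd : DiagRel (jacobiBasis (expA s m) (expB s m)) (jacobiEv (expA s m) (expB s m))
        (mulOp (potPoly (-2 * s * a) (a ^ 2) ω)) u ((lam + evShift s m) • u) := by
    intro n
    have key := integral_mul_jacobiFun_eq_zero hs hr hS h2 n
    set q := potPoly (-2 * s * a) (a ^ 2) ω
    have hq : mulOp q u =ᵐ[intervalMeasure] fun x => q.eval x * r (Real.arccos x) := by
      filter_upwards [coeFn_mulOp q u, hue] with x h1 h2
      rw [h1, h2]
    have hJ := coeFn_jacobiVec (expA s m) (expB s m) n
    rw [coe_jacobiBasis, inner_smul_right, inner_L2I_of_ae hJ hue, inner_L2I_of_ae hJ hq,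
      ← integral_const_mul, ← integral_const_mul, ← sub_eq_zero]
    have ci : ∀ {f : ℝ → ℝ}, Continuous f → Integrable f intervalMeasure := fun hf =>
      hf.continuousOn.integrableOn_Icc
    have c1 := continuous_jacobiFun (expA s m) (expB s m) n
    have c5 : Continuous fun x => q.eval x := q.continuous
    rw [← integral_add (ci (by fun_prop)) (ci (by fun_prop)),
      ← integral_sub (ci (by fun_prop)) (ci (by fun_prop)), ← key]
    congr 1; ext x; ring
  obtain ⟨ha, hae, -, -, -⟩ := eigenvector_regular (natDegree_potPoly _ _ ω) hd
  have heq := Measure.eqOn_Icc_of_ae_eq volume (by norm_num : (-1 : ℝ) ≠ 1) (hue.symm.trans hae)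
    hc.continuousOn ((continuous_rootWeight _ _).mul ha.continuous).continuousOn
  have hSe : ∀ x ∈ Ioo (-1 : ℝ) 1, S x =
        rootWeight (expA s m) (expB s m) x * jacobiSeries (expA s m) (expB s m) u x := fun x hx =>
    (hSr x hx).trans (heq (Ioo_subset_Icc_self hx))
  refine ⟨u, fun h0 => hne ?_, hd, hSe⟩
  rw [hSe x₀ hx₀, h0]
  simp [jacobiSeries]

theorem isEigenfunction_of_vec (hs : s = 2 ∨ s = -2) {ω lam : ℝ} {S : ℝ → ℝ} {u : L2I} (hu : u ≠ 0)
    (hd : DiagRel (jacobiBasis (expA s m) (expB s m)) (jacobiEv (expA s m) (expB s m))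
        (mulOp (potPoly (-2 * s * a) (a ^ 2) ω)) u ((lam + evShift s m) • u))
    (hS : ∀ x ∈ Ioo (-1 : ℝ) 1, S x =
        rootWeight (expA s m) (expB s m) x * jacobiSeries (expA s m) (expB s m) u x) :
    IsEigenfunction a s m ω lam S := by
  obtain ⟨ha, hae, ho, -, hne⟩ := eigenvector_regular (natDegree_potPoly _ _ ω) hd
  refine ⟨isSmoothSpinWeighted_rootWeight_mul hs m ha.contDiff hS, fun x hx => ?_, ?_⟩
  · rw [angularOp_rootWeight_mul hs ha.contDiff hS hx, hS x hx, ho x (Ioo_subset_Icc_self hx)]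
    ring
  · have h1 := (ha.continuous.tendsto (-1)).eventually_ne (hne hu)
    obtain ⟨x, hx1, hx2⟩ := ((h1.filter_mono nhdsWithin_le_nhds).and
      (Ioo_mem_nhdsGT (by norm_num : (-1 : ℝ) < 1))).exists
    exact ⟨x, hx2, by rw [hS x hx2]; exact mul_ne_zero (rootWeight_pos _ _ hx2).ne' hx1⟩

theorem mem_eigenvalues_iff (hs : s = 2 ∨ s = -2) {ω lam : ℝ} : lam ∈ eigenvalues a s m ω ↔
    ∃ n, spheroidEv (expA s m) (expB s m) (-2 * s * a) (a ^ 2) n ω = lam + evShift s m := by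
  constructor
  · rintro ⟨S, hS⟩
    obtain ⟨u, hu, hd, -⟩ := hS.exists_vec hs
    rw [← pencil_eq] at hd
    exact EigSys.exists_eq_of_diagRel (by rw [pencil_eq]; exact mulOp_symm _) (spheroidSys _ _ _ _ ω) hu hd
  · rintro ⟨n, hn⟩
    have hd := diagRel_spheroidVec' (expA s m) (expB s m) (-2 * s * a) (a ^ 2) n ω
    rw [hn] at hd
    exact ⟨_, isEigenfunction_of_vec hs ((orthonormal_spheroidVec _ _ _ _ ω).ne_zero n) hd fun _ _ => rfl⟩

theorem encard_eigenvalues_gt (hs : s = 2 ∨ s = -2) {ω lam : ℝ} {n : ℕ}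
    (hn : spheroidEv (expA s m) (expB s m) (-2 * s * a) (a ^ 2) n ω = lam + evShift s m) :
    {μ ∈ eigenvalues a s m ω | lam < μ}.encard = n := by
  set τ := fun j => spheroidEv (expA s m) (expB s m) (-2 * s * a) (a ^ 2) j ω with hτ
  have hanti : StrictAnti τ := (spheroidSys (expA s m) (expB s m) (-2 * s * a) (a ^ 2) ω).anti
  have e : {μ ∈ eigenvalues a s m ω | lam < μ} = (fun j => τ j - evShift s m) '' ((Finset.range n : Finset ℕ) : Set ℕ) := by
    ext μ
    simp only [mem_ofPred_eq, mem_eigenvalues_iff hs, mem_image, Finset.coe_range, mem_Iio]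
    constructor
    · rintro ⟨⟨j, hj⟩, hlt⟩
      refine ⟨j, hanti.lt_iff_gt.1 ?_, by rw [hτ]; simp only [hj]; ring⟩
      rw [hτ]; simp only [hj, hn]; linarith
    · rintro ⟨j, hj, rfl⟩
      refine ⟨⟨j, by rw [hτ]; ring⟩, ?_⟩
      have := hanti hj
      rw [hτ] at this ⊢
      simp only [hn] at this ⊢
      linarith
  rw [e, Function.Injective.encard_image, encard_coe_eq_coe_finsetCard, Finset.card_range]
  intro i j hij
  exact hanti.injective (by simpa using hij)

/-- The count of larger eigenvalues fixes the index, simplicity fixes `S` up to a factor c, the norm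
gives c² = 1 and positivity near -1 gives c ≥ 0. The conditions do not determine values outside the
open interval. -/
theorem isSpheroidalS_iff (hs : s = 2 ∨ s = -2) {l : ℕ} {ω : ℝ} {S : ℝ → ℝ} :
    IsSpheroidalS a s m l ω S ↔ ∀ x ∈ Ioo (-1 : ℝ) 1, S x =
      spheroidFun (expA s m) (expB s m) (-2 * s * a) (a ^ 2) (l - lMin s m) ω x := by
  set n := l - lMin s m
  set α := expA s m with hα
  set β := expB s m with hβ
  set c₁ : ℝ := -2 * s * a with hc₁
  set c₂ := a ^ 2 with hc₂
  set U := spheroidVec α β c₁ c₂ n ω with hU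
  have hUd := diagRel_spheroidVec' α β c₁ c₂ n ω
  have hU1 : ‖U‖ = 1 := (orthonormal_spheroidVec α β c₁ c₂ ω).1 n
  have hUp := jacobiSeries_spheroidVec_pos α β c₁ c₂ n ω
  obtain ⟨hUa, hUae, -, -, -⟩ := eigenvector_regular (natDegree_potPoly c₁ c₂ ω) hUd
  have hnorm : ∀ {u : L2I} {S : ℝ → ℝ}, (u =ᵐ[intervalMeasure] fun x => rootWeight α β x * jacobiSeries α β u x) →
      (∀ x ∈ Ioo (-1 : ℝ) 1, S x = rootWeight α β x * jacobiSeries α β u x) →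
      ∫ x in Icc (-1 : ℝ) 1, S x ^ 2 = ‖u‖ ^ 2 := by
    intro u S h1 h2
    rw [← real_inner_self_eq_norm_sq, inner_L2I_of_ae h1 h1]
    refine integral_congr_ae ?_
    filter_upwards [ae_mem_Ioo] with x hx
    rw [h2 x hx]; ring
  constructor
  · rintro ⟨⟨lam, h1, h2⟩, h3, h4⟩
    obtain ⟨u, hu, hd, hS⟩ := h1.exists_vec hs
    obtain ⟨j, hj⟩ := (mem_eigenvalues_iff hs).1 ⟨S, h1⟩
    have h5 := encard_eigenvalues_gt hs hj
    rw [h2] at h5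
    have hjn : j = n := by exact_mod_cast h5.symm
    rw [hjn] at hj
    rw [← hj] at hd
    obtain ⟨c, hc⟩ := simpleEigenvalues_mulOp (natDegree_potPoly c₁ c₂ ω) _ _ _ hUd hd
      ((orthonormal_spheroidVec α β c₁ c₂ ω).ne_zero n)
    obtain ⟨hua, huae, -, -, -⟩ := eigenvector_regular (natDegree_potPoly c₁ c₂ ω) hd
    rw [hnorm huae hS, hc, norm_smul, hU1, mul_one, Real.norm_eq_abs, sq_abs] at h3
    have hser : jacobiSeries α β u (-1) = c * jacobiSeries α β U (-1) := by
      rw [hc]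
      simp only [jacobiSeries, inner_smul_right, mul_assoc, tsum_mul_left]
      rfl
    -- Positivity of `S` near -1 passes to the limit only as a weak inequality, which suffices
    -- because the series of `U` at -1 is strictly positive.
    have h6 : 0 ≤ jacobiSeries α β u (-1) := by
      refine ge_of_tendsto ((hua.continuous.tendsto (-1)).mono_left (nhdsWithin_le_nhds (s := Ioi (-1)))) ?_
      filter_upwards [h4, Ioo_mem_nhdsGT (by norm_num : (-1 : ℝ) < 1)] with x hx hx2
      rw [hS x hx2] at hx
      exact ((mul_pos_iff_of_pos_left (rootWeight_pos α β hx2)).1 hx).le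
    have hc1 : c = 1 := by
      rw [hser] at h6
      have : 0 ≤ c := nonneg_of_mul_nonneg_left h6 hUp
      nlinarith
    intro x hx
    rw [spheroidFun_eq α β c₁ c₂ n ω hx, hS x hx, hc, hc1, one_smul]
  · intro h
    have hS : ∀ x ∈ Ioo (-1 : ℝ) 1, S x = rootWeight α β x * jacobiSeries α β U x := fun x hx => by
      rw [h x hx, spheroidFun_eq α β c₁ c₂ n ω hx]
    have hlam : spheroidEv α β c₁ c₂ n ω = (spheroidEv α β c₁ c₂ n ω - evShift s m) + evShift s m := by ring
    refine ⟨⟨spheroidEv α β c₁ c₂ n ω - evShift s m, ?_, encard_eigenvalues_gt hs hlam⟩, ?_, ?_⟩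
    · rw [hlam] at hUd
      exact isEigenfunction_of_vec hs ((orthonormal_spheroidVec _ _ _ _ ω).ne_zero n) hUd hS
    · rw [hnorm hUae hS, hU1, one_pow]
    · filter_upwards [nhdsWithin_le_nhds ((hUa.continuous.tendsto (-1)).eventually (lt_mem_nhds hUp)),
        Ioo_mem_nhdsGT (by norm_num : (-1 : ℝ) < 1)] with x hx hx2
      rw [hS x hx2]
      exact mul_pos (rootWeight_pos α β hx2) hx

/-- The choice made in `spheroidalS` may vary freely at ±1 and beyond, so all identifications with
L² vectors go through the open interval, whose complement in [-1, 1] is a null set. -/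
theorem spheroidalS_eq (hs : s = 2 ∨ s = -2) (l : ℕ) (ω : ℝ) {x : ℝ} (hx : x ∈ Ioo (-1 : ℝ) 1) :
    spheroidalS a s m l ω x =
      spheroidFun (expA s m) (expB s m) (-2 * s * a) (a ^ 2) (l - lMin s m) ω x := by
  have h : ∃ S, IsSpheroidalS a s m l ω S := ⟨_, (isSpheroidalS_iff hs).2 fun _ _ => rfl⟩
  exact (isSpheroidalS_iff hs).1 (Classical.epsilon_spec h) x hx

/-- The eigenfunctions `S_{ml}(ω)` as elements of `L²([-1, 1])`. -/
def modeVec (a : ℝ) (s m : ℤ) (l : ℕ) (ω : ℝ) : L2I :=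
  spheroidVec (expA s m) (expB s m) (-2 * s * a) (a ^ 2) (l - lMin s m) ω

theorem contDiff_modeVec (l : ℕ) : ContDiff ℝ (⊤ : ℕ∞) (modeVec a s m l) :=
  (contDiff_spheroid _ _ _ _ _).1

theorem dS_ae_eq (hs : s = 2 ∨ s = -2) (l k : ℕ) (ω : ℝ) :
    ((iteratedDeriv k (modeVec a s m l) ω : L2I) : ℝ → ℝ) =ᵐ[intervalMeasure] dS a s m l k ω := by
  refine (iteratedDeriv_spheroidFun_ae _ _ _ _ _ k ω).trans ?_
  filter_upwards [ae_mem_Ioo] with x hx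
  rw [dS]
  congr 1
  ext w
  exact (spheroidalS_eq hs l w hx).symm

theorem spheroidalS_ae_eq (hs : s = 2 ∨ s = -2) (l : ℕ) (ω : ℝ) :
    modeVec a s m l ω =ᵐ[intervalMeasure] spheroidalS a s m l ω := by
  have := dS_ae_eq (a := a) (m := m) hs l 0 ω
  have e : dS a s m l 0 ω = spheroidalS a s m l ω := by ext x; simp [dS]
  rwa [iteratedDeriv_zero, e] at this

theorem coeffD_eq (hs : s = 2 ∨ s = -2) (l l' k : ℕ) (ω : ℝ) :
    coeffD a s m l l' k ω = ⟪iteratedDeriv k (modeVec a s m l) ω, modeVec a s m l' ω⟫_ℝ :=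
  (inner_L2I_of_ae (dS_ae_eq hs l k ω) (spheroidalS_ae_eq hs l' ω)).symm

/-- The modes are numbered by the natural numbers. -/
def modesEquiv (s m : ℤ) : Modes s m ≃ ℕ where
  toFun l := l - lMin s m
  invFun n := ⟨n + lMin s m, Nat.le_add_left _ _⟩
  left_inv l := Subtype.ext (Nat.sub_add_cancel l.2)
  right_inv n := by simp

theorem orthonormal_modeVec (ω : ℝ) :
    Orthonormal ℝ fun l : Modes s m => modeVec a s m l ω :=
  (orthonormal_spheroidVec (expA s m) (expB s m) (-2 * s * a) (a ^ 2) ω).comp _ (modesEquiv s m).injective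

theorem hasSum_modeVec (ω : ℝ) (u : L2I) :
    HasSum (fun l : Modes s m => ⟪modeVec a s m l ω, u⟫_ℝ • modeVec a s m l ω) u := by
  set B := spheroidBasis (expA s m) (expB s m) (-2 * s * a) (a ^ 2) ω with hB
  have h : HasSum (fun n => ⟪B n, u⟫_ℝ • B n) u := by
    simpa only [HilbertBasis.repr_apply_apply] using B.hasSum_repr u
  have e : ∀ l : Modes s m, B (modesEquiv s m l) = modeVec a s m l ω := fun l => by
    rw [hB, coe_spheroidBasis]; rfl
  refine ((modesEquiv s m).hasSum_iff.2 h).congr_fun fun l => ?_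
  rw [Function.comp_apply, e]

theorem hasSum_sq_inner_modeVec (ω : ℝ) (u : L2I) :
    HasSum (fun l : Modes s m => ⟪modeVec a s m l ω, u⟫_ℝ ^ 2) (‖u‖ ^ 2) := by
  set B := spheroidBasis (expA s m) (expB s m) (-2 * s * a) (a ^ 2) ω with hB
  have h := B.hasSum_inner_mul_inner u u
  rw [real_inner_self_eq_norm_sq] at h
  have e : ∀ l : Modes s m, B (modesEquiv s m l) = modeVec a s m l ω := fun l => by
    rw [hB, coe_spheroidBasis]; rfl
  refine ((modesEquiv s m).hasSum_iff.2 h).congr_fun fun l => ?_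
  rw [Function.comp_apply, e, pow_two, real_inner_comm u]

end

/-! ### The L² expansion and the uniform coefficient bound -/

section
open scoped InnerProductSpace

variable {a : ℝ} {s m : ℤ}

theorem contDiff_spheroidalS (hs : s = 2 ∨ s = -2) (l : ℕ) {x : ℝ} (hx : x ∈ Ioo (-1 : ℝ) 1) :
    ContDiff ℝ (⊤ : ℕ∞) fun ω => spheroidalS a s m l ω x := by
  simp only [fun ω => spheroidalS_eq (a := a) (m := m) hs l ω hx]
  exact contDiff_spheroidFun _ _ _ _ _ x

theorem memLp_dS (hs : s = 2 ∨ s = -2) (l k : ℕ) (ω : ℝ) :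
    MemLp (dS a s m l k ω) 2 intervalMeasure :=
  (memLp_congr_ae (dS_ae_eq hs l k ω)).1 (Lp.memLp _)

theorem coeFn_sum_smul {ι : Type*} (A : Finset ι) (c : ι → ℝ) {v : ι → L2I} {f : ι → ℝ → ℝ}
    (h : ∀ i, v i =ᵐ[intervalMeasure] f i) :
    ((∑ i ∈ A, c i • v i : L2I) : ℝ → ℝ) =ᵐ[intervalMeasure] fun x => ∑ i ∈ A, c i * f i x := by
  classical
  induction A using Finset.induction_on with
  | empty =>
    simp only [Finset.sum_empty]
    exact Lp.coeFn_zero ℝ 2 _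
  | insert i A hi ih =>
    simp only [Finset.sum_insert hi]
    filter_upwards [ih, Lp.coeFn_add (c i • v i) (∑ i ∈ A, c i • v i), Lp.coeFn_smul (c i) (v i),
      h i] with x h1 h2 h3 h4
    rw [h2, Pi.add_apply, h1, h3, Pi.smul_apply, h4, smul_eq_mul]

theorem tendsto_eLpNorm_dS (hs : s = 2 ∨ s = -2) (l k : ℕ) (ω : ℝ) :
    Tendsto (fun A : Finset (Modes s m) =>
      eLpNorm (fun x => dS a s m l k ω x
          - ∑ l' ∈ A, coeffD a s m l l' k ω * spheroidalS a s m l' ω x) 2 intervalMeasure)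
      atTop (𝓝 0) := by
  set V := iteratedDeriv k (modeVec a s m l) ω with hV
  have h := hasSum_modeVec (a := a) (s := s) (m := m) ω V
  have h1 : Tendsto (fun A : Finset (Modes s m) =>
      ‖V - ∑ l' ∈ A, ⟪modeVec a s m l' ω, V⟫_ℝ • modeVec a s m l' ω‖ₑ) atTop (𝓝 0) := by
    have h2 : Tendsto (fun A : Finset (Modes s m) =>
      V - ∑ l' ∈ A, ⟪modeVec a s m l' ω, V⟫_ℝ • modeVec a s m l' ω) atTop (𝓝 0) := by
      simpa using (tendsto_const_nhds (x := V)).sub h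
    simpa using h2.enorm
  refine h1.congr fun A => ?_
  rw [Lp.enorm_def]
  refine eLpNorm_congr_ae ?_
  have h3 := coeFn_sum_smul A (fun l' : Modes s m => ⟪modeVec a s m l' ω, V⟫_ℝ)
    (v := fun l' => modeVec a s m l' ω) (fun l' => spheroidalS_ae_eq hs l' ω)
  filter_upwards [Lp.coeFn_sub V (∑ l' ∈ A, ⟪modeVec a s m l' ω, V⟫_ℝ • modeVec a s m l' ω), h3,
    dS_ae_eq (a := a) (m := m) hs l k ω] with x h1 h2 h4
  rw [h1, Pi.sub_apply, h2, ← h4]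
  congr 1
  refine Finset.sum_congr rfl fun l' _ => ?_
  rw [coeffD_eq hs, real_inner_comm]

theorem tsum_sq_coeffD (hs : s = 2 ∨ s = -2) (l k : ℕ) (ω : ℝ) :
    ∑' l' : Modes s m, ENNReal.ofReal (coeffD a s m l l' k ω ^ 2) =
      ENNReal.ofReal (‖iteratedDeriv k (modeVec a s m l) ω‖ ^ 2) := by
  have h := hasSum_sq_inner_modeVec (a := a) (s := s) (m := m) ω (iteratedDeriv k (modeVec a s m l) ω)
  rw [← h.tsum_eq, ENNReal.ofReal_tsum_of_nonneg (fun _ => sq_nonneg _) h.summable]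
  refine tsum_congr fun l' => ?_
  rw [coeffD_eq hs, real_inner_comm]

/-- By Parseval the sum over l' is ‖∂_ω^k S_ml‖² ≤ c²/l², because n + N = l for n = l - max(|m|,
|s|). The modes for fixed m are distinct natural numbers l, so one convergent series bounds the sum
for every m, and ε does not depend on k. -/
theorem exists_coeffBound (a : ℝ) (hs : s = 2 ∨ s = -2) : ∃ ε : ℝ, 0 < ε ∧ CoeffBound a s ε := by
  set c₁ : ℝ := -2 * s * a with hc₁
  set c₂ : ℝ := a ^ 2 with hc₂
  refine ⟨(1 + |c₁| + |c₂|)⁻¹, by positivity, fun k hk => ?_⟩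
  obtain ⟨c, hc, h⟩ := exists_bound_spheroidVec c₁ c₂ k hk
  have hsum : Summable fun n : ℕ => c ^ 2 * (1 / (n : ℝ) ^ 2) :=
    (Real.summable_one_div_nat_pow.2 one_lt_two).mul_left _
  refine ⟨⟨∑' n : ℕ, c ^ 2 * (1 / (n : ℝ) ^ 2), tsum_nonneg fun n => by positivity⟩, fun m ω hω => ?_⟩
  rw [ENNReal.tsum_prod']
  simp only [tsum_sq_coeffD hs]
  calc ∑' l : Modes s m, ENNReal.ofReal (‖iteratedDeriv k (modeVec a s m l) ω‖ ^ 2)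
      ≤ ∑' l : Modes s m, ENNReal.ofReal (c ^ 2 * (1 / ((l : ℕ) : ℝ) ^ 2)) := by
        refine ENNReal.tsum_le_tsum fun l => ENNReal.ofReal_le_ofReal ?_
        have h1 := h (expA s m) (expB s m) (lMin s m) (expA_add_expB hs m) (two_le_lMin hs m)
          (l - lMin s m) ω hω
        have e : (((l : ℕ) - lMin s m : ℕ) : ℝ) + lMin s m = (l : ℕ) := by
          rw [← Nat.cast_add, Nat.sub_add_cancel l.2]
        rw [e] at h1
        calc _ ≤ (c / ((l : ℕ) : ℝ)) ^ 2 := pow_le_pow_left₀ (norm_nonneg _) h1 2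
          _ = _ := by rw [div_pow]; ring
    _ ≤ ∑' n : ℕ, ENNReal.ofReal (c ^ 2 * (1 / (n : ℝ) ^ 2)) :=
        ENNReal.tsum_comp_le_tsum_of_injective Subtype.val_injective
          (fun n : ℕ => ENNReal.ofReal (c ^ 2 * (1 / (n : ℝ) ^ 2)))
    _ = ENNReal.ofReal (∑' n : ℕ, c ^ 2 * (1 / (n : ℝ) ^ 2)) :=
        (ENNReal.ofReal_tsum_of_nonneg (fun n => by positivity) hsum).symm
    _ = _ := by rw [ENNReal.ofReal, Real.toNNReal_of_nonneg (tsum_nonneg fun n => by positivity)]; rfl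

/-- The derivatives of the eigenvectors are square summable, given the coefficient bound. -/
theorem CoeffBound.exists_tsum_le {ε : ℝ} (h : CoeffBound a s ε) (hs : s = 2 ∨ s = -2) (k : ℕ)
    (hk : 1 ≤ k) : ∃ C : ℝ≥0, ∀ (m : ℤ) (ω : ℝ), |ω| ≤ ε →
      ∑' l : Modes s m, ENNReal.ofReal (‖iteratedDeriv k (modeVec a s m l) ω‖ ^ 2) ≤ C := by
  obtain ⟨C, hC⟩ := h k hk
  refine ⟨C, fun m ω hω => ?_⟩
  have := hC m ω hω
  rw [ENNReal.tsum_prod'] at this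
  simpa only [tsum_sq_coeffD hs] using this

end

/-! ### The measure of the sphere and completeness of separated functions -/

section

/-- The polar part of the measure of the sphere. -/
def polarMeasure : Measure ℝ :=
  (volume.restrict (Ioo 0 Real.pi)).withDensity fun θ => ENNReal.ofReal (Real.sin θ)

/-- The azimuthal part of the measure of the sphere. -/
abbrev azimuthMeasure : Measure ℝ := volume.restrict (Ioo 0 (2 * Real.pi))

/-- The substitution x = cos θ, under which sin θ dθ becomes Lebesgue measure. -/
theorem map_cos_polarMeasure : polarMeasure.map Real.cos = intervalMeasure := by
  ext A hA
  have hm : MeasurableSet (Real.cos ⁻¹' A) := Real.measurable_cos hA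
  rw [Measure.map_apply Real.measurable_cos hA, polarMeasure, withDensity_apply _ hm,
    Measure.restrict_restrict hm, intervalMeasure, ← restrict_Ioo_eq_restrict_Icc,
    Measure.restrict_apply hA]
  have himg : Real.cos '' (Real.cos ⁻¹' A ∩ Ioo 0 Real.pi) = A ∩ Ioo (-1) 1 := by
    ext x
    constructor
    · rintro ⟨θ, ⟨h1, h2⟩, rfl⟩
      have h3 := Real.sin_pos_of_mem_Ioo h2
      have h4 := Real.sin_sq_add_cos_sq θ
      exact ⟨h1, by nlinarith, by nlinarith⟩
    · rintro ⟨h1, h2⟩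
      have h3 := Real.cos_arccos h2.1.le h2.2.le
      exact ⟨Real.arccos x, ⟨by rw [mem_preimage, h3]; exact h1, Real.arccos_pos.2 h2.2,
        Real.arccos_lt_pi.2 h2.1⟩, h3⟩
  have h := lintegral_image_eq_lintegral_abs_deriv_mul (hm.inter (measurableSet_Ioo (a := 0) (b := Real.pi)))
    (fun x _ => (Real.hasDerivAt_cos x).hasDerivWithinAt)
    (Real.injOn_cos.mono (inter_subset_right.trans Ioo_subset_Icc_self)) (fun _ => 1)
  rw [himg, setLIntegral_one] at h
  rw [h]
  refine setLIntegral_congr_fun (hm.inter measurableSet_Ioo) fun θ hθ => ?_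
  have := Real.sin_pos_of_mem_Ioo hθ.2
  simp only [abs_neg, mul_one, abs_of_pos this]

instance : IsFiniteMeasure polarMeasure := ⟨by
  have h : polarMeasure.map Real.cos univ < ∞ := by rw [map_cos_polarMeasure]; exact measure_lt_top _ _
  rwa [Measure.map_apply Real.measurable_cos MeasurableSet.univ, preimage_univ] at h⟩

theorem sphereMeasure_eq : sphereMeasure = polarMeasure.prod azimuthMeasure := by
  rw [sphereMeasure, polarMeasure, prod_withDensity_left (by fun_prop), Measure.prod_restrict]
  rfl

instance : IsFiniteMeasure sphereMeasure := by rw [sphereMeasure_eq]; infer_instance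

theorem ae_polarMeasure : ∀ᵐ θ ∂polarMeasure, θ ∈ Ioo 0 Real.pi :=
  (withDensity_absolutelyContinuous _ _).ae_le (ae_restrict_mem measurableSet_Ioo)

theorem ae_eq_zero_of_polynomial_cos {f : ℝ → ℂ} (hf : Integrable f polarMeasure)
    (h : ∀ q : Polynomial ℝ, ∫ θ, ((q.eval (Real.cos θ) : ℝ) : ℂ) * f θ ∂polarMeasure = 0) :
    f =ᵐ[polarMeasure] 0 := by
  set F : ℝ → ℂ := fun x => hf.1.mk f (Real.arccos x) with hF
  have hFm : StronglyMeasurable F := hf.1.stronglyMeasurable_mk.comp_measurable Real.measurable_arccos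
  have he : f =ᵐ[polarMeasure] fun θ => F (Real.cos θ) := by
    filter_upwards [hf.1.ae_eq_mk, ae_polarMeasure] with θ h1 h2
    rw [hF]; simp only
    rw [Real.arccos_cos h2.1.le h2.2.le, h1]
  have hi : Integrable F intervalMeasure := by
    rw [← map_cos_polarMeasure, integrable_map_measure hFm.aestronglyMeasurable Real.measurable_cos.aemeasurable]
    exact hf.congr he
  have h0 : F =ᵐ[intervalMeasure] 0 := by
    refine ae_eq_zero_of_integral_polynomial hi fun q => ?_
    have h1 := h q
    have h2 : ∫ x in Icc (-1 : ℝ) 1, q.eval x • F x = ∫ x, q.eval x • F x ∂(polarMeasure.map Real.cos) := by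
      rw [map_cos_polarMeasure]
    have hqm : StronglyMeasurable fun x => q.eval x • F x :=
      q.continuous.stronglyMeasurable.smul hFm
    rw [h2, integral_map Real.measurable_cos.aemeasurable hqm.aestronglyMeasurable, ← h1]
    refine integral_congr_ae ?_
    filter_upwards [he] with θ h3
    rw [h3, Complex.real_smul]
  rw [← map_cos_polarMeasure] at h0
  have h3 := ae_of_ae_map Real.measurable_cos.aemeasurable h0
  filter_upwards [he, h3] with θ h4 h5
  rw [h4, h5]; rfl

/-- An integrable function on `(0, 2π)` with vanishing Fourier coefficients vanishes. -/
theorem ae_eq_zero_of_fourier {f : ℝ → ℂ} (hf : Integrable f azimuthMeasure)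
    (h : ∀ m : ℤ, ∫ φ, f φ * Complex.exp (-(Complex.I * m * φ)) ∂azimuthMeasure = 0) :
    f =ᵐ[azimuthMeasure] 0 := by
  have hpi : 0 < 2 * Real.pi := Real.two_pi_pos
  have : Fact (0 < 2 * Real.pi) := ⟨hpi⟩
  have hbd : ∀ {g : ℝ → ℂ} {C : ℝ}, AEStronglyMeasurable g azimuthMeasure →
      (∀ φ ∈ Ioo 0 (2 * Real.pi), ‖g φ‖ ≤ C) →
      Integrable (fun φ => g φ * f φ) azimuthMeasure := fun {g C} hg hC =>
    hf.bdd_mul hg (by filter_upwards [ae_restrict_mem measurableSet_Ioo] with φ hφ using hC φ hφ)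
  have hcoe : Continuous fun φ : ℝ => (φ : AddCircle (2 * Real.pi)) := AddCircle.continuous_mk' _
  have hint : ∀ P : C(AddCircle (2 * Real.pi), ℂ),
      Integrable (fun φ : ℝ => P φ * f φ) azimuthMeasure := fun P =>
    hbd (P.continuous.comp hcoe).aestronglyMeasurable (fun φ _ => P.norm_coe_le_norm _)
  have hP : ∀ P ∈ Submodule.span ℂ (range (@fourier (2 * Real.pi))),
      ∫ φ : ℝ, P φ * f φ ∂azimuthMeasure = 0 := by
    intro P hP
    induction hP using Submodule.span_induction with
    | mem P hP =>
      obtain ⟨n, rfl⟩ := hP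
      rw [← h (-n)]
      refine integral_congr_ae (Eventually.of_forall fun φ => ?_)
      simp only [fourier_coe_apply]
      rw [mul_comm]
      congr 2
      push_cast
      have : (Real.pi : ℂ) ≠ 0 := by exact_mod_cast Real.pi_ne_zero
      field_simp
    | zero => simp
    | add P Q _ _ h1 h2 =>
      simp only [ContinuousMap.add_apply, add_mul]
      rw [integral_add (hint P) (hint Q), h1, h2, add_zero]
    | smul c P _ h1 =>
      simp only [ContinuousMap.smul_apply, smul_eq_mul, mul_assoc]
      rw [integral_const_mul, h1, mul_zero]
  have key := IsOpen.ae_eq_zero_of_integral_contDiff_smul_eq_zero (μ := azimuthMeasure)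
    (U := Ioo 0 (2 * Real.pi)) isOpen_Ioo (f := f) (hf.locallyIntegrable.locallyIntegrableOn _) ?_
  · filter_upwards [key, ae_restrict_mem measurableSet_Ioo] with φ h1 h2 using h1 h2
  intro g hg _ hsupp
  have hgz : ∀ φ, φ ∉ Ioo 0 (2 * Real.pi) → g φ = 0 := fun φ hφ =>
    image_eq_zero_of_notMem_tsupport fun hc => hφ (hsupp hc)
  -- A test function supported in (0, 2π) vanishes at both ends, so it descends to a continuous
  -- function on the circle and is a uniform limit of trigonometric polynomials.
  set G : C(AddCircle (2 * Real.pi), ℂ) :=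
    ⟨AddCircle.liftIco (2 * Real.pi) 0 (fun φ => (g φ : ℂ)), AddCircle.liftIco_zero_continuous
      (by rw [hgz 0 (by simp), hgz (2 * Real.pi) (by simp)])
      (Complex.continuous_ofReal.comp hg.continuous).continuousOn⟩ with hG
  have hGe : ∀ φ ∈ Ioo 0 (2 * Real.pi), G φ = g φ := fun φ hφ =>
    AddCircle.liftIco_zero_coe_apply (f := fun φ => (g φ : ℂ)) (Ioo_subset_Ico_self hφ)
  have hmem : G ∈ (Submodule.span ℂ (range (@fourier (2 * Real.pi)))).topologicalClosure := by
    rw [span_fourier_closure_eq_top]; trivial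
  have e : ∫ φ, g φ • f φ ∂azimuthMeasure = ∫ φ : ℝ, G φ * f φ ∂azimuthMeasure := by
    refine integral_congr_ae ?_
    filter_upwards [ae_restrict_mem measurableSet_Ioo] with φ hφ
    rw [hGe φ hφ, Complex.real_smul]
  rw [e]
  set I := ∫ φ, ‖f φ‖ ∂azimuthMeasure with hI
  have hI0 : 0 ≤ I := integral_nonneg fun x => norm_nonneg _
  rw [← norm_le_zero_iff]
  refine le_of_forall_pos_le_add fun ε hε => ?_
  obtain ⟨P, hPm, hPd⟩ := Metric.mem_closure_iff.1 hmem (ε / (I + 1)) (by positivity)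
  have e2 : ∫ φ : ℝ, G φ * f φ ∂azimuthMeasure = ∫ φ : ℝ, (G - P) φ * f φ ∂azimuthMeasure := by
    simp only [ContinuousMap.sub_apply, sub_mul]
    rw [integral_sub (hint G) (hint P), hP P hPm, sub_zero]
  rw [e2]
  calc ‖∫ φ : ℝ, (G - P) φ * f φ ∂azimuthMeasure‖
      ≤ ∫ φ, ε / (I + 1) * ‖f φ‖ ∂azimuthMeasure := by
        refine norm_integral_le_of_norm_le (hf.norm.const_mul _) (Eventually.of_forall fun φ => ?_)
        rw [norm_mul]
        refine mul_le_mul_of_nonneg_right ?_ (norm_nonneg _)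
        rw [dist_eq_norm] at hPd
        exact ((G - P).norm_coe_le_norm _).trans hPd.le
    _ = ε / (I + 1) * I := by rw [integral_const_mul]
    _ ≤ 0 + ε := by
        rw [zero_add, div_mul_eq_mul_div, div_le_iff₀ (by positivity)]
        nlinarith

/-- An integrable function on the sphere that is orthogonal to all
`q (cos θ) sin^k θ e^{imφ}` vanishes. -/
theorem ae_eq_zero_of_modes {v : ℝ × ℝ → ℂ} (hv : Integrable v sphereMeasure)
    (h : ∀ m : ℤ, ∃ k : ℕ, ∀ q : Polynomial ℝ, ∫ p, v p *
      (((q.eval (Real.cos p.1) * Real.sin p.1 ^ k : ℝ) : ℂ) * Complex.exp (-(Complex.I * m * p.2)))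
        ∂sphereMeasure = 0) : v =ᵐ[sphereMeasure] 0 := by
  rw [sphereMeasure_eq] at *
  have hexp : ∀ (m : ℤ) (φ : ℝ), ‖Complex.exp (-(Complex.I * m * φ))‖ = 1 := fun m φ => by
    have : -(Complex.I * m * φ) = ((-(m * φ) : ℝ) : ℂ) * Complex.I := by push_cast; ring
    rw [this, Complex.norm_exp_ofReal_mul_I]
  have hexpc : ∀ m : ℤ, Continuous fun φ : ℝ => Complex.exp (-(Complex.I * m * φ)) := fun m => by
    fun_prop
  have hint : ∀ m : ℤ, Integrable (fun p : ℝ × ℝ => v p * Complex.exp (-(Complex.I * m * p.2)))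
      (polarMeasure.prod azimuthMeasure) := fun m =>
    hv.mul_bdd (c := 1) ((hexpc m).comp continuous_snd).aestronglyMeasurable
      (Eventually.of_forall fun p => (hexp m p.2).le)
  have h1 : ∀ m : ℤ, (fun θ => ∫ φ, v (θ, φ) * Complex.exp (-(Complex.I * m * φ)) ∂azimuthMeasure)
      =ᵐ[polarMeasure] 0 := by
    intro m
    obtain ⟨k, hk⟩ := h m
    have hsin : Continuous fun θ => ((Real.sin θ ^ k : ℝ) : ℂ) := by fun_prop
    have hz : (fun θ => ((Real.sin θ ^ k : ℝ) : ℂ) *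
        ∫ φ, v (θ, φ) * Complex.exp (-(Complex.I * m * φ)) ∂azimuthMeasure) =ᵐ[polarMeasure] 0 := by
      refine ae_eq_zero_of_polynomial_cos ?_ fun q => ?_
      · refine (hint m).integral_prod_left.bdd_mul (c := 1) hsin.aestronglyMeasurable
          (Eventually.of_forall fun θ => ?_)
        rw [Complex.norm_real, Real.norm_eq_abs, abs_pow]
        exact pow_le_one₀ (abs_nonneg _) (Real.abs_sin_le_one θ)
      · rw [← hk q, integral_prod]
        · refine integral_congr_ae (Eventually.of_forall fun θ => ?_)
          simp only
          rw [← mul_assoc, ← integral_const_mul]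
          refine integral_congr_ae (Eventually.of_forall fun φ => ?_)
          simp only; push_cast; ring
        · have hqc : Continuous fun θ => ((q.eval (Real.cos θ) * Real.sin θ ^ k : ℝ) : ℂ) := by
            have := q.continuous
            exact Complex.continuous_ofReal.comp ((this.comp Real.continuous_cos).mul (by fun_prop))
          obtain ⟨C, hC⟩ := (isCompact_Icc (a := (-1:ℝ)) (b := 1)).exists_bound_of_continuousOn
            q.continuous.continuousOn
          refine hv.mul_bdd (c := C) ((hqc.comp continuous_fst).mul ((hexpc m).comp continuous_snd)).aestronglyMeasurable
            (Eventually.of_forall fun p => ?_)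
          simp only [norm_mul]
          rw [hexp, mul_one, Complex.norm_real, norm_mul]
          have h2 := hC (Real.cos p.1) ⟨Real.neg_one_le_cos _, Real.cos_le_one _⟩
          refine (mul_le_of_le_one_right (norm_nonneg _) ?_).trans h2
          rw [Real.norm_eq_abs, abs_pow]
          exact pow_le_one₀ (abs_nonneg _) (Real.abs_sin_le_one _)
    -- The factor sin^k θ is positive almost everywhere and can be divided out.
    filter_upwards [hz, ae_polarMeasure] with θ h2 h3
    refine (mul_eq_zero.1 h2).resolve_left ?_
    exact_mod_cast (pow_pos (Real.sin_pos_of_mem_Ioo h3) k).ne'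
  have h2 : ∀ᵐ θ ∂polarMeasure, ∀ᵐ φ ∂azimuthMeasure, v (θ, φ) = 0 := by
    filter_upwards [ae_all_iff.2 h1, hv.prod_right_ae] with θ h3 h4
    exact ae_eq_zero_of_fourier h4 h3
  have hmk : ∀ᵐ z ∂(polarMeasure.prod azimuthMeasure), hv.1.mk v z = 0 := by
    rw [Measure.ae_prod_iff_ae_ae (measurableSet_eq_fun hv.1.stronglyMeasurable_mk.measurable measurable_const)]
    filter_upwards [h2, Measure.ae_ae_of_ae_prod hv.1.ae_eq_mk] with θ h3 h4
    filter_upwards [h3, h4] with φ h5 h6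
    rw [← h6, h5]
  filter_upwards [hmk, hv.1.ae_eq_mk] with z h3 h4
  rw [h4, h3]; rfl

end

/-! ### L²(S²) and the basis of spheroidal harmonics -/

section
open scoped InnerProductSpace

/-- The complex Hilbert space `L²(S²)` in the coordinates `(θ, φ)`. -/
abbrev L2S : Type := Lp ℂ 2 sphereMeasure

/-- The function `(2π)^{-1/2} u (cos θ) e^{imφ}`. -/
def liftFun (m : ℤ) (u : ℝ → ℝ) (p : ℝ × ℝ) : ℂ :=
  ((Real.sqrt (2 * Real.pi))⁻¹ * u (Real.cos p.1) : ℝ) * Complex.exp (Complex.I * (m : ℂ) * (p.2 : ℂ))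

theorem map_cos_sphereMeasure : sphereMeasure.map (fun p : ℝ × ℝ => Real.cos p.1) =
    ENNReal.ofReal (2 * Real.pi) • intervalMeasure := by
  have h : (fun p : ℝ × ℝ => Real.cos p.1) = Real.cos ∘ Prod.fst := rfl
  rw [h, ← Measure.map_map Real.measurable_cos measurable_fst, sphereMeasure_eq, Measure.map_fst_prod,
    Measure.map_smul, map_cos_polarMeasure]
  simp

theorem measurable_cos_fst : Measurable fun p : ℝ × ℝ => Real.cos p.1 :=
  Real.measurable_cos.comp measurable_fst

theorem quasiMeasurePreserving_cos :
    Measure.QuasiMeasurePreserving (fun p : ℝ × ℝ => Real.cos p.1) sphereMeasure intervalMeasure :=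
  ⟨measurable_cos_fst, by rw [map_cos_sphereMeasure]; exact Measure.smul_absolutelyContinuous⟩

theorem norm_exp_I_mul (m : ℤ) (φ : ℝ) : ‖Complex.exp (Complex.I * (m : ℂ) * (φ : ℂ))‖ = 1 := by
  have : Complex.I * (m : ℂ) * φ = ((m * φ : ℝ) : ℂ) * Complex.I := by push_cast; ring
  rw [this, Complex.norm_exp_ofReal_mul_I]

theorem memLp_liftFun (m : ℤ) {u : ℝ → ℝ} (hu : MemLp u 2 intervalMeasure) :
    MemLp (liftFun m u) 2 sphereMeasure := by
  have h1 : MemLp (u ∘ fun p : ℝ × ℝ => Real.cos p.1) 2 sphereMeasure := by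
    refine MemLp.comp_of_map ?_ measurable_cos_fst.aemeasurable
    rw [map_cos_sphereMeasure]
    exact hu.smul_measure ENNReal.ofReal_ne_top
  have hexp : Continuous fun p : ℝ × ℝ => Complex.exp (Complex.I * (m : ℂ) * (p.2 : ℂ)) := by fun_prop
  refine h1.of_le_mul (c := (Real.sqrt (2 * Real.pi))⁻¹) ?_ (Eventually.of_forall fun p => ?_)
  · exact (Complex.continuous_ofReal.comp_aestronglyMeasurable (h1.1.const_mul _)).mul hexp.aestronglyMeasurable
  · rw [liftFun, norm_mul, norm_exp_I_mul, mul_one, Complex.norm_real, norm_mul]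
    rw [Real.norm_of_nonneg (by positivity)]
    rfl

theorem integral_exp_I_mul (k : ℤ) :
    ∫ φ : ℝ, Complex.exp (Complex.I * k * φ) ∂azimuthMeasure = if k = 0 then 2 * (Real.pi : ℂ) else 0 := by
  rw [azimuthMeasure, ← integral_Ioc_eq_integral_Ioo, ← intervalIntegral.integral_of_le Real.two_pi_pos.le]
  split_ifs with h
  · simp [h]
  · rw [integral_exp_mul_complex (mul_ne_zero Complex.I_ne_zero (by exact_mod_cast h))]
    have : Complex.I * (k : ℂ) * ((2 * Real.pi : ℝ) : ℂ) = k * (2 * Real.pi * Complex.I) := by push_cast; ring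
    rw [this, Complex.exp_int_mul_two_pi_mul_I]
    simp

theorem integral_conj_liftFun_mul (m n : ℤ) {u v : ℝ → ℝ} (hu : MemLp u 2 intervalMeasure)
    (hv : MemLp v 2 intervalMeasure) :
    ∫ p, starRingEnd ℂ (liftFun m u p) * liftFun n v p ∂sphereMeasure =
      if m = n then ((∫ x in Icc (-1 : ℝ) 1, u x * v x : ℝ) : ℂ) else 0 := by
  have e : ∀ p : ℝ × ℝ, starRingEnd ℂ (liftFun m u p) * liftFun n v p =
      (((2 * Real.pi)⁻¹ * (u (Real.cos p.1) * v (Real.cos p.1)) : ℝ) : ℂ) *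
        Complex.exp (Complex.I * ((n - m : ℤ) : ℂ) * p.2) := fun p => by
    have h1 : Real.sqrt (2 * Real.pi) * Real.sqrt (2 * Real.pi) = 2 * Real.pi :=
      Real.mul_self_sqrt Real.two_pi_pos.le
    rw [liftFun, liftFun, map_mul, Complex.conj_ofReal, ← Complex.exp_conj, mul_mul_mul_comm,
      ← Complex.exp_add, ← Complex.ofReal_mul]
    have h2 : (Real.sqrt (2 * Real.pi))⁻¹ * (Real.sqrt (2 * Real.pi))⁻¹ = (2 * Real.pi)⁻¹ := by
      rw [← mul_inv, h1]
    congr 2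
    · rw [← h2]; ring
    · simp; ring
  simp only [e]
  rw [sphereMeasure_eq, integral_prod_mul (fun θ : ℝ => (((2 * Real.pi)⁻¹ * (u (Real.cos θ) * v (Real.cos θ)) : ℝ) : ℂ))
    (fun φ : ℝ => Complex.exp (Complex.I * ((n - m : ℤ) : ℂ) * φ)), integral_exp_I_mul, integral_complex_ofReal]
  have huv : AEStronglyMeasurable (fun x => u x * v x) (polarMeasure.map Real.cos) := by
    rw [map_cos_polarMeasure]; exact hu.1.mul hv.1
  rw [integral_const_mul, ← integral_map (f := fun x => u x * v x) Real.measurable_cos.aemeasurable huv,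
    map_cos_polarMeasure]
  by_cases h : m = n
  · rw [if_pos (by omega), if_pos h]
    have : (Real.pi : ℂ) ≠ 0 := by exact_mod_cast Real.pi_ne_zero
    push_cast
    field_simp
  · rw [if_neg (by omega), if_neg h, mul_zero]

theorem inner_L2S (f g : L2S) : ⟪f, g⟫_ℂ = ∫ p, starRingEnd ℂ (f p) * g p ∂sphereMeasure := by
  rw [L2.inner_def]
  refine integral_congr_ae (Eventually.of_forall fun x => ?_)
  simp [mul_comm]

theorem inner_L2S_of_ae {f g : L2S} {F G : ℝ × ℝ → ℂ} (hf : f =ᵐ[sphereMeasure] F)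
    (hg : g =ᵐ[sphereMeasure] G) : ⟪f, g⟫_ℂ = ∫ p, starRingEnd ℂ (F p) * G p ∂sphereMeasure := by
  rw [inner_L2S]
  refine integral_congr_ae ?_
  filter_upwards [hf, hg] with x h1 h2
  rw [h1, h2]

theorem liftFun_congr (m : ℤ) {u v : ℝ → ℝ} (h : u =ᵐ[intervalMeasure] v) :
    liftFun m u =ᵐ[sphereMeasure] liftFun m v := by
  filter_upwards [quasiMeasurePreserving_cos.ae h] with p hp
  rw [liftFun, liftFun, hp]

/-- The real linear map underlying `sector`. -/
def sectorLin (m : ℤ) : L2I →ₗ[ℝ] L2S where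
  toFun u := (memLp_liftFun m (Lp.memLp u)).toLp _
  map_add' u v := by
    rw [← MemLp.toLp_add]
    refine MemLp.toLp_congr _ _ ((liftFun_congr m (Lp.coeFn_add u v)).trans (Eventually.of_forall fun p => ?_))
    simp only [liftFun, Pi.add_apply]; push_cast; ring
  map_smul' c u := by
    rw [RingHom.id_apply, ← MemLp.toLp_const_smul]
    refine MemLp.toLp_congr _ _ ((liftFun_congr m (Lp.coeFn_smul c u)).trans (Eventually.of_forall fun p => ?_))
    simp only [liftFun, Pi.smul_apply, smul_eq_mul, Complex.real_smul]; push_cast; ring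

theorem coeFn_sectorLin (m : ℤ) (u : L2I) : sectorLin m u =ᵐ[sphereMeasure] liftFun m u :=
  MemLp.coeFn_toLp (memLp_liftFun m (Lp.memLp u))

theorem inner_sectorLin (m n : ℤ) (u v : L2I) :
    ⟪sectorLin m u, sectorLin n v⟫_ℂ = if m = n then ((⟪u, v⟫_ℝ : ℝ) : ℂ) else 0 := by
  rw [inner_L2S_of_ae (coeFn_sectorLin m u) (coeFn_sectorLin n v),
    integral_conj_liftFun_mul m n (Lp.memLp u) (Lp.memLp v), inner_L2I]

/-- The isometric embedding `u ↦ (2π)^{-1/2} u (cos θ) e^{imφ}` of `L²([-1, 1])` into `L²(S²)`. -/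
def sector (m : ℤ) : L2I →ₗᵢ[ℝ] L2S where
  toLinearMap := sectorLin m
  norm_map' u := by
    have h := inner_sectorLin m m u u
    rw [if_pos rfl, real_inner_self_eq_norm_sq, inner_self_eq_norm_sq_to_K] at h
    have h2 : ‖sectorLin m u‖ ^ 2 = ‖u‖ ^ 2 := by
      have h3 := congrArg Complex.re h
      simpa [← Complex.ofReal_pow] using h3
    exact (sq_eq_sq₀ (norm_nonneg _) (norm_nonneg _)).1 h2

theorem coeFn_sector (m : ℤ) (u : L2I) : sector m u =ᵐ[sphereMeasure] liftFun m u :=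
  coeFn_sectorLin m u

theorem inner_sector (m n : ℤ) (u v : L2I) :
    ⟪sector m u, sector n v⟫_ℂ = if m = n then ((⟪u, v⟫_ℝ : ℝ) : ℂ) else 0 :=
  inner_sectorLin m n u v

theorem eq_zero_of_inner_sector {v : L2S} (h : ∀ m u, ⟪sector m u, v⟫_ℂ = 0) : v = 0 := by
  rw [Lp.eq_zero_iff_ae_eq_zero]
  refine ae_eq_zero_of_modes ((Lp.memLp v).integrable one_le_two) fun m => ⟨0, fun q => ?_⟩
  have hm := memLp_of_continuous q.continuous
  have h1 := h m (hm.toLp _)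
  have h2 : sector m (hm.toLp _) =ᵐ[sphereMeasure] liftFun m (fun x => q.eval x) :=
    (coeFn_sector m _).trans (liftFun_congr m (MemLp.coeFn_toLp hm))
  rw [inner_L2S_of_ae h2 (ae_eq_refl _)] at h1
  have hc : ((Real.sqrt (2 * Real.pi))⁻¹ : ℂ) ≠ 0 := by
    have : Real.sqrt (2 * Real.pi) ≠ 0 := (Real.sqrt_pos.2 Real.two_pi_pos).ne'
    exact inv_ne_zero (by exact_mod_cast this)
  refine (mul_eq_zero.1 ?_).resolve_left hc
  rw [← integral_const_mul, ← h1]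
  refine integral_congr_ae (Eventually.of_forall fun p => ?_)
  simp only [liftFun, pow_zero, mul_one, map_mul, Complex.conj_ofReal]
  rw [← Complex.exp_conj]
  simp only [map_mul, Complex.conj_I, Complex.conj_ofReal, map_intCast]
  push_cast
  ring_nf

/-- The smooth functions on the sphere are dense in `L²(S²)`. -/
theorem eq_zero_of_integral_smooth {v : L2S}
    (h : ∀ ψ : E3 → ℂ, ContDiff ℝ (⊤ : ℕ∞) ψ → ∫ p, v p * ψ (spherePt p.1 p.2) ∂sphereMeasure = 0) :
    v = 0 := by
  rw [Lp.eq_zero_iff_ae_eq_zero]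
  refine ae_eq_zero_of_modes ((Lp.memLp v).integrable one_le_two) fun m => ⟨m.natAbs, fun q => ?_⟩
  have hq : ContDiff ℝ (⊤ : ℕ∞) fun x : ℝ => q.eval x := by
    simpa [Polynomial.coe_aeval_eq_eval] using q.contDiff_aeval (𝕜 := ℝ) (⊤ : ℕ∞)
  have hz : ∀ θ φ, spherePt θ φ 2 = Real.cos θ := fun θ φ => by simp [spherePt]
  rcases le_or_gt 0 m with hm | hm
  -- On the sphere (x - iy)^|m| equals sin^|m| θ e^{-i|m|φ}. The factor sin^|m| θ makes the test
  -- function the restriction of a smooth function on ℝ³; for m < 0 the conjugate form is used.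
  · rw [← h _ (contDiff_zonal hq formZetaBar m.natAbs 1)]
    refine integral_congr_ae (Eventually.of_forall fun p => ?_)
    have e : (m : ℂ) = (m.natAbs : ℂ) := by
      rw [← Int.cast_natCast, Int.natAbs_of_nonneg hm]
    simp only [hz, formZetaBar_spherePt, e]
    rw [mul_pow, ← Complex.exp_nat_mul]
    push_cast
    ring_nf
  · rw [← h _ (contDiff_zonal hq formZeta m.natAbs 1)]
    refine integral_congr_ae (Eventually.of_forall fun p => ?_)
    have e : (m : ℂ) = -(m.natAbs : ℂ) := by
      rw [← Int.cast_natCast, Int.ofNat_natAbs_of_nonpos hm.le]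
      push_cast
      ring
    simp only [hz, formZeta_spherePt, e]
    rw [mul_pow, ← Complex.exp_nat_mul]
    push_cast
    ring_nf

variable (a : ℝ) (s : ℤ)

/-- The pairs `(m, l)` of mode indices. -/
abbrev ModeIndex : Type := Σ m : ℤ, Modes s m

/-- The spheroidal harmonics as curves in `L²(S²)`. -/
def sphVec (i : ModeIndex s) (ω : ℝ) : L2S := sector i.1 (modeVec a s i.1 i.2 ω)

variable {s}

theorem contDiff_sphVec (i : ModeIndex s) : ContDiff ℝ (⊤ : ℕ∞) (sphVec a s i) :=
  (sector i.1).toContinuousLinearMap.contDiff.comp (contDiff_modeVec i.2)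

theorem iteratedDeriv_sphVec (i : ModeIndex s) (k : ℕ) (ω : ℝ) :
    iteratedDeriv k (sphVec a s i) ω = sector i.1 (iteratedDeriv k (modeVec a s i.1 i.2) ω) :=
  iteratedDeriv_clm_apply (sector i.1).toContinuousLinearMap (contDiff_modeVec i.2) k ω

theorem sphVec_ae_eq (hs : s = 2 ∨ s = -2) (i : ModeIndex s) (ω : ℝ) :
    sphVec a s i ω =ᵐ[sphereMeasure] fun p => spheroidalY a s i.1 i.2 ω p.1 p.2 :=
  (coeFn_sector _ _).trans (liftFun_congr _ (spheroidalS_ae_eq hs _ ω))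

theorem orthonormal_sphVec (ω : ℝ) : Orthonormal ℂ fun i : ModeIndex s => sphVec a s i ω := by
  classical
  rw [orthonormal_iff_ite]
  rintro ⟨m, l⟩ ⟨n, k⟩
  rw [sphVec, sphVec, inner_sector]
  by_cases h : m = n
  · subst h
    have := orthonormal_iff_ite.1 (orthonormal_modeVec (a := a) (s := s) (m := m) ω) l k
    simp only [if_true, this]
    by_cases h2 : l = k <;> simp [h2]
  · rw [if_neg h, if_neg (fun hc => h (congrArg Sigma.fst hc))]

/-- The spheroidal harmonics as a Hilbert basis of `L²(S²)`. -/
def sphBasis (ω : ℝ) : HilbertBasis (ModeIndex s) ℂ L2S :=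
  HilbertBasis.mkOfOrthogonalEqBot (orthonormal_sphVec a ω) (by
    rw [Submodule.eq_bot_iff]
    intro v hv
    have h0 : ∀ i : ModeIndex s, ⟪sphVec a s i ω, v⟫_ℂ = 0 := fun i =>
      (Submodule.mem_orthogonal _ v).1 hv _ (Submodule.subset_span ⟨i, rfl⟩)
    refine eq_zero_of_inner_sector fun m u => ?_
    -- For fixed m the modes span L²([-1, 1]) over ℝ, so orthogonality to them implies orthogonality
    -- to the image of every `u`. The expansion is real, whence the restriction of scalars.
    have h1 := (hasSum_modeVec (a := a) (s := s) (m := m) ω u).mapL (sector m).toContinuousLinearMap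
    have h2 := h1.mapL ((innerSL ℂ v).restrictScalars ℝ)
    have h3 : ∀ l : Modes s m, ((innerSL ℂ v).restrictScalars ℝ) ((sector m).toContinuousLinearMap
        (⟪modeVec a s m l ω, u⟫_ℝ • modeVec a s m l ω)) = 0 := fun l => by
      have h4 : ⟪v, sphVec a s ⟨m, l⟩ ω⟫_ℂ = 0 := by rw [← inner_conj_symm, h0, map_zero]
      rw [map_smul, map_smul]
      change _ • ⟪v, sphVec a s ⟨m, l⟩ ω⟫_ℂ = 0
      rw [h4, smul_zero]
    simp only [h3] at h2
    have h5 : ⟪v, sector m u⟫_ℂ = 0 := h2.unique hasSum_zero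
    rw [← inner_conj_symm, h5, map_zero])

theorem coe_sphBasis (ω : ℝ) : ⇑(sphBasis a (s := s) ω) = fun i => sphVec a s i ω :=
  HilbertBasis.coe_mkOfOrthogonalEqBot _ _

end

/-! ### Parseval in one azimuthal sector and bounds for the differentiated analysis operator -/

section
open scoped InnerProductSpace

variable {ι : Type*} {K : Type*} [NormedAddCommGroup K] [InnerProductSpace ℂ K]

/-- Parseval's identity in `ℝ≥0∞`. -/
theorem tsum_enorm_inner_sq (b : HilbertBasis ι ℂ K) (c : K) :
    ∑' i, ‖⟪b i, c⟫_ℂ‖ₑ ^ 2 = ‖c‖ₑ ^ 2 := by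
  have h := b.hasSum_inner_mul_inner c c
  have h2 : ∀ i, ⟪c, b i⟫_ℂ * ⟪b i, c⟫_ℂ = ((‖⟪b i, c⟫_ℂ‖ ^ 2 : ℝ) : ℂ) := fun i => by
    rw [← inner_conj_symm, mul_comm, Complex.mul_conj, Complex.normSq_eq_norm_sq]
  have h3 : ⟪c, c⟫_ℂ = ((‖c‖ ^ 2 : ℝ) : ℂ) := by rw [inner_self_eq_norm_sq_to_K]; push_cast; rfl
  simp only [h2, h3] at h
  have h4 := Complex.hasSum_ofReal.1 h
  have h5 : ∀ x : K, ‖x‖ₑ ^ 2 = ENNReal.ofReal (‖x‖ ^ 2) := fun x => by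
    rw [← ofReal_norm, ENNReal.ofReal_pow (norm_nonneg _)]
  have h6 : ∀ x : ℂ, ‖x‖ₑ ^ 2 = ENNReal.ofReal (‖x‖ ^ 2) := fun x => by
    rw [← ofReal_norm, ENNReal.ofReal_pow (norm_nonneg _)]
  simp only [h5, h6]
  rw [← h4.tsum_eq, ENNReal.ofReal_tsum_of_nonneg (fun _ => sq_nonneg _) h4.summable]

variable {κ : ι → Type*}

/-- Only the coefficients in one sector matter in the pairing with a vector of this sector. -/
theorem enorm_inner_sq_le_of_sector (b : HilbertBasis (Σ i, κ i) ℂ K) {m : ι} {v : K}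
    (hv : ∀ n l, n ≠ m → ⟪b ⟨n, l⟩, v⟫_ℂ = 0) (c : K) :
    ‖⟪v, c⟫_ℂ‖ₑ ^ 2 ≤ ‖v‖ₑ ^ 2 * ∑' l, ‖⟪b ⟨m, l⟩, c⟫_ℂ‖ₑ ^ 2 := by
  classical
  -- `w` holds the coefficients of the projection of `c` to the sector m; the estimate is
  -- Cauchy–Schwarz for `v` and this projection.
  set w : (Σ i, κ i) → ℂ := fun i => if i.1 = m then ⟪b i, c⟫_ℂ else 0 with hw
  have hmem : Memℓp w 2 := by
    refine memℓp_gen ?_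
    have h1 := lp.memℓp (b.repr c)
    have h2 := h1.summable (by norm_num)
    refine Summable.of_nonneg_of_le (fun i => by positivity) (fun i => ?_) h2
    refine Real.rpow_le_rpow (norm_nonneg _) ?_ (by norm_num)
    rw [HilbertBasis.repr_apply_apply, hw]
    dsimp only
    split_ifs
    · exact le_rfl
    · rw [norm_zero]; exact norm_nonneg _
  set W := b.repr.symm ⟨w, hmem⟩ with hW
  have hWi : ∀ i, ⟪b i, W⟫_ℂ = w i := fun i => by
    rw [← HilbertBasis.repr_apply_apply, hW]; simp
  have h1 : ⟪v, c⟫_ℂ = ⟪v, W⟫_ℂ := by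
    rw [← b.tsum_inner_mul_inner v c, ← b.tsum_inner_mul_inner v W]
    refine tsum_congr fun i => ?_
    rw [hWi, hw]
    by_cases hi : i.1 = m
    · simp [hi]
    · have : ⟪v, b i⟫_ℂ = 0 := by rw [← inner_conj_symm, hv i.1 i.2 hi, map_zero]
      rw [this, zero_mul, zero_mul]
  have h2 : ‖W‖ₑ ^ 2 = ∑' l, ‖⟪b ⟨m, l⟩, c⟫_ℂ‖ₑ ^ 2 := by
    rw [← tsum_enorm_inner_sq b W, ENNReal.tsum_sigma', tsum_eq_single m]
    · refine tsum_congr fun l => ?_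
      rw [hWi, hw]; simp
    · intro n hn
      rw [ENNReal.tsum_eq_zero]
      intro l
      rw [hWi, hw]; simp [hn]
  rw [h1, ← h2, ← mul_pow]
  refine pow_le_pow_left₀ (zero_le) ?_ 2
  rw [← ofReal_norm, ← ofReal_norm, ← ofReal_norm, ← ENNReal.ofReal_mul (norm_nonneg _)]
  exact ENNReal.ofReal_le_ofReal (norm_inner_le_norm v W)

end

section
open scoped InnerProductSpace

variable {a : ℝ} {s : ℤ}

/-- ω-derivatives of a harmonic stay in its azimuthal sector. Within a sector the differentiated
family has a Hilbert–Schmidt bound uniform in m, and Parseval sums the sectors. The squared norms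
themselves need not be summable over all m, so the restriction to a sector is essential. For k = 0
this is Parseval itself. -/
theorem CoeffBound.exists_tsum_inner_le {ε : ℝ} (h : CoeffBound a s ε) (hs : s = 2 ∨ s = -2) (k : ℕ) :
    ∃ C : ℝ≥0, ∀ ω : ℝ, |ω| ≤ ε → ∀ c : L2S,
      ∑' i : ModeIndex s, ‖⟪iteratedDeriv k (sphVec a s i) ω, c⟫_ℂ‖ₑ ^ 2 ≤ C * ‖c‖ₑ ^ 2 := by
  rcases Nat.eq_zero_or_pos k with rfl | hk
  · refine ⟨1, fun ω _ c => ?_⟩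
    have := tsum_enorm_inner_sq (sphBasis a (s := s) ω) c
    rw [coe_sphBasis] at this
    simp only [iteratedDeriv_zero, ENNReal.coe_one, one_mul, this, le_refl]
  · obtain ⟨C, hC⟩ := h.exists_tsum_le hs k hk
    refine ⟨C, fun ω hω c => ?_⟩
    have hp := tsum_enorm_inner_sq (sphBasis a (s := s) ω) c
    rw [← hp, ENNReal.tsum_sigma', ENNReal.tsum_sigma', ← ENNReal.tsum_mul_left]
    refine ENNReal.tsum_le_tsum fun m => ?_
    calc ∑' l : Modes s m, ‖⟪iteratedDeriv k (sphVec a s ⟨m, l⟩) ω, c⟫_ℂ‖ₑ ^ 2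
        ≤ ∑' l : Modes s m, ENNReal.ofReal (‖iteratedDeriv k (modeVec a s m l) ω‖ ^ 2) *
          ∑' l' : Modes s m, ‖⟪sphBasis a ω ⟨m, l'⟩, c⟫_ℂ‖ₑ ^ 2 := by
          refine ENNReal.tsum_le_tsum fun l => ?_
          refine (enorm_inner_sq_le_of_sector (sphBasis a (s := s) ω) (m := m) (fun n l' hn => ?_) c).trans ?_
          · rw [coe_sphBasis, iteratedDeriv_sphVec]
            exact (inner_sector _ _ _ _).trans (if_neg hn)
          · refine mul_le_mul_left (le_of_eq ?_) _
            rw [iteratedDeriv_sphVec, ← ofReal_norm, LinearIsometry.norm_map, ENNReal.ofReal_pow (norm_nonneg _)]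
      _ = _ := ENNReal.tsum_mul_right
      _ ≤ _ := mul_le_mul_left (hC m ω hω) _

end

/-! ### Vector-valued weak derivatives and Sobolev functions on an interval -/

/-- The scalar test functions on `(-ε, ε)`. -/
structure IsTest (ε : ℝ) (χ : ℝ → ℂ) : Prop where
  contDiff : ContDiff ℝ (⊤ : ℕ∞) χ
  hasCompactSupport : HasCompactSupport χ
  tsupport_subset : tsupport χ ⊆ Ioo (-ε) ε

namespace IsTest

variable {ε : ℝ} {χ : ℝ → ℂ}

theorem deriv (h : IsTest ε χ) : IsTest ε (deriv χ) :=
  ⟨(contDiff_infty_iff_deriv.1 h.contDiff).2, h.hasCompactSupport.deriv,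
    (tsupport_deriv_subset (𝕜 := ℝ)).trans h.tsupport_subset⟩

theorem iteratedDeriv (h : IsTest ε χ) (q : ℕ) : IsTest ε (iteratedDeriv q χ) := by
  induction q with
  | zero => simpa using h
  | succ q ih => rw [iteratedDeriv_succ]; exact ih.deriv

theorem mul (h : IsTest ε χ) {f : ℝ → ℂ} (hf : ContDiff ℝ (⊤ : ℕ∞) f) : IsTest ε (fun w => χ w * f w) :=
  ⟨h.contDiff.mul hf, h.hasCompactSupport.mul_right, (tsupport_mul_subset_left (g := f)).trans h.tsupport_subset⟩

theorem of_isCompact (hχ : ContDiff ℝ (⊤ : ℕ∞) χ) {K : Set ℝ} (hK : IsCompact K) (hKI : K ⊆ Ioo (-ε) ε)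
    (h0 : ∀ w ∉ K, χ w = 0) : IsTest ε χ := by
  have hs : tsupport χ ⊆ K := closure_minimal (fun w hw => by_contra fun hn => hw (h0 w hn)) hK.isClosed
  exact ⟨hχ, hK.of_isClosed_subset (isClosed_tsupport χ) hs, hs.trans hKI⟩

theorem exists_bound (h : IsTest ε χ) : ∃ C : ℝ, ∀ w, ‖χ w‖ ≤ C :=
  h.hasCompactSupport.exists_bound_of_continuous h.contDiff.continuous

theorem memLp_smul {E : Type*} [NormedAddCommGroup E] [NormedSpace ℂ E] (h : IsTest ε χ) {g : ℝ → E}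
    (hg : MemLp g 2 (volume.restrict (Ioo (-ε) ε))) :
    MemLp (fun w => χ w • g w) 2 (volume.restrict (Ioo (-ε) ε)) := by
  obtain ⟨C, hC⟩ := h.exists_bound
  refine hg.of_le_mul (c := C) (h.contDiff.continuous.aestronglyMeasurable.smul hg.1)
    (Eventually.of_forall fun w => ?_)
  rw [norm_smul]
  exact mul_le_mul_of_nonneg_right (hC w) (norm_nonneg _)

theorem integrable_smul {E : Type*} [NormedAddCommGroup E] [NormedSpace ℂ E] (h : IsTest ε χ) {g : ℝ → E}
    (hg : MemLp g 2 (volume.restrict (Ioo (-ε) ε))) :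
    Integrable (fun w => χ w • g w) (volume.restrict (Ioo (-ε) ε)) :=
  (h.memLp_smul hg).integrable one_le_two

end IsTest

section
variable {E F : Type*} [NormedAddCommGroup E] [NormedSpace ℂ E] [NormedAddCommGroup F] [NormedSpace ℂ F]

/-- `g'` is the `q`-th weak derivative of the vector-valued function `g` on `(-ε, ε)`. -/
def HasWeakDeriv (ε : ℝ) (q : ℕ) (g g' : ℝ → E) : Prop :=
  ∀ χ : ℝ → ℂ, IsTest ε χ →
    ∫ ω in Ioo (-ε) ε, iteratedDeriv q χ ω • g ω = (-1 : ℂ) ^ q • ∫ ω in Ioo (-ε) ε, χ ω • g' ω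

theorem hasWeakDeriv_iff_interval {ε : ℝ} {q : ℕ} {f g : ℝ → ℂ} :
    HasWeakDeriv ε q f g ↔ IsWeakDerivInterval ε q f g := by
  constructor
  · intro h χ h1 h2 h3
    have := h χ ⟨h1, h2, h3⟩
    simpa only [smul_eq_mul, mul_comm (f _), mul_comm (g _)] using this
  · intro h χ hχ
    have := h χ hχ.1 hχ.2 hχ.3
    simpa only [smul_eq_mul, mul_comm (f _), mul_comm (g _)] using this

variable {ε : ℝ} {q : ℕ} {f g f' g' : ℝ → E}

local notation "ν" => volume.restrict (Ioo (-ε) ε)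

theorem HasWeakDeriv.congr (h : HasWeakDeriv ε q f g) (hf : f =ᵐ[ν] f') (hg : g =ᵐ[ν] g') :
    HasWeakDeriv ε q f' g' := fun χ hχ => by
  have e1 : ∫ ω in Ioo (-ε) ε, iteratedDeriv q χ ω • f' ω = ∫ ω in Ioo (-ε) ε, iteratedDeriv q χ ω • f ω :=
    integral_congr_ae (by filter_upwards [hf] with w hw; rw [hw])
  have e2 : ∫ ω in Ioo (-ε) ε, χ ω • g' ω = ∫ ω in Ioo (-ε) ε, χ ω • g ω :=
    integral_congr_ae (by filter_upwards [hg] with w hw; rw [hw])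
  rw [e1, e2, h χ hχ]

theorem HasWeakDeriv.add (hf : HasWeakDeriv ε q f f') (hg : HasWeakDeriv ε q g g')
    (mf : MemLp f 2 ν) (mf' : MemLp f' 2 ν) (mg : MemLp g 2 ν) (mg' : MemLp g' 2 ν) :
    HasWeakDeriv ε q (fun w => f w + g w) (fun w => f' w + g' w) := fun χ hχ => by
  simp only [smul_add]
  rw [integral_add ((hχ.iteratedDeriv q).integrable_smul mf) ((hχ.iteratedDeriv q).integrable_smul mg),
    integral_add (hχ.integrable_smul mf') (hχ.integrable_smul mg'), smul_add, hf χ hχ, hg χ hχ]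

theorem HasWeakDeriv.clm [CompleteSpace E] [CompleteSpace F] (L : E →L[ℂ] F) (h : HasWeakDeriv ε q f g)
    (mf : MemLp f 2 ν) (mg : MemLp g 2 ν) :
    HasWeakDeriv ε q (fun w => L (f w)) (fun w => L (g w)) := fun χ hχ => by
  simp only [← map_smul]
  rw [L.integral_comp_comm ((hχ.iteratedDeriv q).integrable_smul mf), L.integral_comp_comm (hχ.integrable_smul mg),
    h χ hχ, map_smul]

theorem HasWeakDeriv.comp_succ (h1 : HasWeakDeriv ε 1 f f') (h2 : HasWeakDeriv ε q f' g) :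
    HasWeakDeriv ε (q + 1) f g := fun χ hχ => by
  have e1 := h1 _ (hχ.iteratedDeriv q)
  rw [iteratedDeriv_one, ← iteratedDeriv_succ] at e1
  rw [e1, h2 χ hχ, smul_smul]
  congr 1
  ring

/-- Testing the relation of order q with χ' and comparing with the relation of order q + 1 tested
with χ exhibits the one weak derivative as the first derivative of the other. -/
theorem HasWeakDeriv.of_succ (h1 : HasWeakDeriv ε q f f') (h2 : HasWeakDeriv ε (q + 1) f g) :
    HasWeakDeriv ε 1 f' g := fun χ hχ => by
  have e1 := h1 _ hχ.deriv
  have e2 := h2 _ hχ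
  rw [iteratedDeriv_succ'] at e2
  rw [e1, pow_succ, mul_smul] at e2
  rw [iteratedDeriv_one, pow_one]
  exact (smul_right_injective E (pow_ne_zero q (neg_ne_zero.2 one_ne_zero : (-1 : ℂ) ≠ 0))) e2

/-- The Sobolev functions of order `r` on `(-ε, ε)`. -/
def Sobolev (ε : ℝ) : ℕ → (ℝ → E) → Prop
  | 0, g => MemLp g 2 (volume.restrict (Ioo (-ε) ε))
  | r + 1, g => MemLp g 2 (volume.restrict (Ioo (-ε) ε)) ∧ ∃ g', HasWeakDeriv ε 1 g g' ∧ Sobolev ε r g'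

variable {r : ℕ}

theorem Sobolev.memLp (h : Sobolev ε r g) : MemLp g 2 ν := by
  cases r with
  | zero => exact h
  | succ r => exact h.1

theorem Sobolev.of_succ (h : Sobolev ε (r + 1) g) : Sobolev ε r g := by
  induction r generalizing g with
  | zero => exact h.1
  | succ r ih =>
    obtain ⟨h1, g', h2, h3⟩ := h
    exact ⟨h1, g', h2, ih h3⟩

theorem Sobolev.congr (h : Sobolev ε r g) (hg : g =ᵐ[ν] g') : Sobolev ε r g' := by
  cases r with
  | zero => exact (memLp_congr_ae hg).1 h
  | succ r =>
    obtain ⟨h1, g₁, h2, h3⟩ := h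
    exact ⟨(memLp_congr_ae hg).1 h1, g₁, h2.congr hg (ae_eq_refl _), h3⟩

theorem Sobolev.add (hf : Sobolev ε r f) (hg : Sobolev ε r g) : Sobolev ε r (fun w => f w + g w) := by
  induction r generalizing f g with
  | zero => exact MemLp.add hf hg
  | succ r ih =>
    obtain ⟨h1, g₁, h2, h3⟩ := hf
    obtain ⟨k1, g₂, k2, k3⟩ := hg
    exact ⟨h1.add k1, _, h2.add k2 h1 h3.memLp k1 k3.memLp, ih h3 k3⟩

theorem Sobolev.exists_hasWeakDeriv (h : Sobolev ε r g) (hq : q ≤ r) :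
    ∃ g', MemLp g' 2 ν ∧ HasWeakDeriv ε q g g' := by
  induction q generalizing r g with
  | zero => exact ⟨g, h.memLp, fun χ _ => by simp⟩
  | succ q ih =>
    obtain ⟨r, rfl⟩ : ∃ r', r = r' + 1 := ⟨r - 1, by omega⟩
    obtain ⟨h1, g₁, h2, h3⟩ := h
    obtain ⟨g', k1, k2⟩ := ih h3 (by omega)
    exact ⟨g', k1, h2.comp_succ k2⟩

/-- The inductive definition of `Sobolev` is reached by climbing the given derivatives with
`HasWeakDeriv.of_succ`; `k` counts the orders that remain. -/
theorem sobolev_of_forall (hg : MemLp g 2 ν) (h : ∀ q ≤ r, ∃ g', MemLp g' 2 ν ∧ HasWeakDeriv ε q g g') :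
    Sobolev ε r g := by
  have key : ∀ k q, q + k ≤ r → ∀ g', MemLp g' 2 ν → HasWeakDeriv ε q g g' → Sobolev ε k g' := by
    intro k
    induction k with
    | zero => intro q _ g' m _; exact m
    | succ k ih =>
      intro q hq g' m hw
      obtain ⟨g₁, m1, w1⟩ := h (q + 1) (by omega)
      exact ⟨m, g₁, hw.of_succ w1, ih (q + 1) (by omega) g₁ m1 w1⟩
  exact key r 0 (by omega) g hg fun χ _ => by simp

end

/-! ### Weak derivatives in coordinates of a Hilbert basis -/

section
open scoped InnerProductSpace

variable {ι κ : Type*} {K H : Type*} [NormedAddCommGroup K] [InnerProductSpace ℂ K]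
  [NormedAddCommGroup H] [InnerProductSpace ℂ H]

theorem HilbertBasis.ext_inner (b : HilbertBasis ι ℂ K) {v w : K} (h : ∀ i, ⟪b i, v⟫_ℂ = ⟪b i, w⟫_ℂ) : v = w := by
  apply b.repr.injective
  ext i
  rw [HilbertBasis.repr_apply_apply, HilbertBasis.repr_apply_apply, h]

/-- A function into a Hilbert space is measurable if its coordinates are. -/
theorem aestronglyMeasurable_of_inner [Countable ι] (b : HilbertBasis ι ℂ K) {α : Type*} [MeasurableSpace α]
    {μ : Measure α} {g : α → K} (h : ∀ i, AEStronglyMeasurable (fun x => ⟪b i, g x⟫_ℂ) μ) :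
    AEStronglyMeasurable g μ := by
  refine aestronglyMeasurable_of_tendsto_ae (atTop : Filter (Finset ι))
    (f := fun A x => ∑ i ∈ A, ⟪b i, g x⟫_ℂ • b i) (fun A => ?_) (Eventually.of_forall fun x => ?_)
  · exact Finset.aestronglyMeasurable_fun_sum _ fun i _ => (h i).smul aestronglyMeasurable_const
  · have := b.hasSum_repr (g x)
    simp only [HilbertBasis.repr_apply_apply] at this
    exact this

variable {ε : ℝ} {q : ℕ}

local notation "ν" => volume.restrict (Ioo (-ε) ε)

/-- Bounded functionals commute with the Bochner integral, and a vector is determined by its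
coordinates. -/
theorem hasWeakDeriv_of_inner [CompleteSpace K] (b : HilbertBasis ι ℂ K) {g g' : ℝ → K} (hg : MemLp g 2 ν)
    (hg' : MemLp g' 2 ν) (h : ∀ i, HasWeakDeriv ε q (fun w => ⟪b i, g w⟫_ℂ) (fun w => ⟪b i, g' w⟫_ℂ)) :
    HasWeakDeriv ε q g g' := fun χ hχ => by
  refine HilbertBasis.ext_inner b fun i => ?_
  have h1 := (innerSL ℂ (b i)).integral_comp_comm ((hχ.iteratedDeriv q).integrable_smul hg)
  have h2 := (innerSL ℂ (b i)).integral_comp_comm (hχ.integrable_smul hg')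
  simp only [innerSL_apply_apply] at h1 h2
  rw [inner_smul_right, ← h1, ← h2]
  simp only [inner_smul_right]
  exact h i χ hχ

/-- Integrated form of the Parseval expansion of an inner product. -/
theorem hasSum_integral_inner [Countable ι] (b : HilbertBasis ι ℂ K) {α : Type*} [MeasurableSpace α]
    {μ : Measure α} {x g : α → K} (hx : MemLp x 2 μ) (hg : MemLp g 2 μ) :
    HasSum (fun i => ∫ w, ⟪x w, b i⟫_ℂ * ⟪b i, g w⟫_ℂ ∂μ) (∫ w, ⟪x w, g w⟫_ℂ ∂μ) := by
  have pars : ∀ v : K, HasSum (fun i => ‖⟪b i, v⟫_ℂ‖ ^ 2) (‖v‖ ^ 2) := fun v => by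
    have h := b.hasSum_inner_mul_inner v v
    have h2 : ∀ i, ⟪v, b i⟫_ℂ * ⟪b i, v⟫_ℂ = ((‖⟪b i, v⟫_ℂ‖ ^ 2 : ℝ) : ℂ) := fun i => by
      rw [← inner_conj_symm, mul_comm, Complex.mul_conj, Complex.normSq_eq_norm_sq]
    have h3 : ⟪v, v⟫_ℂ = ((‖v‖ ^ 2 : ℝ) : ℂ) := by rw [inner_self_eq_norm_sq_to_K]; push_cast; rfl
    simp only [h2, h3] at h
    exact Complex.hasSum_ofReal.1 h
  have hb : ∀ w, HasSum (fun i => (‖⟪b i, x w⟫_ℂ‖ ^ 2 + ‖⟪b i, g w⟫_ℂ‖ ^ 2) / 2) ((‖x w‖ ^ 2 + ‖g w‖ ^ 2) / 2) :=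
    fun w => ((pars _).add (pars _)).div_const 2
  refine hasSum_integral_of_dominated_convergence
    (fun i w => (‖⟪b i, x w⟫_ℂ‖ ^ 2 + ‖⟪b i, g w⟫_ℂ‖ ^ 2) / 2) (fun i => ?_) (fun i => Eventually.of_forall fun w => ?_)
    (Eventually.of_forall fun w => (hb w).summable) ?_ (Eventually.of_forall fun w => b.hasSum_inner_mul_inner _ _)
  · exact (hx.1.inner aestronglyMeasurable_const).mul (AEStronglyMeasurable.inner aestronglyMeasurable_const hg.1)
  · rw [norm_mul, norm_inner_symm]
    nlinarith [sq_nonneg (‖⟪b i, x w⟫_ℂ‖ - ‖⟪b i, g w⟫_ℂ‖)]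
  · simp only [fun w => (hb w).tsum_eq]
    exact (((memLp_two_iff_integrable_sq_norm hx.1).1 hx).add ((memLp_two_iff_integrable_sq_norm hg.1).1 hg)).div_const 2

/-- Vector-valued test curves that are smooth in each coordinate. -/
theorem HasWeakDeriv.integral_inner [Countable ι] [CompleteSpace K] (b : HilbertBasis ι ℂ K) {g g' x y : ℝ → K}
    (h : HasWeakDeriv ε q g g') (hg : MemLp g 2 ν) (hg' : MemLp g' 2 ν) (hx : MemLp x 2 ν) (hy : MemLp y 2 ν)
    (T : ι → ℝ → ℂ) (hT : ∀ i, IsTest ε (T i)) (hTx : ∀ i, ∀ w ∈ Ioo (-ε) ε, ⟪x w, b i⟫_ℂ = T i w)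
    (hTy : ∀ i, ∀ w ∈ Ioo (-ε) ε, ⟪y w, b i⟫_ℂ = iteratedDeriv q (T i) w) :
    ∫ w in Ioo (-ε) ε, ⟪y w, g w⟫_ℂ = (-1) ^ q * ∫ w in Ioo (-ε) ε, ⟪x w, g' w⟫_ℂ := by
  have key : ∀ i, ∫ w in Ioo (-ε) ε, ⟪y w, b i⟫_ℂ * ⟪b i, g w⟫_ℂ =
      (-1) ^ q * ∫ w in Ioo (-ε) ε, ⟪x w, b i⟫_ℂ * ⟪b i, g' w⟫_ℂ := fun i => by
    have h1 := (h.clm (innerSL ℂ (b i)) hg hg') (T i) (hT i)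
    simp only [innerSL_apply_apply, smul_eq_mul] at h1
    have e1 : ∫ w in Ioo (-ε) ε, ⟪y w, b i⟫_ℂ * ⟪b i, g w⟫_ℂ =
        ∫ w in Ioo (-ε) ε, iteratedDeriv q (T i) w * ⟪b i, g w⟫_ℂ :=
      setIntegral_congr_fun measurableSet_Ioo fun w hw => by simp only [hTy i w hw]
    have e2 : ∫ w in Ioo (-ε) ε, ⟪x w, b i⟫_ℂ * ⟪b i, g' w⟫_ℂ = ∫ w in Ioo (-ε) ε, T i w * ⟪b i, g' w⟫_ℂ :=
      setIntegral_congr_fun measurableSet_Ioo fun w hw => by simp only [hTx i w hw]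
    rw [e1, e2, h1]
  -- Each coordinate of the curve is a scalar test function, so the identity holds coordinate by
  -- coordinate; dominated convergence sums it without requiring the curve to be differentiable in
  -- norm.
  refine (hasSum_integral_inner b hy hg).unique ?_
  simp only [key]
  exact (hasSum_integral_inner b hx hg').mul_left ((-1) ^ q)

end

/-! ### Operator families smooth in ω and invariance of Sobolev regularity -/

section
open scoped InnerProductSpace

variable {ι κ : Type*} {K H : Type*} [NormedAddCommGroup K] [InnerProductSpace ℂ K]
  [NormedAddCommGroup H] [InnerProductSpace ℂ H]

/-- The operators `A k ω`, `-ε < ω < ε`, are uniformly bounded for each `k`, and the matrix entries of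
`A k` are the `k`-th derivatives of the smooth functions `M i j`. -/
structure IsSmoothOperator (ε : ℝ) (b : HilbertBasis κ ℂ K) (c : HilbertBasis ι ℂ H)
    (M : ι → κ → ℝ → ℂ) (A : ℕ → ℝ → K →L[ℂ] H) : Prop where
  contDiff : ∀ i j, ContDiff ℝ (⊤ : ℕ∞) (M i j)
  entry : ∀ k i j, ∀ ω ∈ Ioo (-ε) ε, ⟪c i, A k ω (b j)⟫_ℂ = iteratedDeriv k (M i j) ω
  bound : ∀ k, ∃ C : ℝ, ∀ ω ∈ Ioo (-ε) ε, ‖A k ω‖ ≤ C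

namespace IsSmoothOperator

variable {ε : ℝ} {b : HilbertBasis κ ℂ K} {c : HilbertBasis ι ℂ H}
  {M : ι → κ → ℝ → ℂ} {A : ℕ → ℝ → K →L[ℂ] H}

local notation "ν" => volume.restrict (Ioo (-ε) ε)

theorem continuous_iteratedDeriv (h : IsSmoothOperator ε b c M A) (k : ℕ) (i : ι) (j : κ) :
    Continuous (iteratedDeriv k (M i j)) :=
  (h.contDiff i j).continuous_iteratedDeriv k (by exact_mod_cast le_top)

theorem contDiff_iteratedDeriv (h : IsSmoothOperator ε b c M A) (k : ℕ) (i : ι) (j : κ) :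
    ContDiff ℝ (⊤ : ℕ∞) (iteratedDeriv k (M i j)) := by
  rw [iteratedDeriv_eq_iterate]
  exact (h.contDiff i j).iterate_deriv k

variable [CompleteSpace K] [CompleteSpace H]

theorem adjoint (h : IsSmoothOperator ε b c M A) :
    IsSmoothOperator ε c b (fun j i w => starRingEnd ℂ (M i j w)) (fun k w => (A k w).adjoint) where
  contDiff j i := Complex.conjCLE.contDiff.comp (h.contDiff i j)
  entry k j i ω hω := by
    have e := iteratedDeriv_clm_apply (Complex.conjCLE : ℂ →L[ℝ] ℂ) (h.contDiff i j) k ω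
    simp only [ContinuousLinearEquiv.coe_coe, Complex.conjCLE_apply] at e
    rw [e, ← h.entry k i j ω hω, ContinuousLinearMap.adjoint_inner_right, inner_conj_symm]
  bound k := by
    obtain ⟨C, hC⟩ := h.bound k
    exact ⟨C, fun ω hω => by rw [LinearIsometryEquiv.norm_map]; exact hC ω hω⟩

variable [Countable κ]

theorem memLp_adjoint (h : IsSmoothOperator ε b c M A) (k : ℕ) (i : ι) :
    MemLp (fun w => (A k w).adjoint (c i)) 2 ν := by
  obtain ⟨C, hC⟩ := h.bound k
  refine MemLp.of_bound (aestronglyMeasurable_of_inner b fun j => ?_) (C * ‖c i‖) ?_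
  · refine ((Complex.continuous_conj.comp (h.continuous_iteratedDeriv k i j)).aestronglyMeasurable).congr ?_
    filter_upwards [ae_restrict_mem measurableSet_Ioo] with w hw
    rw [ContinuousLinearMap.adjoint_inner_right, Function.comp_apply, ← h.entry k i j w hw, inner_conj_symm]
  · filter_upwards [ae_restrict_mem measurableSet_Ioo] with w hw
    refine (ContinuousLinearMap.le_opNorm _ _).trans ?_
    rw [LinearIsometryEquiv.norm_map]
    exact mul_le_mul_of_nonneg_right (hC w hw) (norm_nonneg _)

variable [Countable ι]

theorem memLp_apply (h : IsSmoothOperator ε b c M A) (k : ℕ) {g : ℝ → K} (hg : MemLp g 2 ν) :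
    MemLp (fun w => A k w (g w)) 2 ν := by
  obtain ⟨C, hC⟩ := h.bound k
  refine hg.of_le_mul (c := C) (aestronglyMeasurable_of_inner c fun i => ?_) ?_
  · simp only [← ContinuousLinearMap.adjoint_inner_left]
    exact (h.memLp_adjoint k i).1.inner hg.1
  · filter_upwards [ae_restrict_mem measurableSet_Ioo] with w hw
    exact (ContinuousLinearMap.le_opNorm _ _).trans (mul_le_mul_of_nonneg_right (hC w hw) (norm_nonneg _))

/-- The product rule. -/
theorem hasWeakDeriv (h : IsSmoothOperator ε b c M A) (k : ℕ) {g g' : ℝ → K} (hg : MemLp g 2 ν)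
    (hg' : MemLp g' 2 ν) (hw : HasWeakDeriv ε 1 g g') :
    HasWeakDeriv ε 1 (fun w => A k w (g w)) (fun w => A (k + 1) w (g w) + A k w (g' w)) := by
  refine hasWeakDeriv_of_inner c (h.memLp_apply k hg) ((h.memLp_apply (k + 1) hg).add (h.memLp_apply k hg'))
    fun i χ hχ => ?_
  have hconj : ∀ {χ : ℝ → ℂ}, IsTest ε χ → IsTest ε (fun w => starRingEnd ℂ (χ w)) := fun {χ} hχ =>
    ⟨Complex.conjCLE.contDiff.comp hχ.contDiff, hχ.hasCompactSupport.comp_left (map_zero _),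
      (tsupport_comp_subset (map_zero (starRingEnd ℂ)) χ).trans hχ.tsupport_subset⟩
  -- The test function and the operator are moved onto one test curve w ↦ χ̄(w) A_k(w)* c_i. Its
  -- coordinates are χ times matrix entries, which are smooth, although A_k need not be
  -- differentiable as an operator-valued map.
  have mx : MemLp (fun w => starRingEnd ℂ (χ w) • (A k w).adjoint (c i)) 2 ν :=
    (hconj hχ).memLp_smul (h.memLp_adjoint k i)
  have my : MemLp (fun w => starRingEnd ℂ (deriv χ w) • (A k w).adjoint (c i) +
      starRingEnd ℂ (χ w) • (A (k + 1) w).adjoint (c i)) 2 ν :=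
    ((hconj hχ.deriv).memLp_smul (h.memLp_adjoint k i)).add ((hconj hχ).memLp_smul (h.memLp_adjoint (k + 1) i))
  have key := hw.integral_inner b hg hg' mx my (fun j w => χ w * iteratedDeriv k (M i j) w)
    (fun j => hχ.mul (h.contDiff_iteratedDeriv k i j)) (fun j w hw => ?_) (fun j w hw => ?_)
  · simp only [inner_add_left, inner_smul_left, RingHomCompTriple.comp_apply, RingHom.id_apply,
      ContinuousLinearMap.adjoint_inner_left, pow_one] at key
    have i1 : Integrable (fun w => deriv χ w * ⟪c i, A k w (g w)⟫_ℂ) ν :=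
      hχ.deriv.integrable_smul ((h.memLp_apply k hg).const_inner (c i))
    have i2 : Integrable (fun w => χ w * ⟪c i, A (k + 1) w (g w)⟫_ℂ) ν :=
      hχ.integrable_smul ((h.memLp_apply (k + 1) hg).const_inner (c i))
    have i3 : Integrable (fun w => χ w * ⟪c i, A k w (g' w)⟫_ℂ) ν :=
      hχ.integrable_smul ((h.memLp_apply k hg').const_inner (c i))
    rw [integral_add i1 i2] at key
    simp only [iteratedDeriv_one, smul_eq_mul, inner_add_right, mul_add, pow_one]
    rw [integral_add i2 i3]
    linear_combination key
  · rw [inner_smul_left, ContinuousLinearMap.adjoint_inner_left, h.entry k i j w hw, Complex.conj_conj]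
  · have d1 : HasDerivAt χ (deriv χ w) w := (hχ.contDiff.differentiable (by simp) w).hasDerivAt
    have d2 : HasDerivAt (iteratedDeriv k (M i j)) (iteratedDeriv (k + 1) (M i j) w) w := by
      rw [iteratedDeriv_succ]
      exact ((h.contDiff_iteratedDeriv k i j).differentiable (by simp) w).hasDerivAt
    have d3 := (d1.mul d2).deriv
    change deriv (fun w => χ w * iteratedDeriv k (M i j) w) w = _ at d3
    rw [iteratedDeriv_one, d3, inner_add_left, inner_smul_left, inner_smul_left,
      ContinuousLinearMap.adjoint_inner_left, ContinuousLinearMap.adjoint_inner_left, h.entry k i j w hw,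
      h.entry (k + 1) i j w hw, Complex.conj_conj, Complex.conj_conj]

/-- Each application of the product rule gives one term with the next operator and one with the
derivative of `g`, both of lower Sobolev order; the induction therefore runs over all `k` at once.
-/
theorem sobolev (h : IsSmoothOperator ε b c M A) {r : ℕ} (k : ℕ) {g : ℝ → K} (hg : Sobolev ε r g) :
    Sobolev ε r (fun w => A k w (g w)) := by
  induction r generalizing k g with
  | zero => exact h.memLp_apply k hg
  | succ r ih =>
    obtain ⟨h1, g', h2, h3⟩ := id hg
    exact ⟨h.memLp_apply k h1, _, h.hasWeakDeriv k h1 h3.memLp h2, (ih (k + 1) hg.of_succ).add (ih k h3)⟩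

end IsSmoothOperator

/-- The standard basis of `ℓ²`. -/
def stdBasis (ι : Type*) : HilbertBasis ι ℂ (lp (fun _ : ι => ℂ) 2) :=
  HilbertBasis.ofRepr (LinearIsometryEquiv.refl ℂ _)

theorem inner_stdBasis (i : ι) (v : lp (fun _ : ι => ℂ) 2) : ⟪stdBasis ι i, v⟫_ℂ = v i := by
  rw [← HilbertBasis.repr_apply_apply]
  rfl

theorem enorm_sq_eq_tsum (v : lp (fun _ : ι => ℂ) 2) : ‖v‖ₑ ^ 2 = ∑' i, ‖v i‖ₑ ^ 2 := by
  rw [← tsum_enorm_inner_sq (stdBasis ι)]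
  simp only [inner_stdBasis]

theorem memℓp_of_tsum_enorm {F : ι → ℂ} (h : ∑' i, ‖F i‖ₑ ^ 2 ≠ ∞) : Memℓp F 2 := by
  refine memℓp_gen ?_
  have h2 := ENNReal.summable_toReal h
  refine h2.congr fun i => ?_
  simp

/-- The analysis operator `c ↦ (⟪v i, c⟫)`. -/
theorem exists_analysis_operator {v : ι → K} {C : ℝ≥0} (h : ∀ c, ∑' i, ‖⟪v i, c⟫_ℂ‖ₑ ^ 2 ≤ C * ‖c‖ₑ ^ 2) :
    ∃ T : K →L[ℂ] lp (fun _ : ι => ℂ) 2, (∀ c i, T c i = ⟪v i, c⟫_ℂ) ∧ ‖T‖ ≤ NNReal.sqrt C := by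
  have hm : ∀ c, Memℓp (fun i => ⟪v i, c⟫_ℂ) 2 := fun c =>
    memℓp_of_tsum_enorm ((h c).trans_lt (ENNReal.mul_lt_top ENNReal.coe_lt_top (by
      rw [← ofReal_norm]; exact ENNReal.pow_lt_top ENNReal.ofReal_lt_top))).ne
  let L : K →ₗ[ℂ] lp (fun _ : ι => ℂ) 2 :=
    { toFun := fun c => ⟨fun i => ⟪v i, c⟫_ℂ, hm c⟩
      map_add' := fun c d => by ext i; exact inner_add_right _ _ _
      map_smul' := fun r c => by ext i; exact inner_smul_right _ _ _ }
  have hL : ∀ c, ‖L c‖ ≤ NNReal.sqrt C * ‖c‖ := fun c => by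
    have h1 := h c
    have h2 : ‖L c‖ₑ ^ 2 = ∑' i, ‖⟪v i, c⟫_ℂ‖ₑ ^ 2 := enorm_sq_eq_tsum (L c)
    rw [← h2] at h1
    simp only [enorm_eq_nnnorm] at h1
    have h3 : ‖L c‖₊ ^ 2 ≤ (NNReal.sqrt C * ‖c‖₊) ^ 2 := by
      rw [mul_pow, NNReal.sq_sqrt]
      exact_mod_cast h1
    exact NNReal.coe_le_coe.2 ((pow_le_pow_iff_left₀ (zero_le) (zero_le) two_ne_zero).1 h3)
  exact ⟨L.mkContinuous _ hL, fun c i => rfl, L.mkContinuous_norm_le (NNReal.coe_nonneg _) hL⟩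

variable {ε : ℝ}

local notation "ν" => volume.restrict (Ioo (-ε) ε)

/-- The `ω`-regularity of a vector-valued function can be read off its coefficients with respect to an
orthonormal basis that depends smoothly on `ω`. -/
theorem exists_sobolev_coeff_iff [CompleteSpace K] [Countable ι] (B : ℝ → HilbertBasis ι ℂ K) (y : ι → ℝ → K)
    (hB : ∀ i ω, B ω i = y i ω) (hy : ∀ i, ContDiff ℝ (⊤ : ℕ∞) (y i))
    (hC : ∀ k, ∃ C : ℝ≥0, ∀ ω ∈ Ioo (-ε) ε, ∀ c,
      ∑' i, ‖⟪iteratedDeriv k (y i) ω, c⟫_ℂ‖ₑ ^ 2 ≤ C * ‖c‖ₑ ^ 2) {g : ℝ → K} (hg : MemLp g 2 ν) :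
    ∃ u : ℝ → lp (fun _ : ι => ℂ) 2, MemLp u 2 ν ∧ (∀ ω ∈ Ioo (-ε) ε, ∀ i, u ω i = ⟪y i ω, g ω⟫_ℂ) ∧
      ∀ r, Sobolev ε r g ↔ Sobolev ε r u := by
  choose C hC using hC
  have hT : ∀ k ω, ∃ T : K →L[ℂ] lp (fun _ : ι => ℂ) 2, ω ∈ Ioo (-ε) ε →
      (∀ c i, T c i = ⟪iteratedDeriv k (y i) ω, c⟫_ℂ) ∧ ‖T‖ ≤ NNReal.sqrt (C k) := fun k ω => by
    by_cases hω : ω ∈ Ioo (-ε) ε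
    · obtain ⟨T, hT⟩ := exists_analysis_operator (hC k ω hω)
      exact ⟨T, fun _ => hT⟩
    · exact ⟨0, fun h => absurd h hω⟩
  choose A hA using hT
  -- Matrix entries are taken with respect to the fixed basis `B 0`, so that only the vectors y_i
  -- depend on ω.
  have hS : IsSmoothOperator ε (B 0) (stdBasis ι) (fun i j w => ⟪y i w, B 0 j⟫_ℂ) A := by
    let L : ι → K →L[ℝ] ℂ := fun j =>
      (Complex.conjCLE : ℂ →L[ℝ] ℂ) ∘L ((innerSL ℂ (B 0 j)).restrictScalars ℝ)
    have hL : ∀ j v, L j v = ⟪v, B 0 j⟫_ℂ := fun j v => inner_conj_symm _ _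
    refine ⟨fun i j => ?_, fun k i j ω hω => ?_, fun k => ⟨_, fun ω hω => (hA k ω hω).2⟩⟩
    · simp only [← hL]
      exact (L j).contDiff.comp (hy i)
    · simp only [← hL]
      rw [inner_stdBasis, (hA k ω hω).1, iteratedDeriv_clm_apply (L j) (hy i), hL]
  -- By Parseval in the basis at ω the analysis operator is isometric, so its adjoint is a left
  -- inverse. This is what recovers g from its coefficients in the converse direction.
  have hiso : ∀ ω ∈ Ioo (-ε) ε, ∀ c, (A 0 ω).adjoint (A 0 ω c) = c := fun ω hω c => by
    have h1 : ∀ x, ‖A 0 ω x‖ = ‖x‖ := fun x => by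
      have h2 : ‖A 0 ω x‖ₑ ^ 2 = ‖x‖ₑ ^ 2 := by
        rw [enorm_sq_eq_tsum, ← tsum_enorm_inner_sq (B ω)]
        simp only [(hA 0 ω hω).1, hB, iteratedDeriv_zero]
      simp only [enorm_eq_nnnorm] at h2
      have h3 : ‖A 0 ω x‖₊ ^ 2 = ‖x‖₊ ^ 2 := by exact_mod_cast h2
      exact congrArg NNReal.toReal ((pow_left_inj₀ (zero_le) (zero_le) two_ne_zero).1 h3)
    exact DFunLike.congr_fun ((ContinuousLinearMap.norm_map_iff_adjoint_comp_self _).1 h1) c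
  refine ⟨fun ω => A 0 ω (g ω), hS.memLp_apply 0 hg, fun ω hω i => ?_, fun r => ⟨hS.sobolev 0, fun h => ?_⟩⟩
  · rw [(hA 0 ω hω).1, iteratedDeriv_zero]
  · refine (hS.adjoint.sobolev 0 h).congr ?_
    filter_upwards [ae_restrict_mem measurableSet_Ioo] with ω hω
    exact hiso ω hω _

/-- A family of scalar weak derivatives with integrable squared ℓ² norm is, almost everywhere, a
single ℓ²-valued function; it is measurable and is the weak derivative because both can be checked
on coordinates. -/
theorem sobolev_lp_iff [Countable ι] {u : ℝ → lp (fun _ : ι => ℂ) 2} (hu : MemLp u 2 ν) {F : ι → ℝ → ℂ}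
    (hF : ∀ i, (fun ω => u ω i) =ᵐ[ν] F i) (r : ℕ) :
    Sobolev ε r u ↔ ∀ q ≤ r, ∃ G : ι → ℝ → ℂ,
      (∀ i, AEStronglyMeasurable (G i) ν ∧ IsWeakDerivInterval ε q (F i) (G i)) ∧
      ∫⁻ ω in Ioo (-ε) ε, ∑' i, ‖G i ω‖ₑ ^ 2 < ∞ := by
  have hnorm : ∀ {v : ℝ → lp (fun _ : ι => ℂ) 2}, AEStronglyMeasurable v ν →
      (MemLp v 2 ν ↔ ∫⁻ ω in Ioo (-ε) ε, ‖v ω‖ₑ ^ 2 < ∞) := fun {v} hv => by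
    rw [MemLp, and_iff_right hv, eLpNorm_lt_top_iff_lintegral_rpow_enorm_lt_top (by simp) (by simp)]
    simp
  constructor
  · intro h q hq
    obtain ⟨g, mg, hw⟩ := h.exists_hasWeakDeriv hq
    refine ⟨fun i ω => g ω i, fun i => ⟨?_, ?_⟩, ?_⟩
    · change AEStronglyMeasurable (fun ω => g ω i) ν
      simp only [← inner_stdBasis]
      exact AEStronglyMeasurable.inner aestronglyMeasurable_const mg.1
    · rw [← hasWeakDeriv_iff_interval]
      have := hw.clm (innerSL ℂ (stdBasis ι i)) hu mg
      simp only [innerSL_apply_apply, inner_stdBasis] at this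
      exact this.congr (hF i) (ae_eq_refl _)
    · simp only [← enorm_sq_eq_tsum]
      exact (hnorm mg.1).1 mg
  · intro h
    refine sobolev_of_forall hu fun q hq => ?_
    obtain ⟨G, hG, hfin⟩ := h q hq
    classical
    let g : ℝ → lp (fun _ : ι => ℂ) 2 := fun ω => if hm : Memℓp (fun i => G i ω) 2 then ⟨fun i => G i ω, hm⟩ else 0
    have hae : ∀ᵐ ω ∂ν, ∀ i, g ω i = G i ω := by
      have := ae_lt_top' (AEMeasurable.tsum fun i => (hG i).1.enorm.pow_const 2) hfin.ne
      filter_upwards [this] with ω hω i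
      simp only [g, dif_pos (memℓp_of_tsum_enorm hω.ne)]
    have hgi : ∀ i, (fun ω => g ω i) =ᵐ[ν] G i := fun i => hae.mono fun ω h => h i
    have mg : AEStronglyMeasurable g ν := by
      refine aestronglyMeasurable_of_inner (stdBasis ι) fun i => ?_
      simp only [inner_stdBasis]
      exact (hG i).1.congr (hgi i).symm
    have Mg : MemLp g 2 ν := by
      rw [hnorm mg]
      refine lt_of_le_of_lt (le_of_eq (lintegral_congr_ae ?_)) hfin
      filter_upwards [hae] with ω hω
      simp only [enorm_sq_eq_tsum, hω]
    refine ⟨g, Mg, hasWeakDeriv_of_inner (stdBasis ι) hu Mg fun i => ?_⟩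
    simp only [inner_stdBasis]
    exact (hasWeakDeriv_iff_interval.2 (hG i).2).congr (hF i).symm (hgi i).symm

end

/-! ### Functions on (-ε, ε) × S² as curves in L²(S²) -/

section
open scoped InnerProductSpace

variable {ε : ℝ} {f g : ℝ × ℝ × ℝ → ℂ}

local notation "ν" => volume.restrict (Ioo (-ε) ε)

open scoped Classical in
/-- The function `ω ↦ f(ω, ·)` with values in `L²(S²)`. -/
def slice (f : ℝ × ℝ × ℝ → ℂ) (ω : ℝ) : L2S :=
  if h : MemLp (fun p => f (ω, p)) 2 sphereMeasure then h.toLp _ else 0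

theorem slice_of_memLp {ω : ℝ} (h : MemLp (fun p => f (ω, p)) 2 sphereMeasure) : slice f ω = h.toLp _ :=
  dif_pos h

theorem coeFn_slice_of_memLp {ω : ℝ} (h : MemLp (fun p => f (ω, p)) 2 sphereMeasure) :
    slice f ω =ᵐ[sphereMeasure] fun p => f (ω, p) := by
  rw [slice_of_memLp h]
  exact MemLp.coeFn_toLp h

theorem ae_memLp_slice (hf : MemLp f 2 (cylinderMeasure ε)) :
    ∀ᵐ ω ∂ν, MemLp (fun p => f (ω, p)) 2 sphereMeasure := by
  rw [cylinderMeasure] at hf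
  filter_upwards [hf.1.prodMk_left, ((memLp_two_iff_integrable_sq_norm hf.1).1 hf).prod_right_ae] with ω h1 h2
  exact (memLp_two_iff_integrable_sq_norm h1).2 h2

theorem ae_coeFn_slice (hf : MemLp f 2 (cylinderMeasure ε)) :
    ∀ᵐ ω ∂ν, slice f ω =ᵐ[sphereMeasure] fun p => f (ω, p) :=
  (ae_memLp_slice hf).mono fun _ h => coeFn_slice_of_memLp h

theorem ae_inner_slice (hf : MemLp f 2 (cylinderMeasure ε)) (hg : MemLp g 2 (cylinderMeasure ε)) :
    ∀ᵐ ω ∂ν, ⟪slice g ω, slice f ω⟫_ℂ = ∫ p, starRingEnd ℂ (g (ω, p)) * f (ω, p) ∂sphereMeasure := by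
  filter_upwards [ae_coeFn_slice hf, ae_coeFn_slice hg] with ω h1 h2
  exact inner_L2S_of_ae h2 h1

theorem memLp_conj {α : Type*} [MeasurableSpace α] {μ : Measure α} {F : α → ℂ} (h : MemLp F 2 μ) :
    MemLp (fun x => starRingEnd ℂ (F x)) 2 μ :=
  h.of_le (Complex.continuous_conj.comp_aestronglyMeasurable h.1) (Eventually.of_forall fun x => by simp)

theorem integrable_conj_mul {α : Type*} [MeasurableSpace α] {μ : Measure α} {F G : α → ℂ} (hF : MemLp F 2 μ)
    (hG : MemLp G 2 μ) : Integrable (fun x => starRingEnd ℂ (F x) * G x) μ :=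
  (memLp_conj hF).integrable_mul hG

/-- Fubini's theorem for inner products. -/
theorem integral_inner_slice (hf : MemLp f 2 (cylinderMeasure ε)) (hg : MemLp g 2 (cylinderMeasure ε)) :
    ∫ ω in Ioo (-ε) ε, ⟪slice g ω, slice f ω⟫_ℂ =
      ∫ z, starRingEnd ℂ (g z) * f z ∂(cylinderMeasure ε) := by
  have h := integrable_conj_mul hg hf
  rw [cylinderMeasure] at h ⊢
  rw [integral_prod _ h]
  exact integral_congr_ae (ae_inner_slice hf hg)

theorem lintegral_enorm_slice (hf : MemLp f 2 (cylinderMeasure ε)) :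
    ∫⁻ ω in Ioo (-ε) ε, ‖slice f ω‖ₑ ^ 2 = ∫⁻ z, ‖f z‖ₑ ^ 2 ∂(cylinderMeasure ε) := by
  have hm := hf.1
  rw [cylinderMeasure] at hm ⊢
  rw [lintegral_prod _ (hm.enorm.pow_const 2)]
  refine lintegral_congr_ae ?_
  filter_upwards [ae_memLp_slice hf] with ω h
  rw [slice_of_memLp h, Lp.enorm_toLp, eLpNorm_eq_lintegral_rpow_enorm_toReal (by simp) (by simp), ← ENNReal.rpow_natCast,
    ← ENNReal.rpow_mul]
  simp

theorem memLp_slice (hf : MemLp f 2 (cylinderMeasure ε)) : MemLp (slice f) 2 ν := by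
  have hm : AEStronglyMeasurable (slice f) ν := by
    -- Any countable Hilbert basis of L²(S²) would do; the parameters 0 and 2 carry no meaning here.
    refine aestronglyMeasurable_of_inner (sphBasis 0 (s := 2) 0) fun i => ?_
    set e : L2S := sphBasis 0 (s := 2) 0 i
    have h1 : AEStronglyMeasurable (fun z : ℝ × ℝ × ℝ => starRingEnd ℂ (e z.2) * f z) (cylinderMeasure ε) := by
      refine AEStronglyMeasurable.mul (Complex.continuous_conj.comp_aestronglyMeasurable ?_) hf.1
      exact (Lp.aestronglyMeasurable e).comp_snd
    rw [cylinderMeasure] at h1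
    refine h1.integral_prod_right'.congr ?_
    filter_upwards [ae_coeFn_slice hf] with ω h
    exact (inner_L2S_of_ae (ae_eq_refl _) h).symm
  rw [MemLp, and_iff_right hm, eLpNorm_lt_top_iff_lintegral_rpow_enorm_lt_top (by simp) (by simp)]
  have h2 := hf.2
  rw [eLpNorm_lt_top_iff_lintegral_rpow_enorm_lt_top (by simp) (by simp)] at h2
  simp only [ENNReal.toReal_ofNat, ENNReal.rpow_ofNat] at h2 ⊢
  rwa [lintegral_enorm_slice hf]

theorem slice_congr (h : f =ᵐ[cylinderMeasure ε] g) : slice f =ᵐ[ν] slice g := by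
  filter_upwards [Measure.ae_ae_of_ae_prod h] with ω hω
  by_cases hm : MemLp (fun p => f (ω, p)) 2 sphereMeasure
  · have hm' : MemLp (fun p => g (ω, p)) 2 sphereMeasure := (memLp_congr_ae hω).1 hm
    rw [slice_of_memLp hm, slice_of_memLp hm', MemLp.toLp_eq_toLp_iff]
    exact hω
  · have hm' : ¬ MemLp (fun p => g (ω, p)) 2 sphereMeasure := fun hc => hm ((memLp_congr_ae hω).2 hc)
    rw [slice, slice, dif_neg hm, dif_neg hm']

/-- The linear map underlying `sliceIsometry`. -/
def sliceLin (ε : ℝ) : Lp ℂ 2 (cylinderMeasure ε) →ₗ[ℂ] Lp L2S 2 (volume.restrict (Ioo (-ε) ε)) where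
  toFun F := (memLp_slice (Lp.memLp F)).toLp _
  map_add' F G := by
    rw [← MemLp.toLp_add, MemLp.toLp_eq_toLp_iff]
    refine (slice_congr (Lp.coeFn_add F G)).trans ?_
    filter_upwards [ae_memLp_slice (Lp.memLp F), ae_memLp_slice (Lp.memLp G)] with ω h1 h2
    rw [Pi.add_apply, slice_of_memLp h1, slice_of_memLp h2, ← MemLp.toLp_add]
    exact slice_of_memLp (f := ⇑F + ⇑G) (h1.add h2)
  map_smul' c F := by
    rw [RingHom.id_apply, ← MemLp.toLp_const_smul, MemLp.toLp_eq_toLp_iff]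
    refine (slice_congr (Lp.coeFn_smul c F)).trans ?_
    filter_upwards [ae_memLp_slice (Lp.memLp F)] with ω h1
    rw [Pi.smul_apply, slice_of_memLp h1, ← MemLp.toLp_const_smul]
    exact slice_of_memLp (f := c • ⇑F) (h1.const_smul c)

/-- The isometry `L²((-ε, ε) × S²) → L²((-ε, ε); L²(S²))`. -/
def sliceIsometry (ε : ℝ) : Lp ℂ 2 (cylinderMeasure ε) →ₗᵢ[ℂ] Lp L2S 2 (volume.restrict (Ioo (-ε) ε)) where
  toLinearMap := sliceLin ε
  norm_map' F := by
    change ‖(memLp_slice (Lp.memLp F)).toLp _‖ = ‖F‖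
    rw [Lp.norm_toLp, Lp.norm_def, eLpNorm_eq_lintegral_rpow_enorm_toReal (by simp) (by simp),
      eLpNorm_eq_lintegral_rpow_enorm_toReal (by simp) (by simp)]
    simp only [ENNReal.toReal_ofNat, ENNReal.rpow_ofNat]
    rw [lintegral_enorm_slice (Lp.memLp F)]

theorem sliceIsometry_toLp (hf : MemLp f 2 (cylinderMeasure ε)) :
    sliceIsometry ε (hf.toLp f) = (memLp_slice hf).toLp _ := by
  change (memLp_slice (Lp.memLp (hf.toLp f))).toLp _ = _
  rw [MemLp.toLp_eq_toLp_iff]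
  exact slice_congr (MemLp.coeFn_toLp hf)

theorem slice_mul (r : ℝ → ℂ) (c : L2S) (ω : ℝ) : slice (fun z => r z.1 * c z.2) ω = r ω • c := by
  have h1 : MemLp (r ω • ⇑c) 2 sphereMeasure := (Lp.memLp c).const_smul (r ω)
  rw [slice_of_memLp (f := fun z => r z.1 * c z.2) h1]
  calc h1.toLp _ = r ω • (Lp.memLp c).toLp c := MemLp.toLp_const_smul _ _
    _ = r ω • c := by rw [Lp.toLp_coeFn]

theorem memLp_mul_of_prod {r : ℝ → ℂ} (hr : MemLp r 2 ν) {c : ℝ × ℝ → ℂ} (hc : MemLp c 2 sphereMeasure) :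
    MemLp (fun z : ℝ × ℝ × ℝ => r z.1 * c z.2) 2 (cylinderMeasure ε) := by
  have m3 : AEStronglyMeasurable (fun z : ℝ × ℝ × ℝ => r z.1 * c z.2) (cylinderMeasure ε) :=
    hr.1.comp_fst.mul hc.1.comp_snd
  rw [memLp_two_iff_integrable_sq_norm m3]
  simp only [norm_mul, mul_pow]
  exact ((memLp_two_iff_integrable_sq_norm hr.1).1 hr).mul_prod ((memLp_two_iff_integrable_sq_norm hc.1).1 hc)

theorem indicatorConst_mem_range_sliceIsometry (c : L2S) {s : Set ℝ} (hs : MeasurableSet s)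
    (hμ : (volume.restrict (Ioo (-ε) ε)) s ≠ ∞) :
    indicatorConstLp 2 hs hμ c ∈ Set.range (sliceIsometry ε) := by
  have hm := memLp_mul_of_prod (ε := ε) (memLp_indicator_const 2 hs (1 : ℂ) (Or.inr hμ)) (Lp.memLp c)
  refine ⟨hm.toLp _, ?_⟩
  rw [sliceIsometry_toLp, indicatorConstLp, MemLp.toLp_eq_toLp_iff]
  refine Eventually.of_forall fun ω => ?_
  rw [slice_mul]
  by_cases hω : ω ∈ s
  · rw [Set.indicator_of_mem hω, Set.indicator_of_mem hω, one_smul]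
  · rw [Set.indicator_of_notMem hω, Set.indicator_of_notMem hω, zero_smul]

/-- The range is closed, being that of an isometry, and contains the indicator functions with
constant vector values. It lets a vector-valued weak derivative be represented by a function on the
cylinder. -/
theorem sliceIsometry_surjective : Function.Surjective (sliceIsometry ε) := by
  refine Lp.induction ENNReal.ofNat_ne_top (motive := fun U => U ∈ Set.range (sliceIsometry ε)) ?_ ?_ ?_
  · intro c s hs hμ
    exact indicatorConst_mem_range_sliceIsometry c hs hμ.ne
  · rintro f g hf hg _ ⟨F, hF⟩ ⟨G, hG⟩
    exact ⟨F + G, by rw [map_add, hF, hG]⟩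
  · exact (sliceIsometry ε).isometry.isClosedEmbedding.isClosed_range

theorem exists_slice_eq {u : ℝ → L2S} (hu : MemLp u 2 ν) :
    ∃ f, MemLp f 2 (cylinderMeasure ε) ∧ slice f =ᵐ[ν] u := by
  obtain ⟨F, hF⟩ := sliceIsometry_surjective (hu.toLp u)
  have h : (memLp_slice (Lp.memLp F)).toLp _ = hu.toLp u := hF
  exact ⟨F, Lp.memLp F, (MemLp.toLp_eq_toLp_iff _ _).1 h⟩

end

/-! ### Weak derivatives on the cylinder and the characterisation by coefficients -/

section
open scoped InnerProductSpace

theorem norm_spherePt (θ φ : ℝ) : ‖spherePt θ φ‖ = 1 := by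
  have h : ‖spherePt θ φ‖ ^ 2 = 1 := by
    rw [EuclideanSpace.norm_sq_eq, Fin.sum_univ_three]
    simp only [spherePt, Real.norm_eq_abs, sq_abs]
    simp
    nlinarith [Real.sin_sq_add_cos_sq θ, Real.sin_sq_add_cos_sq φ]
  exact (pow_eq_one_iff_of_nonneg (norm_nonneg _) two_ne_zero).1 h

theorem continuous_spherePt : Continuous fun p : ℝ × ℝ => spherePt p.1 p.2 := by
  unfold spherePt
  refine (PiLp.continuous_toLp 2 _).comp (continuous_pi fun i => ?_)
  fin_cases i <;> simp <;> fun_prop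

/-- The test functions on `(-ε, ε) × S²`. -/
structure IsSphereTest (ε : ℝ) (χ : ℝ × E3 → ℂ) : Prop where
  contDiff : ContDiff ℝ (⊤ : ℕ∞) χ
  exists_compact : ∃ K : Set ℝ, IsCompact K ∧ K ⊆ Ioo (-ε) ε ∧ ∀ w ∉ K, ∀ p, χ (w, p) = 0

/-- The partial derivative in the first variable. -/
def fstDeriv (χ : ℝ × E3 → ℂ) (z : ℝ × E3) : ℂ := fderiv ℝ χ z (1, 0)

namespace IsSphereTest

variable {ε : ℝ} {χ : ℝ × E3 → ℂ}

theorem hasDerivAt (h : IsSphereTest ε χ) (w : ℝ) (p : E3) :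
    HasDerivAt (fun w => χ (w, p)) (fstDeriv χ (w, p)) w := by
  have h1 : HasFDerivAt χ (fderiv ℝ χ (w, p)) (w, p) := (h.contDiff.differentiable (by simp) _).hasFDerivAt
  exact h1.comp_hasDerivAt w ((hasDerivAt_id w).prodMk (hasDerivAt_const w p))

theorem fstDeriv (h : IsSphereTest ε χ) : IsSphereTest ε (fstDeriv χ) := by
  refine ⟨(h.contDiff.fderiv_right (m := (⊤ : ℕ∞)) (by simp)).clm_apply contDiff_const, ?_⟩
  obtain ⟨K, h1, h2, h3⟩ := h.exists_compact
  refine ⟨K, h1, h2, fun w hw p => ?_⟩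
  refine (h.hasDerivAt w p).unique ((hasDerivAt_const w (0 : ℂ)).congr_of_eventuallyEq ?_)
  filter_upwards [h1.isClosed.isOpen_compl.mem_nhds hw] with v hv
  exact h3 v hv p

theorem iterate (h : IsSphereTest ε χ) (q : ℕ) : IsSphereTest ε (Spheroidal.fstDeriv^[q] χ) := by
  induction q with
  | zero => exact h
  | succ q ih => rw [Function.iterate_succ_apply']; exact ih.fstDeriv

theorem iteratedDeriv_eq (h : IsSphereTest ε χ) (q : ℕ) (w : ℝ) (p : E3) :
    iteratedDeriv q (fun w => χ (w, p)) w = (Spheroidal.fstDeriv^[q] χ) (w, p) := by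
  induction q generalizing w with
  | zero => simp
  | succ q ih =>
    rw [iteratedDeriv_succ, funext ih, Function.iterate_succ_apply']
    exact ((h.iterate q).hasDerivAt w p).deriv

theorem exists_bound (h : IsSphereTest ε χ) : ∃ C : ℝ, ∀ w θ φ, ‖χ (w, spherePt θ φ)‖ ≤ C := by
  obtain ⟨K, h1, _, h3⟩ := h.exists_compact
  obtain ⟨C, hC⟩ := (h1.prod (isCompact_closedBall (0 : E3) 1)).exists_bound_of_continuousOn
    h.contDiff.continuous.continuousOn
  refine ⟨max C 0, fun w θ φ => ?_⟩
  by_cases hw : w ∈ K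
  · exact (hC _ ⟨hw, by simp [norm_spherePt]⟩).trans (le_max_left _ _)
  · rw [h3 w hw, norm_zero]; exact le_max_right _ _

theorem continuous_comp (h : IsSphereTest ε χ) :
    Continuous fun z : ℝ × ℝ × ℝ => χ (z.1, spherePt z.2.1 z.2.2) :=
  h.contDiff.continuous.comp (continuous_fst.prodMk (continuous_spherePt.comp continuous_snd))

theorem memLp (h : IsSphereTest ε χ) :
    MemLp (fun z : ℝ × ℝ × ℝ => χ (z.1, spherePt z.2.1 z.2.2)) 2 (cylinderMeasure ε) := by
  obtain ⟨C, hC⟩ := h.exists_bound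
  have : IsFiniteMeasure (cylinderMeasure ε) := by rw [cylinderMeasure]; infer_instance
  exact MemLp.of_bound h.continuous_comp.aestronglyMeasurable C (Eventually.of_forall fun z => hC _ _ _)

theorem memLp_slice (h : IsSphereTest ε χ) (w : ℝ) :
    MemLp (fun p : ℝ × ℝ => χ (w, spherePt p.1 p.2)) 2 sphereMeasure := by
  obtain ⟨C, hC⟩ := h.exists_bound
  exact MemLp.of_bound (h.continuous_comp.comp (Continuous.prodMk_right w)).aestronglyMeasurable C
    (Eventually.of_forall fun p => hC _ _ _)

theorem hasDerivAt_integral (h : IsSphereTest ε χ) {e : ℝ × ℝ → ℂ} (he : MemLp e 2 sphereMeasure) (w : ℝ) :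
    HasDerivAt (fun w => ∫ p, χ (w, spherePt p.1 p.2) * e p ∂sphereMeasure)
      (∫ p, Spheroidal.fstDeriv χ (w, spherePt p.1 p.2) * e p ∂sphereMeasure) w := by
  obtain ⟨C, hC⟩ := h.fstDeriv.exists_bound
  refine (hasDerivAt_integral_of_dominated_loc_of_deriv_le (μ := sphereMeasure) (s := univ)
    (F := fun w p => χ (w, spherePt p.1 p.2) * e p)
    (F' := fun w p => Spheroidal.fstDeriv χ (w, spherePt p.1 p.2) * e p)
    (bound := fun p => C * ‖e p‖) univ_mem
    (Eventually.of_forall fun v => (h.memLp_slice v).1.mul he.1) ((h.memLp_slice w).integrable_mul he)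
    ((h.fstDeriv.memLp_slice w).1.mul he.1) (Eventually.of_forall fun p v _ => ?_)
    ((he.integrable one_le_two).norm.const_mul C) (Eventually.of_forall fun p v _ => ?_)).2
  · rw [norm_mul]
    exact mul_le_mul_of_nonneg_right (hC _ _ _) (norm_nonneg _)
  · exact (h.hasDerivAt v _).mul_const _

theorem iteratedDeriv_integral (h : IsSphereTest ε χ) {e : ℝ × ℝ → ℂ} (he : MemLp e 2 sphereMeasure) (q : ℕ) (w : ℝ) :
    iteratedDeriv q (fun w => ∫ p, χ (w, spherePt p.1 p.2) * e p ∂sphereMeasure) w =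
      ∫ p, (Spheroidal.fstDeriv^[q] χ) (w, spherePt p.1 p.2) * e p ∂sphereMeasure := by
  induction q generalizing w with
  | zero => simp
  | succ q ih =>
    rw [iteratedDeriv_succ, funext ih, Function.iterate_succ_apply']
    exact ((h.iterate q).hasDerivAt_integral he w).deriv

theorem isTest_integral (h : IsSphereTest ε χ) {e : ℝ × ℝ → ℂ} (he : MemLp e 2 sphereMeasure) :
    IsTest ε fun w => ∫ p, χ (w, spherePt p.1 p.2) * e p ∂sphereMeasure := by
  obtain ⟨K, h1, h2, h3⟩ := h.exists_compact
  refine IsTest.of_isCompact ?_ h1 h2 fun w hw => ?_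
  · refine contDiff_of_differentiable_iteratedDeriv fun q _ => ?_
    rw [funext (h.iteratedDeriv_integral he q)]
    exact fun w => ((h.iterate q).hasDerivAt_integral he w).differentiableAt
  · simp only [h3 w hw, zero_mul, integral_zero]

end IsSphereTest

theorem IsTest.isSphereTest_mul {ε : ℝ} {χ : ℝ → ℂ} (hχ : IsTest ε χ) {ψ : E3 → ℂ}
    (hψ : ContDiff ℝ (⊤ : ℕ∞) ψ) : IsSphereTest ε fun z => χ z.1 * ψ z.2 :=
  ⟨(hχ.contDiff.comp contDiff_fst).mul (hψ.comp contDiff_snd), tsupport χ, hχ.hasCompactSupport,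
    hχ.tsupport_subset, fun w hw p => by rw [image_eq_zero_of_notMem_tsupport hw, zero_mul]⟩

variable {ε : ℝ} {f g : ℝ × ℝ × ℝ → ℂ} {q : ℕ}

local notation "ν" => volume.restrict (Ioo (-ε) ε)

/-- The complex conjugate of a test function, in the coordinates `(ω, θ, φ)`. -/
def conjTest (χ : ℝ × E3 → ℂ) (z : ℝ × ℝ × ℝ) : ℂ := starRingEnd ℂ (χ (z.1, spherePt z.2.1 z.2.2))

/-- The test function `χ` as a curve in `L²(S²)`, up to complex conjugation. -/
def testCurve (χ : ℝ × E3 → ℂ) : ℝ → L2S := slice (conjTest χ)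

theorem integral_smul_inner {K : Type*} [NormedAddCommGroup K] [InnerProductSpace ℂ K] [CompleteSpace K]
    {χ : ℝ → ℂ} (hχ : IsTest ε χ) {u : ℝ → K} (hu : MemLp u 2 ν) (e : K) :
    ⟪e, ∫ w in Ioo (-ε) ε, χ w • u w⟫_ℂ = ∫ w in Ioo (-ε) ε, ⟪e, χ w • u w⟫_ℂ :=
  ((innerSL ℂ e).integral_comp_comm (hχ.integrable_smul hu)).symm

namespace IsSphereTest

variable {χ : ℝ × E3 → ℂ}

theorem memLp_conjTest (h : IsSphereTest ε χ) : MemLp (conjTest χ) 2 (cylinderMeasure ε) :=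
  memLp_conj h.memLp

theorem memLp_testCurve (h : IsSphereTest ε χ) : MemLp (testCurve χ) 2 ν :=
  Spheroidal.memLp_slice h.memLp_conjTest

theorem inner_testCurve (h : IsSphereTest ε χ) (w : ℝ) (v : L2S) :
    ⟪testCurve χ w, v⟫_ℂ = ∫ p, χ (w, spherePt p.1 p.2) * v p ∂sphereMeasure := by
  have h1 : MemLp (fun p => conjTest χ (w, p)) 2 sphereMeasure := memLp_conj (h.memLp_slice w)
  rw [testCurve, inner_L2S_of_ae (coeFn_slice_of_memLp (f := conjTest χ) h1) (ae_eq_refl v)]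
  simp only [conjTest, Complex.conj_conj]

theorem integral_mul (h : IsSphereTest ε χ) (hf : MemLp f 2 (cylinderMeasure ε)) :
    ∫ z, f z * χ (z.1, spherePt z.2.1 z.2.2) ∂(cylinderMeasure ε) =
      ∫ w in Ioo (-ε) ε, ⟪testCurve χ w, slice f w⟫_ℂ := by
  rw [testCurve, integral_inner_slice hf h.memLp_conjTest]
  simp only [conjTest, Complex.conj_conj]
  exact integral_congr_ae (Eventually.of_forall fun z => mul_comm _ _)

end IsSphereTest

/-- Weak derivatives on the cylinder are weak derivatives of functions with values in `L²(S²)`. -/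
theorem isWeakDerivSphere_iff (hf : MemLp f 2 (cylinderMeasure ε)) (hg : MemLp g 2 (cylinderMeasure ε)) :
    IsWeakDerivSphere ε q f g ↔ HasWeakDeriv ε q (slice f) (slice g) := by
  constructor
  · intro h χ hχ
    rw [← sub_eq_zero]
    refine eq_zero_of_integral_smooth fun ψ hψ => ?_
    -- From the cylinder to curves, product test functions χ(ω)ψ(p) suffice, since the functions ψ
    -- separate points of L²(S²).
    have one : IsSphereTest ε fun z : ℝ × E3 => χ z.1 * ψ z.2 := hχ.isSphereTest_mul hψ
    have hq := (hχ.iteratedDeriv q).isSphereTest_mul hψ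
    have hm : MemLp (fun p : ℝ × ℝ => starRingEnd ℂ (ψ (spherePt p.1 p.2))) 2 sphereMeasure := by
      obtain ⟨C, hC⟩ := (isCompact_closedBall (0 : E3) 1).exists_bound_of_continuousOn hψ.continuous.continuousOn
      refine memLp_conj (MemLp.of_bound (hψ.continuous.comp continuous_spherePt).aestronglyMeasurable C
        (Eventually.of_forall fun p => hC _ (by simp [norm_spherePt])))
    set e : L2S := hm.toLp _ with he
    have hin : ∀ v : L2S, ⟪e, v⟫_ℂ = ∫ p, v p * ψ (spherePt p.1 p.2) ∂sphereMeasure := fun v => by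
      rw [inner_L2S_of_ae (MemLp.coeFn_toLp hm) (ae_eq_refl v)]
      simp only [Complex.conj_conj, mul_comm]
    have hcurve : ∀ {η : ℝ → ℂ}, IsTest ε η → ∀ w (v : L2S),
        ⟪e, η w • v⟫_ℂ = ⟪testCurve (fun z => η z.1 * ψ z.2) w, v⟫_ℂ := fun {η} hη w v => by
      rw [(hη.isSphereTest_mul hψ).inner_testCurve, inner_smul_right, hin, ← integral_const_mul]
      exact integral_congr_ae (Eventually.of_forall fun p => by ring)
    rw [← hin, inner_sub_right, inner_smul_right, integral_smul_inner (hχ.iteratedDeriv q) (memLp_slice hf),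
      integral_smul_inner hχ (memLp_slice hg)]
    simp only [hcurve hχ, hcurve (hχ.iteratedDeriv q)]
    rw [← one.integral_mul hg, ← hq.integral_mul hf, sub_eq_zero, ← h _ one.1 one.2]
    refine integral_congr_ae (Eventually.of_forall fun z => ?_)
    simp only
    rw [iteratedDeriv_mul_const_field]
  · intro h χ h1 h2
    have hχ : IsSphereTest ε χ := ⟨h1, h2⟩
    simp only [hχ.iteratedDeriv_eq]
    rw [(hχ.iterate q).integral_mul hf, hχ.integral_mul hg]
    -- A general test function is not a product. It is treated as a curve in L²(S²) whose
    -- coordinates in a fixed basis are scalar test functions, by differentiation under the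
    -- integral.
    refine h.integral_inner (sphBasis 0 (s := 2) 0) (memLp_slice hf) (memLp_slice hg) hχ.memLp_testCurve
      (hχ.iterate q).memLp_testCurve _ (fun i => hχ.isTest_integral (Lp.memLp (sphBasis 0 (s := 2) 0 i)))
      (fun i w _ => hχ.inner_testCurve w _) (fun i w _ => ?_)
    rw [(hχ.iterate q).inner_testCurve, hχ.iteratedDeriv_integral (Lp.memLp _)]

theorem weakDerivInL2Sphere_iff (hf : MemLp f 2 (cylinderMeasure ε)) (r : ℕ) :
    (∀ q ≤ r, WeakDerivInL2Sphere ε q f) ↔ Sobolev ε r (slice f) := by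
  constructor
  · intro h
    refine sobolev_of_forall (memLp_slice hf) fun q hq => ?_
    obtain ⟨g, hg, hw⟩ := h q hq
    exact ⟨slice g, memLp_slice hg, (isWeakDerivSphere_iff hf hg).1 hw⟩
  · intro h q hq
    obtain ⟨u, hu, hw⟩ := h.exists_hasWeakDeriv hq
    obtain ⟨g, hg, hgu⟩ := exists_slice_eq hu
    exact ⟨g, hg, (isWeakDerivSphere_iff hf hg).2 (hw.congr (ae_eq_refl _) hgu.symm)⟩

theorem weakDerivInL2Modes_iff {s : ℤ} {F : ℤ → ℕ → ℝ → ℂ} :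
    WeakDerivInL2Modes s ε q F ↔ ∃ G : ModeIndex s → ℝ → ℂ,
      (∀ i, AEStronglyMeasurable (G i) ν ∧ IsWeakDerivInterval ε q (F i.1 i.2) (G i)) ∧
      ∫⁻ ω in Ioo (-ε) ε, ∑' i, ‖G i ω‖ₑ ^ 2 < ∞ := by
  constructor
  · rintro ⟨G, h1, h2⟩
    refine ⟨fun i => G i.1 i.2, fun i => h1 i.1 i.2, ?_⟩
    simpa only [ENNReal.tsum_sigma'] using h2
  · rintro ⟨G, h1, h2⟩
    -- Indices l below max(|m|, |s|) carry no mode, so the value 0 there is arbitrary.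
    let G' : ℤ → ℕ → ℝ → ℂ := fun m l => if h : lMin s m ≤ l then G ⟨m, l, h⟩ else 0
    have hG : ∀ m (l : Modes s m), G' m l = G ⟨m, l⟩ := fun m l => dif_pos l.2
    refine ⟨G', fun m l => ?_, ?_⟩
    · rw [hG]
      exact h1 ⟨m, l⟩
    · simpa only [ENNReal.tsum_sigma', hG] using h2

/-- The characterisation of `ω`-regularity by the spheroidal coefficients. -/
theorem CoeffBound.weakDeriv_iff {a : ℝ} {s : ℤ} (h : CoeffBound a s ε) (hs : s = 2 ∨ s = -2)
    (hf : MemLp f 2 (cylinderMeasure ε)) (r : ℕ) :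
    (∀ q ≤ r, WeakDerivInL2Sphere ε q f) ↔ ∀ q ≤ r, WeakDerivInL2Modes s ε q (modeCoeff a s f) := by
  have hC : ∀ k, ∃ C : ℝ≥0, ∀ ω ∈ Ioo (-ε) ε, ∀ c : L2S,
      ∑' i, ‖⟪iteratedDeriv k (sphVec a s i) ω, c⟫_ℂ‖ₑ ^ 2 ≤ C * ‖c‖ₑ ^ 2 := fun k => by
    obtain ⟨C, hC⟩ := h.exists_tsum_inner_le hs k
    exact ⟨C, fun ω hω => hC ω (abs_le.2 ⟨hω.1.le, hω.2.le⟩)⟩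
  obtain ⟨u, hu, hui, hiff⟩ := exists_sobolev_coeff_iff (sphBasis a (s := s)) (sphVec a s)
    (fun i ω => by rw [coe_sphBasis]) (contDiff_sphVec a) hC (memLp_slice hf)
  have hF : ∀ i : ModeIndex s, (fun ω => u ω i) =ᵐ[ν] modeCoeff a s f i.1 i.2 := fun i => by
    filter_upwards [ae_restrict_mem measurableSet_Ioo, ae_coeFn_slice hf] with ω hω h1
    rw [hui ω hω, inner_L2S_of_ae (sphVec_ae_eq a hs i ω) h1, modeCoeff]
    simp only [mul_comm]
  rw [weakDerivInL2Sphere_iff hf, hiff, sobolev_lp_iff hu hF]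
  simp only [weakDerivInL2Modes_iff]

end

end Spheroidal

end

theorem proposition5 (a : ℝ) (s : ℤ) (hs : s = 2 ∨ s = -2) :
    -- smoothness in `ω`, and the expansion of `∂_ω^k S_{ml}(ω)` in `L²([-1, 1])`
    (∀ (m : ℤ) (l : Spheroidal.Modes s m),
      (∀ x ∈ Ioo (-1 : ℝ) 1, ContDiff ℝ (⊤ : ℕ∞) (fun ω => Spheroidal.spheroidalS a s m l ω x)) ∧
      ∀ (k : ℕ) (ω : ℝ),
        MemLp (Spheroidal.dS a s m l k ω) 2 (volume.restrict (Icc (-1 : ℝ) 1)) ∧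
        Tendsto (fun A : Finset (Spheroidal.Modes s m) =>
            eLpNorm (fun x => Spheroidal.dS a s m l k ω x
                - ∑ l' ∈ A, Spheroidal.coeffD a s m l l' k ω * Spheroidal.spheroidalS a s m l' ω x)
              2 (volume.restrict (Icc (-1 : ℝ) 1)))
          atTop (𝓝 0)) ∧
    -- the uniform bound on the coefficients
    (∃ ε : ℝ, 0 < ε ∧ Spheroidal.CoeffBound a s ε) ∧
    -- the characterisation of `ω`-regularity, for every `ε` for which the bound holds
    ∀ ε : ℝ, 0 < ε → Spheroidal.CoeffBound a s ε →
      ∀ f : ℝ × ℝ × ℝ → ℂ, MemLp f 2 (Spheroidal.cylinderMeasure ε) →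
        ∀ q₀ : ℕ,
          (∀ q ≤ q₀, Spheroidal.WeakDerivInL2Sphere ε q f) ↔
            (∀ q ≤ q₀, Spheroidal.WeakDerivInL2Modes s ε q (Spheroidal.modeCoeff a s f)) := by
  refine ⟨fun m l => ⟨fun x hx => Spheroidal.contDiff_spheroidalS hs l hx, fun k ω =>
    ⟨Spheroidal.memLp_dS hs l k ω, Spheroidal.tendsto_eLpNorm_dS hs l k ω⟩⟩,
    Spheroidal.exists_coeffBound a hs, fun ε _ h f hf r => h.weakDeriv_iff hs hf r⟩
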